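/- Let $q_1,p_1,q_2,p_2$ be affine coordinates on $(\mathbb P^1)^4$ over $\mathbb C$. For a Hamiltonian $I$ depending polynomially on $q_1,p_1,q_2,p_2$ and on moving parameters $b_1,b_2$, consider the non-autonomous Hamiltonian system $$\frac{dq_i}{dt}=\frac{\partial I}{\partial p_i},\qquad \frac{dp_i}{dt}=-\frac{\partial I}{\partial q_i}\qquad(i=1,2),$$ together with a prescribed evolution of $b_1,b_2$. It is called regular on a family of varieties $\mathcal X\setminus\mathcal D$ (depending on $b_1,b_2$) if the corresponding rational vector field on the total space of the family over the $(b_1,b_2)$-plane has no pole at any point of this total space. In both cases below $\mathcal X_{\bf a}$ is obtained from $(\mathbb P^1)^4$ by blowing up successively along sixteen surfaces $C_1,\dots,C_{16}$. Each $C_i$ is the closure of the locus given by two equations in the indicated affine coordinates (strict transform under the earlier blow-ups), and $E_i$ is the exceptional divisor of the $i$-th blow-up. The support $\mathcal D$ of the anti-canonical divisor is the union of the strict transforms of the four divisors $\{q_1=\infty\}$, $\{p_1=\infty\}$, $\{q_2=\infty\}$, $\{p_2=\infty\}$ and of $E_1,E_2,E_3,E_5,E_7,E_9,E_{10},E_{11},E_{13},E_{15}$.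 **Case $A_2^{(1)}+A_2^{(1)}$.** Let ${\bf a}=(a^{(1)}_0,a^{(1)}_1,a^{(1)}_2,a^{(2)}_0,a^{(2)}_1,a^{(2)}_2;b^{(1)},b^{(2)})\in\mathbb C^8$, with $b_j=b^{(j)}$. For $j=1$ put $(q,p,b,a_i)=(q_1,p_1,b^{(1)},a^{(1)}_i)$ and $k=0$; for $j=2$ put $(q,p,b,a_i)=(q_2,p_2,b^{(2)},a^{(2)}_i)$ and $k=8$. With $u=q^{-1}$, $v_1=qp^{-1}$, $v_2=u^{-1}(v_1+1)$, $v_3=u^{-1}(v_2+b)$, the centres (the other pair of coordinates being free) are $$C_{k+1}: q^{-1}=p^{-1}=0;\quad C_{k+2}: u=v_1+1=0;\quad C_{k+3}: u=v_2+b=0;\quad C_{k+4}: u=v_3+b^2+a_0=0;$$ $$C_{k+5}: q^{-1}=p=0;\quad C_{k+6}: q^{-1}=qp-a_1=0;\quad C_{k+7}: q=p^{-1}=0;\quad C_{k+8}: p^{-1}=qp+a_2=0,$$ where $C_{k+6}$ and $C_{k+8}$ are written in the coordinates $(q^{-1},qp)$ and $(qp,p^{-1})$. For $i=1,2$ let $$I_i^{\rm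 NA}=q_ip_i(q_i+p_i-b^{(i)})-a^{(i)}_1q_i+a^{(i)}_2p_i .$$ Then for $i=1,2$ and all constants $a_k^{(j)}\in\mathbb C$ the Hamiltonian system with $I=I_i^{\rm NA}$ and $$\frac{db^{(j)}}{dt}=\begin{cases}\lambda^{(j)}:=a^{(j)}_0+a^{(j)}_1+a^{(j)}_2&(j=i)\\ 0&(j\ne i)\end{cases}$$ is regular on $\mathcal X_{\bf a}\setminus\mathcal D$. **Case $A_5^{(1)}$.** Let ${\bf a}=(a_0,\dots,a_5;b_1,b_2)\in\mathbb C^8$. The centres are $$\begin{aligned} &C_1: q_2^{-1}=p_1^{-1}=0;\quad C_2: u=v_1+1=0;\quad C_3: u=q_1+p_2-b_1=0;\quad C_4: u=v_3+a_0=0;\\ &C_5: q_2^{-1}=p_2=0;\quad C_6: q_2^{-1}=q_2p_2+a_2=0;\quad C_7: q_1=p_1^{-1}=0;\quad C_8: p_1^{-1}=q_1p_1-a_4=0;\\ &C_9: q_1^{-1}=p_2^{-1}=0;\quad C_{10}: w=v_9+1=0;\quad C_{11}: w=q_2+p_1-b_2=0;\quad C_{12}: w=v_{11}+a_3=0;\\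 &C_{13}: q_1^{-1}=p_1=0;\quad C_{14}: q_1^{-1}=q_1p_1+a_5=0;\quad C_{15}: q_2=p_2^{-1}=0;\quad C_{16}: p_2^{-1}=q_2p_2-a_1=0, \end{aligned}$$ where $u=q_2^{-1}$, $v_1=q_2p_1^{-1}$, $v_2=u^{-1}(v_1+1)$, $v_3=u^{-1}(q_1+p_2-b_1)$, $w=q_1^{-1}$, $v_9=q_1p_2^{-1}$, $v_{10}=w^{-1}(v_9+1)$, $v_{11}=w^{-1}(q_2+p_1-b_2)$, and the coordinates are: $(q_1,v_1,u,p_2)$ for $C_2$, $(q_1,v_2,u,p_2)$ for $C_3$, $(q_1,v_2,u,v_3)$ for $C_4$, $(w,p_1,q_2,v_9)$ for $C_{10}$, $(w,p_1,q_2,v_{10})$ for $C_{11}$, $(w,v_{11},q_2,v_{10})$ for $C_{12}$, and $(q_1,p_1,q_2^{-1},q_2p_2)$, $(q_1p_1,p_1^{-1},q_2,p_2)$, $(q_1^{-1},q_1p_1,q_2,p_2)$, $(q_1,p_1,q_2p_2,p_2^{-1})$ for $C_6,C_8,C_{14},C_{16}$. Let $$H_{\rm V}(q,p;\alpha,\beta,\gamma;s,t)=pq(p+t)(q-s)+\alpha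 tq+\beta sp+\gamma pq,\qquad \gamma_0=\tfrac12(a_0+a_2+a_4-a_1-a_3-a_5),$$ $$I_2^{\rm NA}=H_{\rm V}(q_1,p_1;a_5,a_4,-\gamma_0;b_1,-b_2)+H_{\rm V}(q_2,p_2;a_2,a_1,\gamma_0;b_2,-b_1)-2q_1p_1q_2p_2 .$$ Then for all constants $a_0,\dots,a_5\in\mathbb C$ the Hamiltonian system with $I=I_2^{\rm NA}$ and $$\frac{db_j}{dt}=\tfrac12\lambda b_j=\tfrac12(a_0+a_1+\cdots+a_5)\,b_j\qquad(j=1,2)$$ is regular on $\mathcal X_{\bf a}\setminus\mathcal D$. -/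

import Mathlib

/-!
# Two families of blow-ups of `(ℙ¹)⁴` and Hamiltonian vector fields on them

Both families of spaces are families over the plane with coordinates `b₁, b₂`, because `b₁, b₂` move
with the time; the parameters `a` are constants. The total space of each family is a variety whose
function field is `K = ℂ(q₁, p₁, q₂, p₂, b₁, b₂)`. It is described, as in classical birational
geometry, by the set of the local rings of its points, each of which is a local subring of `K`
(an integral separated variety is determined by this set, and a point `y` is in the closure of a
point `x` if and only if `𝒪_y ⊆ 𝒪_x` inside `K`). A rational vector field is a derivation of `K`;
it is regular at a point if and only if it maps the local ring of the point to itself.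
-/

namespace PainleveFlow

open MvPolynomial

/-- The names of the affine coordinates `q₁, p₁, q₂, p₂` and of the moving parameters `b₁, b₂`. -/
inductive Var : Type
  | q₁ | p₁ | q₂ | p₂ | b₁ | b₂

/-- The polynomial ring `ℂ[q₁, p₁, q₂, p₂, b₁, b₂]`. -/
abbrev Poly : Type := MvPolynomial Var ℂ

/-- The rational function field `ℂ(q₁, p₁, q₂, p₂, b₁, b₂)`. -/
abbrev K : Type := FractionRing Poly

/-- A coordinate as an element of the function field. -/
noncomputable def coord (v : Var) : K := algebraMap Poly K (X v)

/-- The coordinate function `q₁`. -/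
noncomputable def q₁ : K := coord Var.q₁
/-- The coordinate function `p₁`. -/
noncomputable def p₁ : K := coord Var.p₁
/-- The coordinate function `q₂`. -/
noncomputable def q₂ : K := coord Var.q₂
/-- The coordinate function `p₂`. -/
noncomputable def p₂ : K := coord Var.p₂
/-- The moving parameter `b₁` (written `b^{(1)}` for the first family). -/
noncomputable def b₁ : K := coord Var.b₁
/-- The moving parameter `b₂` (written `b^{(2)}` for the first family). -/
noncomputable def b₂ : K := coord Var.b₂

/-- A constant as an element of the function field. -/
noncomputable def const (c : ℂ) : K := algebraMap ℂ K c

/-! ### Varieties as sets of local rings, closed subvarieties, blow-ups -/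

/-- The ring `ℂ[y₁, y₂, y₃, y₄, b₁, b₂] ⊆ K` of polynomial functions on the affine chart with the
coordinates `y₁, y₂, y₃, y₄` (times the plane of the parameters). -/
noncomputable def chart (y₁ y₂ y₃ y₄ : K) : Subring K :=
  (Algebra.adjoin ℂ {y₁, y₂, y₃, y₄, b₁, b₂}).toSubring

/-- The points of `Spec A`, for a subring `A` of `K`: the localizations of `A` at its prime
ideals. -/
def spec (A : Subring K) : Set (LocalSubring K) :=
  {R | ∃ (P : Ideal A) (_ : P.IsPrime), R = LocalSubring.ofPrime A P}

/-- The variety `(ℙ¹)⁴` times the plane of the parameters `b₁, b₂`: the union of the sixteen affine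
charts in which each of `q₁, p₁, q₂, p₂` is either a coordinate or replaced by its inverse. -/
def projLines : Set (LocalSubring K) :=
  {R | ∃ y₁ ∈ ({q₁, q₁⁻¹} : Set K), ∃ y₂ ∈ ({p₁, p₁⁻¹} : Set K),
    ∃ y₃ ∈ ({q₂, q₂⁻¹} : Set K), ∃ y₄ ∈ ({p₂, p₂⁻¹} : Set K), R ∈ spec (chart y₁ y₂ y₃ y₄)}

/-- An irreducible subvariety, given by equations on one affine chart that it meets. The subvariety
is the closure of the zero locus on that chart; the equations are elements of the ring of the chart
and generate a prime ideal. -/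
structure Subvariety where
  /-- The ring of the affine chart. -/
  ring : Subring K
  /-- The equations on this chart. -/
  eqns : Set K

namespace Subvariety

/-- The ideal generated by the equations in the ring of the chart. -/
noncomputable def ideal (Z : Subvariety) : Ideal Z.ring := Ideal.span {f | (f : K) ∈ Z.eqns}

/-- The local ring of the generic point of the subvariety: the localization of the ring of the chart
at the ideal of the subvariety. -/
def genericRing (Z : Subvariety) : Set K :=
  {x | ∃ f s : Z.ring, s ∉ Z.ideal ∧ x = (f : K) / (s : K)}

/-- The maximal ideal of the local ring of the generic point: the functions that vanish on the
subvariety. -/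
def genericIdeal (Z : Subvariety) : Set K :=
  {x | ∃ f s : Z.ring, f ∈ Z.ideal ∧ s ∉ Z.ideal ∧ x = (f : K) / (s : K)}

/-- The point with local ring `R` lies on the (closed) subvariety. -/
def Contains (Z : Subvariety) (R : LocalSubring K) : Prop :=
  (R.toSubring : Set K) ⊆ Z.genericRing

/-- The ideal of the subvariety in the local ring `R` of a point on it. -/
def idealAt (Z : Subvariety) (R : LocalSubring K) : Set K :=
  (R.toSubring : Set K) ∩ Z.genericIdeal

end Subvariety

/-- The ring `R[I/g]`, generated by `R` and the quotients `f/g` with `f ∈ I`. -/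
noncomputable def reesChart (R : Subring K) (I : Set K) (g : K) : Subring K :=
  Subring.closure ((R : Set K) ∪ {x | ∃ f ∈ I, x = f / g})

/-- The blow-up of the variety `V` along the subvariety `C`. Points outside `C` stay; over a point
of `C` with local ring `R`, where `C` has the ideal `I ⊆ R`, the blow-up is `Proj (⨁ₙ Iⁿ)`, which is
the union of the affine pieces `Spec R[I/g]` over the nonzero `g ∈ I`. -/
def blowUp (V : Set (LocalSubring K)) (C : Subvariety) : Set (LocalSubring K) :=
  {R | R ∈ V ∧ ¬ C.Contains R} ∪
  {S | ∃ R ∈ V, C.Contains R ∧ ∃ g ∈ C.idealAt R, g ≠ 0 ∧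
    S ∈ spec (reesChart R.toSubring (C.idealAt R) g)}

/-- The result of blowing up successively along the centres in a list. For every centre this is the
blow-up along the closure of its generic point, that is, along its strict transform under the
earlier blow-ups. -/
def iteratedBlowUp (V : Set (LocalSubring K)) (Cs : List Subvariety) : Set (LocalSubring K) :=
  Cs.foldl blowUp V

/-- The complement of a union of (closures of) subvarieties. -/
def complement (V : Set (LocalSubring K)) (Ds : List Subvariety) : Set (LocalSubring K) :=
  {R | R ∈ V ∧ ∀ D ∈ Ds, ¬ D.Contains R}

/-! ### The first family (type `A₂⁽¹⁾ + A₂⁽¹⁾`)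

Here `a j` stands for the parameter `a_j^{(1)}` and `a' j` for the parameter `a_j^{(2)}`. -/

/-- The sixteen centres `C₁, …, C₁₆` of the successive blow-ups, each with the coordinates of the
chart on which its equations are written. -/
noncomputable def centersA2A2 (a a' : Fin 3 → ℂ) : List Subvariety :=
  let u₁ := q₁⁻¹
  let v₁ := q₁ * p₁⁻¹
  let u₂ := u₁
  let v₂ := u₁⁻¹ * (v₁ + 1)
  let u₃ := u₂
  let v₃ := u₂⁻¹ * (v₂ + b₁)
  let u₅ := q₁⁻¹
  let v₅ := q₁ * p₁
  let u₇ := p₁⁻¹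
  let v₇ := q₁ * p₁
  let u₉ := q₂⁻¹
  let v₉ := p₂⁻¹ * q₂
  let u₁₀ := u₉
  let v₁₀ := u₉⁻¹ * (v₉ + 1)
  let u₁₁ := u₁₀
  let v₁₁ := u₁₀⁻¹ * (v₁₀ + b₂)
  let u₁₃ := q₂⁻¹
  let v₁₃ := p₂ * q₂
  let u₁₅ := p₂⁻¹
  let v₁₅ := p₂ * q₂
  [ ⟨chart q₁⁻¹ p₁⁻¹ q₂ p₂, {q₁⁻¹, p₁⁻¹}⟩,
    ⟨chart u₁ v₁ q₂ p₂, {u₁, v₁ + 1}⟩,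
    ⟨chart u₂ v₂ q₂ p₂, {u₂, v₂ + b₁}⟩,
    ⟨chart u₃ v₃ q₂ p₂, {u₃, v₃ + b₁ ^ 2 + const (a 0)}⟩,
    ⟨chart q₁⁻¹ p₁ q₂ p₂, {q₁⁻¹, p₁}⟩,
    ⟨chart u₅ v₅ q₂ p₂, {u₅, v₅ - const (a 1)}⟩,
    ⟨chart q₁ p₁⁻¹ q₂ p₂, {q₁, p₁⁻¹}⟩,
    ⟨chart v₇ u₇ q₂ p₂, {u₇, v₇ + const (a 2)}⟩,
    ⟨chart q₁ p₁ q₂⁻¹ p₂⁻¹, {p₂⁻¹, q₂⁻¹}⟩,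
    ⟨chart q₁ p₁ u₉ v₉, {u₉, v₉ + 1}⟩,
    ⟨chart q₁ p₁ u₁₀ v₁₀, {u₁₀, v₁₀ + b₂}⟩,
    ⟨chart q₁ p₁ u₁₁ v₁₁, {u₁₁, v₁₁ + b₂ ^ 2 + const (a' 0)}⟩,
    ⟨chart q₁ p₁ q₂⁻¹ p₂, {p₂, q₂⁻¹}⟩,
    ⟨chart q₁ p₁ u₁₃ v₁₃, {u₁₃, v₁₃ - const (a' 1)}⟩,
    ⟨chart q₁ p₁ q₂ p₂⁻¹, {p₂⁻¹, q₂}⟩,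
    ⟨chart q₁ p₁ v₁₅ u₁₅, {u₁₅, v₁₅ + const (a' 2)}⟩ ]

/-- The fourteen irreducible components of the anti-canonical divisor: the strict transforms of
`q₁ = ∞`, `p₁ = ∞`, `q₂ = ∞`, `p₂ = ∞` and of the exceptional divisors `E₁, E₂, E₃, E₅, E₇, E₉, E₁₀,
E₁₁, E₁₃, E₁₅`; the exceptional divisor `Eᵢ` is `uᵢ = 0` in the chart `Uᵢ`. -/
noncomputable def boundaryA2A2 : List Subvariety :=
  let u₁ := q₁⁻¹
  let v₁ := q₁ * p₁⁻¹
  let u₂ := u₁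
  let v₂ := u₁⁻¹ * (v₁ + 1)
  let u₃ := u₂
  let v₃ := u₂⁻¹ * (v₂ + b₁)
  let u₅ := q₁⁻¹
  let v₅ := q₁ * p₁
  let u₇ := p₁⁻¹
  let v₇ := q₁ * p₁
  let u₉ := q₂⁻¹
  let v₉ := p₂⁻¹ * q₂
  let u₁₀ := u₉
  let v₁₀ := u₉⁻¹ * (v₉ + 1)
  let u₁₁ := u₁₀
  let v₁₁ := u₁₀⁻¹ * (v₁₀ + b₂)
  let u₁₃ := q₂⁻¹
  let v₁₃ := p₂ * q₂
  let u₁₅ := p₂⁻¹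
  let v₁₅ := p₂ * q₂
  [ ⟨chart q₁⁻¹ p₁ q₂ p₂, {q₁⁻¹}⟩,
    ⟨chart q₁ p₁⁻¹ q₂ p₂, {p₁⁻¹}⟩,
    ⟨chart q₁ p₁ q₂⁻¹ p₂, {q₂⁻¹}⟩,
    ⟨chart q₁ p₁ q₂ p₂⁻¹, {p₂⁻¹}⟩,
    ⟨chart u₁ v₁ q₂ p₂, {u₁}⟩,
    ⟨chart u₂ v₂ q₂ p₂, {u₂}⟩,
    ⟨chart u₃ v₃ q₂ p₂, {u₃}⟩,
    ⟨chart u₅ v₅ q₂ p₂, {u₅}⟩,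
    ⟨chart v₇ u₇ q₂ p₂, {u₇}⟩,
    ⟨chart q₁ p₁ u₉ v₉, {u₉}⟩,
    ⟨chart q₁ p₁ u₁₀ v₁₀, {u₁₀}⟩,
    ⟨chart q₁ p₁ u₁₁ v₁₁, {u₁₁}⟩,
    ⟨chart q₁ p₁ u₁₃ v₁₃, {u₁₃}⟩,
    ⟨chart q₁ p₁ v₁₅ u₁₅, {u₁₅}⟩ ]

/-- The total space of the family `(b₁, b₂) ↦ X_a`. -/
noncomputable def spaceA2A2 (a a' : Fin 3 → ℂ) : Set (LocalSubring K) :=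
  iteratedBlowUp projLines (centersA2A2 a a')

/-- The total space of the family `(b₁, b₂) ↦ X_a ∖ D`. -/
noncomputable def openSpaceA2A2 (a a' : Fin 3 → ℂ) : Set (LocalSubring K) :=
  complement (spaceA2A2 a a') boundaryA2A2

/-! ### The second family (type `A₅⁽¹⁾`) -/

/-- The sixteen centres `C₁, …, C₁₆` of the successive blow-ups. -/
noncomputable def centersA5 (a : Fin 6 → ℂ) : List Subvariety :=
  let u₁ := q₂⁻¹
  let v₁ := q₂ * p₁⁻¹
  let u₂ := u₁
  let v₂ := u₁⁻¹ * (v₁ + 1)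
  let u₃ := u₂
  let v₃ := u₂⁻¹ * (q₁ + p₂ - b₁)
  let u₅ := q₂⁻¹
  let v₅ := p₂ * q₂
  let u₇ := p₁⁻¹
  let v₇ := q₁ * p₁
  let u₉ := q₁⁻¹
  let v₉ := q₁ * p₂⁻¹
  let u₁₀ := u₉
  let v₁₀ := u₉⁻¹ * (v₉ + 1)
  let u₁₁ := u₁₀
  let v₁₁ := u₁₀⁻¹ * (q₂ + p₁ - b₂)
  let u₁₃ := q₁⁻¹
  let v₁₃ := q₁ * p₁
  let u₁₅ := p₂⁻¹
  let v₁₅ := p₂ * q₂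
  [ ⟨chart q₁ p₁⁻¹ q₂⁻¹ p₂, {q₂⁻¹, p₁⁻¹}⟩,
    ⟨chart q₁ v₁ u₁ p₂, {u₁, v₁ + 1}⟩,
    ⟨chart q₁ v₂ u₂ p₂, {u₂, q₁ + p₂ - b₁}⟩,
    ⟨chart q₁ v₂ u₃ v₃, {u₃, v₃ + const (a 0)}⟩,
    ⟨chart q₁ p₁ q₂⁻¹ p₂, {q₂⁻¹, p₂}⟩,
    ⟨chart q₁ p₁ u₅ v₅, {u₅, v₅ + const (a 2)}⟩,
    ⟨chart q₁ p₁⁻¹ q₂ p₂, {q₁, p₁⁻¹}⟩,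
    ⟨chart v₇ u₇ q₂ p₂, {u₇, v₇ - const (a 4)}⟩,
    ⟨chart q₁⁻¹ p₁ q₂ p₂⁻¹, {q₁⁻¹, p₂⁻¹}⟩,
    ⟨chart u₉ p₁ q₂ v₉, {u₉, v₉ + 1}⟩,
    ⟨chart u₁₀ p₁ q₂ v₁₀, {u₁₀, q₂ + p₁ - b₂}⟩,
    ⟨chart u₁₁ v₁₁ q₂ v₁₀, {u₁₁, v₁₁ + const (a 3)}⟩,
    ⟨chart q₁⁻¹ p₁ q₂ p₂, {q₁⁻¹, p₁}⟩,
    ⟨chart u₁₃ v₁₃ q₂ p₂, {u₁₃, v₁₃ + const (a 5)}⟩,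
    ⟨chart q₁ p₁ q₂ p₂⁻¹, {p₂⁻¹, q₂}⟩,
    ⟨chart q₁ p₁ v₁₅ u₁₅, {u₁₅, v₁₅ - const (a 1)}⟩ ]

/-- The fourteen irreducible components of the anti-canonical divisor, listed as for the first
family. -/
noncomputable def boundaryA5 : List Subvariety :=
  let u₁ := q₂⁻¹
  let v₁ := q₂ * p₁⁻¹
  let u₂ := u₁
  let v₂ := u₁⁻¹ * (v₁ + 1)
  let u₃ := u₂
  let v₃ := u₂⁻¹ * (q₁ + p₂ - b₁)
  let u₅ := q₂⁻¹
  let v₅ := p₂ * q₂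
  let u₇ := p₁⁻¹
  let v₇ := q₁ * p₁
  let u₉ := q₁⁻¹
  let v₉ := q₁ * p₂⁻¹
  let u₁₀ := u₉
  let v₁₀ := u₉⁻¹ * (v₉ + 1)
  let u₁₁ := u₁₀
  let v₁₁ := u₁₀⁻¹ * (q₂ + p₁ - b₂)
  let u₁₃ := q₁⁻¹
  let v₁₃ := q₁ * p₁
  let u₁₅ := p₂⁻¹
  let v₁₅ := p₂ * q₂
  [ ⟨chart q₁⁻¹ p₁ q₂ p₂, {q₁⁻¹}⟩,
    ⟨chart q₁ p₁⁻¹ q₂ p₂, {p₁⁻¹}⟩,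
    ⟨chart q₁ p₁ q₂⁻¹ p₂, {q₂⁻¹}⟩,
    ⟨chart q₁ p₁ q₂ p₂⁻¹, {p₂⁻¹}⟩,
    ⟨chart q₁ v₁ u₁ p₂, {u₁}⟩,
    ⟨chart q₁ v₂ u₂ p₂, {u₂}⟩,
    ⟨chart q₁ v₂ u₃ v₃, {u₃}⟩,
    ⟨chart q₁ p₁ u₅ v₅, {u₅}⟩,
    ⟨chart v₇ u₇ q₂ p₂, {u₇}⟩,
    ⟨chart u₉ p₁ q₂ v₉, {u₉}⟩,
    ⟨chart u₁₀ p₁ q₂ v₁₀, {u₁₀}⟩,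
    ⟨chart u₁₁ v₁₁ q₂ v₁₀, {u₁₁}⟩,
    ⟨chart u₁₃ v₁₃ q₂ p₂, {u₁₃}⟩,
    ⟨chart q₁ p₁ v₁₅ u₁₅, {u₁₅}⟩ ]

/-- The total space of the family `(b₁, b₂) ↦ X_a`. -/
noncomputable def spaceA5 (a : Fin 6 → ℂ) : Set (LocalSubring K) :=
  iteratedBlowUp projLines (centersA5 a)

/-- The total space of the family `(b₁, b₂) ↦ X_a ∖ D`. -/
noncomputable def openSpaceA5 (a : Fin 6 → ℂ) : Set (LocalSubring K) :=
  complement (spaceA5 a) boundaryA5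

/-! ### Hamiltonian systems -/

/-- The derivation `δ = d/dt` of the function field is the non-autonomous Hamiltonian system with
the Hamiltonian `I` and `db₁/dt = β₁`, `db₂/dt = β₂`. -/
structure IsHamiltonianSystem (I β₁ β₂ : Poly) (δ : Derivation ℂ K K) : Prop where
  dq₁ : δ q₁ = algebraMap Poly K (pderiv Var.p₁ I)
  dp₁ : δ p₁ = -algebraMap Poly K (pderiv Var.q₁ I)
  dq₂ : δ q₂ = algebraMap Poly K (pderiv Var.p₂ I)
  dp₂ : δ p₂ = -algebraMap Poly K (pderiv Var.q₂ I)
  db₁ : δ b₁ = algebraMap Poly K β₁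
  db₂ : δ b₂ = algebraMap Poly K β₂

/-- The vector field `δ` is regular at every point of `V`. -/
def IsRegularOn (δ : Derivation ℂ K K) (V : Set (LocalSubring K)) : Prop :=
  ∀ R ∈ V, ∀ f ∈ R.toSubring, δ f ∈ R.toSubring

/-- The Hamiltonian system with the Hamiltonian `I` and `db₁/dt = β₁`, `db₂/dt = β₂` determines a
(unique) rational vector field, and this vector field is regular on `V`. -/
def IsRegularSystem (I β₁ β₂ : Poly) (V : Set (LocalSubring K)) : Prop :=
  ∃ δ : Derivation ℂ K K, IsHamiltonianSystem I β₁ β₂ δ ∧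
    (∀ δ' : Derivation ℂ K K, IsHamiltonianSystem I β₁ β₂ δ' → δ' = δ) ∧ IsRegularOn δ V

/-- The Hamiltonian of the fourth Painlevé equation in the normalization
`q p (q + p - b) - a₁ q + a₂ p`. -/
noncomputable def hamIV (q p b : Poly) (a₁ a₂ : ℂ) : Poly :=
  q * p * (q + p - b) - C a₁ * q + C a₂ * p

/-- The Hamiltonian of the fifth Painlevé equation
`p q (p + t) (q - s) + α t q + β s p + γ p q`. -/
noncomputable def hamV (q p : Poly) (α β γ : ℂ) (s t : Poly) : Poly :=
  p * q * (p + t) * (q - s) + C α * t * q + C β * s * p + C γ * p * q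

/-- The coupled fifth Painlevé Hamiltonian. -/
noncomputable def coupledHamV (a : Fin 6 → ℂ) : Poly :=
  let γ : ℂ := (1 / 2) * (a 0 + a 2 + a 4 - a 1 - a 3 - a 5)
  hamV (X Var.q₁) (X Var.p₁) (a 5) (a 4) (-γ) (X Var.b₁) (-X Var.b₂)
    + hamV (X Var.q₂) (X Var.p₂) (a 2) (a 1) γ (X Var.b₂) (-X Var.b₁)
    - 2 * X Var.q₁ * X Var.p₁ * X Var.q₂ * X Var.p₂

end PainleveFlow

/-!
# Places, local subrings and the propagation of ideals through blow-ups
-/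

namespace PainleveFlow

variable {F : Type*} [Field F]

/-! ### Spans over a subring and localizations -/

/-! A vector field can only have poles in codimension one, and the proof makes this principle
explicit. `Good δ 𝒟 R` says that the local ring `R` is the intersection of a `δ`-stable ring with
the valuation rings of those divisors of a finite list `𝒟` that pass through the point. Such a ring
is `δ`-stable as soon as `δ` preserves these valuation rings (`Good.stable`). The components of the
field are polynomial, so the local rings of `(ℙ¹)⁴` are good with only the four divisors at infinity
in the list (`good_projLines`). Blowing up a centre whose ideal at each of its points is generated
by two elements `f`, `g` adds only the exceptional divisor: the residue of `f / g` on it is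
transcendental, hence `g` generates its ideal in `R[f/g]`, and inverting `g` leads back to a
localization of `R` (`Good.blow`, `good_blowUp`).

After sixteen blow-ups there are twenty divisors. Fourteen of them are components of the
anti-canonical divisor, so no point of the complement lies on them. The others are `E₄, E₆, E₈, E₁₂,
E₁₄, E₁₆`, and there the field is computed in coordinates adapted to the exceptional divisor
(`flow_six`, `flow_eight`, `flow_four`, `Half.IsFlowV.six`, `Half.IsFlowV.eight`,
`Half.IsFlowV.four`). The constants in the centres make the poles cancel; along `E₄` and `E₁₂` this
also uses the prescribed motion of `b₁, b₂`.

What remains is to exhibit two generators of the ideal of every centre at every one of its points,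
including those where the other coordinates are infinite or which lie over earlier centres. Generic
points are treated as places with residues in the function field itself: the place of `yᵢ = 0, yⱼ =
c` sends these two coordinates to `0` and `c` and fixes the others. `Kr` records generators of the
ideal of a place in a local ring; `Ret` is the stronger statement that residues have representatives
in that ring. Generators pass through a blow-up by `Kr.step` if the new coordinate has the residue
of an old element, and by `Kr.free` if its residue is transcendental.

In the first family the blow-ups in `(q₁, p₁)` are transverse to those in `(q₂, p₂)`, so the space
is a composition of two independent towers (`exists_tower`, `Tower.ret`).

In the second family the two groups of eight blow-ups are the same construction `Half` with the
coordinates exchanged, but they interact: the closure of `q₁ + p₂ = b₁`, which cuts out the third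
centre, passes through `q₁ = p₂ = ∞`, where the second group starts. Cleared of denominators, its
equation is one of the equations of `C₉` (`Half.Dual.σ₀_eq`). Hence the construction is carried out
for a first centre with generators `σ`, `u`, where `σ` is a unit multiple of `t (1 - u ζ) + u`
(`Half.Sig`, `Half.Input.good`). This form survives the first eight blow-ups (`Half.Dual.input`), so
the same theorem applies twice. -/

/-- The `A`-submodule of the field generated by a set, for a subring `A`. -/
def Spn (A : Subring F) (G : Set F) : Submodule A F := Submodule.span A G

namespace Spn

variable {A B : Subring F} {G H : Set F} {x y a b c : F}

lemma gen (h : x ∈ G) : x ∈ Spn A G := Submodule.subset_span h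

lemma mul (ha : a ∈ A) (hx : x ∈ Spn A G) : a * x ∈ Spn A G :=
  (Spn A G).smul_mem (⟨a, ha⟩ : A) hx

lemma le (hAB : A ≤ B) (hG : ∀ g ∈ G, g ∈ Spn B H) (hx : x ∈ Spn A G) : x ∈ Spn B H := by
  induction hx using Submodule.span_induction with
  | mem x h => exact hG x h
  | zero => exact zero_mem _
  | add x y _ _ hx hy => exact add_mem hx hy
  | smul a x _ hx => exact mul (hAB a.2) hx

lemma mem_pair : x ∈ Spn A {y, c} ↔ ∃ a ∈ A, ∃ b ∈ A, x = a * y + b * c := by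
  constructor
  · intro h
    obtain ⟨a, b, h⟩ := Submodule.mem_span_pair.1 h
    exact ⟨a, a.2, b, b.2, h.symm⟩
  · rintro ⟨a, ha, b, hb, rfl⟩
    exact add_mem (mul ha (gen (by simp))) (mul hb (gen (by simp)))

end Spn

/-- The subring `R` consists of fractions of elements of `A` with denominators invertible in `R`. -/
def Loc (A R : Subring F) : Prop :=
  A ≤ R ∧ ∀ r ∈ R, ∃ a ∈ A, ∃ s ∈ A, s ≠ 0 ∧ s⁻¹ ∈ R ∧ r = a / s

lemma Loc.refl (A : Subring F) : Loc A A :=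
  ⟨le_rfl, fun r hr => ⟨r, hr, 1, one_mem _, one_ne_zero, by simp, by simp⟩⟩

/-- The subring generated by a subring and an element. -/
def adj (A : Subring F) (t : F) : Subring F := Subring.closure ((A : Set F) ∪ {t})

lemma le_adj (A : Subring F) (t : F) : A ≤ adj A t := fun _ hx => Subring.subset_closure (.inl hx)

lemma self_mem_adj (A : Subring F) (t : F) : t ∈ adj A t := Subring.subset_closure (.inr rfl)

lemma adj_le {A B : Subring F} {t : F} (h : A ≤ B) (ht : t ∈ B) : adj A t ≤ B :=
  Subring.closure_le.2 (Set.union_subset h (by simpa using ht))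

/-- Division by `t - w`: modulo it, the new generator becomes an element of the old ring. -/
lemma adj_decomp {A : Subring F} {t w a : F} (hw : w ∈ A) (ha : a ∈ adj A t) :
    ∃ a₀ ∈ A, ∃ a₁ ∈ adj A t, a = a₀ + a₁ * (t - w) := by
  induction ha using Subring.closure_induction with
  | mem x h =>
    rcases h with h | rfl
    · exact ⟨x, h, 0, Subring.zero_mem _, by ring⟩
    · exact ⟨w, hw, 1, Subring.one_mem _, by ring⟩
  | zero => exact ⟨0, Subring.zero_mem _, 0, Subring.zero_mem _, by ring⟩
  | one => exact ⟨1, Subring.one_mem _, 0, Subring.zero_mem _, by ring⟩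
  | add x y _ _ hx hy =>
    obtain ⟨c, hc, c', hc', rfl⟩ := hx
    obtain ⟨d, hd, d', hd', rfl⟩ := hy
    exact ⟨c + d, add_mem hc hd, c' + d', add_mem hc' hd', by ring⟩
  | neg x _ hx =>
    obtain ⟨c, hc, c', hc', rfl⟩ := hx
    exact ⟨-c, neg_mem hc, -c', neg_mem hc', by ring⟩
  | mul x y _ hyA hx hy =>
    obtain ⟨c, hc, c', hc', rfl⟩ := hx
    obtain ⟨d, hd, d', hd', rfl⟩ := hy
    exact ⟨c * d, mul_mem hc hd, c' * (d + d' * (t - w)) + c * d',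
      add_mem (mul_mem hc' hyA) (mul_mem (le_adj _ _ hc) hd'), by ring⟩

/-- Elements of `R[t]` are polynomials in `t`. -/
lemma adj_eval {A : Subring F} {t a : F} (ha : a ∈ adj A t) :
    ∃ (n : ℕ) (f : ℕ → F), (∀ i, f i ∈ A) ∧ a = ∑ i ∈ Finset.range n, f i * t ^ i := by
  have : adj A t ≤ (Algebra.adjoin A {t}).toSubring :=
    adj_le (fun x hx => (Algebra.adjoin A {t}).algebraMap_mem (⟨x, hx⟩ : A))
      (Algebra.subset_adjoin rfl)
  have h2 : a ∈ Algebra.adjoin A {t} := this ha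
  rw [Algebra.adjoin_singleton_eq_range_aeval] at h2
  obtain ⟨p, rfl⟩ := h2
  refine ⟨p.natDegree + 1, fun i => (p.coeff i : F), fun i => (p.coeff i).2, ?_⟩
  change Polynomial.aeval t p = _
  rw [Polynomial.aeval_eq_sum_range]
  rfl

/-! ### The maximal ideal of a local subring -/

/-- The maximal ideal of a local subring of a field, as a set of elements of the field. -/
def Mx (R : LocalSubring F) : Set F :=
  {x | ∃ h : x ∈ R.toSubring, (⟨x, h⟩ : R.toSubring) ∈ IsLocalRing.maximalIdeal R.toSubring}

namespace Mx

variable {R S : LocalSubring F} {x y a : F}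

lemma mem (h : x ∈ Mx R) : x ∈ R.toSubring := h.1

lemma add (hx : x ∈ Mx R) (hy : y ∈ Mx R) : x + y ∈ Mx R :=
  ⟨add_mem hx.1 hy.1, add_mem hx.2 hy.2⟩

lemma mul (ha : a ∈ R.toSubring) (hx : x ∈ Mx R) : a * x ∈ Mx R :=
  ⟨mul_mem ha hx.1, Ideal.mul_mem_left _ (⟨a, ha⟩ : R.toSubring) hx.2⟩

lemma mul' (hx : x ∈ Mx R) (ha : a ∈ R.toSubring) : x * a ∈ Mx R := mul_comm a x ▸ mul ha hx

lemma neg (hx : x ∈ Mx R) : -x ∈ Mx R := ⟨neg_mem hx.1, neg_mem hx.2⟩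

lemma sub (hx : x ∈ Mx R) (hy : y ∈ Mx R) : x - y ∈ Mx R :=
  ⟨sub_mem hx.1 hy.1, sub_mem hx.2 hy.2⟩

lemma one_notMem : (1 : F) ∉ Mx R := fun h =>
  (Ideal.ne_top_iff_one _).1 (IsLocalRing.maximalIdeal.isMaximal R.toSubring).ne_top h.2

lemma zero_mem : (0 : F) ∈ Mx R := ⟨Subring.zero_mem _, Ideal.zero_mem _⟩

lemma ne_zero (h : x ∉ Mx R) : x ≠ 0 := fun h0 => h (h0 ▸ zero_mem)

lemma inv_mem (hx : x ∈ R.toSubring) (h : x ∉ Mx R) : x⁻¹ ∈ R.toSubring := by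
  have hu : IsUnit (⟨x, hx⟩ : R.toSubring) := by
    by_contra hu
    exact h ⟨hx, (IsLocalRing.mem_maximalIdeal _).2 hu⟩
  obtain ⟨⟨v, hv⟩, hv'⟩ := hu.exists_right_inv
  have : x * v = 1 := congrArg Subtype.val hv'
  rwa [← eq_inv_of_mul_eq_one_right this]

lemma notMem_of_inv (h0 : x ≠ 0) (h : x⁻¹ ∈ R.toSubring) : x ∉ Mx R := fun hx =>
  one_notMem (R := R) (by simpa [h0] using mul h hx)

/-- An element congruent to a unit is a unit. -/
lemma notMem_of_sub (h : x - y ∈ Mx R) (hy : y ∉ Mx R) : x ∉ Mx R := fun hx => hy (by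
  simpa using sub hx h)

lemma one_sub_notMem (h : x ∈ Mx R) : 1 - x ∉ Mx R := fun h' =>
  one_notMem (R := R) (by simpa using add h' h)

lemma spn {G : Set F} (hG : ∀ g ∈ G, g ∈ Mx R) (hx : x ∈ Spn R.toSubring G) : x ∈ Mx R := by
  induction hx using Submodule.span_induction with
  | mem x h => exact hG x h
  | zero => exact zero_mem
  | add x y _ _ hx hy => exact add hx hy
  | smul a x _ hx => exact mul a.2 hx

end Mx

/-! ### Places -/

variable [Algebra ℂ F]

/-- A place of the field `F`: the relation `rel x c` says that `x` is regular with residue `c`. -/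
structure Place (F : Type*) [Field F] [Algebra ℂ F] where
  /-- The residue relation. -/
  rel : F → F → Prop
  const (c : ℂ) : rel (algebraMap ℂ F c) (algebraMap ℂ F c)
  add {x y c d : F} : rel x c → rel y d → rel (x + y) (c + d)
  mul {x y c d : F} : rel x c → rel y d → rel (x * y) (c * d)
  inv {x c : F} : rel x c → c ≠ 0 → rel x⁻¹ c⁻¹
  uniq {c : F} : rel 0 c → c = 0

namespace Place

variable {Γ Γ' : Place F} {x y c d : F}

lemma one : Γ.rel 1 1 := by simpa using Γ.const 1

lemma zero : Γ.rel 0 0 := by simpa using Γ.const 0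

lemma neg (h : Γ.rel x c) : Γ.rel (-x) (-c) := by simpa using Γ.mul (Γ.const (-1)) h

lemma sub (h : Γ.rel x c) (h' : Γ.rel y d) : Γ.rel (x - y) (c - d) := by
  simpa [sub_eq_add_neg] using Γ.add h (neg h')

lemma div (h : Γ.rel x c) (h' : Γ.rel y d) (hd : d ≠ 0) : Γ.rel (x / y) (c / d) := by
  simpa [div_eq_mul_inv] using Γ.mul h (Γ.inv h' hd)

lemma pow (h : Γ.rel x c) (n : ℕ) : Γ.rel (x ^ n) (c ^ n) := by
  induction n with
  | zero => simpa using one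
  | succ n ih => simpa [pow_succ] using Γ.mul ih h

lemma eq (h : Γ.rel x c) (h' : Γ.rel x d) : c = d :=
  sub_eq_zero.1 (Γ.uniq (by simpa using sub h h'))

lemma ne_zero (h : Γ.rel x c) (hc : c ≠ 0) : x ≠ 0 := by
  rintro rfl
  exact hc (Γ.uniq h)

lemma cast (h : Γ.rel x c) (hx : x = y) (hc : c = d) : Γ.rel y d := hx ▸ hc ▸ h

/-- Products with an element of residue zero. -/
lemma mul_zero' (h : Γ.rel x c) (h' : Γ.rel y 0) : Γ.rel (x * y) 0 :=
  cast (Γ.mul h h') rfl (mul_zero c)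

/-- The element is regular. -/
def mem (Γ : Place F) (x : F) : Prop := ∃ c, Γ.rel x c

lemma not_mem_inv (h : Γ.rel x 0) (h0 : x ≠ 0) : ¬ Γ.mem x⁻¹ := by
  rintro ⟨c, hc⟩
  have := Γ.mul h hc
  rw [mul_inv_cancel₀ h0, zero_mul] at this
  exact one_ne_zero (eq one this)

/-- The valuation ring of the larger place dominates that of the smaller one, with the same
residues. A typical example is the place of a centre below the place of its exceptional divisor. -/
instance : LE (Place F) := ⟨fun Γ Γ' => ∀ x c, Γ.rel x c → Γ'.rel x c⟩

lemma le_trans' {Γ₁ Γ₂ Γ₃ : Place F} (h : Γ₁ ≤ Γ₂) (h' : Γ₂ ≤ Γ₃) : Γ₁ ≤ Γ₃ :=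
  fun x c hx => h' x c (h x c hx)

/-- The local ring of the place contains the subring `R`. -/
def Sub (R : Subring F) (Γ : Place F) : Prop := ∀ r ∈ R, Γ.mem r

lemma Sub.mono {R S : Subring F} (h : Sub S Γ) (hRS : R ≤ S) : Sub R Γ :=
  fun r hr => h r (hRS hr)

/-- A unit of `R` would have a regular inverse at the place, which is impossible for an element with
residue zero. -/
lemma Sub.mx {R : LocalSubring F} (h : Sub R.toSubring Γ) (hx : x ∈ R.toSubring)
    (h0 : Γ.rel x 0) : x ∈ Mx R := by
  by_contra hx'
  exact not_mem_inv h0 (Mx.ne_zero hx') (h _ (Mx.inv_mem hx hx'))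

lemma Sub.up {R : Subring F} (h : Sub R Γ) (hΓ : Γ ≤ Γ') : Sub R Γ' := fun r hr =>
  let ⟨c, hc⟩ := h r hr
  ⟨c, hΓ _ _ hc⟩

/-- The residue field of the place. -/
def residues (Γ : Place F) : IntermediateField ℂ F where
  carrier := {c | ∃ x, Γ.rel x c}
  mul_mem' := fun ⟨x, hx⟩ ⟨y, hy⟩ => ⟨_, Γ.mul hx hy⟩
  add_mem' := fun ⟨x, hx⟩ ⟨y, hy⟩ => ⟨_, Γ.add hx hy⟩
  algebraMap_mem' := fun c => ⟨_, Γ.const c⟩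
  inv_mem' := by
    rintro c ⟨x, hx⟩
    by_cases hc : c = 0
    · exact ⟨0, by simpa [hc] using zero⟩
    · exact ⟨_, Γ.inv hx hc⟩

lemma mem_residues (h : Γ.rel x c) : c ∈ Γ.residues := ⟨x, h⟩

lemma rel_sum_pow {ι : Type*} (s : Finset ι) (f g : ι → F) (h : ∀ i ∈ s, Γ.rel (f i) (g i)) :
    Γ.rel (∑ i ∈ s, f i) (∑ i ∈ s, g i) := by
  classical
  induction s using Finset.induction_on with
  | empty => simpa using zero
  | insert a s ha ih =>
    rw [Finset.sum_insert ha, Finset.sum_insert ha]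
    exact Γ.add (h a (by simp)) (ih fun i hi => h i (by simp [hi]))

end Place

open Place

/-! ### Ideals of subvarieties in local rings -/

/-- The ideal of the place in the local ring `R ⊆ O_Γ` is generated by `G`. -/
structure Kr (Γ : Place F) (R : LocalSubring F) (G : Set F) : Prop where
  sub : Sub R.toSubring Γ
  ring : ∀ g ∈ G, g ∈ R.toSubring
  zero : ∀ g ∈ G, Γ.rel g 0
  ker : ∀ r ∈ R.toSubring, Γ.rel r 0 → r ∈ Spn R.toSubring G

/-- The place retracts the local ring `R ⊆ O_Γ` to a subring, with the kernel generated by `G`. -/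
structure Ret (Γ : Place F) (R : LocalSubring F) (G : Set F) : Prop where
  ring : ∀ g ∈ G, g ∈ R.toSubring
  zero : ∀ g ∈ G, Γ.rel g 0
  ret : ∀ r ∈ R.toSubring, ∃ c ∈ R.toSubring, Γ.rel r c ∧ r - c ∈ Spn R.toSubring G

variable {Γ Γ' : Place F} {R S : LocalSubring F} {G G' : Set F}

lemma Kr.mx (h : Kr Γ R G) : ∀ g ∈ G, g ∈ Mx R := fun g hg => h.sub.mx (h.ring g hg) (h.zero g hg)

lemma Ret.kr (h : Ret Γ R G) : Kr Γ R G := by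
  refine ⟨fun r hr => ?_, h.ring, h.zero, fun r hr h0 => ?_⟩
  · obtain ⟨c, -, hc, -⟩ := h.ret r hr
    exact ⟨c, hc⟩
  · obtain ⟨c, -, hc, hc'⟩ := h.ret r hr
    rw [Place.eq hc h0] at hc'
    simpa using hc'

/-- An element of `R` already has a residue at the smaller place, and it keeps this residue at the
larger one. So both places cut out the same ideal. -/
lemma Kr.up (h : Kr Γ R G) (hΓ : Γ ≤ Γ') : Kr Γ' R G := by
  refine ⟨h.sub.up hΓ, h.ring, fun g hg => hΓ _ _ (h.zero g hg), fun r hr h0 => ?_⟩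
  obtain ⟨c, hc⟩ := h.sub r hr
  rw [Place.eq (hΓ _ _ hc) h0] at hc
  exact h.ker r hr hc

/-- Change of the generators. -/
lemma Kr.congr (h : Kr Γ R G) (h1 : ∀ g ∈ G', g ∈ R.toSubring) (h2 : ∀ g ∈ G', Γ.rel g 0)
    (h3 : ∀ g ∈ G, g ∈ Spn R.toSubring G') : Kr Γ R G' :=
  ⟨h.sub, h1, h2, fun r hr h0 => Spn.le le_rfl h3 (h.ker r hr h0)⟩

/-- A retraction exists if it exists on generators. -/
lemma Ret.of_gens {X : Set F} (hX : Loc (Subring.closure X) R.toSubring)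
    (hG : ∀ g ∈ G, g ∈ Mx R) (h0 : ∀ g ∈ G, Γ.rel g 0)
    (hgen : ∀ x ∈ X, ∃ c ∈ R.toSubring, Γ.rel x c ∧ x - c ∈ Spn R.toSubring G) : Ret Γ R G := by
  refine ⟨fun g hg => (hG g hg).1, h0, ?_⟩
  have key : ∀ a ∈ Subring.closure X, ∃ c ∈ R.toSubring, Γ.rel a c ∧ a - c ∈ Spn R.toSubring G := by
    intro a ha
    induction ha using Subring.closure_induction with
    | mem x h => exact hgen x h
    | zero => exact ⟨0, Subring.zero_mem _, Place.zero, by simp⟩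
    | one => exact ⟨1, Subring.one_mem _, Place.one, by simp⟩
    | add x y _ _ hx hy =>
      obtain ⟨c, hc, h1, h2⟩ := hx
      obtain ⟨d, hd, h3, h4⟩ := hy
      exact ⟨c + d, add_mem hc hd, Γ.add h1 h3, by
        rw [add_sub_add_comm]; exact add_mem h2 h4⟩
    | neg x _ hx =>
      obtain ⟨c, hc, h1, h2⟩ := hx
      exact ⟨-c, neg_mem hc, Place.neg h1, by
        rw [← neg_sub']; exact neg_mem h2⟩
    | mul x y _ hyA hx hy =>
      obtain ⟨c, hc, h1, h2⟩ := hx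
      obtain ⟨d, hd, h3, h4⟩ := hy
      refine ⟨c * d, mul_mem hc hd, Γ.mul h1 h3, ?_⟩
      have : x * y - c * d = y * (x - c) + c * (y - d) := by ring
      rw [this]
      exact add_mem (Spn.mul (hX.1 hyA) h2) (Spn.mul hc h4)
  intro r hr
  obtain ⟨a, ha, s, hs, hs0, hsR, rfl⟩ := hX.2 r hr
  obtain ⟨c, hc, h1, h2⟩ := key a ha
  obtain ⟨d, hd, h3, h4⟩ := key s hs
  have hsM : s ∉ Mx R := Mx.notMem_of_inv hs0 hsR
  -- A denominator is congruent to its residue modulo the maximal ideal, so the residue is a unit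
  -- too and fractions can be retracted.
  have hdM : d ∉ Mx R := fun hd' => hsM (by simpa using Mx.add (Mx.spn hG h4) hd')
  have hd0 := Mx.ne_zero hdM
  have hdR := Mx.inv_mem hd hdM
  refine ⟨c / d, by rw [div_eq_mul_inv]; exact mul_mem hc hdR, Place.div h1 h3 hd0, ?_⟩
  have : a / s - c / d = s⁻¹ * (a - c) + -(s⁻¹ * d⁻¹ * c) * (s - d) := by field_simp; ring
  rw [this]
  exact add_mem (Spn.mul hsR h2)
    (Spn.mul (neg_mem (mul_mem (mul_mem hsR hdR) hc)) h4)

/-- Passage of a retraction to a ring with one more generator. -/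
lemma Ret.step {t : F} (h : Ret Γ R G) (hS : Loc (adj R.toSubring t) S.toSubring)
    (hG' : ∀ g ∈ G', g ∈ Mx S) (h0 : ∀ g ∈ G', Γ.rel g 0)
    (hGG : ∀ g ∈ G, g ∈ Spn S.toSubring G')
    (ht : ∃ c ∈ S.toSubring, Γ.rel t c ∧ t - c ∈ Spn S.toSubring G') : Ret Γ S G' := by
  have hRS : R.toSubring ≤ S.toSubring := (le_adj _ _).trans hS.1
  refine Ret.of_gens hS hG' h0 ?_
  rintro x (hx | rfl)
  · obtain ⟨c, hc, h1, h2⟩ := h.ret x hx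
    exact ⟨c, hRS hc, h1, Spn.le hRS hGG h2⟩
  · exact ht

/-- Passage of the ideal of a place to a ring with one more generator whose residue is the residue
of an element of the old ring. -/
lemma Kr.step {t w : F} (h : Kr Γ R G) (hS : Loc (adj R.toSubring t) S.toSubring)
    (hΓ : Γ ≤ Γ') (hw : w ∈ R.toSubring) (hr : Γ'.rel (t - w) 0)
    (hG' : ∀ g ∈ G', g ∈ Mx S) (h0 : ∀ g ∈ G', Γ'.rel g 0)
    (hGG : ∀ g ∈ G, g ∈ Spn S.toSubring G') (ht : t - w ∈ Spn S.toSubring G') : Kr Γ' S G' := by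
  have hRS : R.toSubring ≤ S.toSubring := (le_adj _ _).trans hS.1
  have hsub : Sub (adj R.toSubring t) Γ' := by
    intro a ha
    induction ha using Subring.closure_induction with
    | mem x hx =>
      rcases hx with hx | rfl
      · exact h.sub.up hΓ x hx
      · obtain ⟨c, hc⟩ := h.sub w hw
        exact ⟨_, (by simpa using Γ'.add hr (hΓ _ _ hc) : Γ'.rel x c)⟩
    | zero => exact ⟨0, Place.zero⟩
    | one => exact ⟨1, Place.one⟩
    | add x y _ _ hx hy =>
      obtain ⟨c, hc⟩ := hx
      obtain ⟨d, hd⟩ := hy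
      exact ⟨_, Γ'.add hc hd⟩
    | neg x _ hx =>
      obtain ⟨c, hc⟩ := hx
      exact ⟨_, Place.neg hc⟩
    | mul x y _ _ hx hy =>
      obtain ⟨c, hc⟩ := hx
      obtain ⟨d, hd⟩ := hy
      exact ⟨_, Γ'.mul hc hd⟩
  have key : ∀ a ∈ adj R.toSubring t, Γ'.rel a 0 → a ∈ Spn S.toSubring G' := by
    intro a ha ha0
    -- The multiple of `t - w` lies in the new ideal, and what is left is an element of `R` with
    -- residue zero.
    obtain ⟨a₀, ha₀, a₁, ha₁, rfl⟩ := adj_decomp hw ha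
    obtain ⟨c, hc⟩ := hsub a₁ ha₁
    have h1 : Γ'.rel a₀ 0 := by simpa using Place.sub ha0 (mul_zero' hc hr)
    exact add_mem (Spn.le hRS hGG ((h.up hΓ).ker a₀ ha₀ h1)) (Spn.mul (hS.1 ha₁) ht)
  -- The kernel on `R[t]` lies in the maximal ideal of `S`, so denominators that become invertible
  -- in `S` have nonzero residue.
  have hunit : ∀ s ∈ adj R.toSubring t, s ≠ 0 → s⁻¹ ∈ S.toSubring → ¬ Γ'.rel s 0 :=
    fun s hs hs0 hsS hs1 => Mx.notMem_of_inv hs0 hsS (Mx.spn hG' (key s hs hs1))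
  refine ⟨fun r hr => ?_, fun g hg => (hG' g hg).1, h0, fun r hr hr0 => ?_⟩
  · obtain ⟨a, ha, s, hs, hs0, hsS, rfl⟩ := hS.2 r hr
    obtain ⟨c, hc⟩ := hsub a ha
    obtain ⟨d, hd⟩ := hsub s hs
    exact ⟨_, Place.div hc hd (by rintro rfl; exact hunit s hs hs0 hsS hd)⟩
  · obtain ⟨a, ha, s, hs, hs0, hsS, rfl⟩ := hS.2 r hr
    obtain ⟨d, hd⟩ := hsub s hs
    have h1 : Γ'.rel a 0 := by
      have := mul_zero' hd hr0
      rwa [mul_div_cancel₀ _ hs0] at this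
    rw [div_eq_inv_mul]
    exact Spn.mul hsS (key a ha h1)

lemma coeff_eq_zero {L : IntermediateField ℂ F} {τ : F} (hτ : Transcendental L τ) {n : ℕ}
    {f : ℕ → F} (hf : ∀ i, f i ∈ L) (h : ∑ i ∈ Finset.range n, f i * τ ^ i = 0) :
    ∀ i < n, f i = 0 := by
  classical
  let p : Polynomial L := ∑ i ∈ Finset.range n, Polynomial.monomial i (⟨f i, hf i⟩ : L)
  have hp : Polynomial.aeval τ p = 0 := by
    simp only [p, map_sum, Polynomial.aeval_monomial]
    exact h
  have hp0 : p = 0 := by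
    by_contra hne
    exact hτ ⟨p, hne, hp⟩
  intro i hi
  have : p.coeff i = 0 := by simp [hp0]
  simp only [p, Polynomial.finsetSum_coeff, Polynomial.coeff_monomial, Finset.sum_ite_eq',
    Finset.mem_range, hi, if_true] at this
  exact congrArg Subtype.val this

/-- Passage of the ideal of a place to a ring with one more generator whose residue is
transcendental over the old residues: the kernel on the polynomial ring. -/
lemma Kr.free_adj {t τ : F} (h : Kr Γ R G) (hΓ : Γ ≤ Γ') (ht : Γ'.rel t τ)
    (hτ : Transcendental Γ.residues τ) :
    Sub (adj R.toSubring t) Γ' ∧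
      ∀ a ∈ adj R.toSubring t, Γ'.rel a 0 → a ∈ Spn (adj R.toSubring t) G := by
  have main : ∀ a ∈ adj R.toSubring t, ∃ c, Γ'.rel a c ∧ (c = 0 → a ∈ Spn (adj R.toSubring t) G) := by
    intro a ha
    obtain ⟨n, f, hf, rfl⟩ := adj_eval ha
    choose g hg using fun i => h.sub (f i) (hf i)
    refine ⟨∑ i ∈ Finset.range n, g i * τ ^ i, rel_sum_pow _ _ _ fun i _ =>
      Γ'.mul (hΓ _ _ (hg i)) (Place.pow ht i), fun h0 => ?_⟩
    -- By transcendence of `τ` a polynomial in `t` has residue zero only if all its coefficients do.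
    have hz := coeff_eq_zero hτ (fun i => mem_residues (hg i)) h0
    refine sum_mem fun i hi => ?_
    rw [mul_comm]
    refine Spn.mul (pow_mem (self_mem_adj _ _) _) (Spn.le (le_adj _ _) (fun g hg => Spn.gen hg) ?_)
    exact h.ker _ (hf i) (hz i (Finset.mem_range.1 hi) ▸ hg i)
  refine ⟨fun a ha => ?_, fun a ha h0 => ?_⟩
  · obtain ⟨c, hc, -⟩ := main a ha
    exact ⟨c, hc⟩
  · obtain ⟨c, hc, hc'⟩ := main a ha
    exact hc' (Place.eq hc h0)

/-- No new generator is needed: the kernel on `R[t]` is the extension of the old ideal. It lies in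
the maximal ideal of `S`, which excludes denominators with residue zero. -/
lemma Kr.free {t τ : F} (h : Kr Γ R G) (hS : Loc (adj R.toSubring t) S.toSubring)
    (hΓ : Γ ≤ Γ') (ht : Γ'.rel t τ) (hτ : Transcendental Γ.residues τ)
    (hG : ∀ g ∈ G, g ∈ Mx S) : Kr Γ' S G := by
  obtain ⟨hsub, hker⟩ := h.free_adj hΓ ht hτ
  have hRS : R.toSubring ≤ S.toSubring := (le_adj _ _).trans hS.1
  have key : ∀ a ∈ adj R.toSubring t, Γ'.rel a 0 → a ∈ Spn S.toSubring G :=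
    fun a ha h0 => Spn.le hS.1 (fun g hg => Spn.gen hg) (hker a ha h0)
  refine ⟨fun r hr => ?_, fun g hg => (hG g hg).1, fun g hg => hΓ _ _ (h.zero g hg),
    fun r hr hr0 => ?_⟩
  · obtain ⟨a, ha, s, hs, hs0, hsS, rfl⟩ := hS.2 r hr
    obtain ⟨c, hc⟩ := hsub a ha
    obtain ⟨d, hd⟩ := hsub s hs
    refine ⟨_, Place.div hc hd ?_⟩
    rintro rfl
    exact Mx.notMem_of_inv hs0 hsS (Mx.spn hG (key s hs hd))
  · obtain ⟨a, ha, s, hs, hs0, hsS, rfl⟩ := hS.2 r hr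
    obtain ⟨d, hd⟩ := hsub s hs
    have h1 : Γ'.rel a 0 := by
      have := mul_zero' hd hr0
      rwa [mul_div_cancel₀ _ hs0] at this
    rw [div_eq_inv_mul]
    exact Spn.mul hsS (key a ha h1)

end PainleveFlow

namespace PainleveFlow

open Place

/-! ### Rings of fractions with denominators invertible in a given ring -/

section Fractions

variable {F : Type*} [Field F]

/-- The fractions of elements of `B` with denominators invertible in `R`. -/
def fracRing (B R : Subring F) : Subring F where
  carrier := {x | ∃ b ∈ B, ∃ s ∈ B, s ≠ 0 ∧ s⁻¹ ∈ R ∧ x = b / s}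
  zero_mem' := ⟨0, B.zero_mem, 1, B.one_mem, one_ne_zero, by simp, by simp⟩
  one_mem' := ⟨1, B.one_mem, 1, B.one_mem, one_ne_zero, by simp, by simp⟩
  add_mem' := by
    rintro _ _ ⟨b, hb, s, hs, hs0, hsR, rfl⟩ ⟨c, hc, t, ht, ht0, htR, rfl⟩
    exact ⟨b * t + c * s, add_mem (mul_mem hb ht) (mul_mem hc hs), s * t, mul_mem hs ht,
      mul_ne_zero hs0 ht0, by rw [mul_inv]; exact mul_mem hsR htR, by field_simp⟩
  mul_mem' := by
    rintro _ _ ⟨b, hb, s, hs, hs0, hsR, rfl⟩ ⟨c, hc, t, ht, ht0, htR, rfl⟩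
    exact ⟨b * c, mul_mem hb hc, s * t, mul_mem hs ht,
      mul_ne_zero hs0 ht0, by rw [mul_inv]; exact mul_mem hsR htR, by field_simp⟩
  neg_mem' := by
    rintro _ ⟨b, hb, s, hs, hs0, hsR, rfl⟩
    exact ⟨-b, neg_mem hb, s, hs, hs0, hsR, by ring⟩

lemma le_fracRing (B R : Subring F) : B ≤ fracRing B R := fun b hb =>
  ⟨b, hb, 1, B.one_mem, one_ne_zero, by simp, by simp⟩

/-- Fractions of fractions are fractions, so the presentation of `R` can be transferred from `A` to
`B`. -/
lemma Loc.of_frac {A B R : Subring F} (h : Loc A R) (hB : B ≤ R) (hA : A ≤ fracRing B R) :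
    Loc B R := by
  refine ⟨hB, fun r hr => ?_⟩
  obtain ⟨a, ha, s, hs, hs0, hsR, rfl⟩ := h.2 r hr
  obtain ⟨b, hb, s₁, hs₁, hs₁0, hs₁R, rfl⟩ := hA ha
  obtain ⟨c, hc, s₂, hs₂, hs₂0, hs₂R, rfl⟩ := hA hs
  have hc0 : c ≠ 0 := by rintro rfl; simp at hs0
  refine ⟨b * s₂, mul_mem hb hs₂, s₁ * c, mul_mem hs₁ hc, mul_ne_zero hs₁0 hc0, ?_, by field_simp⟩
  have : (s₁ * c)⁻¹ = s₁⁻¹ * (s₂⁻¹ * (c / s₂)⁻¹) := by field_simp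
  rw [this]
  exact mul_mem hs₁R (mul_mem hs₂R hsR)

lemma Loc.of_frac_gens {X : Set F} {B R : Subring F} (h : Loc (Subring.closure X) R) (hB : B ≤ R)
    (hX : ∀ x ∈ X, x ∈ fracRing B R) : Loc B R :=
  h.of_frac hB (Subring.closure_le.2 hX)

lemma mem_fracRing_div {B R : Subring F} {b s : F} (hb : b ∈ B) (hs : s ∈ B) (hs0 : s ≠ 0)
    (hsR : s⁻¹ ∈ R) : b / s ∈ fracRing B R := ⟨b, hb, s, hs, hs0, hsR, rfl⟩

lemma adj_inv_pow {S : Subring F} {g : F} (hg : g ∈ S) (hg0 : g ≠ 0) {x : F} (hx : x ∈ adj S g⁻¹) :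
    ∃ n : ℕ, x * g ^ n ∈ S := by
  induction hx using Subring.closure_induction with
  | mem x h =>
    rcases h with h | rfl
    · exact ⟨0, by simpa using h⟩
    · exact ⟨1, by simp [hg0]⟩
  | zero => exact ⟨0, by simp⟩
  | one => exact ⟨0, by simp⟩
  | add x y _ _ hx hy =>
    obtain ⟨n, hn⟩ := hx
    obtain ⟨m, hm⟩ := hy
    refine ⟨n + m, ?_⟩
    have : (x + y) * g ^ (n + m) = x * g ^ n * g ^ m + y * g ^ m * g ^ n := by ring
    rw [this]
    exact add_mem (mul_mem hn (pow_mem hg _)) (mul_mem hm (pow_mem hg _))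
  | neg x _ hx =>
    obtain ⟨n, hn⟩ := hx
    exact ⟨n, by rw [neg_mul]; exact neg_mem hn⟩
  | mul x y _ _ hx hy =>
    obtain ⟨n, hn⟩ := hx
    obtain ⟨m, hm⟩ := hy
    refine ⟨n + m, ?_⟩
    have : x * y * g ^ (n + m) = x * g ^ n * (y * g ^ m) := by ring
    rw [this]
    exact mul_mem hn hm

lemma fracRing_div {B R : Subring F} {x y : F} (hx : x ∈ fracRing B R)
    (hy : y ∈ fracRing B R) (hy0 : y ≠ 0) (hyR : y⁻¹ ∈ R) : x / y ∈ fracRing B R := by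
  obtain ⟨b, hb, s, hs, hs0, hsR, rfl⟩ := hx
  obtain ⟨c, hc, t, ht, ht0, htR, rfl⟩ := hy
  have hc0 : c ≠ 0 := by rintro rfl; simp at hy0
  refine ⟨b * t, mul_mem hb ht, s * c, mul_mem hs hc, mul_ne_zero hs0 hc0, ?_, by field_simp⟩
  have : (s * c)⁻¹ = s⁻¹ * (t⁻¹ * (c / t)⁻¹) := by field_simp
  rw [this]
  exact mul_mem hsR (mul_mem htR hyR)

/-- This is the only property of a point of an affine chart that is used later. -/
lemma spec_loc {A : Subring K} {R : LocalSubring K} (h : R ∈ spec A) : Loc A R.toSubring := by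
  obtain ⟨P, hP, rfl⟩ := h
  refine ⟨LocalSubring.le_ofPrime A P, fun r hr => ?_⟩
  obtain ⟨a, s, hs⟩ := IsLocalization.exists_mk'_eq P.primeCompl
    (⟨r, hr⟩ : (LocalSubring.ofPrime A P).toSubring)
  have h1 := IsLocalization.mk'_spec (LocalSubring.ofPrime A P).toSubring a s
  rw [hs] at h1
  have h2 : r * (s : A) = (a : K) := congrArg Subtype.val h1
  obtain ⟨⟨v, hv⟩, hv'⟩ :=
    (IsLocalization.map_units (LocalSubring.ofPrime A P).toSubring s).exists_right_inv
  have h3 : ((s : A) : K) * v = 1 := congrArg Subtype.val hv'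
  have h0 : ((s : A) : K) ≠ 0 := left_ne_zero_of_mul_eq_one h3
  refine ⟨a, a.2, (s : A), (s : A).2, h0, ?_, by rw [← h2]; field_simp⟩
  rwa [← eq_inv_of_mul_eq_one_right h3]

end Fractions

/-! ### Blow-ups -/

/-- The local ring of the generic point of the subvariety is the ring of the place. -/
structure Link (C : Subvariety) (Γ : Place K) : Prop where
  ring : ∀ x, x ∈ C.genericRing ↔ Γ.mem x
  ideal : ∀ x, x ∈ C.genericIdeal ↔ Γ.rel x 0

lemma Link.contains {C : Subvariety} {Γ : Place K} (h : Link C Γ) {R : LocalSubring K} :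
    C.Contains R ↔ Sub R.toSubring Γ :=
  forall₂_congr fun x _ => h.ring x

/-- `S` lies over `R` in the blow-up along the subvariety of the place: it is a local ring of one of
the two affine pieces if the ideal in `R` has two generators. -/
structure Over (Γ : Place K) (R S : LocalSubring K) : Prop where
  le : R.toSubring ≤ S.toSubring
  sub : Sub R.toSubring Γ
  loc : ∀ f g : K, f ≠ 0 → g ≠ 0 → Kr Γ R {f, g} →
    Loc (adj R.toSubring (f / g)) S.toSubring ∨ Loc (adj R.toSubring (g / f)) S.toSubring

/-- Blowing up is defined with all `g₀` in the ideal. If the ideal is `(f, g)`, then `g₀ = a f + b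
g`, so `1 = a (f / g₀) + b (g / g₀)` in `S` and one of the two quotients is a unit. This moves the
point to one of the two standard pieces `R[f/g]`, `R[g/f]`. -/
lemma blowUp_cases {V : Set (LocalSubring K)} {C : Subvariety} {Γ : Place K} (hl : Link C Γ)
    {S : LocalSubring K} (hS : S ∈ blowUp V C) :
    (S ∈ V ∧ ¬ Sub S.toSubring Γ) ∨ ∃ R ∈ V, Over Γ R S := by
  rcases hS with ⟨h1, h2⟩ | ⟨R, hR, hC, g₀, hg₀, hg₀0, hS⟩
  · exact .inl ⟨h1, by rwa [← hl.contains]⟩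
  have hloc := spec_loc hS
  have hRr : R.toSubring ≤ reesChart R.toSubring (C.idealAt R) g₀ := fun x hx =>
    Subring.subset_closure (.inl hx)
  have hRS := hRr.trans hloc.1
  have hq : ∀ f ∈ C.idealAt R, f / g₀ ∈ S.toSubring := fun f hf =>
    hloc.1 (Subring.subset_closure (.inr ⟨f, hf, rfl⟩))
  refine .inr ⟨R, hR, hRS, hl.contains.1 hC, ?_⟩
  have main : ∀ f g : K, g ≠ 0 → Kr Γ R {f, g} → g / g₀ ∉ Mx S →
      Loc (adj R.toSubring (f / g)) S.toSubring := by
    intro f g hg0 hk hM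
    have hf : f ∈ C.idealAt R := ⟨hk.ring f (by simp), (hl.ideal f).2 (hk.zero f (by simp))⟩
    have hg : g ∈ C.idealAt R := ⟨hk.ring g (by simp), (hl.ideal g).2 (hk.zero g (by simp))⟩
    have hgi : g₀ / g ∈ S.toSubring := by
      have := Mx.inv_mem (hq g hg) hM
      rwa [inv_div] at this
    have hfg : f / g ∈ S.toSubring := by
      have : f / g = f / g₀ * (g₀ / g) := by field_simp
      rw [this]
      exact mul_mem (hq f hf) hgi
    have hden : ∀ x ∈ C.idealAt R, x / g ∈ adj R.toSubring (f / g) := by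
      intro x hx
      obtain ⟨a, ha, b, hb, rfl⟩ := Spn.mem_pair.1 (hk.ker x hx.1 ((hl.ideal x).1 hx.2))
      have : (a * f + b * g) / g = a * (f / g) + b := by field_simp
      rw [this]
      exact add_mem (mul_mem (le_adj _ _ ha) (self_mem_adj _ _)) (le_adj _ _ hb)
    refine hloc.of_frac_gens (adj_le hRS hfg) ?_
    rintro x (hx | ⟨f', hf', rfl⟩)
    · exact le_fracRing _ _ (le_adj _ _ hx)
    · have : f' / g₀ = (f' / g) / (g₀ / g) := by field_simp
      rw [this]
      refine mem_fracRing_div (hden f' hf') (hden g₀ hg₀) (div_ne_zero hg₀0 hg0) ?_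
      rw [inv_div]
      exact hq g hg
  intro f g hf0 hg0 hk
  have hk' : Kr Γ R {g, f} := by rwa [Set.pair_comm]
  by_cases hM : g / g₀ ∉ Mx S
  · exact .inl (main f g hg0 hk hM)
  · refine .inr (main g f hf0 hk' fun hM' => ?_)
    -- If both quotients were nonunits, so would be `1`.
    obtain ⟨a, ha, b, hb, h⟩ := Spn.mem_pair.1 (hk.ker g₀ hg₀.1 ((hl.ideal g₀).1 hg₀.2))
    refine Mx.one_notMem (R := S) ?_
    have : (1 : K) = a * (f / g₀) + b * (g / g₀) := by
      field_simp; exact h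
    rw [this]
    exact Mx.add (Mx.mul (hRS ha) hM') (Mx.mul (hRS hb) (not_not.1 hM))

/-! ### Intersections of discrete valuation rings -/

/-- The powers of a nonunit compensate every pole. -/
def Place.Arch {F : Type*} [Field F] [Algebra ℂ F] (Γ : Place F) : Prop :=
  ∀ s h, Γ.rel s 0 → ∃ n : ℕ, Γ.mem (s ^ n * h)

section Good

variable {F : Type*} [Field F] [Algebra ℂ F]

/-- The ring is the intersection of a ring stable under the derivation `δ` and of the rings of those
places in the list that contain it. -/
def Good (δ : Derivation ℂ F F) (𝒟 : List (Place F)) (R : Subring F) : Prop :=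
  ∃ T : Subring F, R ≤ T ∧ (∀ t ∈ T, δ t ∈ T) ∧
    ∀ h ∈ T, (∀ D ∈ 𝒟, Sub R D → D.mem h) → h ∈ R

variable {δ : Derivation ℂ F F} {𝒟 : List (Place F)} {R S : Subring F}

lemma deriv_div (δ : Derivation ℂ F F) (a s : F) (hs : s ≠ 0) :
    δ (a / s) = (δ a * s - a * δ s) / s ^ 2 := by
  have h : δ (a / s * s) = δ a := by rw [div_mul_cancel₀ _ hs]
  rw [Derivation.leibniz, smul_eq_mul, smul_eq_mul] at h
  rw [eq_div_iff (pow_ne_zero 2 hs), ← h]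
  field_simp
  ring

lemma Place.mem_mul {Γ : Place F} {x y : F} (hx : Γ.mem x) (hy : Γ.mem y) : Γ.mem (x * y) := by
  obtain ⟨c, hc⟩ := hx
  obtain ⟨d, hd⟩ := hy
  exact ⟨_, Γ.mul hc hd⟩

/-- The localization of the stable ring is stable by the quotient rule. A divisor through `Spec R`
that misses `Spec S` imposes no condition on `S`: some denominator invertible in `S` vanishes along
it, and a power of this denominator removes the pole. -/
lemma Good.loc (h : Good δ 𝒟 R) (hD : ∀ D ∈ 𝒟, D.Arch) (hS : Loc R S) : Good δ 𝒟 S := by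
  obtain ⟨T, hRT, hδ, hT⟩ := h
  let T' : Subring F := fracRing T (fracRing R S)
  -- Same ring as `T'`, with the denominators visibly taken from `R`.
  refine ⟨T'.copy {x | ∃ t ∈ T, ∃ s ∈ R, s ≠ 0 ∧ s⁻¹ ∈ S ∧ x = t / s} ?_, ?_, ?_, ?_⟩
  · ext x
    constructor
    · rintro ⟨t, ht, s, hs, hs0, hsS, rfl⟩
      exact ⟨t, ht, s, hRT hs, hs0, ⟨1, one_mem _, s, hs, hs0, hsS, by simp⟩, rfl⟩
    · rintro ⟨t, ht, s, hs, hs0, ⟨r, hr, s', hs', hs'0, hs'S, he⟩, rfl⟩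
      refine ⟨t * r, mul_mem ht (hRT hr), s', hs', hs'0, hs'S, ?_⟩
      rw [div_eq_mul_inv, he]
      ring
  · intro x hx
    obtain ⟨r, hr, s, hs, hs0, hsS, rfl⟩ := hS.2 x hx
    exact ⟨r, hRT hr, s, hs, hs0, hsS, rfl⟩
  · rintro x ⟨t, ht, s, hs, hs0, hsS, rfl⟩
    refine ⟨δ t * s - t * δ s, sub_mem (mul_mem (hδ t ht) (hRT hs)) (mul_mem ht (hδ s (hRT hs))),
      s ^ 2, pow_mem hs 2, pow_ne_zero 2 hs0, ?_, deriv_div δ t s hs0⟩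
    rw [← inv_pow]
    exact pow_mem hsS 2
  · rintro x ⟨t, ht, s, hs, hs0, hsS, rfl⟩ hx
    -- One denominator is built that clears the poles of `t` along all divisors of the list.
    have key : ∀ l : List (Place F), (∀ D ∈ l, D ∈ 𝒟) → ∃ s' ∈ R, s' ≠ 0 ∧ s'⁻¹ ∈ S ∧
        ∀ D ∈ l, Sub R D → D.mem (s' * t) := by
      intro l
      induction l with
      | nil => exact fun _ => ⟨1, one_mem _, one_ne_zero, by simp, by simp⟩
      | cons D l ih =>
        intro hl
        obtain ⟨s', hs', hs'0, hs'S, h'⟩ := ih fun E hE => hl E (by simp [hE])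
        by_cases hRD : Sub R D
        swap
        · refine ⟨s', hs', hs'0, hs'S, fun E hE hRE => ?_⟩
          rcases List.mem_cons.1 hE with rfl | hE
          · exact absurd hRE hRD
          · exact h' E hE hRE
        by_cases hSD : Sub S D
        · refine ⟨s', hs', hs'0, hs'S, fun E hE hRE => ?_⟩
          rcases List.mem_cons.1 hE with rfl | hE
          · have h1 := hx E (hl E (by simp)) hSD
            have : s' * t = s' * (s * (t / s)) := by field_simp
            rw [this]
            exact mem_mul (hRE s' hs') (mem_mul (hRE s hs) h1)
          · exact h' E hE hRE
        · obtain ⟨y, hy, hyD⟩ : ∃ y ∈ S, ¬ D.mem y := by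
            by_contra hne
            push Not at hne
            exact hSD hne
          obtain ⟨a, ha, w, hw, hw0, hwS, rfl⟩ := hS.2 y hy
          -- A fraction from `S` that is not regular along `D` must have a denominator vanishing on
          -- `D`.
          have hwr : D.rel w 0 := by
            obtain ⟨c, hc⟩ := hRD w hw
            by_contra hc0
            have hc0' : c ≠ 0 := by rintro rfl; exact hc0 hc
            obtain ⟨d, hd⟩ := hRD a ha
            exact hyD ⟨_, Place.div hd hc hc0'⟩
          obtain ⟨n, hn⟩ := hD D (hl D (by simp)) w t hwr
          refine ⟨w ^ n * s', mul_mem (pow_mem hw n) hs', mul_ne_zero (pow_ne_zero n hw0) hs'0, ?_,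
            fun E hE hRE => ?_⟩
          · rw [mul_inv, ← inv_pow]
            exact mul_mem (pow_mem hwS n) hs'S
          · rcases List.mem_cons.1 hE with rfl | hE
            · have : w ^ n * s' * t = s' * (w ^ n * t) := by ring
              rw [this]
              exact mem_mul (hRE s' hs') hn
            · rw [mul_assoc]
              exact mem_mul (hRE _ (pow_mem hw n)) (h' E hE hRE)
    obtain ⟨s', hs', hs'0, hs'S, h'⟩ := key 𝒟 fun _ h => h
    have h1 : s' * t ∈ R := hT _ (mul_mem (hRT hs') ht) h'
    have : t / s = s⁻¹ * (s'⁻¹ * (s' * t)) := by field_simp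
    rw [this]
    exact mul_mem hsS (mul_mem hs'S (hS.1 h1))

lemma Good.weaken {E : Place F} (h : Good δ 𝒟 R) : Good δ (E :: 𝒟) R := by
  obtain ⟨T, h1, h2, h3⟩ := h
  exact ⟨T, h1, h2, fun x hx hx' => h3 x hx fun D hD => hx' D (by simp [hD])⟩

/-- Since `g` generates the ideal of `E` in `S`, one has `S = S[1/g] ∩ O_E`: if `x` is regular along
`E` and `x g^(n+1)` lies in `S`, then the latter vanishes on `E` and can be divided by `g`. -/
lemma Good.cons {S' : Subring F} {E : Place F} {g : F} (h : Good δ 𝒟 S') (hS : S ≤ S')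
    (hS' : ∀ x ∈ S', ∃ n : ℕ, x * g ^ n ∈ S) (hE : Sub S E)
    (hg : ∀ a ∈ S, E.rel a 0 → ∃ a' ∈ S, a = g * a') (hg0 : E.rel g 0) (hgne : g ≠ 0) :
    Good δ (E :: 𝒟) S := by
  obtain ⟨T, h1, h2, h3⟩ := h
  refine ⟨T, hS.trans h1, h2, fun x hx hx' => ?_⟩
  have hxS' : x ∈ S' := h3 x hx fun D hD hD' => hx' D (by simp [hD]) (hD'.mono hS)
  obtain ⟨c, hc⟩ := hx' E (by simp) hE
  obtain ⟨n, hn⟩ := hS' x hxS'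
  induction n with
  | zero => simpa using hn
  | succ n ih =>
    refine ih ?_
    have h0 : E.rel (x * g ^ (n + 1)) 0 := by
      rw [pow_succ, ← mul_assoc]
      exact mul_zero' (E.mul hc (Place.pow hg0 n)) hg0
    obtain ⟨a', ha', he⟩ := hg _ hn h0
    have : x * g ^ n = a' := mul_left_cancel₀ hgne (by rw [← he]; ring)
    rwa [this]

/-- The ideal of `E` in `R[f/g]` is `(f, g) R[f/g] = g R[f/g]`, because the residue of `f / g` is
transcendental. So `E` is the only divisor added, unless `g` is a unit at the point, when `S` is a
localization of `R`. -/
lemma Good.blow {Γ E : Place F} {R S : LocalSubring F} {f g τ : F}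
    (h : Good δ 𝒟 R.toSubring) (hD : ∀ D ∈ 𝒟, D.Arch) (hg0 : g ≠ 0)
    (hk : Kr Γ R {f, g}) (hE : Γ ≤ E) (hτ : E.rel (f / g) τ) (hτ' : Transcendental Γ.residues τ)
    (hS : Loc (adj R.toSubring (f / g)) S.toSubring) : Good δ (E :: 𝒟) S.toSubring := by
  have hRS : R.toSubring ≤ S.toSubring := (le_adj _ _).trans hS.1
  have hgR : g ∈ R.toSubring := hk.ring g (by simp)
  have hfR : f ∈ R.toSubring := hk.ring f (by simp)
  by_cases hgM : g ∈ Mx S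
  swap
  · refine (h.loc hD (hS.of_frac_gens hRS ?_)).weaken
    rintro x (hx | rfl)
    · exact le_fracRing _ _ hx
    · exact mem_fracRing_div hfR hgR hg0 (Mx.inv_mem (hRS hgR) hgM)
  obtain ⟨hsub, hker⟩ := hk.free_adj hE hτ hτ'
  have hker' : ∀ a ∈ adj R.toSubring (f / g), E.rel a 0 →
      ∃ a' ∈ adj R.toSubring (f / g), a = g * a' := by
    intro a ha ha0
    obtain ⟨b, hb, c, hc, rfl⟩ := Spn.mem_pair.1 (hker a ha ha0)
    exact ⟨b * (f / g) + c, add_mem (mul_mem hb (self_mem_adj _ _)) hc, by field_simp⟩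
  have hunit : ∀ s ∈ adj R.toSubring (f / g), s ≠ 0 → s⁻¹ ∈ S.toSubring → ¬ E.rel s 0 := by
    intro s hs hs0 hsS hs1
    obtain ⟨a', ha', rfl⟩ := hker' s hs hs1
    exact Mx.notMem_of_inv hs0 hsS (Mx.mul' hgM (hS.1 ha'))
  have hSE : Sub S.toSubring E := by
    intro r hr
    obtain ⟨a, ha, s, hs, hs0, hsS, rfl⟩ := hS.2 r hr
    obtain ⟨c, hc⟩ := hsub a ha
    obtain ⟨d, hd⟩ := hsub s hs
    exact ⟨_, Place.div hc hd (by rintro rfl; exact hunit s hs hs0 hsS hd)⟩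
  have hgE : E.rel g 0 := hE _ _ (hk.zero g (by simp))
  -- Away from the exceptional divisor the blow-up changes nothing.
  have hloc : Loc R.toSubring (adj S.toSubring g⁻¹) := by
    have hRW : R.toSubring ≤ adj S.toSubring g⁻¹ := hRS.trans (le_adj _ _)
    refine (Loc.refl _).of_frac_gens hRW ?_
    have h1 : adj R.toSubring (f / g) ≤ fracRing R.toSubring (adj S.toSubring g⁻¹) :=
      adj_le (le_fracRing _ _) (mem_fracRing_div hfR hgR hg0 (self_mem_adj _ _))
    rintro x (hx | rfl)
    · obtain ⟨a, ha, s, hs, hs0, hsS, rfl⟩ := hS.2 x hx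
      exact fracRing_div (h1 ha) (h1 hs) hs0 (le_adj _ _ hsS)
    · exact ⟨1, one_mem _, g, hgR, hg0, self_mem_adj _ _, by simp⟩
  refine (h.loc hD hloc).cons (le_adj _ _) (fun x hx => adj_inv_pow (hRS hgR) hg0 hx) hSE ?_ hgE hg0
  intro r hr hr0
  obtain ⟨a, ha, s, hs, hs0, hsS, rfl⟩ := hS.2 r hr
  obtain ⟨d, hd⟩ := hsub s hs
  have h1 : E.rel a 0 := by
    have := mul_zero' hd hr0
    rwa [mul_div_cancel₀ _ hs0] at this
  obtain ⟨a', ha', rfl⟩ := hker' a ha h1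
  exact ⟨a' * s⁻¹, mul_mem (hS.1 ha') hsS, by ring⟩

/-- Change of one projective coordinate to its inverse: the two charts agree where `ξ` is
invertible, and `ξ` generates the ideal of the divisor `E` in the new one, because every element is
its residue plus a multiple of `ξ`. -/
lemma Good.base {E : Place F} {X : Set F} {ξ : F}
    (h : Good δ 𝒟 (Subring.closure (X ∪ {ξ⁻¹}))) (hD : ∀ D ∈ 𝒟, D.Arch) (hX : ∀ x ∈ X, E.rel x x)
    (hξ : E.rel ξ 0) (hξ0 : ξ ≠ 0) : Good δ (E :: 𝒟) (Subring.closure (X ∪ {ξ})) := by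
  set A := Subring.closure (X ∪ {ξ}) with hA
  have hξA : ξ ∈ A := Subring.subset_closure (.inr rfl)
  have hXA : ∀ x ∈ X, x ∈ A := fun x hx => Subring.subset_closure (.inl hx)
  have key : ∀ a ∈ A, ∃ c w, w ∈ A ∧ E.rel a c ∧ a = c + ξ * w := by
    intro a ha
    induction ha using Subring.closure_induction with
    | mem x h =>
      rcases h with h | rfl
      · exact ⟨x, 0, zero_mem _, hX x h, by ring⟩
      · exact ⟨0, 1, one_mem _, hξ, by ring⟩
    | zero => exact ⟨0, 0, zero_mem _, Place.zero, by ring⟩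
    | one => exact ⟨1, 0, zero_mem _, Place.one, by ring⟩
    | add x y _ _ hx hy =>
      obtain ⟨c, w, hw, h1, h2⟩ := hx
      obtain ⟨d, v, hv, h3, h4⟩ := hy
      exact ⟨c + d, w + v, add_mem hw hv, E.add h1 h3, by rw [h2, h4]; ring⟩
    | neg x _ hx =>
      obtain ⟨c, w, hw, h1, h2⟩ := hx
      exact ⟨-c, -w, neg_mem hw, Place.neg h1, by rw [h2]; ring⟩
    | mul x y hxA _ hx hy =>
      obtain ⟨c, w, hw, h1, h2⟩ := hx
      obtain ⟨d, v, hv, h3, h4⟩ := hy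
      refine ⟨c * d, w * y + (x - ξ * w) * v,
        add_mem (mul_mem hw ‹_›) (mul_mem (sub_mem hxA (mul_mem hξA hw)) hv), E.mul h1 h3, ?_⟩
      have : c = x - ξ * w := by rw [h2]; ring
      rw [this]
      have : d = y - ξ * v := by rw [h4]; ring
      rw [this]
      ring
  have hloc : Loc (Subring.closure (X ∪ {ξ⁻¹})) (adj A ξ⁻¹) := by
    have hle : Subring.closure (X ∪ {ξ⁻¹}) ≤ adj A ξ⁻¹ := by
      refine Subring.closure_le.2 ?_
      rintro x (hx | rfl)
      · exact le_adj _ _ (hXA x hx)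
      · exact self_mem_adj _ _
    refine (Loc.refl _).of_frac_gens hle ?_
    rintro x (hx | rfl)
    · refine (?_ : A ≤ fracRing _ _) hx
      refine Subring.closure_le.2 ?_
      rintro x (hx | rfl)
      · exact le_fracRing _ _ (Subring.subset_closure (.inl hx))
      · refine ⟨1, one_mem _, x⁻¹, Subring.subset_closure (.inr rfl), inv_ne_zero hξ0, ?_, by simp⟩
        rw [inv_inv]
        exact le_adj _ _ hξA
    · exact le_fracRing _ _ (Subring.subset_closure (.inr rfl))
  refine (h.loc hD hloc).cons (le_adj _ _) (fun x hx => adj_inv_pow hξA hξ0 hx) ?_ ?_ hξ hξ0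
  · intro a ha
    obtain ⟨c, w, hw, h1, h2⟩ := key a ha
    exact ⟨c, h1⟩
  · intro a ha ha0
    obtain ⟨c, w, hw, h1, h2⟩ := key a ha
    refine ⟨w, hw, ?_⟩
    rw [Place.eq h1 ha0, zero_add] at h2
    exact h2

/-- A derivative lies in the stable ring in any case, and it is regular along each divisor through
the point, hence it lies in the intersection. -/
lemma Good.stable (h : Good δ 𝒟 R)
    (hD : ∀ D ∈ 𝒟, Sub R D → ∀ x, D.mem x → D.mem (δ x)) : ∀ r ∈ R, δ r ∈ R := by
  obtain ⟨T, h1, h2, h3⟩ := h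
  exact fun r hr => h3 _ (h2 _ (h1 hr)) fun D hD' hR => hD D hD' hR r (hR r hr)

end Good

/-- Blowing up keeps the local rings intersections of discrete valuation rings. -/
theorem good_blowUp {V : Set (LocalSubring K)} {C : Subvariety} {Γ E : Place K}
    {δ : Derivation ℂ K K} {𝒟 : List (Place K)} (hl : Link C Γ) (hE : Γ ≤ E)
    (hD : ∀ D ∈ 𝒟, D.Arch) (hV : ∀ R ∈ V, Good δ 𝒟 R.toSubring)
    (hC : ∀ R ∈ V, Sub R.toSubring Γ → ∃ f g τ : K, f ≠ 0 ∧ g ≠ 0 ∧ Kr Γ R {f, g} ∧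
      E.rel (f / g) τ ∧ Transcendental Γ.residues τ) :
    ∀ S ∈ blowUp V C, Good δ (E :: 𝒟) S.toSubring := by
  intro S hS
  rcases blowUp_cases hl hS with ⟨h, -⟩ | ⟨R, hR, h⟩
  · exact (hV S h).weaken
  · obtain ⟨f, g, τ, hf, hg, hk, hτ, hτ'⟩ := hC R hR h.sub
    rcases h.loc f g hf hg hk with hS | hS
    · exact (hV R hR).blow hD hg hk hE hτ hτ' hS
    -- On the other affine piece the coordinate of the exceptional divisor is the inverse one, which
    -- is again transcendental.
    · have hτ0 : τ ≠ 0 := by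
        rintro rfl
        exact hτ' (isAlgebraic_zero)
      refine (hV R hR).blow (τ := τ⁻¹) hD hf (by rwa [Set.pair_comm]) hE ?_ ?_ hS
      · rw [← inv_div]
        exact E.inv hτ hτ0
      · exact fun h => hτ' (by simpa using h.inv)

end PainleveFlow

/-!
# Places given by coordinate systems of the function field
-/

namespace PainleveFlow

open Place MvPolynomial

/-! ### Coordinate systems -/

/-- The tuple of coordinates on a chart. -/
noncomputable def tup (y₁ y₂ y₃ y₄ : K) : Fin 6 → K := ![y₁, y₂, y₃, y₄, b₁, b₂]

lemma chart_eq (y₁ y₂ y₃ y₄ : K) :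
    chart y₁ y₂ y₃ y₄ = (Algebra.adjoin ℂ (Set.range (tup y₁ y₂ y₃ y₄))).toSubring := by
  have : Set.range (tup y₁ y₂ y₃ y₄) = {y₁, y₂, y₃, y₄, b₁, b₂} := by
    simp only [tup, Matrix.range_cons, Matrix.range_empty, Set.union_empty, Set.singleton_union]
  rw [this, chart]

/-- The functions generate the function field. -/
def Gen (y : Fin 6 → K) : Prop := IntermediateField.adjoin ℂ (Set.range y) = ⊤

lemma eq_top_of_coords {L : IntermediateField ℂ K} (h1 : q₁ ∈ L) (h2 : p₁ ∈ L) (h3 : q₂ ∈ L)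
    (h4 : p₂ ∈ L) (h5 : b₁ ∈ L) (h6 : b₂ ∈ L) : L = ⊤ := by
  have hP : ∀ p : Poly, algebraMap Poly K p ∈ L := by
    intro p
    induction p using MvPolynomial.induction_on with
    | C a =>
      have : algebraMap Poly K (C a) = algebraMap ℂ K a :=
        (IsScalarTower.algebraMap_apply ℂ Poly K a).symm
      rw [this]
      exact L.algebraMap_mem a
    | add p q hp hq => rw [map_add]; exact add_mem hp hq
    | mul_X p v hp =>
      rw [map_mul]
      refine mul_mem hp ?_
      cases v <;> assumption
  rw [eq_top_iff]
  intro x _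
  obtain ⟨a, s, -, rfl⟩ := IsFractionRing.div_surjective (A := Poly) x
  exact div_mem (hP a) (hP s)

lemma gen_tup {y₁ y₂ y₃ y₄ : K}
    (h : ∀ L : IntermediateField ℂ K, y₁ ∈ L → y₂ ∈ L → y₃ ∈ L → y₄ ∈ L → b₁ ∈ L → b₂ ∈ L →
      q₁ ∈ L ∧ p₁ ∈ L ∧ q₂ ∈ L ∧ p₂ ∈ L) : Gen (tup y₁ y₂ y₃ y₄) := by
  set L := IntermediateField.adjoin ℂ (Set.range (tup y₁ y₂ y₃ y₄)) with hL
  have hk : ∀ k, tup y₁ y₂ y₃ y₄ k ∈ L := fun k =>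
    IntermediateField.subset_adjoin ℂ _ ⟨k, rfl⟩
  obtain ⟨h1, h2, h3, h4⟩ := h L (hk 0) (hk 1) (hk 2) (hk 3) (hk 4) (hk 5)
  exact eq_top_of_coords h1 h2 h3 h4 (hk 4) (hk 5)

lemma six_le_trdeg : (6 : Cardinal) ≤ Algebra.trdeg ℂ K := by
  have h : AlgebraicIndependent ℂ (fun v : Var => algebraMap Poly K (X v)) := by
    have := (MvPolynomial.algebraicIndependent_X Var ℂ).map'
      (f := IsScalarTower.toAlgHom ℂ Poly K) (IsFractionRing.injective Poly K)
    exact this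
  let e : Fin 6 → Var := ![.q₁, .p₁, .q₂, .p₂, .b₁, .b₂]
  have he : Function.Injective e := by
    intro i j hij
    fin_cases i <;> fin_cases j <;> simp_all [e]
  have := (h.comp e he).cardinalMk_le_trdeg
  simpa using this

/-- Six generators of a field of transcendence degree at least six form a transcendence basis. -/
lemma Gen.algebraicIndependent {y : Fin 6 → K} (h : Gen y) : AlgebraicIndependent ℂ y := by
  have halg : Algebra.IsAlgebraic (Algebra.adjoin ℂ (Set.range y)) K := by
    rw [← IntermediateField.isAlgebraic_adjoin_iff_top]
    unfold Gen at h
    rw [h]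
    exact ⟨fun x => isAlgebraic_algebraMap (⟨x, trivial⟩ : (⊤ : IntermediateField ℂ K))⟩
  exact (Algebra.IsAlgebraic.isTranscendenceBasis_of_le_trdeg_of_finite ℂ y (by simpa using six_le_trdeg)).1

lemma Gen.frac {y : Fin 6 → K} (h : Gen y) (x : K) :
    ∃ p q : MvPolynomial (Fin 6) ℂ, q ≠ 0 ∧ x * aeval y q = aeval y p := by
  have hx : x ∈ IntermediateField.adjoin ℂ (Set.range y) := by
    unfold Gen at h
    rw [h]
    trivial
  obtain ⟨r, s, rfl⟩ := (IntermediateField.mem_adjoin_range_iff _ _ _).1 hx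
  by_cases hs : aeval y s = 0
  · exact ⟨0, 1, one_ne_zero, by simp [hs]⟩
  · exact ⟨r, s, by rintro rfl; simp at hs, by field_simp⟩

/-! ### The place of a specialization of coordinates -/

/-- The place that sends the coordinates `y` to the values `z`. -/
noncomputable def placeOf (y z : Fin 6 → K) (hy : Gen y) : Place K where
  rel x c := ∃ p q : MvPolynomial (Fin 6) ℂ, aeval z q ≠ 0 ∧ x * aeval y q = aeval y p ∧
    c * aeval z q = aeval z p
  const c := ⟨C c, 1, by simp, by simp, by simp⟩
  add := by
    rintro x x' c c' ⟨p, q, h, h1, h2⟩ ⟨p', q', h', h1', h2'⟩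
    refine ⟨p * q' + p' * q, q * q', by simp [h, h'], ?_, ?_⟩
    · simp only [map_add, map_mul, ← h1, ← h1']; ring
    · simp only [map_add, map_mul, ← h2, ← h2']; ring
  mul := by
    rintro x x' c c' ⟨p, q, h, h1, h2⟩ ⟨p', q', h', h1', h2'⟩
    refine ⟨p * p', q * q', by simp [h, h'], ?_, ?_⟩
    · simp only [map_mul, ← h1, ← h1']; ring
    · simp only [map_mul, ← h2, ← h2']; ring
  inv := by
    rintro x c ⟨p, q, h, h1, h2⟩ hc
    have hp : aeval z p ≠ 0 := by rw [← h2]; exact mul_ne_zero hc h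
    have hx : x ≠ 0 := by
      rintro rfl
      rw [zero_mul] at h1
      have : p = 0 := hy.algebraicIndependent (by rw [← h1, map_zero])
      simp [this] at hp
    refine ⟨q, p, hp, ?_, ?_⟩
    · rw [← h1]; field_simp
    · rw [← h2]; field_simp
  uniq := by
    rintro c ⟨p, q, h, h1, h2⟩
    rw [zero_mul] at h1
    have : p = 0 := hy.algebraicIndependent (by rw [← h1, map_zero])
    rw [this, map_zero] at h2
    exact (mul_eq_zero.1 h2).resolve_right h

variable {y z : Fin 6 → K} {hy : Gen y} {Γ : Place K}

lemma placeOf_rel (k : Fin 6) : (placeOf y z hy).rel (y k) (z k) :=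
  ⟨X k, 1, by simp, by simp, by simp⟩

lemma placeOf_rel_aeval (p : MvPolynomial (Fin 6) ℂ) :
    (placeOf y z hy).rel (aeval y p) (aeval z p) := ⟨p, 1, by simp, by simp, by simp⟩

lemma rel_aeval (h : ∀ k, Γ.rel (y k) (z k)) (p : MvPolynomial (Fin 6) ℂ) :
    Γ.rel (aeval y p) (aeval z p) := by
  induction p using MvPolynomial.induction_on with
  | C a => simpa using Γ.const a
  | add p q hp hq => simpa using Γ.add hp hq
  | mul_X p v hp => simpa using Γ.mul hp (h v)

/-- The ring of `placeOf y z` consists of fractions of polynomials in `y` whose denominators do not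
vanish at `z`, so places can be compared on the six coordinates. -/
lemma placeOf_le (h : ∀ k, Γ.rel (y k) (z k)) : placeOf y z hy ≤ Γ := by
  rintro x c ⟨p, q, hq, h1, h2⟩
  have hp := rel_aeval h p
  have hq' := rel_aeval h q
  have hq0 : aeval y q ≠ 0 := Place.ne_zero hq' hq
  exact Place.cast (Place.div hp hq' hq) (by rw [← h1]; field_simp) (by rw [← h2]; field_simp)

lemma placeOf_residues_le {L : IntermediateField ℂ K} (h : ∀ k, z k ∈ L) :
    (placeOf y z hy).residues ≤ L := by
  rintro c ⟨x, p, q, hq, h1, h2⟩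
  have hL : ∀ p : MvPolynomial (Fin 6) ℂ, aeval z p ∈ L := fun p => by
    induction p using MvPolynomial.induction_on with
    | C a => rw [aeval_C]; exact L.algebraMap_mem a
    | add p q hp hq => rw [map_add]; exact add_mem hp hq
    | mul_X p v hp => rw [map_mul, aeval_X]; exact mul_mem hp (h v)
  have : c = aeval z p / aeval z q := by rw [← h2]; field_simp
  rw [this]
  exact div_mem (hL p) (hL q)

/-- A coordinate is transcendental over the residues of a place if these are expressed in the other
coordinates. -/
lemma transcendental_residues {y' : Fin 6 → K} (hy' : Gen y') (i : Fin 6)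
    (h : ∀ L : IntermediateField ℂ K, (∀ k, k ≠ i → y' k ∈ L) → ∀ k, z k ∈ L) :
    Transcendental (placeOf y z hy).residues (y' i) := by
  have h1 : Transcendental (IntermediateField.adjoin ℂ (y' '' {i}ᶜ)) (y' i) := by
    rw [IntermediateField.transcendental_adjoin_iff]
    exact hy'.algebraicIndependent.transcendental_adjoin (by simp)
  have h2 : (placeOf y z hy).residues ≤ IntermediateField.adjoin ℂ (y' '' {i}ᶜ) :=
    placeOf_residues_le (h _ fun k hk => IntermediateField.subset_adjoin ℂ _ ⟨k, hk, rfl⟩)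
  rintro ⟨p, hp, hp0⟩
  refine h1 ⟨p.map (IntermediateField.inclusion h2).toRingHom, ?_, ?_⟩
  · exact (Polynomial.map_ne_zero_iff (IntermediateField.inclusion h2).injective).2 hp
  · rw [Polynomial.aeval_def, Polynomial.eval₂_map]
    exact hp0

/-- Affine functions of a transcendental element are transcendental. -/
lemma Transcendental.affine {L : IntermediateField ℂ K} {τ c d : K} (h : Transcendental L τ)
    (hc : c ∈ L) (hd : d ∈ L) (hc0 : c ≠ 0) : Transcendental L (c * τ + d) := by
  intro h'
  have hc' : IsAlgebraic L c := isAlgebraic_algebraMap (⟨c, hc⟩ : L)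
  have hd' : IsAlgebraic L d := isAlgebraic_algebraMap (⟨d, hd⟩ : L)
  have := (h'.sub hd').mul hc'.inv
  rw [add_sub_cancel_right, mul_comm, inv_mul_cancel_left₀ hc0] at this
  exact h this

/-- The fixed elements of a place form a field. -/
def Place.fixed (Γ : Place K) : IntermediateField ℂ K where
  carrier := {c | Γ.rel c c}
  mul_mem' := fun hx hy => Γ.mul hx hy
  add_mem' := fun hx hy => Γ.add hx hy
  algebraMap_mem' := fun c => Γ.const c
  inv_mem' := by
    intro c hc
    by_cases h : c = 0
    · subst h; simpa using Place.zero
    · exact Γ.inv hc h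

/-! ### Places of subvarieties -/

lemma mem_adjoin_iff {x : K} : x ∈ Algebra.adjoin ℂ (Set.range y) ↔
    ∃ p : MvPolynomial (Fin 6) ℂ, aeval y p = x := by
  rw [Algebra.adjoin_range_eq_range_aeval]
  rfl

/-- The difference `p(y) - p(z)` lies in the ideal of the `yₖ - zₖ`, by induction on `p`. Hence the
kernel of the specialization on the chart is generated by the given equations, and the fractions
with denominators outside it form the ring of the place. That the `zₖ` are fixed makes each
difference vanish at the place. -/
lemma link_of {eqns : Set K}
    (h1 : ∀ k, z k ∈ Algebra.adjoin ℂ (Set.range y))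
    (h2 : ∀ k, (placeOf y z hy).rel (z k) (z k))
    (h3 : ∀ k, y k = z k ∨ y k - z k ∈ eqns)
    (h4 : ∀ e ∈ eqns, ∃ k, e = y k - z k) :
    Link ⟨(Algebra.adjoin ℂ (Set.range y)).toSubring, eqns⟩ (placeOf y z hy) := by
  set Γ := placeOf y z hy with hΓ
  set Z : Subvariety := ⟨(Algebra.adjoin ℂ (Set.range y)).toSubring, eqns⟩ with hZ
  have hyc : ∀ p : MvPolynomial (Fin 6) ℂ, aeval y p ∈ Algebra.adjoin ℂ (Set.range y) := fun p =>
    mem_adjoin_iff.2 ⟨p, rfl⟩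
  have hzc : ∀ p : MvPolynomial (Fin 6) ℂ, aeval z p ∈ Algebra.adjoin ℂ (Set.range y) := fun p => by
    induction p using MvPolynomial.induction_on with
    | C a => rw [aeval_C, ← aeval_C y]; exact hyc _
    | add p q hp hq => rw [map_add]; exact add_mem hp hq
    | mul_X p v hp => rw [map_mul, aeval_X]; exact mul_mem hp (h1 v)
  have hrel : ∀ f : Z.ring, f ∈ Z.ideal → Γ.rel f 0 := by
    intro f hf
    induction hf using Submodule.span_induction with
    | mem x h =>
      obtain ⟨k, hk⟩ := h4 x h
      rw [hk]
      simpa using Place.sub (placeOf_rel (z := z) (hy := hy) k) (h2 k)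
    | zero => exact Place.zero
    | add x y _ _ hx hy => simpa using Γ.add hx hy
    | smul a x _ hx =>
      obtain ⟨p, hp⟩ := mem_adjoin_iff.1 a.2
      have := placeOf_rel_aeval (z := z) (hy := hy) p
      rw [hp] at this
      exact mul_zero' this hx
  have hdiff : ∀ p : MvPolynomial (Fin 6) ℂ,
      (⟨aeval y p - aeval z p, sub_mem (hyc p) (hzc p)⟩ : Z.ring) ∈ Z.ideal := by
    intro p
    induction p using MvPolynomial.induction_on with
    | C a =>
      convert Z.ideal.zero_mem using 1
      ext
      simp
    | add p q hp hq =>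
      convert Z.ideal.add_mem hp hq using 1
      ext
      simp only [map_add, AddMemClass.mk_add_mk]
      ring
    | mul_X p v hp =>
      have hv : (⟨y v - z v, by
          have := hyc (X v); rw [aeval_X] at this
          exact sub_mem this (h1 v)⟩ : Z.ring) ∈ Z.ideal := by
        rcases h3 v with h | h
        · convert Z.ideal.zero_mem using 1
          ext
          simp [h]
        · exact Ideal.subset_span h
      convert Z.ideal.add_mem (Z.ideal.mul_mem_left (⟨aeval y p, hyc p⟩ : Z.ring) hv)
        (Z.ideal.mul_mem_left (⟨z v, h1 v⟩ : Z.ring) hp) using 1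
      ext
      simp only [map_mul, aeval_X, MulMemClass.mk_mul_mk, AddMemClass.mk_add_mk]
      ring
  have hmem : ∀ f : Z.ring, f ∈ Z.ideal ↔ Γ.rel f 0 := by
    refine fun f => ⟨hrel f, fun h => ?_⟩
    obtain ⟨p, hp⟩ := mem_adjoin_iff.1 f.2
    have h5 := placeOf_rel_aeval (z := z) (hy := hy) p
    rw [hp] at h5
    have h6 := hdiff p
    have h7 : aeval z p = 0 := Place.eq h5 h
    convert h6 using 1
    ext
    simp [h7, hp]
  refine ⟨fun x => ⟨?_, ?_⟩, fun x => ⟨?_, ?_⟩⟩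
  · rintro ⟨f, s, hs, rfl⟩
    obtain ⟨p, hp⟩ := mem_adjoin_iff.1 f.2
    obtain ⟨q, hq⟩ := mem_adjoin_iff.1 s.2
    have h5 := placeOf_rel_aeval (z := z) (hy := hy) p
    have h6 := placeOf_rel_aeval (z := z) (hy := hy) q
    rw [hp] at h5
    rw [hq] at h6
    refine ⟨_, Place.div h5 h6 fun h0 => hs ((hmem s).2 ?_)⟩
    rwa [h0] at h6
  · rintro ⟨c, p, q, hq, h5, h6⟩
    have h7 := placeOf_rel_aeval (z := z) (hy := hy) q
    refine ⟨⟨_, hyc p⟩, ⟨_, hyc q⟩, fun h => hq (Place.eq h7 ((hmem _).1 h)), ?_⟩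
    have := Place.ne_zero h7 hq
    simp only [← h5]
    field_simp
  · rintro ⟨f, s, hf, hs, rfl⟩
    obtain ⟨q, hq'⟩ := mem_adjoin_iff.1 s.2
    have h6 := placeOf_rel_aeval (z := z) (hy := hy) q
    rw [hq'] at h6
    have h7 : aeval z q ≠ 0 := fun h0 => hs ((hmem s).2 (by rwa [h0] at h6))
    simpa using Place.div ((hmem f).1 hf) h6 h7
  · rintro ⟨p, q, hq, h5, h6⟩
    have h7 := placeOf_rel_aeval (z := z) (hy := hy) q
    have h8 := placeOf_rel_aeval (z := z) (hy := hy) p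
    rw [← h6, zero_mul] at h8
    refine ⟨⟨_, hyc p⟩, ⟨_, hyc q⟩, (hmem _).2 h8,
      fun h => hq (Place.eq h7 ((hmem _).1 h)), ?_⟩
    have := Place.ne_zero h7 hq
    simp only [← h5]
    field_simp

/-! ### Places of prime divisors -/

/-- By algebraic independence the polynomial itself vanishes after the substitution `Xᵢ = 0`, and
this substitution does not change classes modulo `Xᵢ`. -/
lemma X_dvd_of_aeval_update_eq_zero {y : Fin 6 → K} (hy : AlgebraicIndependent ℂ y) (i : Fin 6)
    {p : MvPolynomial (Fin 6) ℂ} (h : aeval (Function.update y i 0) p = 0) :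
    (X i : MvPolynomial (Fin 6) ℂ) ∣ p := by
  let φ : MvPolynomial (Fin 6) ℂ →ₐ[ℂ] MvPolynomial (Fin 6) ℂ := aeval (Function.update X i 0)
  have h1 : aeval y (φ p) = aeval (Function.update y i 0) p := by
    have : (aeval y).comp φ = aeval (Function.update y i 0) := by
      ext k
      by_cases hk : k = i
      · subst hk; simp [φ]
      · simp [φ, hk]
    rw [← this]
    rfl
  have h2 : φ p = 0 := hy (by rw [h1, h, map_zero])
  let π := Ideal.Quotient.mkₐ ℂ (Ideal.span {(X i : MvPolynomial (Fin 6) ℂ)})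
  have h3 : π.comp φ = π := by
    ext k
    by_cases hk : k = i
    · subst hk
      simp only [φ, AlgHom.comp_apply, aeval_X, Function.update_self, map_zero]
      exact (Ideal.Quotient.eq_zero_iff_mem.2 (Ideal.mem_span_singleton_self _)).symm
    · simp [φ, hk]
  have h4 : π p = 0 := by
    rw [← h3, AlgHom.comp_apply, h2, map_zero]
  exact Ideal.mem_span_singleton.1 (Ideal.Quotient.eq_zero_iff_mem.1 h4)

/-- The valuation is discrete: if `Xᵢ` divides the denominator of `h` exactly `n` times, then the
`n`-th power of any `s` vanishing on the divisor cancels these factors. -/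
lemma placeOf_arch (i : Fin 6) : (placeOf y (Function.update y i 0) hy).Arch := by
  set z := Function.update y i 0 with hz
  rintro s h ⟨p, q, hq, h1, h2⟩
  rw [zero_mul] at h2
  obtain ⟨p₁, rfl⟩ := X_dvd_of_aeval_update_eq_zero hy.algebraicIndependent i h2.symm
  obtain ⟨a, b, hb, hab⟩ := hy.frac h
  have hfin : FiniteMultiplicity (X i : MvPolynomial (Fin 6) ℂ) b :=
    FiniteMultiplicity.of_not_isUnit (by
      intro hu
      have := hu.map (aeval (R := ℂ) (fun _ : Fin 6 => (0 : ℂ)))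
      simp at this) hb
  obtain ⟨b', hb', hb''⟩ := hfin.exists_eq_pow_mul_and_not_dvd
  set n := multiplicity (X i : MvPolynomial (Fin 6) ℂ) b
  have hzb : aeval z b' ≠ 0 := fun h0 =>
    hb'' (X_dvd_of_aeval_update_eq_zero hy.algebraicIndependent i h0)
  refine ⟨n, aeval z (p₁ ^ n * a) / aeval z (q ^ n * b'), p₁ ^ n * a, q ^ n * b', ?_, ?_, ?_⟩
  · rw [map_mul, map_pow]
    exact mul_ne_zero (pow_ne_zero _ hq) hzb
  · have hyi : aeval y (X i : MvPolynomial (Fin 6) ℂ) ≠ 0 := fun h0 =>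
      X_ne_zero i (hy.algebraicIndependent (by rw [h0, map_zero]))
    rw [hb', map_mul, map_pow] at hab
    rw [map_mul] at h1
    refine mul_left_cancel₀ (pow_ne_zero n hyi) ?_
    simp only [map_mul, map_pow]
    calc _ = (s * aeval y q) ^ n * (h * (aeval y (X i) ^ n * aeval y b')) := by ring
      _ = _ := by rw [h1, hab]; ring
  · have : aeval z (q ^ n * b') ≠ 0 := by
      rw [map_mul, map_pow]
      exact mul_ne_zero (pow_ne_zero _ hq) hzb
    field_simp

/-- A derivation preserves the ring of a place if it maps the coordinates into this ring. -/
lemma placeOf_stable {δ : Derivation ℂ K K} (h : ∀ k, (placeOf y z hy).mem (δ (y k))) {x : K}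
    (hx : (placeOf y z hy).mem x) : (placeOf y z hy).mem (δ x) := by
  set Γ := placeOf y z hy with hΓ
  have hpoly : ∀ p : MvPolynomial (Fin 6) ℂ, Γ.mem (δ (aeval y p)) := fun p => by
    induction p using MvPolynomial.induction_on with
    | C a => exact ⟨0, by rw [aeval_C, Derivation.map_algebraMap]; exact Place.zero⟩
    | add p q hp hq =>
      obtain ⟨c, hc⟩ := hp
      obtain ⟨d, hd⟩ := hq
      exact ⟨_, by rw [map_add, map_add]; exact Γ.add hc hd⟩
    | mul_X p v hp =>
      obtain ⟨c, hc⟩ := hp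
      obtain ⟨d, hd⟩ := h v
      exact ⟨_, by
        rw [map_mul, aeval_X, Derivation.leibniz]
        exact Γ.add (Γ.mul (placeOf_rel_aeval p) hd) (Γ.mul (placeOf_rel v) hc)⟩
  obtain ⟨c, p, q, hq, h1, h2⟩ := hx
  have hqy : Γ.rel (aeval y q) (aeval z q) := placeOf_rel_aeval q
  have hpy : Γ.rel (aeval y p) (aeval z p) := placeOf_rel_aeval p
  have hq0 := Place.ne_zero hqy hq
  have hx : x = aeval y p / aeval y q := by rw [← h1]; field_simp
  obtain ⟨c', hc'⟩ := hpoly p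
  obtain ⟨d', hd'⟩ := hpoly q
  rw [hx, deriv_div δ _ _ hq0]
  exact ⟨_, Place.div (Place.sub (Γ.mul hc' hqy) (Γ.mul hpy hd')) (Place.pow hqy 2)
    (pow_ne_zero 2 hq)⟩

end PainleveFlow

/-!
# Local rings of `(ℙ¹)⁴`, centres of blow-ups and their exceptional divisors
-/

namespace PainleveFlow

open Place MvPolynomial

/-! ### Places of subvarieties of charts -/

/-- The place of the subvariety `yᵢ = 0, yⱼ = c`. -/
noncomputable def ctr (y : Fin 6 → K) (i j : Fin 6) (c : K) (hy : Gen y) : Place K :=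
  placeOf y (Function.update (Function.update y i 0) j c) hy

/-- The place of the prime divisor `yᵢ = 0`. -/
noncomputable def dvs (y : Fin 6 → K) (i : Fin 6) (hy : Gen y) : Place K :=
  placeOf y (Function.update y i 0) hy

section

variable {y y' : Fin 6 → K} {i j k : Fin 6} {c : K} {hy : Gen y} {hy' : Gen y'} {Γ : Place K}

lemma ctr_fst (hij : i ≠ j) : (ctr y i j c hy).rel (y i) 0 := by
  have := placeOf_rel (y := y) (z := Function.update (Function.update y i 0) j c) (hy := hy) i
  rwa [Function.update_of_ne hij, Function.update_self] at this

lemma ctr_snd : (ctr y i j c hy).rel (y j) c := by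
  have := placeOf_rel (y := y) (z := Function.update (Function.update y i 0) j c) (hy := hy) j
  rwa [Function.update_self] at this

lemma ctr_fix (hi : k ≠ i) (hj : k ≠ j) : (ctr y i j c hy).rel (y k) (y k) := by
  have := placeOf_rel (y := y) (z := Function.update (Function.update y i 0) j c) (hy := hy) k
  rwa [Function.update_of_ne hj, Function.update_of_ne hi] at this

lemma ctr_le (h1 : Γ.rel (y i) 0) (h2 : Γ.rel (y j) c)
    (h3 : ∀ k, k ≠ i → k ≠ j → Γ.rel (y k) (y k)) : ctr y i j c hy ≤ Γ := by
  refine placeOf_le fun k => ?_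
  by_cases hj : k = j
  · subst hj
    rwa [Function.update_self]
  · rw [Function.update_of_ne hj]
    by_cases hi : k = i
    · subst hi
      rwa [Function.update_self]
    · rw [Function.update_of_ne hi]
      exact h3 k hi hj

lemma dvs_zero : (dvs y i hy).rel (y i) 0 := by
  have := placeOf_rel (y := y) (z := Function.update y i 0) (hy := hy) i
  rwa [Function.update_self] at this

lemma dvs_fix (hk : k ≠ i) : (dvs y i hy).rel (y k) (y k) := by
  have := placeOf_rel (y := y) (z := Function.update y i 0) (hy := hy) k
  rwa [Function.update_of_ne hk] at this

lemma dvs_arch : (dvs y i hy).Arch := placeOf_arch i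

lemma dvs_stable {δ : Derivation ℂ K K} (h : ∀ k, (dvs y i hy).mem (δ (y k))) {x : K}
    (hx : (dvs y i hy).mem x) : (dvs y i hy).mem (δ x) := placeOf_stable h hx

/-- The data of the blow-up along `f = g = 0`: the places of the centre and of the exceptional
divisor. -/
structure Center (C : Subvariety) (Γ E : Place K) (f g : K) : Prop where
  link : Link C Γ
  le : Γ ≤ E
  arch : E.Arch
  fst : f ≠ 0
  snd : g ≠ 0
  zero_fst : Γ.rel f 0
  zero_snd : Γ.rel g 0
  fix : E.rel (f / g) (f / g)
  trans : Transcendental Γ.residues (f / g)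

lemma gen_ne_zero (hy : Gen y) (i : Fin 6) : y i ≠ 0 := hy.algebraicIndependent.ne_zero i

lemma gen_exc (hy : Gen y) (hij : i ≠ j)
    (hc : c ∈ Algebra.adjoin ℂ (y '' {i, j}ᶜ)) (hk : ∀ k, k ≠ j → y' k = y k)
    (hj : y' j = (y j - c) / y i) : Gen y' := by
  unfold Gen at hy ⊢
  rw [eq_top_iff, ← hy, IntermediateField.adjoin_le_iff]
  set L := IntermediateField.adjoin ℂ (Set.range y')
  have hL : ∀ k, y' k ∈ L := fun k => IntermediateField.subset_adjoin ℂ _ ⟨k, rfl⟩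
  have hy0 : y i ≠ 0 := gen_ne_zero hy i
  have hcL : c ∈ L := by
    have : Algebra.adjoin ℂ (y '' {i, j}ᶜ) ≤ L.toSubalgebra := by
      refine Algebra.adjoin_le ?_
      rintro _ ⟨k, hk', rfl⟩
      rw [← hk k fun h => hk' (by simp [h])]
      exact hL k
    exact this hc
  rintro _ ⟨k, rfl⟩
  by_cases hkj : k = j
  · have h1 : y k = y' i * y' j + c := by
      rw [hj, hk i hij, hkj]
      field_simp
      ring
    rw [h1]
    exact add_mem (mul_mem (hL i) (hL j)) hcL
  · rw [← hk k hkj]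
    exact hL k

/-- The coordinate `(yⱼ - c) / yᵢ` together with the other five generates the field, so it is
transcendental over the residues of the centre, and `yᵢ = 0` in the new coordinates is the
exceptional divisor. The value `c` may depend on the coordinates other than `yᵢ`, `yⱼ`, which these
places fix. -/
lemma center_mk {R : Subring K} {eqns : Set K} (hij : i ≠ j)
    (hR : R = (Algebra.adjoin ℂ (Set.range y)).toSubring) (heq : eqns = {y i, y j - c})
    (hc : c ∈ Algebra.adjoin ℂ (y '' {i, j}ᶜ)) (hk : ∀ k, k ≠ j → y' k = y k)
    (hj : y' j = (y j - c) / y i) :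
    Center ⟨R, eqns⟩ (ctr y i j c hy) (dvs y' i hy') (y j - c) (y i) := by
  have hy0 : y i ≠ 0 := gen_ne_zero hy i
  have hfix : ∀ {Γ : Place K}, (∀ k, k ≠ i → k ≠ j → Γ.rel (y k) (y k)) → Γ.rel c c := by
    intro Γ h
    have : Algebra.adjoin ℂ (y '' {i, j}ᶜ) ≤ Γ.fixed.toSubalgebra := by
      refine Algebra.adjoin_le ?_
      rintro _ ⟨k, hk', rfl⟩
      exact h k (fun h => hk' (by simp [h])) (fun h => hk' (by simp [h]))
    exact this hc
  have hf : y j - c ≠ 0 := by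
    intro h
    have h1 := gen_ne_zero hy' j
    rw [hj, h, zero_div] at h1
    exact h1 rfl
  have hE : ∀ k, k ≠ i → k ≠ j → (dvs y' i hy').rel (y k) (y k) := fun k h1 h2 => by
    rw [← hk k h2]
    exact dvs_fix h1
  have hEi : (dvs y' i hy').rel (y i) 0 := by
    rw [← hk i hij]
    exact dvs_zero
  have hT : (dvs y' i hy').rel ((y j - c) / y i) ((y j - c) / y i) := by
    rw [← hj]
    exact dvs_fix hij.symm
  refine ⟨?_, ctr_le hEi ?_ hE, dvs_arch, hf, hy0, ?_, ctr_fst hij, hT, ?_⟩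
  · rw [hR, heq]
    have hcr : c ∈ Algebra.adjoin ℂ (Set.range y) :=
      Algebra.adjoin_mono (Set.image_subset_range _ _) hc
    refine link_of ?_ ?_ ?_ ?_
    · intro k
      by_cases hkj : k = j
      · subst hkj; rwa [Function.update_self]
      · rw [Function.update_of_ne hkj]
        by_cases hki : k = i
        · subst hki; rw [Function.update_self]; exact Subalgebra.zero_mem _
        · rw [Function.update_of_ne hki]; exact Algebra.subset_adjoin ⟨k, rfl⟩
    · intro k
      by_cases hkj : k = j
      · subst hkj; rw [Function.update_self]; exact hfix fun k h1 h2 => ctr_fix h1 h2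
      · rw [Function.update_of_ne hkj]
        by_cases hki : k = i
        · subst hki; rw [Function.update_self]; exact Place.zero
        · rw [Function.update_of_ne hki]; exact ctr_fix hki hkj
    · intro k
      by_cases hkj : k = j
      · subst hkj; rw [Function.update_self]; right; simp
      · rw [Function.update_of_ne hkj]
        by_cases hki : k = i
        · subst hki; rw [Function.update_self]; right; simp
        · rw [Function.update_of_ne hki]; exact .inl rfl
    · rintro e (rfl | rfl)
      · exact ⟨i, by rw [Function.update_of_ne hij, Function.update_self, sub_zero]⟩
      · exact ⟨j, by rw [Function.update_self]⟩
  · have := (dvs y' i hy').mul hT hEi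
    rw [div_mul_cancel₀ _ hy0, mul_zero] at this
    simpa using (dvs y' i hy').add this (hfix hE)
  · simpa using Place.sub (ctr_snd (y := y) (i := i) (j := j) (c := c) (hy := hy))
      (hfix fun k h1 h2 => ctr_fix h1 h2)
  · rw [← hj]
    refine transcendental_residues hy' j fun L hL k => ?_
    by_cases hkj : k = j
    · subst hkj
      rw [Function.update_self]
      have : Algebra.adjoin ℂ (y '' {i, k}ᶜ) ≤ L.toSubalgebra := by
        refine Algebra.adjoin_le ?_
        rintro _ ⟨l, hl, rfl⟩
        have hlk : l ≠ k := fun h => hl (by simp [h])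
        rw [← hk l hlk]
        exact hL l hlk
      exact this hc
    · rw [Function.update_of_ne hkj]
      by_cases hki : k = i
      · subst hki; rw [Function.update_self]; exact zero_mem _
      · rw [Function.update_of_ne hki, ← hk k hkj]; exact hL k hkj

lemma dvs_link {R : Subring K} {g : K} (hR : R = (Algebra.adjoin ℂ (Set.range y)).toSubring)
    (hg : g = y i) : Link ⟨R, {g}⟩ (dvs y i hy) := by
  rw [hR, hg]
  refine link_of ?_ ?_ ?_ ?_
  · intro k
    by_cases hki : k = i
    · subst hki; rw [Function.update_self]; exact Subalgebra.zero_mem _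
    · rw [Function.update_of_ne hki]; exact Algebra.subset_adjoin ⟨k, rfl⟩
  · intro k
    by_cases hki : k = i
    · subst hki; rw [Function.update_self]; exact Place.zero
    · rw [Function.update_of_ne hki]; exact dvs_fix hki
  · intro k
    by_cases hki : k = i
    · subst hki; rw [Function.update_self]; right; simp
    · rw [Function.update_of_ne hki]; exact .inl rfl
  · rintro e rfl
    exact ⟨i, by rw [Function.update_self, sub_zero]⟩

end

lemma forall_fin_six {P : Fin 6 → Prop} :
    (∀ k, P k) ↔ P 0 ∧ P 1 ∧ P 2 ∧ P 3 ∧ P 4 ∧ P 5 :=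
  ⟨fun h => ⟨h 0, h 1, h 2, h 3, h 4, h 5⟩, fun ⟨h0, h1, h2, h3, h4, h5⟩ k => by
    fin_cases k <;> assumption⟩

lemma dvs_rel₁ {y₁ y₂ y₃ y₄ : K} {h : Gen (tup y₁ y₂ y₃ y₄)} :
    (dvs (tup y₁ y₂ y₃ y₄) 0 h).rel y₁ 0 ∧
    (dvs (tup y₁ y₂ y₃ y₄) 0 h).rel y₂ y₂ ∧
    (dvs (tup y₁ y₂ y₃ y₄) 0 h).rel y₃ y₃ ∧
    (dvs (tup y₁ y₂ y₃ y₄) 0 h).rel y₄ y₄ ∧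
    (dvs (tup y₁ y₂ y₃ y₄) 0 h).rel b₁ b₁ ∧
    (dvs (tup y₁ y₂ y₃ y₄) 0 h).rel b₂ b₂ :=
  ⟨dvs_zero, dvs_fix (k := 1) (by decide), dvs_fix (k := 2) (by decide),
   dvs_fix (k := 3) (by decide), dvs_fix (k := 4) (by decide), dvs_fix (k := 5) (by decide)⟩

lemma dvs_rel₂ {y₁ y₂ y₃ y₄ : K} {h : Gen (tup y₁ y₂ y₃ y₄)} :
    (dvs (tup y₁ y₂ y₃ y₄) 1 h).rel y₁ y₁ ∧
    (dvs (tup y₁ y₂ y₃ y₄) 1 h).rel y₂ 0 ∧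
    (dvs (tup y₁ y₂ y₃ y₄) 1 h).rel y₃ y₃ ∧
    (dvs (tup y₁ y₂ y₃ y₄) 1 h).rel y₄ y₄ ∧
    (dvs (tup y₁ y₂ y₃ y₄) 1 h).rel b₁ b₁ ∧
    (dvs (tup y₁ y₂ y₃ y₄) 1 h).rel b₂ b₂ :=
  ⟨dvs_fix (k := 0) (by decide), dvs_zero, dvs_fix (k := 2) (by decide),
   dvs_fix (k := 3) (by decide), dvs_fix (k := 4) (by decide), dvs_fix (k := 5) (by decide)⟩

lemma dvs_rel₃ {y₁ y₂ y₃ y₄ : K} {h : Gen (tup y₁ y₂ y₃ y₄)} :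
    (dvs (tup y₁ y₂ y₃ y₄) 2 h).rel y₁ y₁ ∧
    (dvs (tup y₁ y₂ y₃ y₄) 2 h).rel y₂ y₂ ∧
    (dvs (tup y₁ y₂ y₃ y₄) 2 h).rel y₃ 0 ∧
    (dvs (tup y₁ y₂ y₃ y₄) 2 h).rel y₄ y₄ ∧
    (dvs (tup y₁ y₂ y₃ y₄) 2 h).rel b₁ b₁ ∧
    (dvs (tup y₁ y₂ y₃ y₄) 2 h).rel b₂ b₂ :=
  ⟨dvs_fix (k := 0) (by decide), dvs_fix (k := 1) (by decide), dvs_zero,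
   dvs_fix (k := 3) (by decide), dvs_fix (k := 4) (by decide), dvs_fix (k := 5) (by decide)⟩

lemma dvs_rel₄ {y₁ y₂ y₃ y₄ : K} {h : Gen (tup y₁ y₂ y₃ y₄)} :
    (dvs (tup y₁ y₂ y₃ y₄) 3 h).rel y₁ y₁ ∧
    (dvs (tup y₁ y₂ y₃ y₄) 3 h).rel y₂ y₂ ∧
    (dvs (tup y₁ y₂ y₃ y₄) 3 h).rel y₃ y₃ ∧
    (dvs (tup y₁ y₂ y₃ y₄) 3 h).rel y₄ 0 ∧
    (dvs (tup y₁ y₂ y₃ y₄) 3 h).rel b₁ b₁ ∧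
    (dvs (tup y₁ y₂ y₃ y₄) 3 h).rel b₂ b₂ :=
  ⟨dvs_fix (k := 0) (by decide), dvs_fix (k := 1) (by decide), dvs_fix (k := 2) (by decide),
   dvs_zero, dvs_fix (k := 4) (by decide), dvs_fix (k := 5) (by decide)⟩

/-! ### Coordinates are nonzero -/

lemma coord_ne_zero (v : Var) : coord v ≠ 0 := by
  unfold coord
  rw [Ne, map_eq_zero_iff _ (IsFractionRing.injective Poly K)]
  exact X_ne_zero v

lemma q₁_ne : q₁ ≠ 0 := coord_ne_zero _
lemma p₁_ne : p₁ ≠ 0 := coord_ne_zero _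
lemma q₂_ne : q₂ ≠ 0 := coord_ne_zero _
lemma p₂_ne : p₂ ≠ 0 := coord_ne_zero _

/-! ### Local rings of `(ℙ¹)⁴` -/

lemma chart_closure (y₁ y₂ y₃ y₄ : K) : chart y₁ y₂ y₃ y₄ =
    Subring.closure (Set.range (algebraMap ℂ K) ∪ {y₁, y₂, y₃, y₄, b₁, b₂}) :=
  Algebra.adjoin_eq_ring_closure _

lemma projLines_cases {R : LocalSubring K} (hR : R ∈ projLines) :
    ((q₁ ∈ R.toSubring ∨ q₁⁻¹ ∈ R.toSubring) ∧ (p₁ ∈ R.toSubring ∨ p₁⁻¹ ∈ R.toSubring) ∧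
      (q₂ ∈ R.toSubring ∨ q₂⁻¹ ∈ R.toSubring) ∧ (p₂ ∈ R.toSubring ∨ p₂⁻¹ ∈ R.toSubring)) ∧
    (b₁ ∈ R.toSubring ∧ b₂ ∈ R.toSubring ∧ ∀ c : ℂ, algebraMap ℂ K c ∈ R.toSubring) := by
  obtain ⟨y₁, h1, y₂, h2, y₃, h3, y₄, h4, h⟩ := hR
  have hl := (spec_loc h).1
  rw [chart_closure] at hl
  have hX : ∀ x ∈ Set.range (algebraMap ℂ K) ∪ {y₁, y₂, y₃, y₄, b₁, b₂}, x ∈ R.toSubring :=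
    fun x hx => hl (Subring.subset_closure hx)
  have e1 := hX y₁ (by simp)
  have e2 := hX y₂ (by simp)
  have e3 := hX y₃ (by simp)
  have e4 := hX y₄ (by simp)
  refine ⟨⟨?_, ?_, ?_, ?_⟩, hX b₁ (by simp), hX b₂ (by simp), fun c => hX _ (.inl ⟨c, rfl⟩)⟩
  · rcases h1 with rfl | rfl
    exacts [.inl e1, .inr e1]
  · rcases h2 with rfl | rfl
    exacts [.inl e2, .inr e2]
  · rcases h3 with rfl | rfl
    exacts [.inl e3, .inr e3]
  · rcases h4 with rfl | rfl
    exacts [.inl e4, .inr e4]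

/-- The residue of `x` is congruent to `x` modulo the ideal generated by `G`. -/
def Cg (Γ : Place K) (R : LocalSubring K) (G : Set K) (x : K) : Prop :=
  x ∈ R.toSubring → ∃ c ∈ R.toSubring, Γ.rel x c ∧ x - c ∈ Spn R.toSubring G

lemma Cg.fix {Γ : Place K} {R : LocalSubring K} {G : Set K} {x : K} (h : Γ.rel x x) :
    Cg Γ R G x := fun hx => ⟨x, hx, h, by simp⟩

lemma Cg.gen {Γ : Place K} {R : LocalSubring K} {G : Set K} {x : K} (h : x ∈ G)
    (h0 : Γ.rel x 0) : Cg Γ R G x :=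
  fun _ => ⟨0, Subring.zero_mem _, h0, by simpa using Spn.gen h⟩

/-- Void case: if the inverse is a nonunit of `R`, then `x` is not in `R`. -/
lemma Cg.absurd {Γ : Place K} {R : LocalSubring K} {G : Set K} {x : K} (h0 : x ≠ 0)
    (h : x⁻¹ ∈ Mx R) : Cg Γ R G x :=
  fun hx => (Mx.notMem_of_inv (inv_ne_zero h0) (by simpa using hx) h).elim

/-- Generators of the ideal of a place in a local ring of `(ℙ¹)⁴`. -/
lemma projLines_ret {R : LocalSubring K} (hR : R ∈ projLines) {Γ : Place K} {G : Set K}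
    (hG : ∀ g ∈ G, g ∈ Mx R) (h0 : ∀ g ∈ G, Γ.rel g 0)
    (h1 : Cg Γ R G q₁ ∧ Cg Γ R G q₁⁻¹) (h2 : Cg Γ R G p₁ ∧ Cg Γ R G p₁⁻¹)
    (h3 : Cg Γ R G q₂ ∧ Cg Γ R G q₂⁻¹) (h4 : Cg Γ R G p₂ ∧ Cg Γ R G p₂⁻¹)
    (h5 : Γ.rel b₁ b₁) (h6 : Γ.rel b₂ b₂) : Ret Γ R G := by
  obtain ⟨y₁, g1, y₂, g2, y₃, g3, y₄, g4, h⟩ := hR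
  have hl := spec_loc h
  rw [chart_closure] at hl
  refine Ret.of_gens hl hG h0 ?_
  have hX : ∀ x ∈ Set.range (algebraMap ℂ K) ∪ {y₁, y₂, y₃, y₄, b₁, b₂}, x ∈ R.toSubring :=
    fun x hx => hl.1 (Subring.subset_closure hx)
  rintro x (⟨c, rfl⟩ | hx)
  · exact Cg.fix (Γ.const c) (hX _ (.inl ⟨c, rfl⟩))
  · refine (?_ : Cg Γ R G x) (hX x (.inr hx))
    rcases hx with rfl | rfl | rfl | rfl | rfl | rfl
    · rcases g1 with rfl | rfl
      exacts [h1.1, h1.2]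
    · rcases g2 with rfl | rfl
      exacts [h2.1, h2.2]
    · rcases g3 with rfl | rfl
      exacts [h3.1, h3.2]
    · rcases g4 with rfl | rfl
      exacts [h4.1, h4.2]
    · exact Cg.fix h5
    · exact Cg.fix h6

/-! ### The divisors at infinity -/

lemma gen_inf₁ : Gen (tup q₁⁻¹ p₁ q₂ p₂) :=
  gen_tup fun L h1 h2 h3 h4 _ _ => ⟨by simpa using L.inv_mem h1, h2, h3, h4⟩
lemma gen_inf₂ : Gen (tup q₁ p₁⁻¹ q₂ p₂) :=
  gen_tup fun L h1 h2 h3 h4 _ _ => ⟨h1, by simpa using L.inv_mem h2, h3, h4⟩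
lemma gen_inf₃ : Gen (tup q₁ p₁ q₂⁻¹ p₂) :=
  gen_tup fun L h1 h2 h3 h4 _ _ => ⟨h1, h2, by simpa using L.inv_mem h3, h4⟩
lemma gen_inf₄ : Gen (tup q₁ p₁ q₂ p₂⁻¹) :=
  gen_tup fun L h1 h2 h3 h4 _ _ => ⟨h1, h2, h3, by simpa using L.inv_mem h4⟩

/-- The place of the divisor `q₁ = ∞`. -/
noncomputable def inf₁ : Place K := dvs (tup q₁⁻¹ p₁ q₂ p₂) 0 gen_inf₁
/-- The place of the divisor `p₁ = ∞`. -/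
noncomputable def inf₂ : Place K := dvs (tup q₁ p₁⁻¹ q₂ p₂) 1 gen_inf₂
/-- The place of the divisor `q₂ = ∞`. -/
noncomputable def inf₃ : Place K := dvs (tup q₁ p₁ q₂⁻¹ p₂) 2 gen_inf₃
/-- The place of the divisor `p₂ = ∞`. -/
noncomputable def inf₄ : Place K := dvs (tup q₁ p₁ q₂ p₂⁻¹) 3 gen_inf₄

/-- The four divisors at infinity. -/
noncomputable def infs : List (Place K) := [inf₄, inf₃, inf₂, inf₁]

lemma infs_arch : ∀ D ∈ infs, D.Arch := by
  intro D hD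
  simp only [infs, List.mem_cons, List.not_mem_nil, or_false] at hD
  rcases hD with rfl | rfl | rfl | rfl
  all_goals exact dvs_arch

/-- The coordinates are inverted one at a time; each step adds the divisor where that coordinate is
infinite, whose place fixes all the others. -/
lemma good_chart {δ : Derivation ℂ K K} (hδ : ∀ x ∈ chart q₁ p₁ q₂ p₂, δ x ∈ chart q₁ p₁ q₂ p₂)
    {y₁ y₂ y₃ y₄ : K} (h1 : y₁ ∈ ({q₁, q₁⁻¹} : Set K)) (h2 : y₂ ∈ ({p₁, p₁⁻¹} : Set K))
    (h3 : y₃ ∈ ({q₂, q₂⁻¹} : Set K)) (h4 : y₄ ∈ ({p₂, p₂⁻¹} : Set K)) :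
    Good δ infs (chart y₁ y₂ y₃ y₄) := by
  have fixp : ∀ {Γ : Place K} {y q : K}, Γ.rel q q → y ∈ ({q, q⁻¹} : Set K) → Γ.rel y y := by
    rintro Γ y q hq (rfl | rfl)
    · exact hq
    · exact Γ.fixed.inv_mem hq
  have ar : ∀ {l : List (Place K)}, (∀ D ∈ l, D ∈ infs) → ∀ D ∈ l, D.Arch :=
    fun h D hD => infs_arch D (h D hD)
  have g0 : Good δ [] (chart q₁ p₁ q₂ p₂) := ⟨_, le_rfl, hδ, fun h hh _ => hh⟩
  have g1 : Good δ [inf₁] (chart y₁ p₁ q₂ p₂) := by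
    rcases h1 with rfl | rfl
    · exact g0.weaken
    have e : ∀ y : K, chart y p₁ q₂ p₂ = Subring.closure
        ((Set.range (algebraMap ℂ K) ∪ {p₁, q₂, p₂, b₁, b₂}) ∪ {y}) := fun y => by
      rw [chart_closure]; congr 1; ext x; simp only [Set.mem_union, Set.mem_insert_iff,
        Set.mem_singleton_iff]; tauto
    obtain ⟨r1, r2, r3, r4, r5, r6⟩ := dvs_rel₁ (h := gen_inf₁)
    rw [e]
    refine Good.base (by rwa [inv_inv, ← e]) (by simp) ?_ r1 (inv_ne_zero q₁_ne)
    rintro x (⟨c, rfl⟩ | rfl | rfl | rfl | rfl | rfl)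
    exacts [Place.const _ c, r2, r3, r4, r5, r6]
  have g2 : Good δ [inf₂, inf₁] (chart y₁ y₂ q₂ p₂) := by
    rcases h2 with rfl | rfl
    · exact g1.weaken
    have e : ∀ y : K, chart y₁ y q₂ p₂ = Subring.closure
        ((Set.range (algebraMap ℂ K) ∪ {y₁, q₂, p₂, b₁, b₂}) ∪ {y}) := fun y => by
      rw [chart_closure]; congr 1; ext x; simp only [Set.mem_union, Set.mem_insert_iff,
        Set.mem_singleton_iff]; tauto
    obtain ⟨r1, r2, r3, r4, r5, r6⟩ := dvs_rel₂ (h := gen_inf₂)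
    rw [e]
    refine Good.base (by rwa [inv_inv, ← e]) (ar (by simp [infs])) ?_ r2 (inv_ne_zero p₁_ne)
    rintro x (⟨c, rfl⟩ | rfl | rfl | rfl | rfl | rfl)
    exacts [Place.const _ c, fixp r1 h1, r3, r4, r5, r6]
  have g3 : Good δ [inf₃, inf₂, inf₁] (chart y₁ y₂ y₃ p₂) := by
    rcases h3 with rfl | rfl
    · exact g2.weaken
    have e : ∀ y : K, chart y₁ y₂ y p₂ = Subring.closure
        ((Set.range (algebraMap ℂ K) ∪ {y₁, y₂, p₂, b₁, b₂}) ∪ {y}) := fun y => by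
      rw [chart_closure]; congr 1; ext x; simp only [Set.mem_union, Set.mem_insert_iff,
        Set.mem_singleton_iff]; tauto
    obtain ⟨r1, r2, r3, r4, r5, r6⟩ := dvs_rel₃ (h := gen_inf₃)
    rw [e]
    refine Good.base (by rwa [inv_inv, ← e]) (ar (by simp [infs])) ?_ r3 (inv_ne_zero q₂_ne)
    rintro x (⟨c, rfl⟩ | rfl | rfl | rfl | rfl | rfl)
    exacts [Place.const _ c, fixp r1 h1, fixp r2 h2, r4, r5, r6]
  rcases h4 with rfl | rfl
  · exact g3.weaken
  have e : ∀ y : K, chart y₁ y₂ y₃ y = Subring.closure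
      ((Set.range (algebraMap ℂ K) ∪ {y₁, y₂, y₃, b₁, b₂}) ∪ {y}) := fun y => by
    rw [chart_closure]; congr 1; ext x; simp only [Set.mem_union, Set.mem_insert_iff,
      Set.mem_singleton_iff]; tauto
  obtain ⟨r1, r2, r3, r4, r5, r6⟩ := dvs_rel₄ (h := gen_inf₄)
  rw [e]
  refine Good.base (by rwa [inv_inv, ← e]) (ar (by simp [infs])) ?_ r4 (inv_ne_zero p₂_ne)
  rintro x (⟨c, rfl⟩ | rfl | rfl | rfl | rfl | rfl)
  exacts [Place.const _ c, fixp r1 h1, fixp r2 h2, fixp r3 h3, r5, r6]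

lemma good_projLines {δ : Derivation ℂ K K}
    (hδ : ∀ x ∈ chart q₁ p₁ q₂ p₂, δ x ∈ chart q₁ p₁ q₂ p₂) :
    ∀ R ∈ projLines, Good δ infs R.toSubring := by
  rintro R ⟨y₁, h1, y₂, h2, y₃, h3, y₄, h4, h⟩
  exact (good_chart hδ h1 h2 h3 h4).loc infs_arch (spec_loc h)

lemma link_inf₁ : Link ⟨chart q₁⁻¹ p₁ q₂ p₂, {q₁⁻¹}⟩ inf₁ := dvs_link (chart_eq ..) rfl
lemma link_inf₂ : Link ⟨chart q₁ p₁⁻¹ q₂ p₂, {p₁⁻¹}⟩ inf₂ := dvs_link (chart_eq ..) rfl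
lemma link_inf₃ : Link ⟨chart q₁ p₁ q₂⁻¹ p₂, {q₂⁻¹}⟩ inf₃ := dvs_link (chart_eq ..) rfl
lemma link_inf₄ : Link ⟨chart q₁ p₁ q₂ p₂⁻¹, {p₂⁻¹}⟩ inf₄ := dvs_link (chart_eq ..) rfl

/-! ### Existence and uniqueness of the rational vector field -/

lemma ext_of_coords {δ δ' : Derivation ℂ K K} (h : ∀ v, δ (coord v) = δ' (coord v)) : δ = δ' := by
  have hP : ∀ p : Poly, δ (algebraMap Poly K p) = δ' (algebraMap Poly K p) := by
    intro p
    induction p using MvPolynomial.induction_on with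
    | C a =>
      have : algebraMap Poly K (C a) = algebraMap ℂ K a :=
        (IsScalarTower.algebraMap_apply ℂ Poly K a).symm
      rw [this, Derivation.map_algebraMap, Derivation.map_algebraMap]
    | add p q hp hq => rw [map_add, map_add, map_add, hp, hq]
    | mul_X p v hp =>
      rw [map_mul, Derivation.leibniz, Derivation.leibniz, hp]
      exact congrArg₂ _ (congrArg _ (h v)) rfl
  ext x
  obtain ⟨a, s, hs, rfl⟩ := IsFractionRing.div_surjective (A := Poly) x
  have hs0 : algebraMap Poly K s ≠ 0 := by
    rw [Ne, map_eq_zero_iff _ (IsFractionRing.injective Poly K)]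
    exact nonZeroDivisors.ne_zero hs
  rw [deriv_div δ _ _ hs0, deriv_div δ' _ _ hs0, hP, hP]

/-- A derivation is the second component of an algebra map to the dual numbers `K[ε]` that lifts the
identity. Such a map is prescribed freely on polynomials and extends to fractions, since an element
of `K[ε]` with nonzero first component is a unit. -/
lemma exists_derivation (f : Var → K) : ∃ δ : Derivation ℂ K K, ∀ v, δ (coord v) = f v := by
  let φ : Poly →ₐ[ℂ] TrivSqZeroExt K K :=
    aeval fun v => TrivSqZeroExt.inl (coord v) + TrivSqZeroExt.inr (f v)
  have hfst : ∀ p, (φ p).fst = algebraMap Poly K p := by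
    have : (TrivSqZeroExt.fstHom ℂ K K).comp φ = IsScalarTower.toAlgHom ℂ Poly K := by
      ext v
      simp [φ, coord]
    exact fun p => congrArg (fun g => g p) this
  have hu : ∀ s : nonZeroDivisors Poly, IsUnit (φ s) := fun s => by
    rw [TrivSqZeroExt.isUnit_iff_isUnit_fst, hfst]
    exact IsLocalization.map_units K s
  let ψ : K →ₐ[ℂ] TrivSqZeroExt K K := IsLocalization.liftAlgHom (M := nonZeroDivisors Poly) hu
  have hψ : ∀ p, ψ (algebraMap Poly K p) = φ p := fun p => by
    simp [ψ]
  have hψfst : ∀ x, (ψ x).fst = x := by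
    intro x
    obtain ⟨a, s, hs, rfl⟩ := IsFractionRing.div_surjective (A := Poly) x
    change ((TrivSqZeroExt.fstHom ℂ K K).comp ψ) _ = _
    rw [map_div₀]
    change (ψ _).fst / (ψ _).fst = _
    rw [hψ, hψ, hfst, hfst]
  refine ⟨Derivation.mk' ((TrivSqZeroExt.sndHom K K).restrictScalars ℂ ∘ₗ ψ.toLinearMap) ?_, ?_⟩
  · intro a b
    simp only [LinearMap.comp_apply, LinearMap.restrictScalars_apply, AlgHom.toLinearMap_apply,
      TrivSqZeroExt.sndHom_apply, map_mul, TrivSqZeroExt.snd_mul, hψfst]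
    simp [mul_comm]
  · intro v
    simp [coord, hψ, φ]

end PainleveFlow

/-!
# Ideals of places on families of local rings
-/

namespace PainleveFlow

open Place MvPolynomial

/-! ### Families of local rings -/

/-- A function or its inverse is regular at every point. -/
def Crd (V : Set (LocalSubring K)) (x : K) : Prop :=
  ∀ R ∈ V, x ∈ R.toSubring ∨ x⁻¹ ∈ R.toSubring

/-- The function is regular at every point. -/
def Reg (V : Set (LocalSubring K)) (x : K) : Prop := ∀ R ∈ V, x ∈ R.toSubring

/-- The ideal of the place is generated by `G` at every point that lies on the center of a place
above it. -/
def KrOn (V : Set (LocalSubring K)) (Γ : Place K) (G : Set K) : Prop :=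
  ∀ R ∈ V, ∀ Γ', Γ ≤ Γ' → Sub R.toSubring Γ' → Kr Γ R G

/-- The analogue of `KrOn` for retractions. -/
def RetOn (V : Set (LocalSubring K)) (Γ : Place K) (G : Set K) : Prop :=
  ∀ R ∈ V, ∀ Γ', Γ ≤ Γ' → Sub R.toSubring Γ' → Ret Γ R G

lemma RetOn.krOn {V : Set (LocalSubring K)} {Γ : Place K} {G : Set K} (h : RetOn V Γ G) :
    KrOn V Γ G := fun R hR Γ' hΓ hs => (h R hR Γ' hΓ hs).kr

section

variable {V : Set (LocalSubring K)} {C : Subvariety} {Γ Γ' E : Place K} {G : Set K} {x f g w : K}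

lemma Crd.blowUp (h : Crd V x) (hl : Link C Γ) : Crd (blowUp V C) x := by
  intro S hS
  rcases blowUp_cases hl hS with ⟨h1, -⟩ | ⟨R, hR, h1⟩
  · exact h S h1
  · exact (h R hR).imp (fun h2 => h1.le h2) (fun h2 => h1.le h2)

lemma Reg.blowUp (h : Reg V x) (hl : Link C Γ) : Reg (blowUp V C) x := by
  intro S hS
  rcases blowUp_cases hl hS with ⟨h1, -⟩ | ⟨R, hR, h1⟩
  · exact h S h1
  · exact h1.le (h R hR)

/-- Choice of the affine piece of a blow-up that contains the centre of a place. -/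
lemma loc_choice {R S : LocalSubring K} (hf : f ≠ 0) (hg : g ≠ 0) (hRS : R.toSubring ≤ S.toSubring)
    (h : Loc (adj R.toSubring (f / g)) S.toSubring ∨ Loc (adj R.toSubring (g / f)) S.toSubring)
    (hw : w ∈ S.toSubring) (hr : Γ.rel (f / g - w) 0) (hs : Sub S.toSubring Γ) :
    Loc (adj R.toSubring (f / g)) S.toSubring := by
  rcases h with h | h
  · exact h
  have hτ : g / f ∈ S.toSubring := h.1 (self_mem_adj _ _)
  -- Even in the other piece `(g / f) w` is congruent to `1`, so `g / f` is a unit of `S` and the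
  -- two pieces agree there.
  have h1 : Γ.rel (1 - g / f * w) 0 := by
    obtain ⟨d, hd⟩ := hs _ hτ
    have : 1 - g / f * w = g / f * (f / g - w) := by field_simp
    rw [this]
    exact mul_zero' hd hr
  have h2 : g / f ∉ Mx S := fun h3 => by
    refine Mx.one_notMem (R := S) ?_
    have := Mx.add (hs.mx (sub_mem (one_mem _) (mul_mem hτ hw)) h1) (Mx.mul' h3 hw)
    simpa using this
  have h3 : f / g ∈ S.toSubring := by
    have := Mx.inv_mem hτ h2
    rwa [inv_div] at this
  refine h.of_frac_gens (adj_le hRS h3) ?_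
  rintro x (hx | rfl)
  · exact le_fracRing _ _ (le_adj _ _ hx)
  · exact ⟨1, one_mem _, f / g, self_mem_adj _ _, div_ne_zero hf hg, by rwa [inv_div],
      by field_simp⟩

/-- The next blow-up in a chain: the new centre is a section over the old one. -/
lemma KrOn.chain (hl : Link C Γ) (h : KrOn V Γ {f, g}) (hf : f ≠ 0) (hg : g ≠ 0) (hΓ : Γ ≤ Γ')
    (hw : Reg V w) (hr : Γ'.rel (f / g - w) 0) : KrOn (blowUp V C) Γ' {f / g - w, g} := by
  intro S hS Γ'' hΓ' hs
  have hΓΓ'' := le_trans' hΓ hΓ'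
  rcases blowUp_cases hl hS with ⟨h1, h2⟩ | ⟨R, hR, h1⟩
  -- A point left unchanged by the blow-up is off the old centre, hence it is off everything above
  -- it.
  · exact (h2 (h S h1 Γ'' hΓΓ'' hs).sub).elim
  have hk := h R hR Γ'' hΓΓ'' (hs.mono h1.le)
  have hloc := loc_choice hf hg h1.le (h1.loc f g hf hg hk) (h1.le (hw R hR)) (hΓ' _ _ hr) hs
  have hT : f / g ∈ S.toSubring := hloc.1 (self_mem_adj _ _)
  have hgS : g ∈ S.toSubring := h1.le (hk.ring g (by simp))
  have hTw : f / g - w ∈ S.toSubring := sub_mem hT (h1.le (hw R hR))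
  have hz : ∀ x ∈ ({f / g - w, g} : Set K), Γ'.rel x 0 := by
    rintro x (rfl | rfl)
    exacts [hr, hΓ _ _ (hk.zero _ (by simp))]
  refine hk.step hloc hΓ (hw R hR) hr ?_ hz ?_ (Spn.gen (by simp))
  · rintro x hx
    refine hs.mx ?_ (hΓ' _ _ (hz x hx))
    rcases hx with rfl | rfl
    exacts [hTw, hgS]
  · rintro x (hx | hx)
    · have : x = f / g * g := by rw [hx]; field_simp
      rw [this]
      exact Spn.mul hT (Spn.gen (by simp))
    · exact Spn.gen (by simp [Set.mem_singleton_iff.1 hx])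

/-- The centre of the blow-up is disjoint from the centre of the place. -/
lemma KrOn.disjoint (hl : Link C Γ) (h : KrOn V Γ' G) (hx : Crd V x) (h1 : Γ.rel x⁻¹ 0)
    (h2 : Γ'.rel x 0) (h0 : x ≠ 0) : KrOn (blowUp V C) Γ' G := by
  intro S hS Γ'' hΓ' hs
  rcases blowUp_cases hl hS with ⟨h3, -⟩ | ⟨R, hR, h3⟩
  · exact h S h3 Γ'' hΓ' hs
  · rcases hx R hR with hx | hx
    · exact (not_mem_inv h1 (inv_ne_zero h0) (by rw [inv_inv]; exact h3.sub _ hx)).elim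
    · exact (not_mem_inv (hΓ' _ _ h2) h0 (hs _ (h3.le hx))).elim

/-- Blow-up along a centre that is transverse to the centre of the place. -/
lemma RetOn.transverse (hl : Link C Γ) (hk : KrOn V Γ {f, g}) (hf : f ≠ 0) (hg : g ≠ 0)
    (h : RetOn V Γ' G) (hfix : Γ'.rel (f / g) (f / g)) : RetOn (blowUp V C) Γ' G := by
  intro S hS Γ'' hΓ' hs
  rcases blowUp_cases hl hS with ⟨h3, -⟩ | ⟨R, hR, h3⟩
  · exact h S h3 Γ'' hΓ' hs
  have hret := h R hR Γ'' hΓ' (hs.mono h3.le)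
  have hG : ∀ g ∈ G, g ∈ Mx S := fun g hg =>
    hs.mx (h3.le (hret.ring g hg)) (hΓ' _ _ (hret.zero g hg))
  rcases h3.loc f g hf hg (hk R hR Γ (fun _ _ h => h) h3.sub) with h4 | h4
  · exact hret.step h4 hG hret.zero (fun g hg => Spn.gen hg)
      ⟨_, h4.1 (self_mem_adj _ _), hfix, by simp⟩
  · have hfix' : Γ'.rel (g / f) (g / f) := by
      rw [← inv_div]
      exact Γ'.fixed.inv_mem hfix
    exact hret.step h4 hG hret.zero (fun g hg => Spn.gen hg)
      ⟨_, h4.1 (self_mem_adj _ _), hfix', by simp⟩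

lemma Center.good {δ : Derivation ℂ K K} {𝒟 : List (Place K)} (hc : Center C Γ E f g)
    (h : KrOn V Γ {f, g}) (hD : ∀ D ∈ 𝒟, D.Arch) (hV : ∀ R ∈ V, Good δ 𝒟 R.toSubring) :
    ∀ S ∈ blowUp V C, Good δ (E :: 𝒟) S.toSubring :=
  good_blowUp hc.link hc.le hD hV fun R hR hs =>
    ⟨f, g, f / g, hc.fst, hc.snd, h R hR Γ (fun _ _ h => h) hs, hc.fix, hc.trans⟩

end

end PainleveFlow

/-!
# Towers of blow-ups in a pair of coordinates
-/

namespace PainleveFlow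

open Place MvPolynomial

/-! ### Integral elements of places -/

/-- The valuation ring of a place. -/
def Place.integers (Γ : Place K) : Subalgebra ℂ K where
  carrier := {x | Γ.mem x}
  mul_mem' := fun hx hy => mem_mul hx hy
  add_mem' := by
    rintro x y ⟨c, hc⟩ ⟨d, hd⟩
    exact ⟨_, Γ.add hc hd⟩
  algebraMap_mem' := fun c => ⟨_, Γ.const c⟩

lemma Place.integers_of_rel {Γ : Place K} {x c : K} (h : Γ.rel x c) : x ∈ Γ.integers := ⟨c, h⟩

section

variable {y : Fin 6 → K} {i j : Fin 6} {c c' : K} {hy : Gen y} {Γ : Place K}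

/-- The coordinate `y i` is a uniformizer of the divisor. This turns the vanishing of a numerator on
the divisor into the absence of a pole. -/
lemma dvs_div {x : K} (h : (dvs y i hy).rel x 0) : x / y i ∈ (dvs y i hy).integers := by
  obtain ⟨p, q, hq, h1, h2⟩ := h
  rw [zero_mul] at h2
  obtain ⟨p', rfl⟩ := X_dvd_of_aeval_update_eq_zero hy.algebraicIndependent i h2.symm
  refine ⟨aeval (Function.update y i 0) p' / aeval (Function.update y i 0) q, p', q, hq, ?_, ?_⟩
  · have := gen_ne_zero hy i
    rw [map_mul, aeval_X] at h1
    field_simp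
    linear_combination h1
  · field_simp

lemma fixes_of_adjoin (h : ∀ k, k ≠ i → k ≠ j → Γ.rel (y k) (y k))
    (hc : c ∈ Algebra.adjoin ℂ (y '' {i, j}ᶜ)) : Γ.rel c c := by
  have : Algebra.adjoin ℂ (y '' {i, j}ᶜ) ≤ Γ.fixed.toSubalgebra := by
    refine Algebra.adjoin_le ?_
    rintro _ ⟨k, hk', rfl⟩
    exact h k (fun h => hk' (by simp [h])) (fun h => hk' (by simp [h]))
  exact this hc

end

/-! ### Replacement of a pair of coordinates -/

/-- The coordinates with a pair of them replaced. -/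
def pr (B : Fin 6 → K) (i j : Fin 6) (α β : K) : Fin 6 → K :=
  Function.update (Function.update B i α) j β

/-- The subvariety `α = 0, β = c` of the chart with a pair of coordinates replaced by `α, β`. -/
noncomputable def Cp (B : Fin 6 → K) (i j : Fin 6) (α β c : K) : Subvariety :=
  ⟨(Algebra.adjoin ℂ (Set.range (pr B i j α β))).toSubring, {α, β - c}⟩

/-- Successive blow-ups along `f = g = 0` for functions `f, g` with `f / g` in the field `L`; the list
`Es` consists of the places of the exceptional divisors. -/
inductive Tower (L : IntermediateField ℂ K) :
    Set (LocalSubring K) → List Subvariety → List (Place K) → Prop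
  | nil (V) : Tower L V [] []
  | cons {V C Γ E f g Cs Es} (hC : Center C Γ E f g) (hk : KrOn V Γ {f, g}) (hL : f / g ∈ L)
      (h : Tower L (blowUp V C) Cs Es) : Tower L V (C :: Cs) (E :: Es)

namespace Tower

variable {L : IntermediateField ℂ K} {V : Set (LocalSubring K)} {Cs : List Subvariety}
  {Es : List (Place K)}

lemma arch (h : Tower L V Cs Es) : ∀ D ∈ Es, D.Arch := by
  induction h with
  | nil => simp
  | cons hC _ _ _ ih =>
    rintro D (_ | ⟨_, hD⟩)
    exacts [hC.arch, ih D hD]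

/-- Every blow-up puts its exceptional divisor at the head of the list, hence the reversal. -/
lemma good {δ : Derivation ℂ K K} (h : Tower L V Cs Es) {𝒟 : List (Place K)}
    (hD : ∀ D ∈ 𝒟, D.Arch) (hV : ∀ R ∈ V, Good δ 𝒟 R.toSubring) :
    ∀ R ∈ iteratedBlowUp V Cs, Good δ (Es.reverse ++ 𝒟) R.toSubring := by
  induction h generalizing 𝒟 with
  | nil => exact hV
  | @cons V C Γ E f g Cs Es hC hk _ _ ih =>
    have := ih (𝒟 := E :: 𝒟)
      (by rintro D (_ | ⟨_, hD'⟩); exacts [hC.arch, hD D hD']) (hC.good hk hD hV)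
    simpa [iteratedBlowUp] using this

/-- A place fixing `L` fixes all quotients `f / g` of the tower, so each blow-up is transverse to
it. -/
lemma ret (h : Tower L V Cs Es) {Γ : Place K} {G : Set K} (hΓ : L ≤ Γ.fixed) (hV : RetOn V Γ G) :
    RetOn (iteratedBlowUp V Cs) Γ G := by
  induction h with
  | nil => exact hV
  | cons hC hk hL _ ih => exact ih (hV.transverse hC.link hk hC.fst hC.snd (hΓ hL))

lemma crd (h : Tower L V Cs Es) {x : K} (hV : Crd V x) : Crd (iteratedBlowUp V Cs) x := by
  induction h with
  | nil => exact hV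
  | cons hC _ _ _ ih => exact ih (hV.blowUp hC.link)

lemma reg (h : Tower L V Cs Es) {x : K} (hV : Reg V x) : Reg (iteratedBlowUp V Cs) x := by
  induction h with
  | nil => exact hV
  | cons hC _ _ _ ih => exact ih (hV.blowUp hC.link)

end Tower

section

variable {B : Fin 6 → K} {i j k : Fin 6} {α β γ c c' : K} {V : Set (LocalSubring K)}
  {Γ : Place K}

lemma pr_fst (hij : i ≠ j) : pr B i j α β i = α := by
  rw [pr, Function.update_of_ne hij, Function.update_self]

lemma pr_snd : pr B i j α β j = β := by rw [pr, Function.update_self]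

lemma pr_of_ne (hi : k ≠ i) (hj : k ≠ j) : pr B i j α β k = B k := by
  rw [pr, Function.update_of_ne hj, Function.update_of_ne hi]

lemma pr_comm (hij : i ≠ j) : pr B i j α β = pr B j i β α := Function.update_comm hij ..

lemma pr_image : pr B i j α β '' {i, j}ᶜ = B '' {i, j}ᶜ := by
  refine Set.image_congr fun k hk => ?_
  simp only [Set.mem_compl_iff, Set.mem_insert_iff, Set.mem_singleton_iff, not_or] at hk
  exact pr_of_ne hk.1 hk.2

lemma gen_pr (hB : Gen B) (hij : i ≠ j)
    (h : ∀ L : IntermediateField ℂ K, α ∈ L → β ∈ L → B i ∈ L ∧ B j ∈ L) : Gen (pr B i j α β) := by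
  unfold Gen at hB ⊢
  rw [eq_top_iff, ← hB, IntermediateField.adjoin_le_iff]
  set L := IntermediateField.adjoin ℂ (Set.range (pr B i j α β))
  have hL : ∀ k, pr B i j α β k ∈ L := fun k => IntermediateField.subset_adjoin ℂ _ ⟨k, rfl⟩
  obtain ⟨h1, h2⟩ := h L (by simpa [pr_fst hij] using hL i) (by simpa [pr_snd] using hL j)
  rintro _ ⟨k, rfl⟩
  by_cases hi : k = i
  · rwa [hi]
  by_cases hj : k = j
  · rwa [hj]
  rw [← pr_of_ne (B := B) (α := α) (β := β) hi hj]
  exact hL k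

lemma gen_pr_exc (hij : i ≠ j) (hc : c ∈ Algebra.adjoin ℂ (B '' {i, j}ᶜ))
    (h : Gen (pr B i j α β)) : Gen (pr B i j α ((β - c) / α)) := by
  refine gen_exc h hij (by rwa [pr_image]) (fun k hk => ?_) ?_
  · by_cases hi : k = i
    · rw [hi, pr_fst hij, pr_fst hij]
    · rw [pr_of_ne hi hk, pr_of_ne hi hk]
  · rw [pr_snd, pr_snd, pr_fst hij]

lemma center_pr (hij : i ≠ j) (hc : c ∈ Algebra.adjoin ℂ (B '' {i, j}ᶜ))
    (h : Gen (pr B i j α β)) (h' : Gen (pr B i j α ((β - c) / α))) :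
    Center (Cp B i j α β c) (ctr (pr B i j α β) i j c h)
      (dvs (pr B i j α ((β - c) / α)) i h') (β - c) α := by
  have := center_mk (y := pr B i j α β) (y' := pr B i j α ((β - c) / α)) (c := c) (hy := h)
    (hy' := h') (R := (Algebra.adjoin ℂ (Set.range (pr B i j α β))).toSubring)
    (eqns := {α, β - c}) hij rfl (by rw [pr_snd, pr_fst hij]) (by rwa [pr_image]) (fun k hk => by
      by_cases hi : k = i
      · rw [hi, pr_fst hij, pr_fst hij]
      · rw [pr_of_ne hi hk, pr_of_ne hi hk]) (by rw [pr_snd, pr_snd, pr_fst hij])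
  rwa [pr_snd, pr_fst hij] at this

/-- The place of the next centre lies over the place of a centre. -/
lemma ctr_pr_le (hij : i ≠ j) (hc : c ∈ Algebra.adjoin ℂ (B '' {i, j}ᶜ))
    (h : Gen (pr B i j α β)) (h' : Gen (pr B i j α ((β - c) / α))) :
    ctr (pr B i j α β) i j c h ≤ ctr (pr B i j α ((β - c) / α)) i j c' h' := by
  have hα : α ≠ 0 := by simpa [pr_fst hij] using gen_ne_zero h i
  have h1 : (ctr (pr B i j α ((β - c) / α)) i j c' h').rel α 0 := by
    simpa [pr_fst hij] using ctr_fst (hy := h') (c := c') hij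
  have h2 : (ctr (pr B i j α ((β - c) / α)) i j c' h').rel ((β - c) / α) c' := by
    simpa [pr_snd] using ctr_snd (i := i) (j := j) (hy := h') (c := c')
  have h3 : ∀ k, k ≠ i → k ≠ j → (ctr (pr B i j α ((β - c) / α)) i j c' h').rel (B k) (B k) :=
    fun k hi hj => by
      simpa [pr_of_ne hi hj] using ctr_fix (hy := h') (c := c') hi hj
  refine ctr_le (by rwa [pr_fst hij]) ?_ fun k hi hj => by rw [pr_of_ne hi hj]; exact h3 k hi hj
  rw [pr_snd]
  have h4 := Place.add _ (Place.mul _ h2 h1) (fixes_of_adjoin h3 hc)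
  rwa [div_mul_cancel₀ _ hα, mul_zero, zero_add, sub_add_cancel] at h4

/-- Two successive blow-ups. -/
lemma KrOn.tower (hij : i ≠ j) (hc : c ∈ Algebra.adjoin ℂ (B '' {i, j}ᶜ))
    (hc' : c' ∈ Algebra.adjoin ℂ (B '' {i, j}ᶜ)) (hV : Reg V c')
    (h : Gen (pr B i j α β)) (h' : Gen (pr B i j α ((β - c) / α)))
    (hk : KrOn V (ctr (pr B i j α β) i j c h) {β - c, α}) :
    KrOn (blowUp V (Cp B i j α β c)) (ctr (pr B i j α ((β - c) / α)) i j c' h')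
      {(β - c) / α - c', α} := by
  have hC := center_pr hij hc h h'
  refine hk.chain hC.link hC.fst hC.snd (ctr_pr_le hij hc h h') hV ?_
  have h2 : (ctr (pr B i j α ((β - c) / α)) i j c' h').rel ((β - c) / α) c' := by
    simpa [pr_snd] using ctr_snd (i := i) (j := j) (hy := h') (c := c')
  have h3 : ∀ k, k ≠ i → k ≠ j → (ctr (pr B i j α ((β - c) / α)) i j c' h').rel (B k) (B k) :=
    fun k hi hj => by
      simpa [pr_of_ne hi hj] using ctr_fix (hy := h') (c := c') hi hj
  simpa using Place.sub h2 (fixes_of_adjoin h3 hc')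

end

/-! ### The tower of eight blow-ups for a pair of coordinates -/

section

variable (B : Fin 6 → K) (i j : Fin 6) (b : K) (a : Fin 3 → ℂ)

/-- The coordinates on the successive exceptional divisors over `q = p = ∞`. -/
noncomputable def vc₁ : K := ((B j)⁻¹ - 0) / (B i)⁻¹
/-- A coordinate on the next exceptional divisor. -/
noncomputable def vc₂ : K := (vc₁ B i j - -1) / (B i)⁻¹
/-- A coordinate on the next exceptional divisor. -/
noncomputable def vc₃ : K := (vc₂ B i j - -b) / (B i)⁻¹
/-- A coordinate on the next exceptional divisor. -/
noncomputable def vc₄ : K := (vc₃ B i j b - -(b ^ 2 + const (a 0))) / (B i)⁻¹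

/-- The centres of the blow-ups. -/
noncomputable def pairCenters : List Subvariety :=
  [Cp B i j (B i)⁻¹ (B j)⁻¹ 0,
    Cp B i j (B i)⁻¹ (vc₁ B i j) (-1),
    Cp B i j (B i)⁻¹ (vc₂ B i j) (-b),
    Cp B i j (B i)⁻¹ (vc₃ B i j b) (-(b ^ 2 + const (a 0))),
    Cp B i j (B i)⁻¹ (B j) 0,
    Cp B i j (B i)⁻¹ ((B j - 0) / (B i)⁻¹) (const (a 1)),
    Cp B j i (B j)⁻¹ (B i) 0,
    Cp B j i (B j)⁻¹ ((B i - 0) / (B j)⁻¹) (-const (a 2))]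

/-- The exceptional divisors that belong to the anti-canonical divisor. -/
noncomputable def pairBoundary : List Subvariety :=
  [⟨(Algebra.adjoin ℂ (Set.range (pr B i j (B i)⁻¹ (vc₁ B i j)))).toSubring, {(B i)⁻¹}⟩,
    ⟨(Algebra.adjoin ℂ (Set.range (pr B i j (B i)⁻¹ (vc₂ B i j)))).toSubring, {(B i)⁻¹}⟩,
    ⟨(Algebra.adjoin ℂ (Set.range (pr B i j (B i)⁻¹ (vc₃ B i j b)))).toSubring, {(B i)⁻¹}⟩,
    ⟨(Algebra.adjoin ℂ (Set.range (pr B i j (B i)⁻¹ ((B j - 0) / (B i)⁻¹)))).toSubring,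
      {(B i)⁻¹}⟩,
    ⟨(Algebra.adjoin ℂ (Set.range (pr B j i (B j)⁻¹ ((B i - 0) / (B j)⁻¹)))).toSubring,
      {(B j)⁻¹}⟩]

variable {B i j b a}

lemma gen_pair (hB : Gen B) (hij : i ≠ j) {x y : K} (hx : x = B i ∨ x = (B i)⁻¹)
    (hy : y = B j ∨ y = (B j)⁻¹) : Gen (pr B i j x y) := by
  refine gen_pr hB hij fun L h1 h2 => ⟨?_, ?_⟩
  · rcases hx with rfl | rfl
    exacts [h1, by simpa using L.inv_mem h1]
  · rcases hy with rfl | rfl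
    exacts [h2, by simpa using L.inv_mem h2]

/-- The vector field is regular along the divisor. -/
def Stable (δ : Derivation ℂ K K) (D : Place K) : Prop := ∀ x, D.mem x → D.mem (δ x)

/-- The eight centres form three chains, of lengths four, two and two. Within a chain each new
centre is a section of the exceptional divisor before it, so the generators come from `KrOn.tower`;
different chains lie at opposite values `0` and `∞` of `q` or `p`. The zeros and double signs keep
all centres in the uniform shape `α = 0, β - c = 0`. -/
theorem exists_tower (hB : Gen B) (hij : i ≠ j) (hb : b ∈ Algebra.adjoin ℂ (B '' {i, j}ᶜ))
    {V : Set (LocalSubring K)} (hVb : Reg V b) (hVc : ∀ c, Reg V (const c)) (hq : Crd V (B i))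
    (hp : Crd V (B j)) 
    (h1 : ∀ h, KrOn V (ctr (pr B i j (B i)⁻¹ (B j)⁻¹) i j 0 h) {(B j)⁻¹ - 0, (B i)⁻¹})
    (h5 : ∀ h, KrOn V (ctr (pr B i j (B i)⁻¹ (B j)) i j 0 h) {B j - 0, (B i)⁻¹})
    (h7 : ∀ h, KrOn V (ctr (pr B j i (B j)⁻¹ (B i)) j i 0 h) {B i - 0, (B j)⁻¹}) :
    ∃ g1 g2 g3 g4 g5 g6 g7 g8,
    Tower (IntermediateField.adjoin ℂ {B i, B j, b}) V (pairCenters B i j b a)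
      [dvs (pr B i j (B i)⁻¹ (vc₁ B i j)) i g1, dvs (pr B i j (B i)⁻¹ (vc₂ B i j)) i g2,
        dvs (pr B i j (B i)⁻¹ (vc₃ B i j b)) i g3, dvs (pr B i j (B i)⁻¹ (vc₄ B i j b a)) i g4,
        dvs (pr B i j (B i)⁻¹ ((B j - 0) / (B i)⁻¹)) i g5,
        dvs (pr B i j (B i)⁻¹ (((B j - 0) / (B i)⁻¹ - const (a 1)) / (B i)⁻¹)) i g6,
        dvs (pr B j i (B j)⁻¹ ((B i - 0) / (B j)⁻¹)) j g7,
        dvs (pr B j i (B j)⁻¹ (((B i - 0) / (B j)⁻¹ - -const (a 2)) / (B j)⁻¹)) j g8] := by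
  set L := IntermediateField.adjoin ℂ {B i, B j, b}
  have hji := hij.symm
  have hpair : ({j, i} : Set (Fin 6)) = {i, j} := Set.pair_comm _ _
  have qL : B i ∈ L := IntermediateField.subset_adjoin ℂ _ (by simp)
  have pL : B j ∈ L := IntermediateField.subset_adjoin ℂ _ (by simp)
  have bL : b ∈ L := IntermediateField.subset_adjoin ℂ _ (by simp)
  have cL : ∀ c, const c ∈ L := fun c => L.algebraMap_mem c
  have uL := L.inv_mem qL
  have tL := L.inv_mem pL
  have v1L : vc₁ B i j ∈ L := div_mem (sub_mem tL (zero_mem _)) uL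
  have v2L : vc₂ B i j ∈ L := div_mem (sub_mem v1L (neg_mem (one_mem _))) uL
  have v3L : vc₃ B i j b ∈ L := div_mem (sub_mem v2L (neg_mem bL)) uL
  have v4L : vc₄ B i j b a ∈ L :=
    div_mem (sub_mem v3L (neg_mem (add_mem (pow_mem bL 2) (cL _)))) uL
  have w1L : (B j - 0) / (B i)⁻¹ ∈ L := div_mem (sub_mem pL (zero_mem _)) uL
  have z1L : (B i - 0) / (B j)⁻¹ ∈ L := div_mem (sub_mem qL (zero_mem _)) tL
  have k0 : (0 : K) ∈ Algebra.adjoin ℂ (B '' {i, j}ᶜ) := zero_mem _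
  have k1 : (-1 : K) ∈ Algebra.adjoin ℂ (B '' {i, j}ᶜ) := neg_mem (one_mem _)
  have kb := neg_mem hb
  have kc : ∀ c, const c ∈ Algebra.adjoin ℂ (B '' {i, j}ᶜ) := fun c => Subalgebra.algebraMap_mem _ c
  have ks := neg_mem (add_mem (pow_mem hb 2) (kc (a 0)))
  have g0 : Gen (pr B i j (B i)⁻¹ (B j)⁻¹) := gen_pair hB hij (.inr rfl) (.inr rfl)
  have g1 : Gen (pr B i j (B i)⁻¹ (vc₁ B i j)) := gen_pr_exc hij k0 g0
  have g2 : Gen (pr B i j (B i)⁻¹ (vc₂ B i j)) := gen_pr_exc hij k1 g1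
  have g3 : Gen (pr B i j (B i)⁻¹ (vc₃ B i j b)) := gen_pr_exc hij kb g2
  have g4 : Gen (pr B i j (B i)⁻¹ (vc₄ B i j b a)) := gen_pr_exc hij ks g3
  have g4' : Gen (pr B i j (B i)⁻¹ (B j)) := gen_pair hB hij (.inr rfl) (.inl rfl)
  have g5 := gen_pr_exc hij k0 g4'
  have g6 := gen_pr_exc hij (kc (a 1)) g5
  have g6' : Gen (pr B j i (B j)⁻¹ (B i)) := gen_pair hB hji (.inr rfl) (.inl rfl)
  have g7 := gen_pr_exc hji (by rw [hpair]; exact k0) g6'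
  have g8 := gen_pr_exc hji (by rw [hpair]; exact neg_mem (kc (a 2))) g7
  refine ⟨g1, g2, g3, g4, g5, g6, g7, g8, ?_⟩
  have C1 := center_pr hij k0 g0 g1
  have C2 := center_pr hij k1 g1 g2
  have C3 := center_pr hij kb g2 g3
  have C4 := center_pr hij ks g3 g4
  have C5 := center_pr hij k0 g4' g5
  have C6 := center_pr hij (kc (a 1)) g5 g6
  have C7 := center_pr hji (by rw [hpair]; exact k0) g6' g7
  have C8 := center_pr hji (by rw [hpair]; exact neg_mem (kc (a 2))) g7 g8
  have r1 : Reg V (-1) := fun R _ => neg_mem (one_mem _)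
  have r2 : Reg V (-b) := fun R hR => neg_mem (hVb R hR)
  have r3 : Reg V (-(b ^ 2 + const (a 0))) := fun R hR =>
    neg_mem (add_mem (pow_mem (hVb R hR) 2) (hVc _ R hR))
  have K1 := h1 g0
  have K2 := K1.tower hij k0 k1 r1 g0 g1
  have K3 := K2.tower hij k1 kb (r2.blowUp C1.link) g1 g2
  have K4 := K3.tower hij kb ks ((r3.blowUp C1.link).blowUp C2.link) g2 g3
  have t1 := C1.zero_fst
  have l1 := ctr_pr_le hij k0 g0 g1 (c' := -1)
  have l2 := ctr_pr_le hij k1 g1 g2 (c' := -b)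
  have l3 := ctr_pr_le hij kb g2 g3 (c' := -(b ^ 2 + const (a 0)))
  have l5 := ctr_pr_le hij k0 g4' g5 (c' := const (a 1))
  have hp0 : B j ≠ 0 := gen_ne_zero hB j
  have hq0 : B i ≠ 0 := gen_ne_zero hB i
  simp only [sub_zero] at t1
  have p0 := C5.zero_fst
  simp only [sub_zero] at p0
  have q0 := C7.zero_fst
  simp only [sub_zero] at q0
  have hp1 := hp.blowUp C1.link
  have hp2 := hp1.blowUp C2.link
  have hp3 := hp2.blowUp C3.link
  have hq1 := hq.blowUp C1.link
  have hq2 := hq1.blowUp C2.link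
  have hq3 := hq2.blowUp C3.link
  have hq4 := hq3.blowUp C4.link
  have hq5 := hq4.blowUp C5.link
  -- The fifth centre has `p = 0`, while the first four lie over `p = ∞`.
  have K5 := ((((h5 g4').disjoint C1.link hp t1 p0 hp0).disjoint C2.link hp1 (l1 _ _ t1) p0
    hp0).disjoint C3.link hp2 (l2 _ _ (l1 _ _ t1)) p0 hp0).disjoint C4.link hp3
    (l3 _ _ (l2 _ _ (l1 _ _ t1))) p0 hp0
  have r6 : Reg V (const (a 1)) := hVc _
  have r8 : Reg V (-const (a 2)) := fun R hR => neg_mem (hVc _ R hR)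
  have K6 := K5.tower hij k0 (kc (a 1)) ((((r6.blowUp C1.link).blowUp C2.link).blowUp
    C3.link).blowUp C4.link) g4' g5
  -- The seventh centre has `q = 0`, while the first six lie over `q = ∞`.
  have K7 := ((((((h7 g6').disjoint C1.link hq C1.zero_snd q0 hq0).disjoint C2.link hq1
    C2.zero_snd q0 hq0).disjoint C3.link hq2 C3.zero_snd q0 hq0).disjoint C4.link hq3
    C4.zero_snd q0 hq0).disjoint C5.link hq4 C5.zero_snd q0 hq0).disjoint C6.link hq5
    C6.zero_snd q0 hq0
  have K8 := K7.tower hji (by rw [hpair]; exact k0) (by rw [hpair]; exact neg_mem (kc (a 2)))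
    ((((((r8.blowUp C1.link).blowUp C2.link).blowUp C3.link).blowUp C4.link).blowUp
    C5.link).blowUp C6.link) g6' g7
  exact .cons C1 K1 (div_mem (sub_mem tL (zero_mem _)) uL) <|
    .cons C2 K2 (div_mem (sub_mem v1L (neg_mem (one_mem _))) uL) <|
    .cons C3 K3 (div_mem (sub_mem v2L (neg_mem bL)) uL) <|
    .cons C4 K4 (div_mem (sub_mem v3L (neg_mem (add_mem (pow_mem bL 2) (cL _)))) uL) <|
    .cons C5 K5 (div_mem (sub_mem pL (zero_mem _)) uL) <|
    .cons C6 K6 (div_mem (sub_mem w1L (cL _)) uL) <|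
    .cons C7 K7 (div_mem (sub_mem qL (zero_mem _)) tL) <|
    .cons C8 K8 (div_mem (sub_mem z1L (neg_mem (cL _))) tL) <| .nil _

end

end PainleveFlow

/-!
# The vector field of the fourth Painlevé equation along the exceptional divisors
-/

namespace PainleveFlow

open Place MvPolynomial

lemma deriv_inv (δ : Derivation ℂ K K) (x : K) : δ x⁻¹ = -(x⁻¹) ^ 2 * δ x := by
  rw [Derivation.leibniz_inv, smul_eq_mul]

lemma deriv_const (δ : Derivation ℂ K K) (c : ℂ) : δ (const c) = 0 := δ.map_algebraMap c

lemma deriv_mul (δ : Derivation ℂ K K) (x y : K) : δ (x * y) = δ x * y + x * δ y := by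
  rw [Derivation.leibniz, smul_eq_mul, smul_eq_mul]
  ring

/-- The derivative of the coordinate on an exceptional divisor. -/
lemma deriv_exc (δ : Derivation ℂ K K) {v c u w : K} (hu : u ≠ 0) (hw : w = (v - c) / u) :
    δ w = (δ v - δ c - w * δ u) / u := by
  rw [hw, deriv_div δ _ _ hu, map_sub]
  field_simp

/-- The vector field of the fourth Painlevé equation, or zero. -/
structure IsFlowIV (δ : Derivation ℂ K K) (q p b : K) (a : Fin 3 → ℂ) (ε : K) : Prop where
  dq : δ q = ε * (q * (q + 2 * p - b) + const (a 2))
  dp : δ p = -ε * (p * (2 * q + p - b) - const (a 1))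
  db : δ b = ε * const (a 0 + a 1 + a 2)

section

variable {B : Fin 6 → K} {i j : Fin 6} {b ε : K} {a : Fin 3 → ℂ} {δ : Derivation ℂ K K}

lemma stable_dvs_pr {α β : K} {g : Gen (pr B i j α β)} (hij : i ≠ j)
    (ho : ∀ Γ : Place K, (∀ k, k ≠ i → k ≠ j → Γ.rel (B k) (B k)) →
      ∀ k, k ≠ i → k ≠ j → Γ.mem (δ (B k)))
    (hα : δ α ∈ (dvs (pr B i j α β) i g).integers) (hβ : δ β ∈ (dvs (pr B i j α β) i g).integers) :
    Stable δ (dvs (pr B i j α β) i g) := by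
  refine fun x hx => dvs_stable (fun k => ?_) hx
  by_cases hi : k = i
  · rw [hi, pr_fst hij]
    exact hα
  by_cases hj : k = j
  · rw [hj, pr_snd]
    exact hβ
  rw [pr_of_ne hi hj]
  refine ho _ (fun k hi hj => ?_) k hi hj
  simpa [pr_of_ne hi hj] using dvs_fix (hy := g) hi

lemma dvs_pr_rel {α β : K} {g : Gen (pr B i j α β)} (hij : i ≠ j) :
    (dvs (pr B i j α β) i g).rel α 0 ∧ (dvs (pr B i j α β) i g).rel β β ∧
      ∀ c ∈ Algebra.adjoin ℂ (B '' {i, j}ᶜ), (dvs (pr B i j α β) i g).rel c c := by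
  refine ⟨by simpa [pr_fst hij] using dvs_zero (hy := g) (i := i),
    by simpa [pr_snd] using dvs_fix (hy := g) hij.symm, fun c hc => ?_⟩
  refine fixes_of_adjoin (fun k hi hj => ?_) hc
  simpa [pr_of_ne hi hj] using dvs_fix (hy := g) hi

lemma dvs_pr_div {α β x : K} {g : Gen (pr B i j α β)} (hij : i ≠ j)
    (h : (dvs (pr B i j α β) i g).rel x 0) : x / α ∈ (dvs (pr B i j α β) i g).integers := by
  simpa [pr_fst hij] using dvs_div h

/-- The first exceptional coordinate `w = q p` still contributes the term `-(w - a₁) / u` to its own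
derivative. This is `-v` exactly because the next centre is `w = a₁`, and the result is polynomial
in `u`, `v`, `w`, `b`. -/
lemma flow_six {q p u v w : K} (hf : IsFlowIV δ q p b a ε) (hq : q ≠ 0) (hu : u = q⁻¹)
    (hw : w = (p - 0) / u) (hv : v = (w - const (a 1)) / u) :
    δ u = -ε * (1 + 2 * u ^ 2 * w - b * u + const (a 2) * u ^ 2) ∧
    δ v = ε * (w * (w + const (a 2)) + v * (2 * u * w - b + const (a 2) * u)) := by
  have hu0 : u ≠ 0 := by rw [hu]; exact inv_ne_zero hq
  have hq' : q = u⁻¹ := by rw [hu, inv_inv]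
  have hp' : p = u * w := by rw [hw]; field_simp; ring
  have hw' : w = u * v + const (a 1) := by rw [hv]; field_simp; ring
  have du : δ u = -ε * (1 + 2 * u ^ 2 * w - b * u + const (a 2) * u ^ 2) := by
    rw [hu, deriv_inv, ← hu, hf.dq, hp', hq']
    field_simp
  have dw : δ w = ε * (-v + u * w * (w + const (a 2))) := by
    rw [deriv_exc δ hu0 hw, map_zero, hf.dp, du, hp', hq']
    field_simp
    rw [hw']
    ring
  refine ⟨du, ?_⟩
  rw [deriv_exc δ hu0 hv, deriv_const, dw, du]
  field_simp
  ring

lemma flow_eight {q p u v w : K} (hf : IsFlowIV δ q p b a ε) (hp : p ≠ 0) (hu : u = p⁻¹)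
    (hw : w = (q - 0) / u) (hv : v = (w - -const (a 2)) / u) :
    δ u = ε * (1 + 2 * u ^ 2 * w - b * u - const (a 1) * u ^ 2) ∧
    δ v = ε * (-w * (w - const (a 1)) - v * (2 * u * w - b - const (a 1) * u)) := by
  have hu0 : u ≠ 0 := by rw [hu]; exact inv_ne_zero hp
  have hp' : p = u⁻¹ := by rw [hu, inv_inv]
  have hq' : q = u * w := by rw [hw]; field_simp; ring
  have hw' : w = u * v - const (a 2) := by rw [hv]; field_simp; ring
  have du : δ u = ε * (1 + 2 * u ^ 2 * w - b * u - const (a 1) * u ^ 2) := by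
    rw [hu, deriv_inv, ← hu, hf.dp, hp', hq']
    field_simp
    ring
  have dw : δ w = ε * (v - u * w * (w - const (a 1))) := by
    rw [deriv_exc δ hu0 hw, map_zero, hf.dq, du, hp', hq']
    field_simp
    rw [hw']
    ring
  refine ⟨du, ?_⟩
  rw [deriv_exc δ hu0 hv, map_neg, deriv_const, dw, du]
  field_simp
  ring

/-- Differentiating up the chain `v₁, v₂, v₃, v₄` leaves a single division by `u` in the last
derivative. The term `2 b (a₀ + a₁ + a₂)` in the numerator comes from the motion of `b`; it is what
lets the numerator vanish on `u = 0`. -/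
lemma flow_four {q p u v₁ v₂ v₃ v₄ : K} (hf : IsFlowIV δ q p b a ε) (hq : q ≠ 0) (hp : p ≠ 0)
    (hu : u = q⁻¹) (h1 : v₁ = (p⁻¹ - 0) / u) (h2 : v₂ = (v₁ - -1) / u) (h3 : v₃ = (v₂ - -b) / u)
    (h4 : v₄ = (v₃ - -(b ^ 2 + const (a 0))) / u) :
    δ u = -ε * (1 + 2 * v₁⁻¹ - b * u + const (a 2) * u ^ 2) ∧
    δ v₄ = ε * ((2 * v₂ * v₄ * v₁⁻¹ * u + 2 * v₂ * v₃ * v₁⁻¹ + 2 * b ^ 2 * v₂ * v₁⁻¹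
      - 4 * b * v₃ * v₁⁻¹ + 2 * u * v₃ ^ 2 * v₁⁻¹ - 4 * b * v₃ + 2 * const (a 2) * v₂
      + 2 * const (a 1) * v₂ - const (a 1) * u * v₂ ^ 2 + const (a 2) * u * v₃
      + 2 * b * const (a 0 + a 1 + a 2) - u * v₄ * (b - const (a 2) * u)) / u) := by
  have hu0 : u ≠ 0 := by rw [hu]; exact inv_ne_zero hq
  have hv1 : v₁ ≠ 0 := by rw [h1, sub_zero]; exact div_ne_zero (inv_ne_zero hp) hu0
  have hq' : q = u⁻¹ := by rw [hu, inv_inv]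
  have hp' : p = u⁻¹ * v₁⁻¹ := by rw [h1]; field_simp; ring
  have e1 : v₁ = u * v₂ - 1 := by rw [h2]; field_simp; ring
  have e2 : v₂ = u * v₃ - b := by rw [h3]; field_simp; ring
  have e3 : v₃ = u * v₄ - b ^ 2 - const (a 0) := by rw [h4]; field_simp; ring
  have du : δ u = -ε * (1 + 2 * v₁⁻¹ - b * u + const (a 2) * u ^ 2) := by
    rw [hu, deriv_inv, ← hu, hf.dq, hp', hq']
    field_simp
  have hs : const (a 0 + a 1 + a 2) = const (a 0) + const (a 1) + const (a 2) := by
    simp [const]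
  have d1 : δ v₁ = ε * (3 * v₂ - 2 * b * v₁ + const (a 2) * u * v₁ - const (a 1) * u * v₁ ^ 2) := by
    rw [deriv_exc δ hu0 h1, map_zero, deriv_inv, hf.dp, du, hp', hq']
    field_simp
    rw [e1]
    ring
  have d2 : δ v₂ = ε * (2 * v₃ + 2 * v₂ ^ 2 * v₁⁻¹ - 3 * b * v₂ + const (a 2) * v₁
      - const (a 1) * v₁ ^ 2 + const (a 2) * u * v₂) := by
    rw [deriv_exc δ hu0 h2, map_neg, Derivation.map_one_eq_zero, d1, du]
    field_simp
    rw [e1, e2]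
    ring
  have d3 : δ v₃ = ε * (v₄ + 2 * v₂ * v₁⁻¹ * v₃ + 2 * b ^ 2 * v₂ * v₁⁻¹
      + 2 * (-2 * b * v₃ + u * v₃ ^ 2) * v₁⁻¹ - 3 * b * v₃ + 2 * const (a 2) * v₂
      + const (a 1) * (2 * v₂ - u * v₂ ^ 2) + v₃ * (-b + const (a 2) * u)) := by
    rw [deriv_exc δ hu0 h3, map_neg, hf.db, d2, du, hs]
    field_simp
    rw [e1, e2, e3]
    ring
  refine ⟨du, ?_⟩
  rw [deriv_exc δ hu0 h4, map_neg, map_add, deriv_const, pow_two b, deriv_mul, hf.db, d3, du, hs]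
  field_simp
  rw [e1, e2, e3]
  ring

/-- Elements that are integral or vanish along the divisor `u = 0`. -/
lemma residues_four {D : Place K} {u v₁ v₂ v₃ v₄ c : K} (hu : D.rel u 0) (hv : D.rel v₄ v₄)
    (hb : D.rel b b) (hc : D.rel c c) (e1 : v₁ = u * v₂ - 1) (e2 : v₂ = u * v₃ - b)
    (e3 : v₃ = u * v₄ - b ^ 2 - c) :
    D.rel v₃ (-b ^ 2 - c) ∧ D.rel v₂ (-b) ∧ D.rel v₁⁻¹ (-1) := by
  have r3 : D.rel v₃ (-b ^ 2 - c) := by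
    have := Place.sub (Place.sub (D.mul hu hv) (Place.pow hb 2)) hc
    rw [← e3] at this
    simpa using this
  have r2 : D.rel v₂ (-b) := by
    have := Place.sub (D.mul hu r3) hb
    rw [← e2] at this
    simpa using this
  have r1 : D.rel v₁ (-1) := by
    have := Place.sub (D.mul hu r2) Place.one
    rw [← e1] at this
    simpa using this
  refine ⟨r3, r2, ?_⟩
  have := D.inv r1 (by simp)
  convert this using 1
  norm_num

lemma stable_six (hf : IsFlowIV δ (B i) (B j) b a ε) (hij : i ≠ j)
    (hb : b ∈ Algebra.adjoin ℂ (B '' {i, j}ᶜ)) (hε : ε ∈ Set.range const)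
    (ho : ∀ Γ : Place K, (∀ k, k ≠ i → k ≠ j → Γ.rel (B k) (B k)) →
      ∀ k, k ≠ i → k ≠ j → Γ.mem (δ (B k))) (hB : Gen B)
    (g : Gen (pr B i j (B i)⁻¹ (((B j - 0) / (B i)⁻¹ - const (a 1)) / (B i)⁻¹))) :
    Stable δ (dvs _ i g) := by
  have hq : B i ≠ 0 := gen_ne_zero hB i
  obtain ⟨d1, d2⟩ := flow_six hf hq rfl rfl rfl
  obtain ⟨e, rfl⟩ := hε
  obtain ⟨r1, r2, r3⟩ := dvs_pr_rel (g := g) hij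
  have hu : (B i)⁻¹ ∈ (dvs _ i g).integers := integers_of_rel r1
  have hb' := integers_of_rel (r3 b hb)
  have hv := integers_of_rel r2
  have hc : ∀ c, const c ∈ (dvs _ i g).integers := fun c => Subalgebra.algebraMap_mem _ c
  have hn : (2 : K) ∈ (dvs _ i g).integers := ofNat_mem _ 2
  have hw : (B j - 0) / (B i)⁻¹ ∈ (dvs _ i g).integers := by
    have := add_mem (mul_mem hv hu) (hc (a 1))
    rwa [div_mul_cancel₀ _ (inv_ne_zero hq), sub_add_cancel] at this
  refine stable_dvs_pr hij ho ?_ ?_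
  · rw [d1]
    exact mul_mem (neg_mem (hc e)) (add_mem (sub_mem (add_mem (one_mem _)
      (mul_mem (mul_mem hn (pow_mem hu 2)) hw)) (mul_mem hb' hu)) (mul_mem (hc _) (pow_mem hu 2)))
  · rw [d2]
    exact mul_mem (hc e) (add_mem (mul_mem hw (add_mem hw (hc _))) (mul_mem hv
      (add_mem (sub_mem (mul_mem (mul_mem hn hu) hw) hb') (mul_mem (hc _) hu))))

lemma stable_eight (hf : IsFlowIV δ (B i) (B j) b a ε) (hij : i ≠ j)
    (hb : b ∈ Algebra.adjoin ℂ (B '' {i, j}ᶜ)) (hε : ε ∈ Set.range const)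
    (ho : ∀ Γ : Place K, (∀ k, k ≠ i → k ≠ j → Γ.rel (B k) (B k)) →
      ∀ k, k ≠ i → k ≠ j → Γ.mem (δ (B k))) (hB : Gen B)
    (g : Gen (pr B j i (B j)⁻¹ (((B i - 0) / (B j)⁻¹ - -const (a 2)) / (B j)⁻¹))) :
    Stable δ (dvs _ j g) := by
  have hp : B j ≠ 0 := gen_ne_zero hB j
  obtain ⟨d1, d2⟩ := flow_eight hf hp rfl rfl rfl
  obtain ⟨e, rfl⟩ := hε
  obtain ⟨r1, r2, r3⟩ := dvs_pr_rel (g := g) hij.symm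
  have hu : (B j)⁻¹ ∈ (dvs _ j g).integers := integers_of_rel r1
  have hb' := integers_of_rel (r3 b (by rwa [Set.pair_comm]))
  have hv := integers_of_rel r2
  have hc : ∀ c, const c ∈ (dvs _ j g).integers := fun c => Subalgebra.algebraMap_mem _ c
  have hn : (2 : K) ∈ (dvs _ j g).integers := ofNat_mem _ 2
  have hw : (B i - 0) / (B j)⁻¹ ∈ (dvs _ j g).integers := by
    have h1 : (B i - 0) / (B j)⁻¹ = ((B i - 0) / (B j)⁻¹ - -const (a 2)) / (B j)⁻¹ * (B j)⁻¹
        - const (a 2) := by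
      rw [div_mul_cancel₀ _ (inv_ne_zero hp), sub_neg_eq_add, add_sub_cancel_right]
    exact (congrArg (· ∈ (dvs _ j g).integers) h1).mpr (sub_mem (mul_mem hv hu) (hc (a 2)))
  refine stable_dvs_pr hij.symm (fun Γ h k h1 h2 => ho Γ (fun k h3 h4 => h k h4 h3) k h2 h1) ?_ ?_
  · rw [d1]
    exact mul_mem (hc e) (sub_mem (sub_mem (add_mem (one_mem _)
      (mul_mem (mul_mem hn (pow_mem hu 2)) hw)) (mul_mem hb' hu)) (mul_mem (hc _) (pow_mem hu 2)))
  · rw [d2]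
    exact mul_mem (hc e) (sub_mem (mul_mem (neg_mem hw) (sub_mem hw (hc _))) (mul_mem hv
      (sub_mem (sub_mem (mul_mem (mul_mem hn hu) hw) hb') (mul_mem (hc _) hu))))

lemma stable_four (hf : IsFlowIV δ (B i) (B j) b a ε) (hij : i ≠ j)
    (hb : b ∈ Algebra.adjoin ℂ (B '' {i, j}ᶜ)) (hε : ε ∈ Set.range const)
    (ho : ∀ Γ : Place K, (∀ k, k ≠ i → k ≠ j → Γ.rel (B k) (B k)) →
      ∀ k, k ≠ i → k ≠ j → Γ.mem (δ (B k))) (hB : Gen B)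
    (g : Gen (pr B i j (B i)⁻¹ (vc₄ B i j b a))) : Stable δ (dvs _ i g) := by
  have hq : B i ≠ 0 := gen_ne_zero hB i
  have hp : B j ≠ 0 := gen_ne_zero hB j
  have hu0 := inv_ne_zero hq
  obtain ⟨d1, d2⟩ := flow_four hf hq hp rfl (vc₁.eq_1 B i j) (vc₂.eq_1 B i j) (vc₃.eq_1 B i j b)
    (vc₄.eq_1 B i j b a)
  obtain ⟨e, rfl⟩ := hε
  obtain ⟨r1, r2, r3⟩ := dvs_pr_rel (g := g) hij
  have rc : ∀ c, (dvs _ i g).rel (const c) (const c) := fun c => Place.const _ c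
  have rn : ∀ n : ℕ, (dvs _ i g).rel (n : K) n := fun n => by simpa using Place.const (dvs _ i g) n
  have rn2 : (dvs _ i g).rel (2 : K) 2 := rn 2
  have rn4 : (dvs _ i g).rel (4 : K) 4 := rn 4
  have rb := r3 b hb
  obtain ⟨s3, s2, s1⟩ := residues_four r1 r2 rb (rc (a 0)) (v₁ := vc₁ B i j) (v₂ := vc₂ B i j)
    (v₃ := vc₃ B i j b) (by rw [vc₂]; field_simp; ring) (by rw [vc₃]; field_simp; ring)
    (by rw [vc₄]; field_simp; ring)
  set D := dvs _ i g
  refine stable_dvs_pr hij ho ?_ ?_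
  · rw [d1]
    exact integers_of_rel (D.mul (neg (rc e)) (D.add (Place.sub (D.add Place.one (D.mul rn2 s1))
      (D.mul rb r1)) (D.mul (rc _) (Place.pow r1 2))))
  · rw [d2]
    refine mul_mem (integers_of_rel (rc e)) (dvs_pr_div hij ?_)
    -- The residue of the numerator, assembled term by term. At `v₁⁻¹ = -1`, `v₂ = -b`, `v₃ = -b² -
    -- a₀` it is identically zero, so the division by `u` is harmless.
    have := Place.sub (D.add (D.add (Place.sub (D.add (D.add (Place.sub (D.add (Place.sub (D.add (D.add
      (D.mul (D.mul (D.mul (D.mul rn2 s2) r2) s1) r1) (D.mul (D.mul (D.mul rn2 s2) s3) s1))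
      (D.mul (D.mul (D.mul rn2 (Place.pow rb 2)) s2) s1))
      (D.mul (D.mul (D.mul rn4 rb) s3) s1)) (D.mul (D.mul (D.mul rn2 r1) (Place.pow s3 2)) s1))
      (D.mul (D.mul rn4 rb) s3)) (D.mul (D.mul rn2 (rc (a 2))) s2))
      (D.mul (D.mul rn2 (rc (a 1))) s2)) (D.mul (D.mul (rc (a 1)) r1) (Place.pow s2 2)))
      (D.mul (D.mul (rc (a 2)) r1) s3)) (D.mul (D.mul rn2 rb) (rc (a 0 + a 1 + a 2))))
      (D.mul (D.mul r1 r2) (Place.sub rb (D.mul (rc (a 2)) r1)))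
    convert this using 1
    simp only [const, map_add]
    ring

end

end PainleveFlow

/-!
# Regularity for the first family
-/

namespace PainleveFlow

open Place MvPolynomial

/-! ### Subvarieties of `(ℙ¹)⁴` -/

lemma Crd.inv {V : Set (LocalSubring K)} {x : K} (h : Crd V x) : Crd V x⁻¹ := fun R hR => by
  rw [inv_inv]
  exact (h R hR).symm

lemma crd_q₁ : Crd projLines q₁ := fun _ hR => (projLines_cases hR).1.1
lemma crd_p₁ : Crd projLines p₁ := fun _ hR => (projLines_cases hR).1.2.1
lemma crd_q₂ : Crd projLines q₂ := fun _ hR => (projLines_cases hR).1.2.2.1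
lemma crd_p₂ : Crd projLines p₂ := fun _ hR => (projLines_cases hR).1.2.2.2
lemma reg_b₁ : Reg projLines b₁ := fun _ hR => (projLines_cases hR).2.1
lemma reg_b₂ : Reg projLines b₂ := fun _ hR => (projLines_cases hR).2.2.1
lemma reg_const (c : ℂ) : Reg projLines (const c) := fun _ hR => (projLines_cases hR).2.2.2 c

/-- The coordinate function is fixed, or it or its inverse is among the equations. -/
def Std (Γ : Place K) (G : Set K) (x : K) : Prop := Γ.rel x x ∨ x ∈ G ∨ x⁻¹ ∈ G

lemma Crd.mx {V : Set (LocalSubring K)} {x : K} {Γ : Place K} {R : LocalSubring K} (h : Crd V x)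
    (hR : R ∈ V) (hs : Sub R.toSubring Γ) (h0 : Γ.rel x 0) (hx : x ≠ 0) : x ∈ Mx R := by
  rcases h R hR with h | h
  · exact hs.mx h h0
  · exact (not_mem_inv h0 hx (hs _ h)).elim

/-- In each affine chart every coordinate is either fixed by the place or one of the equations, so
the residue of a generator is itself or `0`. A coordinate whose inverse is among the equations has a
pole and does not occur. -/
lemma retOn_projLines {Γ : Place K} {G : Set K}
    (hG : ∀ g ∈ G, Γ.rel g 0 ∧ g ≠ 0 ∧ Crd projLines g) (h1 : Std Γ G q₁) (h2 : Std Γ G p₁)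
    (h3 : Std Γ G q₂) (h4 : Std Γ G p₂) (h5 : Γ.rel b₁ b₁) (h6 : Γ.rel b₂ b₂) :
    RetOn projLines Γ G := by
  intro R hR Γ' hΓ hs
  have hM : ∀ g ∈ G, g ∈ Mx R := fun g hg =>
    (hG g hg).2.2.mx hR hs (hΓ _ _ (hG g hg).1) (hG g hg).2.1
  have key : ∀ {x : K}, x ≠ 0 → Std Γ G x → Cg Γ R G x ∧ Cg Γ R G x⁻¹ := by
    rintro x hx (h | h | h)
    · exact ⟨Cg.fix h, Cg.fix (Γ.fixed.inv_mem h)⟩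
    · exact ⟨Cg.gen h (hG x h).1, Cg.absurd (inv_ne_zero hx) (by rw [inv_inv]; exact hM x h)⟩
    · exact ⟨Cg.absurd hx (hM _ h), Cg.gen h (hG _ h).1⟩
  exact projLines_ret hR hM (fun g hg => (hG g hg).1) (key q₁_ne h1) (key p₁_ne h2) (key q₂_ne h3)
    (key p₂_ne h4) h5 h6

/-! ### The first family as two towers -/

/-- The affine coordinates. -/
noncomputable def crds : Fin 6 → K := tup q₁ p₁ q₂ p₂

lemma gen_crds : Gen crds := gen_tup fun _ h1 h2 h3 h4 _ _ => ⟨h1, h2, h3, h4⟩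

lemma pr_left (α β : K) : pr crds 0 1 α β = tup α β q₂ p₂ := by
  ext k; fin_cases k <;> simp [pr, crds, tup]

lemma pr_left' (α β : K) : pr crds 1 0 α β = tup β α q₂ p₂ := by
  ext k; fin_cases k <;> simp [pr, crds, tup]

lemma pr_right (α β : K) : pr crds 2 3 α β = tup q₁ p₁ α β := by
  ext k; fin_cases k <;> simp [pr, crds, tup]

lemma pr_right' (α β : K) : pr crds 3 2 α β = tup q₁ p₁ β α := by
  ext k; fin_cases k <;> simp [pr, crds, tup]

lemma centersA2A2_eq (a a' : Fin 3 → ℂ) :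
    centersA2A2 a a' = pairCenters crds 0 1 b₁ a ++ pairCenters crds 2 3 b₂ a' := by
  have e0 : crds 0 = q₁ := rfl
  have e1 : crds 1 = p₁ := rfl
  have e2 : crds 2 = q₂ := rfl
  have e3 : crds 3 = p₂ := rfl
  simp only [centersA2A2, pairCenters, Cp, pr_left, pr_left', pr_right, pr_right', ← chart_eq, vc₁,
    vc₂, vc₃, e0, e1, e2, e3, sub_zero, sub_neg_eq_add, div_inv_eq_mul, List.cons_append,
    List.nil_append, inv_inv, List.cons.injEq, Subvariety.mk.injEq, and_true, true_and]
  constructorm* _ ∧ _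
  all_goals first
    | exact Set.pair_comm _ _
    | (congr 1; ring1)
    | (congr 2; ring1)

lemma boundaryA2A2_eq : pairBoundary crds 0 1 b₁ = (boundaryA2A2.drop 4).take 5 ∧
    pairBoundary crds 2 3 b₂ = boundaryA2A2.drop 9 := by
  have e0 : crds 0 = q₁ := rfl
  have e1 : crds 1 = p₁ := rfl
  have e2 : crds 2 = q₂ := rfl
  have e3 : crds 3 = p₂ := rfl
  simp only [boundaryA2A2, pairBoundary, pr_left, pr_left', pr_right, pr_right', ← chart_eq, vc₁,
    vc₂, vc₃, e0, e1, e2, e3, sub_zero, sub_neg_eq_add, div_inv_eq_mul, List.drop_succ_cons,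
    List.drop_zero, List.take_succ_cons, List.take_zero, inv_inv, List.cons.injEq,
    Subvariety.mk.injEq, and_true, true_and]
  constructorm* _ ∧ _
  all_goals (congr 1; ring1)

lemma boundary_left {D : Subvariety} (h : D ∈ pairBoundary crds 0 1 b₁) : D ∈ boundaryA2A2 := by
  rw [boundaryA2A2_eq.1] at h
  exact List.mem_of_mem_drop (List.mem_of_mem_take h)

lemma boundary_right {D : Subvariety} (h : D ∈ pairBoundary crds 2 3 b₂) : D ∈ boundaryA2A2 := by
  rw [boundaryA2A2_eq.2] at h
  exact List.mem_of_mem_drop h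

/-- The divisor belongs to the boundary, or the vector field is regular along it. -/
def Fine (δ : Derivation ℂ K K) (𝒵 : List Subvariety) (D : Place K) : Prop :=
  (∃ Z ∈ 𝒵, Link Z D) ∨ Stable δ D

/-- A point of the complement lies on no boundary divisor, so among the divisors through it only
those with a regular field count. -/
lemma regular_of_fine {δ : Derivation ℂ K K} {V : Set (LocalSubring K)} {𝒵 : List Subvariety}
    {𝒟 : List (Place K)} (hV : ∀ R ∈ V, Good δ 𝒟 R.toSubring) (hD : ∀ D ∈ 𝒟, Fine δ 𝒵 D) :
    IsRegularOn δ (complement V 𝒵) := by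
  rintro R ⟨hR, hZ⟩
  refine (hV R hR).stable fun D hD' hs => ?_
  rcases hD D hD' with ⟨Z, hZ', hl⟩ | h
  · exact (hZ Z hZ' (hl.contains.2 hs)).elim
  · exact h

lemma fine_infs_A2A2 (δ : Derivation ℂ K K) : ∀ D ∈ infs, Fine δ boundaryA2A2 D := by
  intro D hD
  simp only [infs, List.mem_cons, List.not_mem_nil, or_false] at hD
  rcases hD with rfl | rfl | rfl | rfl
  exacts [.inl ⟨_, by simp [boundaryA2A2], link_inf₄⟩, .inl ⟨_, by simp [boundaryA2A2], link_inf₃⟩,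
    .inl ⟨_, by simp [boundaryA2A2], link_inf₂⟩, .inl ⟨_, by simp [boundaryA2A2], link_inf₁⟩]

section

variable {B : Fin 6 → K} {i j : Fin 6} {b ε : K} {a : Fin 3 → ℂ} {δ : Derivation ℂ K K}
  {V : Set (LocalSubring K)}

/-- The exceptional divisors of a tower belong to the boundary, or the vector field is regular along
them. -/
theorem exists_fine_tower (hB : Gen B) (hij : i ≠ j) (hb : b ∈ Algebra.adjoin ℂ (B '' {i, j}ᶜ))
    (hVb : Reg V b) (hVc : ∀ c, Reg V (const c)) (hq : Crd V (B i)) (hp : Crd V (B j))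
    (h1 : ∀ h, KrOn V (ctr (pr B i j (B i)⁻¹ (B j)⁻¹) i j 0 h) {(B j)⁻¹, (B i)⁻¹})
    (h5 : ∀ h, KrOn V (ctr (pr B i j (B i)⁻¹ (B j)) i j 0 h) {B j, (B i)⁻¹})
    (h7 : ∀ h, KrOn V (ctr (pr B j i (B j)⁻¹ (B i)) j i 0 h) {B i, (B j)⁻¹})
    (hf : IsFlowIV δ (B i) (B j) b a ε) (hε : ε ∈ Set.range const)
    (ho : ∀ Γ : Place K, (∀ k, k ≠ i → k ≠ j → Γ.rel (B k) (B k)) →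
      ∀ k, k ≠ i → k ≠ j → Γ.mem (δ (B k))) :
    ∃ Es, Tower (IntermediateField.adjoin ℂ {B i, B j, b}) V (pairCenters B i j b a) Es ∧
      ∀ D ∈ Es, Fine δ (pairBoundary B i j b) D := by
  obtain ⟨g1, g2, g3, g4, g5, g6, g7, g8, h⟩ := exists_tower (a := a) hB hij hb hVb hVc hq hp
    (by simpa using h1) (by simpa using h5) (by simpa using h7)
  refine ⟨_, h, ?_⟩
  intro D hD
  simp only [List.mem_cons, List.not_mem_nil, or_false] at hD
  rcases hD with rfl | rfl | rfl | rfl | rfl | rfl | rfl | rfl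
  · exact .inl ⟨_, by simp [pairBoundary], dvs_link rfl (pr_fst hij).symm⟩
  · exact .inl ⟨_, by simp [pairBoundary], dvs_link rfl (pr_fst hij).symm⟩
  · exact .inl ⟨_, by simp [pairBoundary], dvs_link rfl (pr_fst hij).symm⟩
  · exact .inr (stable_four hf hij hb hε ho hB g4)
  · exact .inl ⟨_, by simp [pairBoundary], dvs_link rfl (pr_fst hij).symm⟩
  · exact .inr (stable_six hf hij hb hε ho hB g6)
  · exact .inl ⟨_, by simp [pairBoundary], dvs_link rfl (pr_fst hij.symm).symm⟩
  · exact .inr (stable_eight hf hij hb hε ho hB g8)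

end

end PainleveFlow

/-! ### The first family as two transverse towers -/

namespace PainleveFlow

open Place MvPolynomial

lemma retOn_pair_left {x y : K} (hx : x = q₁ ∨ x = q₁⁻¹) (hy : y = p₁ ∨ y = p₁⁻¹)
    (h : Gen (pr crds 0 1 x y)) : RetOn projLines (ctr (pr crds 0 1 x y) 0 1 0 h) {y, x} := by
  have hx0 : x ≠ 0 := gen_ne_zero h 0
  have hy0 : y ≠ 0 := gen_ne_zero h 1
  have r1 : (ctr (pr crds 0 1 x y) 0 1 0 h).rel x 0 := ctr_fst (by decide)
  have r2 : (ctr (pr crds 0 1 x y) 0 1 0 h).rel y 0 := ctr_snd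
  have r3 : ∀ k, k ≠ 0 → k ≠ 1 → (ctr (pr crds 0 1 x y) 0 1 0 h).rel (crds k) (crds k) :=
    fun k h0 h1 => by simpa [pr_of_ne h0 h1] using ctr_fix (hy := h) (c := 0) h0 h1
  refine retOn_projLines ?_ (.inr ?_) (.inr ?_) (.inl (r3 2 (by decide) (by decide)))
    (.inl (r3 3 (by decide) (by decide))) (r3 4 (by decide) (by decide))
    (r3 5 (by decide) (by decide))
  · rintro g (rfl | rfl)
    · refine ⟨r2, hy0, ?_⟩
      rcases hy with rfl | rfl
      exacts [crd_p₁, crd_p₁.inv]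
    · refine ⟨r1, hx0, ?_⟩
      rcases hx with rfl | rfl
      exacts [crd_q₁, crd_q₁.inv]
  · rcases hx with rfl | rfl <;> simp
  · rcases hy with rfl | rfl <;> simp

lemma retOn_pair_right {x y : K} (hx : x = q₂ ∨ x = q₂⁻¹) (hy : y = p₂ ∨ y = p₂⁻¹)
    (h : Gen (pr crds 2 3 x y)) : RetOn projLines (ctr (pr crds 2 3 x y) 2 3 0 h) {y, x} := by
  have hx0 : x ≠ 0 := gen_ne_zero h 2
  have hy0 : y ≠ 0 := gen_ne_zero h 3
  have r1 : (ctr (pr crds 2 3 x y) 2 3 0 h).rel x 0 := ctr_fst (by decide)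
  have r2 : (ctr (pr crds 2 3 x y) 2 3 0 h).rel y 0 := ctr_snd
  have r3 : ∀ k, k ≠ 2 → k ≠ 3 → (ctr (pr crds 2 3 x y) 2 3 0 h).rel (crds k) (crds k) :=
    fun k h0 h1 => by simpa [pr_of_ne h0 h1] using ctr_fix (hy := h) (c := 0) h0 h1
  refine retOn_projLines ?_ (.inl (r3 0 (by decide) (by decide)))
    (.inl (r3 1 (by decide) (by decide))) (.inr ?_) (.inr ?_) (r3 4 (by decide) (by decide))
    (r3 5 (by decide) (by decide))
  · rintro g (rfl | rfl)
    · refine ⟨r2, hy0, ?_⟩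
      rcases hy with rfl | rfl
      exacts [crd_p₂, crd_p₂.inv]
    · refine ⟨r1, hx0, ?_⟩
      rcases hx with rfl | rfl
      exacts [crd_q₂, crd_q₂.inv]
  · rcases hx with rfl | rfl <;> simp
  · rcases hy with rfl | rfl <;> simp

lemma ctr_pr_comm {B : Fin 6 → K} {i j : Fin 6} {α β : K} (hij : i ≠ j) (h : Gen (pr B j i β α))
    (h' : Gen (pr B i j α β)) : ctr (pr B j i β α) j i 0 h = ctr (pr B i j α β) i j 0 h' := by
  unfold ctr
  congr 1
  · exact (pr_comm hij).symm
  · rw [pr_comm hij, Function.update_comm hij]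

lemma stable_adjoin {δ : Derivation ℂ K K} {s : Set K}
    (h : ∀ x ∈ s, δ x ∈ Algebra.adjoin ℂ s) : ∀ x ∈ Algebra.adjoin ℂ s, δ x ∈ Algebra.adjoin ℂ s := by
  intro x hx
  induction hx using Algebra.adjoin_induction with
  | mem x hx => exact h x hx
  | algebraMap r => rw [Derivation.map_algebraMap]; exact zero_mem _
  | add x y _ _ hx hy => rw [map_add]; exact add_mem hx hy
  | mul x y hx' hy' hx hy =>
    rw [deriv_mul]
    exact add_mem (mul_mem hx hy') (mul_mem hx' hy)

lemma IsFlowIV.mem {δ : Derivation ℂ K K} {q p b ε : K} {a : Fin 3 → ℂ} (h : IsFlowIV δ q p b a ε)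
    (hε : ε ∈ Set.range const) {S : Subalgebra ℂ K} (hq : q ∈ S) (hp : p ∈ S) (hb : b ∈ S) :
    δ q ∈ S ∧ δ p ∈ S ∧ δ b ∈ S := by
  obtain ⟨e, rfl⟩ := hε
  have hc : ∀ c, const c ∈ S := fun c => S.algebraMap_mem c
  have h2 : (2 : K) ∈ S := ofNat_mem _ 2
  rw [h.dq, h.dp, h.db]
  exact ⟨mul_mem (hc _) (add_mem (mul_mem hq (sub_mem (add_mem hq (mul_mem h2 hp)) hb)) (hc _)),
    mul_mem (neg_mem (hc _)) (sub_mem (mul_mem hp (sub_mem (add_mem (mul_mem h2 hq) hp) hb)) (hc _)),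
    mul_mem (hc _) (hc _)⟩

/-- The factors `ε` and `ε'` are constants, so both flows are covered at once: one factor is `1` and
the other `0`. The second tower is built over the result of the first, through which its initial
centres pass unchanged. -/
theorem regular_A2A2 {a a' : Fin 3 → ℂ} {δ : Derivation ℂ K K} {ε ε' : K}
    (hf : IsFlowIV δ q₁ p₁ b₁ a ε) (hf' : IsFlowIV δ q₂ p₂ b₂ a' ε') (hε : ε ∈ Set.range const)
    (hε' : ε' ∈ Set.range const) : IsRegularOn δ (openSpaceA2A2 a a') := by
  have hb1 : b₁ ∈ Algebra.adjoin ℂ (crds '' {0, 1}ᶜ) := Algebra.subset_adjoin ⟨4, by decide, rfl⟩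
  have hb2 : b₂ ∈ Algebra.adjoin ℂ (crds '' {2, 3}ᶜ) := Algebra.subset_adjoin ⟨5, by decide, rfl⟩
  have ho1 : ∀ Γ : Place K, (∀ k, k ≠ 0 → k ≠ 1 → Γ.rel (crds k) (crds k)) →
      ∀ k, k ≠ 0 → k ≠ 1 → Γ.mem (δ (crds k)) := by
    intro Γ h
    obtain ⟨m1, m2, m3⟩ := hf'.mem hε' (S := Γ.integers)
      (integers_of_rel (h 2 (by decide) (by decide))) (integers_of_rel (h 3 (by decide) (by decide)))
      (integers_of_rel (h 5 (by decide) (by decide)))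
    have m4 : Γ.mem (δ b₁) := by
      obtain ⟨e, rfl⟩ := hε
      rw [hf.db]
      exact ⟨_, Γ.mul (Γ.const _) (Γ.const _)⟩
    intro k h0 h1
    fin_cases k
    exacts [(h0 rfl).elim, (h1 rfl).elim, m1, m2, m4, m3]
  have ho2 : ∀ Γ : Place K, (∀ k, k ≠ 2 → k ≠ 3 → Γ.rel (crds k) (crds k)) →
      ∀ k, k ≠ 2 → k ≠ 3 → Γ.mem (δ (crds k)) := by
    intro Γ h
    obtain ⟨m1, m2, m3⟩ := hf.mem hε (S := Γ.integers)
      (integers_of_rel (h 0 (by decide) (by decide))) (integers_of_rel (h 1 (by decide) (by decide)))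
      (integers_of_rel (h 4 (by decide) (by decide)))
    have m4 : Γ.mem (δ b₂) := by
      obtain ⟨e, rfl⟩ := hε'
      rw [hf'.db]
      exact ⟨_, Γ.mul (Γ.const _) (Γ.const _)⟩
    intro k h0 h1
    fin_cases k
    exacts [m1, m2, (h0 rfl).elim, (h1 rfl).elim, m3, m4]
  have hδ : ∀ x ∈ chart q₁ p₁ q₂ p₂, δ x ∈ chart q₁ p₁ q₂ p₂ := by
    refine stable_adjoin ?_
    have hm : ∀ x ∈ ({q₁, p₁, q₂, p₂, b₁, b₂} : Set K),
        x ∈ Algebra.adjoin ℂ ({q₁, p₁, q₂, p₂, b₁, b₂} : Set K) :=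
      fun x hx => Algebra.subset_adjoin hx
    obtain ⟨m1, m2, m3⟩ := hf.mem hε (hm q₁ (by simp)) (hm p₁ (by simp)) (hm b₁ (by simp))
    obtain ⟨m4, m5, m6⟩ := hf'.mem hε' (hm q₂ (by simp)) (hm p₂ (by simp)) (hm b₂ (by simp))
    rintro x (rfl | rfl | rfl | rfl | rfl | rfl)
    exacts [m1, m2, m4, m5, m3, m6]
  have hij1 : (0 : Fin 6) ≠ 1 := by decide
  have hij2 : (2 : Fin 6) ≠ 3 := by decide
  obtain ⟨Es, hT, hE⟩ := exists_fine_tower (V := projLines) gen_crds hij1 hb1 reg_b₁ reg_const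
    crd_q₁ crd_p₁ (fun h => (retOn_pair_left (.inr rfl) (.inr rfl) h).krOn)
    (fun h => (retOn_pair_left (.inr rfl) (.inl rfl) h).krOn)
    (fun h => by
      have h' := gen_pair gen_crds hij1 (.inl rfl) (.inr rfl)
      rw [ctr_pr_comm hij1 h h', Set.pair_comm]
      exact (retOn_pair_left (.inl rfl) (.inr rfl) h').krOn) hf hε ho1
  -- The places of the second pair fix `q₁, p₁, b₁`, hence every coordinate introduced by the first
  -- tower.
  have hL : ∀ {α β : K} (h : Gen (pr crds 2 3 α β)),
      IntermediateField.adjoin ℂ {crds 0, crds 1, b₁} ≤ (ctr (pr crds 2 3 α β) 2 3 0 h).fixed := by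
    intro α β h
    rw [IntermediateField.adjoin_le_iff]
    rintro x (rfl | rfl | rfl)
    exacts [ctr_fix (k := 0) (hy := h) (by decide) (by decide), ctr_fix (k := 1) (hy := h) (by decide) (by decide),
      ctr_fix (k := 4) (hy := h) (by decide) (by decide)]
  obtain ⟨Es', hT', hE'⟩ := exists_fine_tower
    (V := iteratedBlowUp projLines (pairCenters crds 0 1 b₁ a)) gen_crds hij2 hb2 (hT.reg reg_b₂)
    (fun c => hT.reg (reg_const c)) (hT.crd crd_q₂) (hT.crd crd_p₂)
    (fun h => (hT.ret (hL h) (retOn_pair_right (.inr rfl) (.inr rfl) h)).krOn)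
    (fun h => (hT.ret (hL h) (retOn_pair_right (.inr rfl) (.inl rfl) h)).krOn)
    (fun h => by
      have h' := gen_pair gen_crds hij2 (.inl rfl) (.inr rfl)
      rw [ctr_pr_comm hij2 h h', Set.pair_comm]
      exact (hT.ret (hL h') (retOn_pair_right (.inl rfl) (.inr rfl) h')).krOn) hf' hε' ho2
  have hG := hT'.good (𝒟 := Es.reverse ++ infs) (by
    intro D hD
    rcases List.mem_append.1 hD with hD | hD
    exacts [hT.arch D (List.mem_reverse.1 hD), infs_arch D hD])
    (hT.good infs_arch (good_projLines hδ))
  unfold openSpaceA2A2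
  refine regular_of_fine (𝒟 := Es'.reverse ++ (Es.reverse ++ infs)) ?_ ?_
  · rw [spaceA2A2, centersA2A2_eq, iteratedBlowUp, List.foldl_append]
    exact hG
  · intro D hD
    simp only [List.mem_append, List.mem_reverse] at hD
    rcases hD with hD | hD | hD
    · exact (hE' D hD).imp_left fun ⟨Z, hZ, h⟩ => ⟨Z, boundary_right hZ, h⟩
    · exact (hE D hD).imp_left fun ⟨Z, hZ, h⟩ => ⟨Z, boundary_left hZ, h⟩
    · exact fine_infs_A2A2 δ D hD

/-! ### The Hamiltonian systems of the first family -/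

/-- The components of a Hamiltonian system. -/
noncomputable def hamField (I β₁ β₂ : Poly) : Var → K
  | .q₁ => algebraMap Poly K (pderiv Var.p₁ I)
  | .p₁ => -algebraMap Poly K (pderiv Var.q₁ I)
  | .q₂ => algebraMap Poly K (pderiv Var.p₂ I)
  | .p₂ => -algebraMap Poly K (pderiv Var.q₂ I)
  | .b₁ => algebraMap Poly K β₁
  | .b₂ => algebraMap Poly K β₂

lemma isRegularSystem_of {I β₁ β₂ : Poly} {V : Set (LocalSubring K)}
    (h : ∀ δ, IsHamiltonianSystem I β₁ β₂ δ → IsRegularOn δ V) : IsRegularSystem I β₁ β₂ V := by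
  obtain ⟨δ, hδ⟩ := exists_derivation (hamField I β₁ β₂)
  have hH : IsHamiltonianSystem I β₁ β₂ δ := ⟨hδ .q₁, hδ .p₁, hδ .q₂, hδ .p₂, hδ .b₁, hδ .b₂⟩
  refine ⟨δ, hH, fun δ' h' => ext_of_coords fun v => ?_, h δ hH⟩
  rw [hδ v]
  cases v
  exacts [h'.dq₁, h'.dp₁, h'.dq₂, h'.dp₂, h'.db₁, h'.db₂]

lemma algebraMap_C (c : ℂ) : algebraMap Poly K (C c) = const c :=
  (IsScalarTower.algebraMap_apply ℂ Poly K c).symm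

lemma const_one : const 1 = 1 := map_one _
lemma const_zero : const 0 = 0 := map_zero _

theorem isRegularSystem_A2A2_left (a a' : Fin 3 → ℂ) :
    IsRegularSystem (hamIV (X .q₁) (X .p₁) (X .b₁) (a 1) (a 2)) (C (a 0 + a 1 + a 2)) 0
      (openSpaceA2A2 a a') := by
  refine isRegularSystem_of fun δ h => ?_
  refine regular_A2A2 (ε := const 1) (ε' := const 0) ⟨?_, ?_, ?_⟩ ⟨?_, ?_, ?_⟩ ⟨1, rfl⟩ ⟨0, rfl⟩
  · rw [h.dq₁]
    simp [hamIV, algebraMap_C, const_one]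
    change q₁ * p₁ + (q₁ + p₁ - b₁) * q₁ = _
    ring
  · rw [h.dp₁]
    simp [hamIV, algebraMap_C, const_one]
    change q₁ * p₁ + (q₁ + p₁ - b₁) * p₁ = _
    ring
  · rw [h.db₁, algebraMap_C, const_one, one_mul]
  · simp [h.dq₂, hamIV, const_zero]
  · simp [h.dp₂, hamIV, const_zero]
  · simp [h.db₂, const_zero]

theorem isRegularSystem_A2A2_right (a a' : Fin 3 → ℂ) :
    IsRegularSystem (hamIV (X .q₂) (X .p₂) (X .b₂) (a' 1) (a' 2)) 0 (C (a' 0 + a' 1 + a' 2))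
      (openSpaceA2A2 a a') := by
  refine isRegularSystem_of fun δ h => ?_
  refine regular_A2A2 (ε := const 0) (ε' := const 1) ⟨?_, ?_, ?_⟩ ⟨?_, ?_, ?_⟩ ⟨0, rfl⟩ ⟨1, rfl⟩
  · simp [h.dq₁, hamIV, const_zero]
  · simp [h.dp₁, hamIV, const_zero]
  · simp [h.db₁, const_zero]
  · rw [h.dq₂]
    simp [hamIV, algebraMap_C, const_one]
    change q₂ * p₂ + (q₂ + p₂ - b₂) * q₂ = _
    ring
  · rw [h.dp₂]
    simp [hamIV, algebraMap_C, const_one]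
    change q₂ * p₂ + (q₂ + p₂ - b₂) * p₂ = _
    ring
  · rw [h.db₂, algebraMap_C, const_one, one_mul]

end PainleveFlow

/-!
# Eight blow-ups of the second family
-/

namespace PainleveFlow

open Place MvPolynomial

/-! ### Units of places -/

section

variable {Γ Γ' : Place K} {x y c d : K}

/-- The element has a nonzero residue. -/
def Place.unit (Γ : Place K) (x : K) : Prop := ∃ c, Γ.rel x c ∧ c ≠ 0

lemma Place.unit.ne_zero (h : Γ.unit x) : x ≠ 0 := by
  obtain ⟨c, h1, h2⟩ := h
  exact Place.ne_zero h1 h2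

lemma Place.unit.mem (h : Γ.unit x) : x ∈ Γ.integers := by
  obtain ⟨c, h1, -⟩ := h
  exact ⟨c, h1⟩

lemma Place.unit.up (h : Γ.unit x) (hΓ : Γ ≤ Γ') : Γ'.unit x := by
  obtain ⟨c, h1, h2⟩ := h
  exact ⟨c, hΓ _ _ h1, h2⟩

lemma Place.unit.mul (h : Γ.unit x) (h' : Γ.unit y) : Γ.unit (x * y) := by
  obtain ⟨c, h1, h2⟩ := h
  obtain ⟨d, h3, h4⟩ := h'
  exact ⟨_, Γ.mul h1 h3, mul_ne_zero h2 h4⟩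

lemma Place.unit.inv (h : Γ.unit x) : Γ.unit x⁻¹ := by
  obtain ⟨c, h1, h2⟩ := h
  exact ⟨_, Γ.inv h1 h2, inv_ne_zero h2⟩

lemma Place.unit.div (h : Γ.unit x) (h' : Γ.unit y) : Γ.unit (x / y) := by
  rw [div_eq_mul_inv]
  exact h.mul h'.inv

lemma Place.unit.pow (h : Γ.unit x) (n : ℕ) : Γ.unit (x ^ n) := by
  obtain ⟨c, h1, h2⟩ := h
  exact ⟨_, Place.pow h1 n, pow_ne_zero n h2⟩

lemma Place.unit_one : Γ.unit 1 := ⟨1, Place.one, one_ne_zero⟩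

lemma Place.unit.neg (h : Γ.unit x) : Γ.unit (-x) := by
  obtain ⟨c, h1, h2⟩ := h
  exact ⟨_, Place.neg h1, neg_ne_zero.2 h2⟩

lemma Place.unit_of_fix (h : Γ.rel x x) (h0 : x ≠ 0) : Γ.unit x := ⟨x, h, h0⟩

lemma Place.rel_mul_mem (h : Γ.rel x 0) (h' : y ∈ Γ.integers) : Γ.rel (x * y) 0 := by
  obtain ⟨c, hc⟩ := h'
  simpa using Γ.mul h hc

lemma Place.rel_mem_mul (h : Γ.rel x 0) (h' : y ∈ Γ.integers) : Γ.rel (y * x) 0 := by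
  rw [mul_comm]
  exact rel_mul_mem h h'

lemma Place.rel_zero_add (h : Γ.rel x 0) (h' : Γ.rel y 0) : Γ.rel (x + y) 0 := by
  simpa using Γ.add h h'

lemma Place.unit_add (h : Γ.unit x) (h' : Γ.rel y 0) : Γ.unit (x + y) := by
  obtain ⟨c, h1, h2⟩ := h
  exact ⟨c, by simpa using Γ.add h1 h', h2⟩

lemma Place.unit_sub (h : Γ.unit x) (h' : Γ.rel y 0) : Γ.unit (x - y) := by
  obtain ⟨c, h1, h2⟩ := h
  exact ⟨c, by simpa using Place.sub h1 h', h2⟩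

end

/-! ### Blow-ups at a point -/

section

variable {Γ Γ' Γ'' : Place K} {R S : LocalSubring K} {f g w : K} {G G' : Set K}

lemma Over.loc_of (h : Over Γ R S) (hk : Kr Γ R {f, g}) (hf : f ≠ 0) (hg : g ≠ 0)
    (hs : Sub S.toSubring Γ'') (hw : w ∈ R.toSubring) (hr : Γ''.rel (f / g - w) 0) :
    Loc (adj R.toSubring (f / g)) S.toSubring :=
  loc_choice hf hg h.le (h.loc f g hf hg hk) (h.le hw) hr hs

lemma Over.mem_of (h : Over Γ R S) (hk : Kr Γ R {f, g}) (hf : f ≠ 0) (hg : g ≠ 0)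
    (hs : Sub S.toSubring Γ'') (hw : w ∈ R.toSubring) (hr : Γ''.rel (f / g - w) 0) :
    f / g ∈ S.toSubring := (h.loc_of hk hf hg hs hw hr).1 (self_mem_adj _ _)

/-- The ideal of a place after a blow-up, for a place that meets the exceptional divisor in a
section. -/
lemma Over.kr {Γ₀ : Place K} (h : Over Γ R S) (hk : Kr Γ R {f, g}) (hf : f ≠ 0) (hg : g ≠ 0)
    (ha : Kr Γ₀ R G) (hΓ : Γ₀ ≤ Γ') (hs : Sub S.toSubring Γ'') (hw : w ∈ R.toSubring)
    (hr : Γ'.rel (f / g - w) 0) (hr' : Γ''.rel (f / g - w) 0)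
    (hG' : ∀ g ∈ G', g ∈ S.toSubring ∧ Γ'.rel g 0 ∧ Γ''.rel g 0)
    (hGG : ∀ g ∈ G, g ∈ Spn S.toSubring G') (ht : f / g - w ∈ Spn S.toSubring G') :
    Kr Γ' S G' :=
  ha.step (h.loc_of hk hf hg hs hw hr') hΓ hw hr (fun g hg => hs.mx (hG' g hg).1 (hG' g hg).2.2)
    (fun g hg => (hG' g hg).2.1) hGG ht

/-- The ideal of a transverse place after a blow-up. -/
lemma Over.ret (h : Over Γ R S) (hk : Kr Γ R {f, g}) (hf : f ≠ 0) (hg : g ≠ 0)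
    (ha : Ret Γ' R G) (hs : Sub S.toSubring Γ'') (h0 : ∀ g ∈ G, Γ''.rel g 0)
    (hfix : Γ'.rel (f / g) (f / g)) : Ret Γ' S G := by
  have hG : ∀ g ∈ G, g ∈ Mx S := fun g hg => hs.mx (h.le (ha.ring g hg)) (h0 g hg)
  rcases h.loc f g hf hg hk with h4 | h4
  · exact ha.step h4 hG ha.zero (fun g hg => Spn.gen hg)
      ⟨_, h4.1 (self_mem_adj _ _), hfix, by simp⟩
  · have hfix' : Γ'.rel (g / f) (g / f) := by
      rw [← inv_div]
      exact Γ'.fixed.inv_mem hfix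
    exact ha.step h4 hG ha.zero (fun g hg => Spn.gen hg)
      ⟨_, h4.1 (self_mem_adj _ _), hfix', by simp⟩

/-- The centre followed by a blow-up of a section over it. -/
lemma Over.chain (h : Over Γ R S) (hk : Kr Γ R {f, g}) (hf : f ≠ 0) (hg : g ≠ 0) (hΓ : Γ ≤ Γ')
    (hs : Sub S.toSubring Γ'') (hw : w ∈ R.toSubring) (hr : Γ'.rel (f / g - w) 0)
    (hr' : Γ''.rel (f / g - w) 0) (hg' : Γ''.rel g 0) : Kr Γ' S {f / g - w, g} := by
  have hgS : g ∈ S.toSubring := h.le (hk.ring g (by simp))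
  have hT := h.mem_of hk hf hg hs hw hr'
  refine h.kr hk hf hg hk hΓ hs hw hr hr' ?_ ?_ (Spn.gen (by simp))
  · rintro x (rfl | rfl)
    exacts [⟨sub_mem hT (h.le hw), hr, hr'⟩, ⟨hgS, hΓ _ _ (hk.zero _ (by simp)), hg'⟩]
  · rintro x (hx | hx)
    · have h1 : x = g * (f / g - w) + w * g := by rw [hx]; field_simp; ring
      rw [h1]
      exact add_mem (Spn.mul hgS (Spn.gen (by simp))) (Spn.mul (h.le hw) (Spn.gen (by simp)))
    · exact Spn.gen (by simp [Set.mem_singleton_iff.1 hx])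

end

/-- It suffices to know generators whose quotient is an affine function of the standard coordinate on
the exceptional divisor. -/
theorem Center.good_of {V : Set (LocalSubring K)} {C : Subvariety} {Γ E : Place K} {f₀ g₀ : K}
    {δ : Derivation ℂ K K} {𝒟 : List (Place K)} (hc : Center C Γ E f₀ g₀)
    (h : ∀ R ∈ V, Sub R.toSubring Γ → ∃ f g c d, f ≠ 0 ∧ g ≠ 0 ∧ Kr Γ R {f, g} ∧ Γ.unit c ∧
      d ∈ Γ.integers ∧ f / g = c * (f₀ / g₀) + d)
    (hD : ∀ D ∈ 𝒟, D.Arch) (hV : ∀ R ∈ V, Good δ 𝒟 R.toSubring) :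
    ∀ S ∈ blowUp V C, Good δ (E :: 𝒟) S.toSubring := by
  refine good_blowUp hc.link hc.le hD hV fun R hR hs => ?_
  obtain ⟨f, g, c, d, hf, hg, hk, ⟨c', hc1, hc0⟩, ⟨d', hd⟩, he⟩ := h R hR hs
  refine ⟨f, g, c' * (f₀ / g₀) + d', hf, hg, hk, ?_,
    Transcendental.affine hc.trans (mem_residues hc1) (mem_residues hd) hc0⟩
  rw [he]
  exact E.add (E.mul (hc.le _ _ hc1) hc.fix) (hc.le _ _ hd)

/-! ### The centres and the exceptional divisors -/

/-- A coordinate system of the affine space with the constants of eight blow-ups; the centres of the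
blow-ups lie over `Q = P = ∞`, `Q⁻¹ = p = 0` and `P⁻¹ = q = 0`. -/
structure Half where
  (Q P q p b : K)
  (a₀ α β : ℂ)
  gen : Gen (tup Q P q p)
  hb : b = b₁ ∨ b = b₂

namespace Half

variable (H : Half)

/-- The function `Q⁻¹`. -/
noncomputable def u : K := H.Q⁻¹
/-- The function `P⁻¹`. -/
noncomputable def t : K := H.P⁻¹
/-- The coordinate on the first exceptional divisor. -/
noncomputable def v₁ : K := (H.t - 0) / H.u
/-- The coordinate on the second exceptional divisor. -/
noncomputable def v₂ : K := (H.v₁ - -1) / H.u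
/-- The equation of the third centre. -/
noncomputable def s : K := H.p - (H.b - H.q)
/-- The coordinate on the third exceptional divisor. -/
noncomputable def v₃ : K := (H.p - (H.b - H.q)) / H.u
/-- The coordinate on the fourth exceptional divisor. -/
noncomputable def v₄ : K := (H.v₃ - -const H.a₀) / H.u
/-- The coordinate on the fifth exceptional divisor. -/
noncomputable def w₁ : K := (H.p - 0) / H.u
/-- The coordinate on the sixth exceptional divisor. -/
noncomputable def w₂ : K := (H.w₁ - const H.α) / H.u
/-- The coordinate on the seventh exceptional divisor. -/
noncomputable def z₁ : K := (H.q - 0) / H.t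
/-- The coordinate on the eighth exceptional divisor. -/
noncomputable def z₂ : K := (H.z₁ - const H.β) / H.t

lemma Q_ne : H.Q ≠ 0 := gen_ne_zero H.gen 0
lemma P_ne : H.P ≠ 0 := gen_ne_zero H.gen 1
lemma q_ne : H.q ≠ 0 := gen_ne_zero H.gen 2
lemma p_ne : H.p ≠ 0 := gen_ne_zero H.gen 3
lemma u_ne : H.u ≠ 0 := inv_ne_zero H.Q_ne
lemma t_ne : H.t ≠ 0 := inv_ne_zero H.P_ne

end Half

lemma gen_of_gen {y₁ y₂ y₃ y₄ x₁ x₂ x₃ x₄ : K} (h : Gen (tup x₁ x₂ x₃ x₄))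
    (hL : ∀ L : IntermediateField ℂ K, y₁ ∈ L → y₂ ∈ L → y₃ ∈ L → y₄ ∈ L → b₁ ∈ L → b₂ ∈ L →
      x₁ ∈ L ∧ x₂ ∈ L ∧ x₃ ∈ L ∧ x₄ ∈ L) : Gen (tup y₁ y₂ y₃ y₄) := by
  unfold Gen at h ⊢
  rw [eq_top_iff, ← h, IntermediateField.adjoin_le_iff]
  set L := IntermediateField.adjoin ℂ (Set.range (tup y₁ y₂ y₃ y₄))
  have hk : ∀ k, tup y₁ y₂ y₃ y₄ k ∈ L := fun k => IntermediateField.subset_adjoin ℂ _ ⟨k, rfl⟩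
  obtain ⟨h1, h2, h3, h4⟩ := hL L (hk 0) (hk 1) (hk 2) (hk 3) (hk 4) (hk 5)
  rintro _ ⟨k, rfl⟩
  fin_cases k
  exacts [h1, h2, h3, h4, hk 4, hk 5]

namespace Half

variable (H : Half)

lemma b_mem {L : Type*} [SetLike L K] {l : L} (h1 : b₁ ∈ l) (h2 : b₂ ∈ l) : H.b ∈ l := by
  rcases H.hb with h | h <;> rw [h] <;> assumption

lemma gen₀ : Gen (tup H.u H.t H.q H.p) := gen_of_gen H.gen fun L h1 h2 h3 h4 _ _ =>
  ⟨by simpa [u] using L.inv_mem h1, by simpa [t] using L.inv_mem h2, h3, h4⟩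

lemma mem_of_exc {L : IntermediateField ℂ K} {x y c u : K} (hu : u ≠ 0) (hy : y = (x - c) / u)
    (h1 : u ∈ L) (h2 : y ∈ L) (h3 : c ∈ L) : x ∈ L := by
  have : x = y * u + c := by rw [hy]; field_simp; ring
  rw [this]
  exact add_mem (mul_mem h2 h1) h3

lemma gen₁ : Gen (tup H.u H.v₁ H.q H.p) := gen_of_gen H.gen₀ fun _ h1 h2 h3 h4 _ _ =>
  ⟨h1, mem_of_exc H.u_ne rfl h1 h2 (zero_mem _), h3, h4⟩

lemma gen₂ : Gen (tup H.u H.v₂ H.q H.p) := gen_of_gen H.gen₁ fun _ h1 h2 h3 h4 _ _ =>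
  ⟨h1, mem_of_exc H.u_ne rfl h1 h2 (neg_mem (one_mem _)), h3, h4⟩

lemma gen₃ : Gen (tup H.u H.v₂ H.q H.v₃) := gen_of_gen H.gen₂ fun _ h1 h2 h3 h4 h5 h6 =>
  ⟨h1, h2, h3, mem_of_exc H.u_ne rfl h1 h4 (sub_mem (H.b_mem h5 h6) h3)⟩

lemma gen₄ : Gen (tup H.u H.v₂ H.q H.v₄) := gen_of_gen H.gen₃ fun L h1 h2 h3 h4 _ _ =>
  ⟨h1, h2, h3, mem_of_exc H.u_ne rfl h1 h4 (neg_mem (L.algebraMap_mem _))⟩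

lemma gen₅ : Gen (tup H.u H.P H.q H.p) := gen_of_gen H.gen fun L h1 h2 h3 h4 _ _ =>
  ⟨by simpa [u] using L.inv_mem h1, h2, h3, h4⟩

lemma gen₆ : Gen (tup H.u H.P H.q H.w₁) := gen_of_gen H.gen₅ fun _ h1 h2 h3 h4 _ _ =>
  ⟨h1, h2, h3, mem_of_exc H.u_ne rfl h1 h4 (zero_mem _)⟩

lemma gen_w₂ : Gen (tup H.u H.P H.q H.w₂) := gen_of_gen H.gen₆ fun L h1 h2 h3 h4 _ _ =>
  ⟨h1, h2, h3, mem_of_exc H.u_ne rfl h1 h4 (L.algebraMap_mem _)⟩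

lemma gen₇ : Gen (tup H.Q H.t H.q H.p) := gen_of_gen H.gen fun L h1 h2 h3 h4 _ _ =>
  ⟨h1, by simpa [t] using L.inv_mem h2, h3, h4⟩

lemma gen₈ : Gen (tup H.Q H.t H.z₁ H.p) := gen_of_gen H.gen₇ fun _ h1 h2 h3 h4 _ _ =>
  ⟨h1, h2, mem_of_exc H.t_ne rfl h2 h3 (zero_mem _), h4⟩

lemma gen_z₂ : Gen (tup H.Q H.t H.z₂ H.p) := gen_of_gen H.gen₈ fun L h1 h2 h3 h4 _ _ =>
  ⟨h1, h2, mem_of_exc H.t_ne rfl h2 h3 (L.algebraMap_mem _), h4⟩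

/-- The place of a centre. -/
noncomputable def Γ₁ : Place K := ctr (tup H.u H.t H.q H.p) 0 1 0 H.gen₀
/-- The place of a centre. -/
noncomputable def Γ₂ : Place K := ctr (tup H.u H.v₁ H.q H.p) 0 1 (-1) H.gen₁
/-- The place of a centre. -/
noncomputable def Γ₃ : Place K := ctr (tup H.u H.v₂ H.q H.p) 0 3 (H.b - H.q) H.gen₂
/-- The place of a centre. -/
noncomputable def Γ₄ : Place K := ctr (tup H.u H.v₂ H.q H.v₃) 0 3 (-const H.a₀) H.gen₃
/-- The place of a centre. -/
noncomputable def Γ₅ : Place K := ctr (tup H.u H.P H.q H.p) 0 3 0 H.gen₅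
/-- The place of a centre. -/
noncomputable def Γ₆ : Place K := ctr (tup H.u H.P H.q H.w₁) 0 3 (const H.α) H.gen₆
/-- The place of a centre. -/
noncomputable def Γ₇ : Place K := ctr (tup H.Q H.t H.q H.p) 1 2 0 H.gen₇
/-- The place of a centre. -/
noncomputable def Γ₈ : Place K := ctr (tup H.Q H.t H.z₁ H.p) 1 2 (const H.β) H.gen₈

/-- The place of an exceptional divisor. -/
noncomputable def E₁ : Place K := dvs (tup H.u H.v₁ H.q H.p) 0 H.gen₁
/-- The place of an exceptional divisor. -/
noncomputable def E₂ : Place K := dvs (tup H.u H.v₂ H.q H.p) 0 H.gen₂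
/-- The place of an exceptional divisor. -/
noncomputable def E₃ : Place K := dvs (tup H.u H.v₂ H.q H.v₃) 0 H.gen₃
/-- The place of an exceptional divisor. -/
noncomputable def E₄ : Place K := dvs (tup H.u H.v₂ H.q H.v₄) 0 H.gen₄
/-- The place of an exceptional divisor. -/
noncomputable def E₅ : Place K := dvs (tup H.u H.P H.q H.w₁) 0 H.gen₆
/-- The place of an exceptional divisor. -/
noncomputable def E₆ : Place K := dvs (tup H.u H.P H.q H.w₂) 0 H.gen_w₂
/-- The place of an exceptional divisor. -/
noncomputable def E₇ : Place K := dvs (tup H.Q H.t H.z₁ H.p) 1 H.gen₈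
/-- The place of an exceptional divisor. -/
noncomputable def E₈ : Place K := dvs (tup H.Q H.t H.z₂ H.p) 1 H.gen_z₂

/-- The subvariety of a chart with given equations. -/
noncomputable def _root_.PainleveFlow.sv (y : Fin 6 → K) (eqns : Set K) : Subvariety :=
  ⟨(Algebra.adjoin ℂ (Set.range y)).toSubring, eqns⟩

/-- A centre. -/
noncomputable def C₁ : Subvariety := sv (tup H.u H.t H.q H.p) {H.u, H.t - 0}
/-- A centre. -/
noncomputable def C₂ : Subvariety := sv (tup H.u H.v₁ H.q H.p) {H.u, H.v₁ - -1}
/-- A centre. -/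
noncomputable def C₃ : Subvariety := sv (tup H.u H.v₂ H.q H.p) {H.u, H.p - (H.b - H.q)}
/-- A centre. -/
noncomputable def C₄ : Subvariety := sv (tup H.u H.v₂ H.q H.v₃) {H.u, H.v₃ - -const H.a₀}
/-- A centre. -/
noncomputable def C₅ : Subvariety := sv (tup H.u H.P H.q H.p) {H.u, H.p - 0}
/-- A centre. -/
noncomputable def C₆ : Subvariety := sv (tup H.u H.P H.q H.w₁) {H.u, H.w₁ - const H.α}
/-- A centre. -/
noncomputable def C₇ : Subvariety := sv (tup H.Q H.t H.q H.p) {H.t, H.q - 0}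
/-- A centre. -/
noncomputable def C₈ : Subvariety := sv (tup H.Q H.t H.z₁ H.p) {H.t, H.z₁ - const H.β}

end Half

lemma tup_ne₁ {a x x' c d : K} : ∀ k, k ≠ 1 → tup a x' c d k = tup a x c d k := fun k hk => by
  fin_cases k <;> first | rfl | exact (hk rfl).elim

lemma tup_ne₂ {a b x x' d : K} : ∀ k, k ≠ 2 → tup a b x' d k = tup a b x d k := fun k hk => by
  fin_cases k <;> first | rfl | exact (hk rfl).elim

lemma tup_ne₃ {a b c x x' : K} : ∀ k, k ≠ 3 → tup a b c x' k = tup a b c x k := fun k hk => by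
  fin_cases k <;> first | rfl | exact (hk rfl).elim

namespace Half

variable (H : Half)

lemma center₁ : Center H.C₁ H.Γ₁ H.E₁ (H.t - 0) H.u :=
  center_mk (by decide) rfl rfl (zero_mem _) tup_ne₁ rfl

lemma center₂ : Center H.C₂ H.Γ₂ H.E₂ (H.v₁ - -1) H.u :=
  center_mk (by decide) rfl rfl (neg_mem (one_mem _)) tup_ne₁ rfl

lemma center₃ : Center H.C₃ H.Γ₃ H.E₃ (H.p - (H.b - H.q)) H.u :=
  center_mk (by decide) rfl rfl (sub_mem (H.b_mem (Algebra.subset_adjoin ⟨4, by decide, rfl⟩)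
    (Algebra.subset_adjoin ⟨5, by decide, rfl⟩)) (Algebra.subset_adjoin ⟨2, by decide, rfl⟩))
    tup_ne₃ rfl

lemma center₄ : Center H.C₄ H.Γ₄ H.E₄ (H.v₃ - -const H.a₀) H.u :=
  center_mk (by decide) rfl rfl (neg_mem (Subalgebra.algebraMap_mem _ _)) tup_ne₃ rfl

lemma center₅ : Center H.C₅ H.Γ₅ H.E₅ (H.p - 0) H.u :=
  center_mk (by decide) rfl rfl (zero_mem _) tup_ne₃ rfl

lemma center₆ : Center H.C₆ H.Γ₆ H.E₆ (H.w₁ - const H.α) H.u :=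
  center_mk (by decide) rfl rfl (Subalgebra.algebraMap_mem _ _) tup_ne₃ rfl

lemma center₇ : Center H.C₇ H.Γ₇ H.E₇ (H.q - 0) H.t :=
  center_mk (by decide) rfl rfl (zero_mem _) tup_ne₂ rfl

lemma center₈ : Center H.C₈ H.Γ₈ H.E₈ (H.z₁ - const H.β) H.t :=
  center_mk (by decide) rfl rfl (Subalgebra.algebraMap_mem _ _) tup_ne₂ rfl

/-- The place of the intersection of the first centre with the closure of `q + p = b`. -/
noncomputable def W : Place K :=
  placeOf (tup H.u H.t H.q H.p) (tup 0 0 H.q (H.b - H.q)) H.gen₀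
/-- The place of the intersection of the second centre with the closure of `q + p = b`. -/
noncomputable def W' : Place K :=
  placeOf (tup H.u H.v₁ H.q H.p) (tup 0 (-1) H.q (H.b - H.q)) H.gen₁

variable {H} {Γ : Place K}

lemma rel_W (h : H.W ≤ Γ) : Γ.rel H.u 0 ∧ Γ.rel H.t 0 ∧ Γ.rel H.q H.q ∧ Γ.rel H.p (H.b - H.q) ∧
    Γ.rel b₁ b₁ ∧ Γ.rel b₂ b₂ :=
  ⟨h _ _ (placeOf_rel 0), h _ _ (placeOf_rel 1), h _ _ (placeOf_rel 2), h _ _ (placeOf_rel 3),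
    h _ _ (placeOf_rel 4), h _ _ (placeOf_rel 5)⟩

lemma rel_W' (h : H.W' ≤ Γ) : Γ.rel H.u 0 ∧ Γ.rel H.v₁ (-1) ∧ Γ.rel H.q H.q ∧
    Γ.rel H.p (H.b - H.q) ∧ Γ.rel b₁ b₁ ∧ Γ.rel b₂ b₂ :=
  ⟨h _ _ (placeOf_rel 0), h _ _ (placeOf_rel 1), h _ _ (placeOf_rel 2), h _ _ (placeOf_rel 3),
    h _ _ (placeOf_rel 4), h _ _ (placeOf_rel 5)⟩

lemma rel₁ (h : H.Γ₁ ≤ Γ) : Γ.rel H.u 0 ∧ Γ.rel H.t 0 ∧ Γ.rel H.q H.q ∧ Γ.rel H.p H.p ∧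
    Γ.rel b₁ b₁ ∧ Γ.rel b₂ b₂ :=
  ⟨h _ _ (ctr_fst (by decide)), h _ _ ctr_snd, h _ _ (ctr_fix (k := 2) (by decide) (by decide)),
    h _ _ (ctr_fix (k := 3) (by decide) (by decide)),
    h _ _ (ctr_fix (k := 4) (by decide) (by decide)),
    h _ _ (ctr_fix (k := 5) (by decide) (by decide))⟩

lemma rel₂ (h : H.Γ₂ ≤ Γ) : Γ.rel H.u 0 ∧ Γ.rel H.v₁ (-1) ∧ Γ.rel H.q H.q ∧ Γ.rel H.p H.p ∧
    Γ.rel b₁ b₁ ∧ Γ.rel b₂ b₂ :=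
  ⟨h _ _ (ctr_fst (by decide)), h _ _ ctr_snd, h _ _ (ctr_fix (k := 2) (by decide) (by decide)),
    h _ _ (ctr_fix (k := 3) (by decide) (by decide)),
    h _ _ (ctr_fix (k := 4) (by decide) (by decide)),
    h _ _ (ctr_fix (k := 5) (by decide) (by decide))⟩

lemma rel₃ (h : H.Γ₃ ≤ Γ) : Γ.rel H.u 0 ∧ Γ.rel H.v₂ H.v₂ ∧ Γ.rel H.q H.q ∧
    Γ.rel H.p (H.b - H.q) ∧ Γ.rel b₁ b₁ ∧ Γ.rel b₂ b₂ :=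
  ⟨h _ _ (ctr_fst (by decide)), h _ _ (ctr_fix (k := 1) (by decide) (by decide)),
    h _ _ (ctr_fix (k := 2) (by decide) (by decide)), h _ _ ctr_snd,
    h _ _ (ctr_fix (k := 4) (by decide) (by decide)),
    h _ _ (ctr_fix (k := 5) (by decide) (by decide))⟩

lemma rel₄ (h : H.Γ₄ ≤ Γ) : Γ.rel H.u 0 ∧ Γ.rel H.v₂ H.v₂ ∧ Γ.rel H.q H.q ∧
    Γ.rel H.v₃ (-const H.a₀) ∧ Γ.rel b₁ b₁ ∧ Γ.rel b₂ b₂ :=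
  ⟨h _ _ (ctr_fst (by decide)), h _ _ (ctr_fix (k := 1) (by decide) (by decide)),
    h _ _ (ctr_fix (k := 2) (by decide) (by decide)), h _ _ ctr_snd,
    h _ _ (ctr_fix (k := 4) (by decide) (by decide)),
    h _ _ (ctr_fix (k := 5) (by decide) (by decide))⟩

lemma rel₅ (h : H.Γ₅ ≤ Γ) : Γ.rel H.u 0 ∧ Γ.rel H.P H.P ∧ Γ.rel H.q H.q ∧ Γ.rel H.p 0 ∧
    Γ.rel b₁ b₁ ∧ Γ.rel b₂ b₂ :=
  ⟨h _ _ (ctr_fst (by decide)), h _ _ (ctr_fix (k := 1) (by decide) (by decide)),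
    h _ _ (ctr_fix (k := 2) (by decide) (by decide)), h _ _ ctr_snd,
    h _ _ (ctr_fix (k := 4) (by decide) (by decide)),
    h _ _ (ctr_fix (k := 5) (by decide) (by decide))⟩

lemma rel₆ (h : H.Γ₆ ≤ Γ) : Γ.rel H.u 0 ∧ Γ.rel H.P H.P ∧ Γ.rel H.q H.q ∧
    Γ.rel H.w₁ (const H.α) ∧ Γ.rel b₁ b₁ ∧ Γ.rel b₂ b₂ :=
  ⟨h _ _ (ctr_fst (by decide)), h _ _ (ctr_fix (k := 1) (by decide) (by decide)),
    h _ _ (ctr_fix (k := 2) (by decide) (by decide)), h _ _ ctr_snd,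
    h _ _ (ctr_fix (k := 4) (by decide) (by decide)),
    h _ _ (ctr_fix (k := 5) (by decide) (by decide))⟩

lemma rel₇ (h : H.Γ₇ ≤ Γ) : Γ.rel H.Q H.Q ∧ Γ.rel H.t 0 ∧ Γ.rel H.q 0 ∧ Γ.rel H.p H.p ∧
    Γ.rel b₁ b₁ ∧ Γ.rel b₂ b₂ :=
  ⟨h _ _ (ctr_fix (k := 0) (by decide) (by decide)), h _ _ (ctr_fst (by decide)), h _ _ ctr_snd,
    h _ _ (ctr_fix (k := 3) (by decide) (by decide)),
    h _ _ (ctr_fix (k := 4) (by decide) (by decide)),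
    h _ _ (ctr_fix (k := 5) (by decide) (by decide))⟩

lemma rel₈ (h : H.Γ₈ ≤ Γ) : Γ.rel H.Q H.Q ∧ Γ.rel H.t 0 ∧ Γ.rel H.z₁ (const H.β) ∧
    Γ.rel H.p H.p ∧ Γ.rel b₁ b₁ ∧ Γ.rel b₂ b₂ :=
  ⟨h _ _ (ctr_fix (k := 0) (by decide) (by decide)), h _ _ (ctr_fst (by decide)), h _ _ ctr_snd,
    h _ _ (ctr_fix (k := 3) (by decide) (by decide)),
    h _ _ (ctr_fix (k := 4) (by decide) (by decide)),
    h _ _ (ctr_fix (k := 5) (by decide) (by decide))⟩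

lemma rel_b (h1 : Γ.rel b₁ b₁) (h2 : Γ.rel b₂ b₂) : Γ.rel H.b H.b := by
  rcases H.hb with h | h <;> rw [h] <;> assumption

lemma eq_of_exc {x y c u : K} (hu : u ≠ 0) (hy : y = (x - c) / u) : x = y * u + c := by
  rw [hy]
  field_simp
  ring

lemma rel_of_exc {x y c c' d u : K} (hu : u ≠ 0) (hy : y = (x - c) / u) (h1 : Γ.rel u 0)
    (h2 : Γ.rel y d) (h3 : Γ.rel c c') : Γ.rel x c' := by
  rw [eq_of_exc hu hy]
  simpa using Γ.add (Γ.mul h2 h1) h3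

lemma t_of_v₁ {c : K} (h1 : Γ.rel H.u 0) (h2 : Γ.rel H.v₁ c) : Γ.rel H.t 0 :=
  rel_of_exc H.u_ne rfl h1 h2 Place.zero

lemma v₁_of_v₂ {c : K} (h1 : Γ.rel H.u 0) (h2 : Γ.rel H.v₂ c) : Γ.rel H.v₁ (-1) :=
  rel_of_exc H.u_ne rfl h1 h2 (Place.neg Place.one)

lemma le₁₂ : H.Γ₁ ≤ H.Γ₂ := by
  obtain ⟨h1, h2, h3, h4, h5, h6⟩ := rel₂ (fun _ _ h => h : H.Γ₂ ≤ H.Γ₂)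
  refine ctr_le h1 (t_of_v₁ h1 h2) fun k hi hj => ?_
  fin_cases k
  exacts [(hi rfl).elim, (hj rfl).elim, h3, h4, h5, h6]

lemma le_W_W' : H.W ≤ H.W' := by
  obtain ⟨h1, h2, h3, h4, h5, h6⟩ := rel_W' (fun _ _ h => h : H.W' ≤ H.W')
  exact placeOf_le (forall_fin_six.2 ⟨h1, t_of_v₁ h1 h2, h3, h4, h5, h6⟩)

/-- The third centre is not a section over the second: it lies over the hypersurface `q + p = b` of
the second centre and contains the whole fibre with coordinate `v₂`. Therefore the chain passes
through this place of smaller dimension instead of `Γ₂`. -/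
lemma le_W'_₃ : H.W' ≤ H.Γ₃ := by
  obtain ⟨h1, h2, h3, h4, h5, h6⟩ := rel₃ (fun _ _ h => h : H.Γ₃ ≤ H.Γ₃)
  exact placeOf_le (forall_fin_six.2 ⟨h1, v₁_of_v₂ h1 h2, h3, h4, h5, h6⟩)

lemma le₃₄ : H.Γ₃ ≤ H.Γ₄ := by
  obtain ⟨h1, h2, h3, h4, h5, h6⟩ := rel₄ (fun _ _ h => h : H.Γ₄ ≤ H.Γ₄)
  refine ctr_le h1 (rel_of_exc H.u_ne rfl h1 h4 (Place.sub (rel_b h5 h6) h3)) fun k hi hj => ?_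
  fin_cases k
  exacts [(hi rfl).elim, h2, h3, (hj rfl).elim, h5, h6]

lemma le₅₆ : H.Γ₅ ≤ H.Γ₆ := by
  obtain ⟨h1, h2, h3, h4, h5, h6⟩ := rel₆ (fun _ _ h => h : H.Γ₆ ≤ H.Γ₆)
  refine ctr_le h1 (rel_of_exc H.u_ne rfl h1 h4 Place.zero) fun k hi hj => ?_
  fin_cases k
  exacts [(hi rfl).elim, h2, h3, (hj rfl).elim, h5, h6]

lemma le₇₈ : H.Γ₇ ≤ H.Γ₈ := by
  obtain ⟨h1, h2, h3, h4, h5, h6⟩ := rel₈ (fun _ _ h => h : H.Γ₈ ≤ H.Γ₈)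
  refine ctr_le h2 (rel_of_exc H.t_ne rfl h2 h3 Place.zero) fun k hi hj => ?_
  fin_cases k
  exacts [h1, (hi rfl).elim, (hj rfl).elim, h4, h5, h6]

end Half

end PainleveFlow

/-!
# The first four blow-ups of a half of the second family
-/

namespace PainleveFlow

open Place MvPolynomial

namespace Half

variable (H : Half)

/-- The places over the first centre. -/
def First (Γ : Place K) : Prop := H.Γ₁ ≤ Γ ∨ H.W ≤ Γ

/-- The function `σ` is a unit multiple of `t (1 - u ζ) + u`. -/
structure Sig (σ γ ζ : K) : Prop where
  eq : γ * σ = H.t * (1 - H.u * ζ) + H.u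
  unit : ∀ Γ, H.First Γ → Γ.unit γ
  int : ∀ Γ, H.First Γ → ζ ∈ Γ.integers

/-- The places over the second centre. -/
def Second (Γ : Place K) : Prop := H.Γ₂ ≤ Γ ∨ H.W' ≤ Γ

variable {H} {Γ Γ' Γ'' : Place K} {R S : LocalSubring K} {σ γ ζ d g κ : K}

lemma Second.first (h : H.Second Γ) : H.First Γ :=
  h.imp (le_trans' le₁₂) (le_trans' le_W_W')

lemma second_of_three (h : H.Γ₃ ≤ Γ) : H.Second Γ := .inr (le_trans' le_W'_₃ h)

lemma First.rel (h : H.First Γ) : Γ.rel H.u 0 ∧ Γ.rel H.t 0 ∧ Γ.rel H.q H.q ∧ Γ.rel b₁ b₁ ∧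
    Γ.rel b₂ b₂ := by
  rcases h with h | h
  · obtain ⟨h1, h2, h3, -, h4, h5⟩ := rel₁ h
    exact ⟨h1, h2, h3, h4, h5⟩
  · obtain ⟨h1, h2, h3, -, h4, h5⟩ := rel_W h
    exact ⟨h1, h2, h3, h4, h5⟩

lemma Second.rel (h : H.Second Γ) : Γ.rel H.v₁ (-1) := by
  rcases h with h | h
  · exact (rel₂ h).2.1
  · exact (rel_W' h).2.1

lemma first_E₁ : H.First H.E₁ := .inl H.center₁.le

lemma first_W : H.First H.W := .inr fun _ _ h => h

/-- The fibre coordinate over `q + p = b` is free, which is what `Kr.free` needs at the third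
centre. -/
lemma transcendental_v₂ : Transcendental H.W'.residues H.v₂ := by
  refine transcendental_residues H.gen₂ 1 fun L h => ?_
  have hb : H.b ∈ L := H.b_mem (h 4 (by decide)) (h 5 (by decide))
  exact forall_fin_six.2 ⟨zero_mem _, neg_mem (one_mem _), h 2 (by decide),
    sub_mem hb (h 2 (by decide)), h 4 (by decide), h 5 (by decide)⟩

lemma v₃_eq : H.v₃ = H.s / H.u := rfl
lemma s_eq : H.s = H.p - (H.b - H.q) := rfl
lemma v₁_eq : H.v₁ = H.t / H.u := by rw [v₁, sub_zero]
lemma v₂_eq : H.v₂ = (H.v₁ + 1) / H.u := by rw [v₂, sub_neg_eq_add]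
lemma v₄_eq : H.v₄ = (H.v₃ + const H.a₀) / H.u := by rw [v₄, sub_neg_eq_add]
lemma w₁_eq : H.w₁ = H.p / H.u := by rw [w₁, sub_zero]
lemma z₁_eq : H.z₁ = H.q / H.t := by rw [z₁, sub_zero]

namespace Sig

variable (h : H.Sig σ γ ζ)
include h

lemma γ_ne : γ ≠ 0 := (h.unit _ first_W).ne_zero

/-- An affine function of the standard coordinate with a unit slope at the relevant places. Thus `σ`
can replace `t` in the description of the exceptional divisor. -/
lemma div_eq : σ / H.u = (1 - H.u * ζ) / γ * H.v₁ + 1 / γ := by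
  have h1 := h.γ_ne
  have h2 := H.u_ne
  rw [v₁_eq]
  field_simp
  linear_combination h.eq

lemma div_div_eq : σ / H.u / H.u = (1 - H.u * ζ) / γ * H.v₂ + ζ / γ := by
  have h1 := h.γ_ne
  have h2 := H.u_ne
  rw [v₂_eq, v₁_eq]
  field_simp
  linear_combination h.eq

lemma unit_sub (hΓ : H.First Γ) : Γ.unit (1 - H.u * ζ) :=
  Place.unit_sub unit_one (rel_mul_mem hΓ.rel.1 (h.int _ hΓ))

/-- At `u = 0`, `v₁ = -1` the expression `(1 - u ζ) v₁ + 1` vanishes, so `σ / u` serves as an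
equation of the second centre. -/
lemma rel_div (hΓ : H.Second Γ) : Γ.rel (σ / H.u) 0 := by
  have h1 : σ / H.u = ((1 - H.u * ζ) * H.v₁ + 1) * γ⁻¹ := by
    rw [h.div_eq]
    ring
  obtain ⟨z, hz⟩ := h.int _ hΓ.first
  rw [h1]
  refine rel_mul_mem ?_ (h.unit _ hΓ.first).inv.mem
  have := Γ.add (Γ.mul (Place.sub Place.one (Γ.mul hΓ.first.rel.1 hz)) hΓ.rel) Place.one
  simpa using this

/-- If `σ` were zero, taking residues on the first exceptional divisor would give `v₁ = -1`,
although `v₁` is a coordinate there. -/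
lemma ne_zero : σ ≠ 0 := by
  rintro rfl
  have hE := first_E₁ (H := H)
  obtain ⟨z, hz⟩ := h.int _ hE
  have h1 : (1 - H.u * ζ) * H.v₁ + 1 = 0 := by
    have h2 := H.u_ne
    have := h.eq
    rw [v₁_eq]
    field_simp
    linear_combination -this
  have h3 := H.E₁.add (H.E₁.mul (Place.sub Place.one (H.E₁.mul hE.rel.1 hz)) H.center₁.fix)
    Place.one
  have h4 := H.E₁.uniq ((congrArg (H.E₁.rel · _) h1).mp h3)
  have h5 : H.v₁ - -1 ≠ 0 := H.center₂.fst
  refine h5 ?_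
  change (1 - 0 * z) * H.v₁ + 1 = 0 at h4
  linear_combination h4

lemma div_ne : σ / H.u ≠ 0 := div_ne_zero h.ne_zero H.u_ne

end Sig

/-! ### The ideals of the first four centres at a point -/

lemma Sig.kr₂ (h : H.Sig σ γ ζ) (ho : Over H.Γ₁ R S) (hk : Kr H.Γ₁ R {σ, H.u})
    (hΓ : H.Second Γ) (hs : Sub S.toSubring Γ) : Kr H.Γ₂ S {σ / H.u, H.u} := by
  have := ho.chain hk h.ne_zero H.u_ne le₁₂ hs (Subring.zero_mem _)
    (by simpa using h.rel_div (.inl fun _ _ h => h)) (by simpa using h.rel_div hΓ) hΓ.first.rel.1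
  simpa using this

lemma Sig.kr_W' (h : H.Sig σ γ ζ) (ho : Over H.Γ₁ R S) (hk : Kr H.Γ₁ R {σ, H.u})
    (hw : Kr H.W R {σ, H.u, d * H.s}) (hΓ : H.W' ≤ Γ) (hs : Sub S.toSubring Γ) :
    Kr H.W' S {σ / H.u, H.u, d * H.s} := by
  have hW := h.rel_div (.inr fun _ _ h => h : H.Second H.W')
  have hz := h.rel_div (.inr hΓ)
  have hm := ho.mem_of hk h.ne_zero H.u_ne hs (Subring.zero_mem _) (by simpa using hz)
  have hu := ho.le (hk.ring H.u (by simp))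
  refine ho.kr hk h.ne_zero H.u_ne hw le_W_W' hs (Subring.zero_mem _) (by simpa using hW)
    (by simpa using hz) ?_ ?_ (Spn.gen (by simp))
  · rintro x (rfl | rfl | rfl)
    · exact ⟨hm, hW, hz⟩
    · exact ⟨hu, le_W_W' _ _ (hw.zero _ (by simp)), hΓ _ _ (le_W_W' _ _ (hw.zero _ (by simp)))⟩
    · exact ⟨ho.le (hw.ring _ (by simp)), le_W_W' _ _ (hw.zero _ (by simp)),
        hΓ _ _ (le_W_W' _ _ (hw.zero _ (by simp)))⟩
  · rintro x (rfl | rfl | rfl)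
    · have : x = H.u * (x / H.u) := by rw [mul_div_cancel₀ _ H.u_ne]
      exact (congrArg (· ∈ Spn _ _) this).mpr (Spn.mul hu (Spn.gen (by simp)))
    · exact Spn.gen (by simp)
    · exact Spn.gen (by simp)

/-- Over the hypersurface there are three generators `σ/u`, `u`, `d s`. After the blow-up along
`(σ/u, u)` one of the first two is a multiple of the other, and the survivor is `g`. The ideal stays
generated because the quotient `σ/u²` has transcendental residue. -/
lemma Sig.kr₃ (h : H.Sig σ γ ζ) (ho : Over H.Γ₂ R S) (hk : Kr H.Γ₂ R {σ / H.u, H.u})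
    (hw : Kr H.W' R {σ / H.u, H.u, d * H.s}) (hΓ : H.Γ₃ ≤ Γ) (hs : Sub S.toSubring Γ) :
    ∃ g κ, κ * g = H.u ∧ κ ∈ S.toSubring ∧ (∀ Γ, H.Γ₃ ≤ Γ → Γ.unit κ) ∧
      (g = H.u ∨ g = σ / H.u) ∧ Kr H.Γ₃ S {d * H.s, g} := by
  have hu := H.u_ne
  obtain ⟨r1, r2, -⟩ := rel₃ (fun _ _ h => h : H.Γ₃ ≤ H.Γ₃)
  have h1 := first_W (H := H)
  have hF : H.First H.W' := .inr le_W_W'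
  have hF₃ : H.First H.Γ₃ := (second_of_three fun _ _ h => h).first
  obtain ⟨c, hc, hc0⟩ := ((h.unit_sub hF).div (h.unit _ hF))
  obtain ⟨z, hz⟩ := h.int _ hF
  obtain ⟨γ', hγ, hγ0⟩ := h.unit _ hF
  have hres := le_W'_₃ _ _ hc
  have hres' := le_W'_₃ _ _ (Place.div hz hγ hγ0)
  have htr := Transcendental.affine transcendental_v₂ (mem_residues hc)
    (mem_residues (Place.div hz hγ hγ0)) hc0
  set τ := c * H.v₂ + z / γ' with hτ
  have hrel : H.Γ₃.rel (σ / H.u / H.u) τ := by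
    rw [h.div_div_eq]
    exact H.Γ₃.add (H.Γ₃.mul hres r2) hres'
  have hτ0 : τ ≠ 0 := by
    intro h0
    rw [h0] at htr
    exact htr isAlgebraic_zero
  have hM : ∀ x ∈ ({σ / H.u, H.u, d * H.s} : Set K), x ∈ Mx S := fun x hx =>
    hs.mx (ho.le (hw.ring x hx)) (hΓ _ _ (le_W'_₃ _ _ (hw.zero x hx)))
  have hu' : H.Γ₃.unit (σ / H.u / H.u) := ⟨τ, hrel, hτ0⟩
  rcases ho.loc _ _ h.div_ne hu hk with hl | hl
  · refine ⟨H.u, 1, one_mul _, one_mem _, fun _ _ => unit_one, .inl rfl, ?_⟩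
    have hk' := hw.free hl le_W'_₃ hrel htr hM
    refine hk'.congr ?_ ?_ ?_
    · rintro x (rfl | rfl)
      exacts [hk'.ring _ (by simp), hk'.ring _ (by simp)]
    · rintro x (rfl | rfl)
      exacts [hk'.zero _ (by simp), hk'.zero _ (by simp)]
    · rintro x (rfl | rfl | rfl)
      · have : σ / H.u = σ / H.u / H.u * H.u := by rw [div_mul_cancel₀ _ hu]
        exact (congrArg (· ∈ Spn _ _) this).mpr
          (Spn.mul (hl.1 (self_mem_adj _ _)) (Spn.gen (by simp)))
      · exact Spn.gen (by simp)
      · exact Spn.gen (by simp)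
  · have hσ := h.div_ne
    refine ⟨σ / H.u, H.u / (σ / H.u), div_mul_cancel₀ _ hσ, hl.1 (self_mem_adj _ _),
      fun Γ' hΓ' => ?_, .inr rfl, ?_⟩
    · rw [← inv_div]
      exact (hu'.up hΓ').inv
    have hk' := hw.free hl le_W'_₃ (τ := τ⁻¹) (by rw [← inv_div]; exact H.Γ₃.inv hrel hτ0)
      (fun h => htr (by simpa using h.inv)) hM
    refine hk'.congr ?_ ?_ ?_
    · rintro x (rfl | rfl)
      exacts [hk'.ring _ (by simp), hk'.ring _ (by simp)]
    · rintro x (rfl | rfl)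
      exacts [hk'.zero _ (by simp), hk'.zero _ (by simp)]
    · rintro x (rfl | rfl | rfl)
      · exact Spn.gen (by simp)
      · have : H.u = H.u / (σ / H.u) * (σ / H.u) := by rw [div_mul_cancel₀ _ hσ]
        exact (congrArg (· ∈ Spn _ _) this).mpr
          (Spn.mul (hl.1 (self_mem_adj _ _)) (Spn.gen (by simp)))
      · exact Spn.gen (by simp)

lemma ne_of_mul_eq (hg : κ * g = H.u) : κ ≠ 0 ∧ g ≠ 0 := by
  have := H.u_ne
  rw [← hg] at this
  exact ⟨left_ne_zero_of_mul this, right_ne_zero_of_mul this⟩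

lemma s_ne : H.s ≠ 0 := H.center₃.fst

lemma mul_s_div (hg : κ * g = H.u) : d * H.s / g = d * κ * H.v₃ := by
  obtain ⟨h1, h2⟩ := ne_of_mul_eq hg
  rw [v₃_eq, ← hg]
  field_simp

lemma mul_v₃_div (hg : κ * g = H.u) :
    d * κ * (H.v₃ + const H.a₀) / g = d * κ ^ 2 * H.v₄ := by
  obtain ⟨h1, h2⟩ := ne_of_mul_eq hg
  rw [v₄_eq, ← hg]
  field_simp

lemma rel_mul_v₃ (hΓ : H.Γ₄ ≤ Γ) (hd : Γ.unit d) (hκ : Γ.unit κ) :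
    Γ.rel (d * κ * (H.v₃ + const H.a₀)) 0 := by
  refine rel_mem_mul ?_ (hd.mul hκ).mem
  have := Γ.add (rel₄ hΓ).2.2.2.1 (Γ.const H.a₀)
  rwa [const, neg_add_cancel] at this

/-- The quotient `d s / g` equals `d κ v₃`, so the centre `v₃ = -a₀` is a section with value `-d κ
a₀`, an element of the ring below. -/
lemma kr₄ (ho : Over H.Γ₃ R S) (hk : Kr H.Γ₃ R {d * H.s, g}) (hg : κ * g = H.u)
    (hκ : κ ∈ R.toSubring) (hd : d ∈ R.toSubring) (hc : const H.a₀ ∈ R.toSubring)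
    (hκ' : ∀ Γ, H.Γ₃ ≤ Γ → Γ.unit κ) (hd' : H.Γ₃.unit d)
    (hΓ : H.Γ₄ ≤ Γ) (hs : Sub S.toSubring Γ) :
    Kr H.Γ₄ S {d * κ * (H.v₃ + const H.a₀), g} := by
  have hΓ₃ := le_trans' le₃₄ hΓ
  have e : d * H.s / g - -(d * κ * const H.a₀) = d * κ * (H.v₃ + const H.a₀) := by
    rw [mul_s_div hg]
    ring
  have := ho.chain hk (mul_ne_zero hd'.ne_zero s_ne) (ne_of_mul_eq hg).2 le₃₄ hs
    (w := -(d * κ * const H.a₀)) (neg_mem (mul_mem (mul_mem hd hκ) hc))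
    (by rw [e]; exact rel_mul_v₃ (fun _ _ h => h) (hd'.up le₃₄) (hκ' _ le₃₄))
    (by rw [e]; exact rel_mul_v₃ hΓ (hd'.up hΓ₃) (hκ' _ hΓ₃)) (hΓ₃ _ _ (hk.zero _ (by simp)))
  rwa [e] at this

end Half

end PainleveFlow

/-!
# The eight blow-ups of a half of the second family
-/

namespace PainleveFlow

open Place MvPolynomial

namespace Half

variable (H : Half) (ζ₀ : K) (T : Set K) (D : Subring K → K → Prop)

/-- The standard equation `t (1 - u ζ₀) + u`. -/
noncomputable def σ₀ : K := H.t * (1 - H.u * ζ₀) + H.u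

/-- The function `u / (1 - u ζ₀)`. -/
noncomputable def e₀ : K := H.u / (1 - H.u * ζ₀)

/-- The point does not lie on the first centre. -/
def Off (R : LocalSubring K) : Prop := ∀ Γ, H.First Γ → ¬ Sub R.toSubring Γ

/-- Generators of the ideal of the first centre. -/
def D₁ (R : LocalSubring K) : Prop :=
  ∃ σ ∈ T, ∃ γ ζ, H.Sig σ γ ζ ∧ (∀ Γ, H.First Γ → Sub R.toSubring Γ → Kr H.Γ₁ R {σ, H.u}) ∧
    (∀ Γ, H.W ≤ Γ → Sub R.toSubring Γ →
      ∃ d ∈ R.toSubring, H.W.unit d ∧ D R.toSubring d ∧ Kr H.W R {σ, H.u, d * H.s}) ∧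
    (γ = 1 ∧ ζ = ζ₀ ∨ ∀ Γ, H.Γ₅ ≤ Γ ∨ H.Γ₇ ≤ Γ → ¬ Sub R.toSubring Γ)

/-- Generators of the ideal of the second centre. -/
def D₂ (R : LocalSubring K) : Prop :=
  ∃ σ ∈ T, ∃ γ ζ, H.Sig σ γ ζ ∧
    (∀ Γ, H.Second Γ → Sub R.toSubring Γ → Kr H.Γ₂ R {σ / H.u, H.u}) ∧
    (∀ Γ, H.W' ≤ Γ → Sub R.toSubring Γ →
      ∃ d ∈ R.toSubring, H.W.unit d ∧ D R.toSubring d ∧ Kr H.W' R {σ / H.u, H.u, d * H.s})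

/-- Generators of the ideal of the third centre. -/
def D₃ (R : LocalSubring K) : Prop :=
  ∀ Γ, H.Γ₃ ≤ Γ → Sub R.toSubring Γ → ∃ g κ d, κ * g = H.u ∧ κ ∈ R.toSubring ∧ d ∈ R.toSubring ∧
    (∀ Γ, H.Γ₃ ≤ Γ → Γ.unit κ) ∧ H.W.unit d ∧ D R.toSubring d ∧ (g = H.u ∨ ∃ σ ∈ T, g = σ / H.u) ∧
    Kr H.Γ₃ R {d * H.s, g}

/-- Generators of the ideal of the fourth centre. -/
def D₄ (R : LocalSubring K) : Prop :=
  ∀ Γ, H.Γ₄ ≤ Γ → Sub R.toSubring Γ → ∃ g κ d, κ * g = H.u ∧ (∀ Γ, H.Γ₃ ≤ Γ → Γ.unit κ) ∧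
    H.W.unit d ∧ Kr H.Γ₄ R {d * κ * (H.v₃ + const H.a₀), g}

/-- Generators of the ideal of the fifth centre. -/
def D₅ (R : LocalSubring K) : Prop :=
  ∀ Γ, H.Γ₅ ≤ Γ → Sub R.toSubring Γ → ∃ e ∈ R.toSubring,
    (e = 1 ∧ H.Off R ∨ e = H.σ₀ ζ₀ ∧ H.u / H.σ₀ ζ₀ ∈ R.toSubring ∧ H.t ∈ R.toSubring) ∧
    Kr H.Γ₅ R {H.p, H.u / e}

/-- Generators of the ideal of the sixth centre. -/
def D₆ (R : LocalSubring K) : Prop :=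
  ∀ Γ, H.Γ₆ ≤ Γ → Sub R.toSubring Γ → ∃ e ∈ R.toSubring,
    (e = 1 ∧ H.Off R ∨ e = H.σ₀ ζ₀ ∧ H.u / H.σ₀ ζ₀ ∈ R.toSubring ∧ H.t ∈ R.toSubring) ∧
    Kr H.Γ₆ R {e * (H.w₁ - const H.α), H.u / e}

/-- Generators of the ideal of the seventh centre. -/
def D₇ (R : LocalSubring K) : Prop :=
  ∀ Γ, H.Γ₇ ≤ Γ → Sub R.toSubring Γ → H.Off R ∧ Ret H.Γ₇ R {H.q, H.t} ∨
    H.u ∈ R.toSubring ∧ H.e₀ ζ₀ ∈ R.toSubring ∧ H.t / H.e₀ ζ₀ ∈ R.toSubring ∧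
      Kr H.Γ₇ R {H.q, H.t / H.e₀ ζ₀}

/-- Generators of the ideal of the eighth centre. -/
def D₈ (R : LocalSubring K) : Prop :=
  ∀ Γ, H.Γ₈ ≤ Γ → Sub R.toSubring Γ → ∃ e ∈ R.toSubring,
    (e = 1 ∨ e = H.e₀ ζ₀ ∧ H.u ∈ R.toSubring) ∧
    Kr H.Γ₈ R {e * (H.z₁ - const H.β), H.t / e}

variable {H} {ζ₀ : K} {T : Set K} {D : Subring K → K → Prop} {V : Set (LocalSubring K)}
  {C : Subvariety} {Γ Γ' : Place K} {R S : LocalSubring K}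

lemma Off.mono (h : H.Off R) (hRS : R.toSubring ≤ S.toSubring) : H.Off S :=
  fun Γ hΓ hs => h Γ hΓ (hs.mono hRS)

/-! ### The first four centres -/

section

variable (hD : ∀ A B d, A ≤ B → D A d → D B d)
include hD

lemma d₂ (h : ∀ R ∈ V, H.D₁ ζ₀ T D R) : ∀ S ∈ blowUp V H.C₁, H.D₂ T D S := by
  intro S hS
  rcases blowUp_cases H.center₁.link hS with ⟨hV, hn⟩ | ⟨R, hR, ho⟩
  · obtain ⟨σ, hσ, γ, ζ, hsig, h1, -⟩ := h S hV
    refine ⟨σ, hσ, γ, ζ, hsig, fun Γ hΓ hs => (hn (h1 Γ hΓ.first hs).sub).elim,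
      fun Γ hΓ hs => (hn (h1 Γ (Second.first (.inr hΓ)) hs).sub).elim⟩
  · obtain ⟨σ, hσ, γ, ζ, hsig, h1, h2, -⟩ := h R hR
    have hk := h1 _ (.inl fun _ _ h => h) ho.sub
    refine ⟨σ, hσ, γ, ζ, hsig, fun Γ hΓ hs => hsig.kr₂ ho hk hΓ hs, fun Γ hΓ hs => ?_⟩
    obtain ⟨d, hd, hd1, hd2, hd3⟩ := h2 Γ (le_trans' le_W_W' hΓ) (hs.mono ho.le)
    exact ⟨d, ho.le hd, hd1, hD _ _ _ ho.le hd2, hsig.kr_W' ho hk hd3 hΓ hs⟩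

lemma d₃ (h : ∀ R ∈ V, H.D₂ T D R) : ∀ S ∈ blowUp V H.C₂, H.D₃ T D S := by
  intro S hS Γ hΓ hs
  rcases blowUp_cases H.center₂.link hS with ⟨hV, hn⟩ | ⟨R, hR, ho⟩
  · obtain ⟨σ, hσ, γ, ζ, hsig, h1, -⟩ := h S hV
    exact (hn (h1 Γ (second_of_three hΓ) hs).sub).elim
  · obtain ⟨σ, hσ, γ, ζ, hsig, h1, h2⟩ := h R hR
    have hk := h1 _ (.inl fun _ _ h => h) ho.sub
    obtain ⟨d, hd, hd1, hd2, hd3⟩ := h2 Γ (le_trans' le_W'_₃ hΓ) (hs.mono ho.le)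
    obtain ⟨g, κ, g1, g2, g3, g4, g5⟩ := hsig.kr₃ ho hk hd3 hΓ hs
    exact ⟨g, κ, d, g1, g2, ho.le hd, g3, hd1, hD _ _ _ ho.le hd2,
      g4.imp_right fun h => ⟨σ, hσ, h⟩, g5⟩

end

lemma le_W_₃ : H.W ≤ H.Γ₃ := le_trans' le_W_W' le_W'_₃

lemma d₄ (hc : Reg V (const H.a₀)) (h : ∀ R ∈ V, H.D₃ T D R) : ∀ S ∈ blowUp V H.C₃, H.D₄ S := by
  intro S hS Γ hΓ hs
  rcases blowUp_cases H.center₃.link hS with ⟨hV, hn⟩ | ⟨R, hR, ho⟩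
  · obtain ⟨g, κ, d, -, -, -, -, -, -, -, hk⟩ := h S hV Γ (le_trans' le₃₄ hΓ) hs
    exact (hn hk.sub).elim
  · obtain ⟨g, κ, d, g1, g2, g3, g4, g5, -, -, hk⟩ := h R hR _ (fun _ _ h => h) ho.sub
    exact ⟨g, κ, d, g1, g4, g5, kr₄ ho hk g1 g2 g3 (hc R hR) g4 (g5.up le_W_₃) hΓ hs⟩

/-! ### The other four centres -/

/-- The element depends only on the parameters. -/
def Param (ζ₀ : K) : Prop := ζ₀ = 0 ∨ ζ₀ = b₁ ∨ ζ₀ = b₂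

section

variable (hζ : Param ζ₀)
include hζ

lemma _root_.PainleveFlow.Half.Param.rel (h1 : Γ.rel b₁ b₁) (h2 : Γ.rel b₂ b₂) : Γ.rel ζ₀ ζ₀ := by
  rcases hζ with rfl | rfl | rfl
  exacts [Place.zero, h1, h2]

lemma one_sub_ne : 1 - H.u * ζ₀ ≠ 0 := by
  intro h
  have hQ : H.Q = ζ₀ := by
    have := H.Q_ne
    rw [u] at h
    field_simp at h
    linear_combination h
  have hi := H.gen.algebraicIndependent.injective
  rcases hζ with rfl | rfl | rfl
  · exact H.Q_ne hQ
  · exact absurd (hi (a₁ := 0) (a₂ := 4) hQ) (by decide)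
  · exact absurd (hi (a₁ := 0) (a₂ := 5) hQ) (by decide)

lemma sig₀ : H.Sig (H.σ₀ ζ₀) 1 ζ₀ := by
  refine ⟨one_mul _, fun _ _ => unit_one, fun Γ hΓ => ⟨_, hζ.rel ?_ ?_⟩⟩
  exacts [hΓ.rel.2.2.2.1, hΓ.rel.2.2.2.2]

lemma e₀_ne : H.e₀ ζ₀ ≠ 0 := div_ne_zero H.u_ne (one_sub_ne hζ)

lemma div_e₀ : H.t / H.e₀ ζ₀ = H.σ₀ ζ₀ / H.u - 1 := by
  have h1 := one_sub_ne (H := H) hζ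
  have h2 := H.u_ne
  rw [e₀, σ₀]
  field_simp
  ring

/-- Residues at the fifth centre. -/
lemma unit₅ (hΓ : H.Γ₅ ≤ Γ) : Γ.rel H.u 0 ∧ Γ.unit H.t ∧ Γ.unit (1 - H.u * ζ₀) ∧
    Γ.unit (H.σ₀ ζ₀) := by
  obtain ⟨h1, h2, -, -, h5, h6⟩ := rel₅ hΓ
  have ht : Γ.unit H.t := ⟨_, Γ.inv h2 H.P_ne, inv_ne_zero H.P_ne⟩
  have h3 : Γ.unit (1 - H.u * ζ₀) :=
    Place.unit_sub unit_one (rel_mul_mem h1 ⟨_, hζ.rel h5 h6⟩)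
  exact ⟨h1, ht, h3, unit_add (ht.mul h3) h1⟩

/-- Residues at the seventh centre. -/
lemma unit₇ (hΓ : H.Γ₇ ≤ Γ) : Γ.rel H.t 0 ∧ Γ.unit H.u ∧ Γ.unit (1 - H.u * ζ₀) ∧
    Γ.rel (H.σ₀ ζ₀ / H.u - 1) 0 := by
  obtain ⟨h1, h2, -, -, h5, h6⟩ := rel₇ hΓ
  have hu : Γ.rel H.u H.u := Γ.inv h1 H.Q_ne
  have hz := hζ.rel h5 h6
  have h3 : Γ.unit (1 - H.u * ζ₀) :=
    unit_of_fix (Place.sub Place.one (Γ.mul hu hz)) (one_sub_ne hζ)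
  have hu' := unit_of_fix hu H.u_ne
  refine ⟨h2, hu', h3, ?_⟩
  rw [← div_e₀ hζ, e₀]
  exact (div_eq_mul_inv H.t _).symm ▸ rel_mul_mem h2 (hu'.div h3).inv.mem

/-- At the fifth place `t`, and so `σ₀`, is a unit and `u` vanishes. Its centre thus meets the first
exceptional divisor in the piece with coordinate `u / σ₀`, at value `0`, and there `u / σ₀` replaces
`u` as a generator. -/
lemma d₅ (hV : Reg V ζ₀) (h : ∀ R ∈ V, H.D₁ ζ₀ T D R)
    (h5 : ∀ R ∈ V, ∀ Γ, H.Γ₅ ≤ Γ → Sub R.toSubring Γ → Kr H.Γ₅ R {H.p, H.u}) :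
    ∀ S ∈ blowUp V H.C₁, H.D₅ ζ₀ S := by
  intro S hS Γ hΓ hs
  rcases blowUp_cases H.center₁.link hS with ⟨hV, hn⟩ | ⟨R, hR, ho⟩
  · obtain ⟨σ, hσ, γ, ζ, hsig, h1, -⟩ := h S hV
    exact ⟨1, one_mem _, .inl ⟨rfl, fun Γ hΓ hs => hn (h1 Γ hΓ hs).sub⟩,
      by simpa using h5 S hV Γ hΓ hs⟩
  · have hs' := hs.mono ho.le
    obtain ⟨σ, hσ, γ, ζ, hsig, h1, -, h2⟩ := h R hR
    rcases h2 with ⟨rfl, rfl⟩ | h2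
    swap
    · exact (h2 Γ (.inl hΓ) hs').elim
    have hk := h1 _ (.inl fun _ _ h => h) ho.sub
    have hσ : σ = H.σ₀ ζ := by rw [σ₀, ← hsig.eq, one_mul]
    subst hσ
    have h0 := hsig.ne_zero
    have hk5 := h5 R hR Γ hΓ hs'
    have hw : ∀ {Γ}, H.Γ₅ ≤ Γ → Γ.rel (H.u / H.σ₀ ζ) 0 := fun hΓ => by
      obtain ⟨h1, -, -, h2⟩ := unit₅ hζ hΓ
      rw [div_eq_mul_inv]
      exact rel_mul_mem h1 h2.inv.mem
    have hk' := (Set.pair_comm _ _).subst (motive := Kr H.Γ₁ R) hk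
    have hm := ho.mem_of hk' H.u_ne h0 hs (Subring.zero_mem _) (by simpa using hw hΓ)
    have hσR := hk.ring (H.σ₀ ζ) (by simp)
    have hinv := Mx.inv_mem (sub_mem (one_mem _) (mul_mem (hk.ring H.u (by simp)) (hV R hR)))
      (Mx.one_sub_notMem (Mx.mul' (hk.mx H.u (by simp)) (hV R hR)))
    refine ⟨_, ho.le hσR, .inr ⟨rfl, hm, ho.le ?_⟩, ?_⟩
    · have : H.t = (H.σ₀ ζ - H.u) * (1 - H.u * ζ)⁻¹ := by
        have := one_sub_ne (H := H) hζ
        rw [σ₀]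
        field_simp
        ring
      rw [this]
      exact mul_mem (sub_mem hσR (hk.ring H.u (by simp))) hinv
    · refine ho.kr hk' H.u_ne h0 hk5 (fun _ _ h => h) hs (Subring.zero_mem _)
        (by simpa using hw fun _ _ h => h) (by simpa using hw hΓ) ?_ ?_
        (by simpa using Spn.gen (by simp))
      · rintro x (rfl | rfl)
        · exact ⟨ho.le (hk5.ring _ (by simp)), hk5.zero _ (by simp), hΓ _ _ (hk5.zero _ (by simp))⟩
        · exact ⟨hm, hw fun _ _ h => h, hw hΓ⟩
      · rintro x (rfl | rfl)
        · exact Spn.gen (by simp)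
        · have : H.u = H.σ₀ ζ * (H.u / H.σ₀ ζ) := by rw [mul_div_cancel₀ _ h0]
          exact (congrArg (· ∈ Spn _ _) this).mpr (Spn.mul (ho.le hσR) (Spn.gen (by simp)))

/-- By the identity `t / e₀ = σ₀ / u - 1`, the strict transform of `t = 0` meets the first
exceptional divisor at `σ₀ / u = 1`. There `t / e₀` replaces `t` as a generator. -/
lemma d₇ (hV : Reg V ζ₀) (h : ∀ R ∈ V, H.D₁ ζ₀ T D R)
    (h7 : ∀ R ∈ V, ∀ Γ, H.Γ₇ ≤ Γ → Sub R.toSubring Γ → Ret H.Γ₇ R {H.q, H.t}) :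
    ∀ S ∈ blowUp V H.C₁, H.D₇ ζ₀ S := by
  intro S hS Γ hΓ hs
  rcases blowUp_cases H.center₁.link hS with ⟨hV, hn⟩ | ⟨R, hR, ho⟩
  · obtain ⟨σ, hσ, γ, ζ, hsig, h1, -⟩ := h S hV
    exact .inl ⟨fun Γ hΓ hs => hn (h1 Γ hΓ hs).sub, h7 S hV Γ hΓ hs⟩
  · have hs' := hs.mono ho.le
    obtain ⟨σ, hσ, γ, ζ, hsig, h1, -, h2⟩ := h R hR
    rcases h2 with ⟨rfl, rfl⟩ | h2
    swap
    · exact (h2 Γ (.inr hΓ) hs').elim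
    have hk := h1 _ (.inl fun _ _ h => h) ho.sub
    have hσ : σ = H.σ₀ ζ := by rw [σ₀, ← hsig.eq, one_mul]
    subst hσ
    have h0 := hsig.ne_zero
    have hk7 := (h7 R hR Γ hΓ hs').kr
    have hw : ∀ {Γ}, H.Γ₇ ≤ Γ → Γ.rel (H.σ₀ ζ / H.u - 1) 0 := fun hΓ => (unit₇ hζ hΓ).2.2.2
    have hm := ho.mem_of hk h0 H.u_ne hs (one_mem _) (hw hΓ)
    have huR := hk.ring H.u (by simp)
    have hinv := Mx.inv_mem (sub_mem (one_mem _) (mul_mem huR (hV R hR)))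
      (Mx.one_sub_notMem (Mx.mul' (hk.mx H.u (by simp)) (hV R hR)))
    have he : H.e₀ ζ ∈ R.toSubring := by
      rw [e₀, div_eq_mul_inv]
      exact mul_mem huR hinv
    have hm' : H.t / H.e₀ ζ ∈ S.toSubring := by
      rw [div_e₀ hζ]
      exact sub_mem hm (one_mem _)
    refine .inr ⟨ho.le huR, ho.le he, hm', ?_⟩
    refine ho.kr hk h0 H.u_ne hk7 (fun _ _ h => h) hs (one_mem _)
      (hw fun _ _ h => h) (hw hΓ) ?_ ?_ (by rw [← div_e₀ hζ]; exact Spn.gen (by simp))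
    · rintro x (rfl | rfl)
      · exact ⟨ho.le (hk7.ring _ (by simp)), hk7.zero _ (by simp), hΓ _ _ (hk7.zero _ (by simp))⟩
      · rw [div_e₀ hζ] at hm' ⊢
        exact ⟨hm', hw fun _ _ h => h, hw hΓ⟩
    · rintro x (rfl | rfl)
      · exact Spn.gen (by simp)
      · have : H.t = H.e₀ ζ * (H.t / H.e₀ ζ) := by rw [mul_div_cancel₀ _ (e₀_ne hζ)]
        exact (congrArg (· ∈ Spn _ _) this).mpr (Spn.mul (ho.le he) (Spn.gen (by simp)))

/-- Over the first centre, the places above the second centre have `σ₀ / u = 0`, while `u / σ₀` is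
regular at the points of the fifth. So the two do not meet. -/
lemma D₅.persist (hl : Link C Γ') (hΓ' : H.Second Γ') (h : ∀ R ∈ V, H.D₅ ζ₀ R) :
    ∀ S ∈ blowUp V C, H.D₅ ζ₀ S := by
  intro S hS Γ hΓ hs
  rcases blowUp_cases hl hS with ⟨hV, -⟩ | ⟨R, hR, ho⟩
  · exact h S hV Γ hΓ hs
  · obtain ⟨e, -, he, -⟩ := h R hR Γ hΓ (hs.mono ho.le)
    have hsig := sig₀ (H := H) hζ
    rcases he with ⟨-, he⟩ | ⟨-, he, -⟩
    · exact (he _ hΓ'.first ho.sub).elim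
    · exact (not_mem_inv (hsig.rel_div hΓ') hsig.div_ne (by rw [inv_div]; exact ho.sub _ he)).elim

/-- A point of both centres would have `σ₀ / u` congruent to `0` and to `1`. -/
lemma D₇.persist (hl : Link C Γ') (hΓ' : H.Second Γ') (h : ∀ R ∈ V, H.D₇ ζ₀ R) :
    ∀ S ∈ blowUp V C, H.D₇ ζ₀ S := by
  intro S hS Γ hΓ hs
  rcases blowUp_cases hl hS with ⟨hV, -⟩ | ⟨R, hR, ho⟩
  · exact h S hV Γ hΓ hs
  · have hsig := sig₀ (H := H) hζ
    rcases h R hR Γ hΓ (hs.mono ho.le) with ⟨he, -⟩ | ⟨-, -, he, -⟩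
    · exact (he _ hΓ'.first ho.sub).elim
    · have h1 : H.σ₀ ζ₀ / H.u - 1 ∈ Mx R := by
        refine (hs.mono ho.le).mx ?_ (unit₇ hζ hΓ).2.2.2
        rwa [← div_e₀ hζ]
      have h2 : H.σ₀ ζ₀ / H.u ∈ Mx R := by
        refine ho.sub.mx ?_ (hsig.rel_div hΓ')
        simpa using add_mem (Mx.mem h1) (one_mem R.toSubring)
      exact (Mx.one_notMem (R := R) (by simpa using Mx.sub h2 h1)).elim

/-- The fifth chain is transverse to the seventh centre off the first centre. Over the first centre
the values of `u / σ₀` are `0` and `1` respectively, so there they are disjoint. -/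
lemma D₇.over {e f g : K} (ho : Over Γ' R S) (hΓ' : H.Γ₅ ≤ Γ')
    (he : e = 1 ∧ H.Off R ∨ e = H.σ₀ ζ₀ ∧ H.u / H.σ₀ ζ₀ ∈ R.toSubring ∧ H.t ∈ R.toSubring)
    (hk : Kr Γ' R {f, g}) (hf : f ≠ 0) (hg : g ≠ 0)
    (hfix : e = 1 → H.Γ₇.rel (f / g) (f / g)) (h : H.D₇ ζ₀ R) : H.D₇ ζ₀ S := by
  intro Γ hΓ hs
  have hsig := sig₀ (H := H) hζ
  obtain ⟨r1, r2, r3, r4⟩ := unit₅ hζ hΓ'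
  obtain ⟨s1, s2, s3, s4⟩ := unit₇ hζ hΓ
  rcases h Γ hΓ (hs.mono ho.le) with ⟨h1, h2⟩ | ⟨-, -, h1, -⟩
  · rcases he with ⟨h3, h4⟩ | ⟨-, h3, -⟩
    · exact .inl ⟨h1.mono ho.le, ho.ret hk hf hg h2 hs (fun g hg => hΓ _ _ (h2.zero g hg)) (hfix h3)⟩
    · have h4 : H.u / H.σ₀ ζ₀ ∈ Mx R := ho.sub.mx h3 (by
        rw [div_eq_mul_inv]
        exact rel_mul_mem r1 r4.inv.mem)
      have h5 : Γ.rel (1 - H.u / H.σ₀ ζ₀) 0 := by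
        have := Γ.inv (Γ.add s4 Place.one) (by simp)
        rw [sub_add_cancel, inv_div] at this
        simpa using Place.sub Place.one this
      have h6 := (hs.mono ho.le).mx (sub_mem (one_mem _) h3) h5
      exact (Mx.one_notMem (R := R) (by simpa using Mx.add h6 h4)).elim
  · refine (not_mem_inv (x := H.e₀ ζ₀ / H.t) ?_ (div_ne_zero (e₀_ne hζ) H.t_ne)
      (by rw [inv_div]; exact ho.sub _ h1)).elim
    rw [e₀, div_div, div_eq_mul_inv]
    exact rel_mul_mem r1 (r3.mul r2).inv.mem

end

/-! ### From the fifth centre to the sixth and from the seventh to the eighth -/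

lemma div_div_w (e x : K) : x / (H.u / e) = e * (x / H.u) := by
  rw [div_div_eq_mul_div, mul_comm, mul_div_assoc]

lemma unit_e₅ (hζ : Param ζ₀) (hΓ : H.Γ₅ ≤ Γ) {e : K} {X Y : Prop}
    (h : e = 1 ∧ X ∨ e = H.σ₀ ζ₀ ∧ Y) : Γ.unit e := by
  rcases h with ⟨rfl, -⟩ | ⟨rfl, -⟩
  exacts [unit_one, (unit₅ hζ hΓ).2.2.2]

lemma unit_e₇ (hζ : Param ζ₀) (hΓ : H.Γ₇ ≤ Γ) {e : K} {Y : Prop}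
    (h : e = 1 ∨ e = H.e₀ ζ₀ ∧ Y) : Γ.unit e := by
  rcases h with rfl | ⟨rfl, -⟩
  exacts [unit_one, (unit₇ hζ hΓ).2.1.div (unit₇ hζ hΓ).2.2.1]

lemma div_eq₅ (e : K) : H.p / (H.u / e) = e * H.w₁ := by rw [div_div_w, w₁_eq]

lemma div_eq₆ (e : K) :
    e * (H.w₁ - const H.α) / (H.u / e) = e ^ 2 * H.w₂ := by
  rw [div_div_w, mul_div_assoc, pow_two, mul_assoc]
  rfl

lemma div_eq₇ (e : K) : H.q / (H.t / e) = e * H.z₁ := by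
  rw [div_div_eq_mul_div, mul_comm, mul_div_assoc, z₁_eq]

lemma div_eq₈ (e : K) :
    e * (H.z₁ - const H.β) / (H.t / e) = e ^ 2 * H.z₂ := by
  rw [z₂, div_div_eq_mul_div, mul_right_comm, ← pow_two, mul_div_assoc]

lemma D₅.six (hζ : Param ζ₀) (hc : Reg V (const H.α)) (h : ∀ R ∈ V, H.D₅ ζ₀ R) :
    ∀ S ∈ blowUp V H.C₅, H.D₆ ζ₀ S := by
  intro S hS Γ hΓ hs
  rcases blowUp_cases H.center₅.link hS with ⟨hV, hn⟩ | ⟨R, hR, ho⟩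
  · obtain ⟨e, -, -, hk⟩ := h S hV Γ (le_trans' le₅₆ hΓ) hs
    exact (hn hk.sub).elim
  · obtain ⟨e, heR, he, hk⟩ := h R hR _ (fun _ _ h => h) ho.sub
    have hu := fun {Γ} hΓ => unit_e₅ (Γ := Γ) hζ hΓ he
    have h0 := (hu (fun _ _ h => h : H.Γ₅ ≤ H.Γ₅)).ne_zero
    -- Rescaling `u` by `e` multiplies the exceptional coordinate by `e`, so the section `w₁ = α`
    -- takes the value `e α`.
    have heq : H.p / (H.u / e) - e * const H.α = e * (H.w₁ - const H.α) := by
      rw [div_eq₅, mul_sub]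
    have hz : ∀ {Γ}, H.Γ₆ ≤ Γ → Γ.rel (e * (H.w₁ - const H.α)) 0 := fun {Γ} hΓ => by
      refine rel_mem_mul ?_ (hu (le_trans' le₅₆ hΓ)).mem
      have := Place.sub (rel₆ hΓ).2.2.2.1 (Γ.const H.α)
      rwa [const, sub_self] at this
    have := ho.chain hk H.p_ne (div_ne_zero H.u_ne h0) le₅₆ hs (mul_mem heR (hc R hR))
      (by rw [heq]; exact hz fun _ _ h => h) (by rw [heq]; exact hz hΓ)
      (le_trans' le₅₆ hΓ _ _ (hk.zero _ (by simp)))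
    rw [heq] at this
    refine ⟨e, ho.le heR, ?_, this⟩
    exact he.imp (fun h => ⟨h.1, h.2.mono ho.le⟩) fun h => ⟨h.1, ho.le h.2.1, ho.le h.2.2⟩

lemma D₇.eight (hζ : Param ζ₀) (hc : Reg V (const H.β)) (h : ∀ R ∈ V, H.D₇ ζ₀ R) :
    ∀ S ∈ blowUp V H.C₇, H.D₈ ζ₀ S := by
  intro S hS Γ hΓ hs
  rcases blowUp_cases H.center₇.link hS with ⟨hV, hn⟩ | ⟨R, hR, ho⟩
  · rcases h S hV Γ (le_trans' le₇₈ hΓ) hs with ⟨-, hk⟩ | ⟨-, -, -, hk⟩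
    exacts [(hn hk.kr.sub).elim, (hn hk.sub).elim]
  · obtain ⟨e, heR, he, hk⟩ : ∃ e ∈ R.toSubring, (e = 1 ∨ e = H.e₀ ζ₀ ∧ H.u ∈ R.toSubring) ∧
        Kr H.Γ₇ R {H.q, H.t / e} := by
      rcases h R hR _ (fun _ _ h => h) ho.sub with ⟨-, hk⟩ | ⟨h1, h2, -, hk⟩
      exacts [⟨1, one_mem _, .inl rfl, by simpa using hk.kr⟩, ⟨_, h2, .inr ⟨rfl, h1⟩, hk⟩]
    have hu := fun {Γ} hΓ => unit_e₇ (Γ := Γ) hζ hΓ he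
    have h0 := (hu (fun _ _ h => h : H.Γ₇ ≤ H.Γ₇)).ne_zero
    have heq : H.q / (H.t / e) - e * const H.β = e * (H.z₁ - const H.β) := by
      rw [div_eq₇, mul_sub]
    have hz : ∀ {Γ}, H.Γ₈ ≤ Γ → Γ.rel (e * (H.z₁ - const H.β)) 0 := fun {Γ} hΓ => by
      refine rel_mem_mul ?_ (hu (le_trans' le₇₈ hΓ)).mem
      have := Place.sub (rel₈ hΓ).2.2.1 (Γ.const H.β)
      rwa [const, sub_self] at this
    have := ho.chain hk H.q_ne (div_ne_zero H.t_ne h0) le₇₈ hs (mul_mem heR (hc R hR))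
      (by rw [heq]; exact hz fun _ _ h => h) (by rw [heq]; exact hz hΓ)
      (le_trans' le₇₈ hΓ _ _ (hk.zero _ (by simp)))
    rw [heq] at this
    exact ⟨e, ho.le heR, he.imp_right fun h => ⟨h.1, ho.le h.2⟩, this⟩

/-- Residues of the coordinates on the fifth and sixth exceptional divisors. -/
lemma fix_w (hu : Γ.rel H.u H.u) (hp : Γ.rel H.p H.p) : Γ.rel H.w₁ H.w₁ ∧ Γ.rel H.w₂ H.w₂ := by
  have h1 : Γ.rel H.w₁ H.w₁ := Place.div (Place.sub hp Place.zero) hu H.u_ne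
  exact ⟨h1, Place.div (Place.sub h1 (Γ.const _)) hu H.u_ne⟩

/-- Residues of the coordinates on the seventh and eighth exceptional divisors. -/
lemma fix_z (ht : Γ.rel H.t H.t) (hq : Γ.rel H.q H.q) : Γ.rel H.z₁ H.z₁ ∧ Γ.rel H.z₂ H.z₂ := by
  have h1 : Γ.rel H.z₁ H.z₁ := Place.div (Place.sub hq Place.zero) ht H.t_ne
  exact ⟨h1, Place.div (Place.sub h1 (Γ.const _)) ht H.t_ne⟩

lemma w₁_ne : H.w₁ - const H.α ≠ 0 := H.center₆.fst

lemma z₁_ne : H.z₁ - const H.β ≠ 0 := H.center₈.fst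

lemma D₇.five (hζ : Param ζ₀) (h5 : ∀ R ∈ V, H.D₅ ζ₀ R) (h : ∀ R ∈ V, H.D₇ ζ₀ R) :
    ∀ S ∈ blowUp V H.C₅, H.D₇ ζ₀ S := by
  intro S hS
  rcases blowUp_cases H.center₅.link hS with ⟨hV, -⟩ | ⟨R, hR, ho⟩
  · exact h S hV
  · obtain ⟨e, -, he, hk⟩ := h5 R hR _ (fun _ _ h => h) ho.sub
    have h0 := (unit_e₅ hζ (fun _ _ h => h : H.Γ₅ ≤ H.Γ₅) he).ne_zero
    refine D₇.over hζ ho (fun _ _ h => h) he hk H.p_ne (div_ne_zero H.u_ne h0) ?_ (h R hR)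
    rintro rfl
    obtain ⟨r1, -, -, r2, -⟩ := rel₇ (fun _ _ h => h : H.Γ₇ ≤ H.Γ₇)
    rw [div_eq₅, one_mul]
    exact (fix_w (H.Γ₇.inv r1 H.Q_ne) r2).1

lemma D₇.six (hζ : Param ζ₀) (h6 : ∀ R ∈ V, H.D₆ ζ₀ R) (h : ∀ R ∈ V, H.D₇ ζ₀ R) :
    ∀ S ∈ blowUp V H.C₆, H.D₇ ζ₀ S := by
  intro S hS
  rcases blowUp_cases H.center₆.link hS with ⟨hV, -⟩ | ⟨R, hR, ho⟩
  · exact h S hV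
  · obtain ⟨e, -, he, hk⟩ := h6 R hR _ (fun _ _ h => h) ho.sub
    have h0 := (unit_e₅ hζ (fun _ _ h => h : H.Γ₅ ≤ H.Γ₅) he).ne_zero
    refine D₇.over hζ ho le₅₆ he hk (mul_ne_zero h0 w₁_ne) (div_ne_zero H.u_ne h0) ?_ (h R hR)
    rintro rfl
    obtain ⟨r1, -, -, r2, -⟩ := rel₇ (fun _ _ h => h : H.Γ₇ ≤ H.Γ₇)
    rw [div_eq₆, one_pow, one_mul]
    exact (fix_w (H.Γ₇.inv r1 H.Q_ne) r2).2

end Half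

end PainleveFlow

/-!
# Divisorial places after the eight blow-ups of a half of the second family
-/

namespace PainleveFlow

open Place MvPolynomial

namespace Half

/-- The conditions for the eight blow-ups on the original space. -/
structure Input (H : Half) (ζ₀ : K) (T : Set K) (D : Subring K → K → Prop)
    (V : Set (LocalSubring K)) : Prop where
  param : Param ζ₀
  mono : ∀ A B d, A ≤ B → D A d → D B d
  reg : Reg V ζ₀
  const : ∀ c, Reg V (const c)
  one : ∀ R ∈ V, H.D₁ ζ₀ T D R
  five : ∀ R ∈ V, ∀ Γ, H.Γ₅ ≤ Γ → Sub R.toSubring Γ → Kr H.Γ₅ R {H.p, H.u}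
  seven : ∀ R ∈ V, ∀ Γ, H.Γ₇ ≤ Γ → Sub R.toSubring Γ → Ret H.Γ₇ R {H.q, H.t}

variable (H : Half) (V : Set (LocalSubring K))

/-- The first blow-up. -/
def V₁ : Set (LocalSubring K) := blowUp V H.C₁
/-- The first two blow-ups. -/
def V₂ : Set (LocalSubring K) := blowUp (H.V₁ V) H.C₂
/-- The first three blow-ups. -/
def V₃ : Set (LocalSubring K) := blowUp (H.V₂ V) H.C₃
/-- The first four blow-ups. -/
def V₄ : Set (LocalSubring K) := blowUp (H.V₃ V) H.C₄
/-- The first five blow-ups. -/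
def V₅ : Set (LocalSubring K) := blowUp (H.V₄ V) H.C₅
/-- The first six blow-ups. -/
def V₆ : Set (LocalSubring K) := blowUp (H.V₅ V) H.C₆
/-- The first seven blow-ups. -/
def V₇ : Set (LocalSubring K) := blowUp (H.V₆ V) H.C₇
/-- The eight blow-ups. -/
def V₈ : Set (LocalSubring K) := blowUp (H.V₇ V) H.C₈

/-- The eight centres. -/
noncomputable def centers : List Subvariety := [H.C₁, H.C₂, H.C₃, H.C₄, H.C₅, H.C₆, H.C₇, H.C₈]

/-- The eight exceptional divisors, the last one first. -/
noncomputable def divisors : List (Place K) := [H.E₈, H.E₇, H.E₆, H.E₅, H.E₄, H.E₃, H.E₂, H.E₁]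

lemma divisors_arch : ∀ E ∈ H.divisors, E.Arch := by
  intro E hE
  simp only [divisors, List.mem_cons, List.not_mem_nil, or_false] at hE
  rcases hE with rfl | rfl | rfl | rfl | rfl | rfl | rfl | rfl
  all_goals exact dvs_arch

variable {H V} {ζ₀ : K} {T : Set K} {D : Subring K → K → Prop}

lemma reg_V {x : K} (h : Reg V x) : Reg (H.V₁ V) x ∧ Reg (H.V₂ V) x ∧ Reg (H.V₃ V) x ∧
    Reg (H.V₄ V) x ∧ Reg (H.V₅ V) x ∧ Reg (H.V₆ V) x ∧ Reg (H.V₇ V) x ∧ Reg (H.V₈ V) x := by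
  have h1 := h.blowUp H.center₁.link
  have h2 := h1.blowUp H.center₂.link
  have h3 := h2.blowUp H.center₃.link
  have h4 := h3.blowUp H.center₄.link
  have h5 := h4.blowUp H.center₅.link
  have h6 := h5.blowUp H.center₆.link
  have h7 := h6.blowUp H.center₇.link
  exact ⟨h1, h2, h3, h4, h5, h6, h7, h7.blowUp H.center₈.link⟩

lemma crd_V {x : K} (h : Crd V x) : Crd (H.V₁ V) x ∧ Crd (H.V₂ V) x ∧ Crd (H.V₃ V) x ∧
    Crd (H.V₄ V) x ∧ Crd (H.V₅ V) x ∧ Crd (H.V₆ V) x ∧ Crd (H.V₇ V) x ∧ Crd (H.V₈ V) x := by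
  have h1 := h.blowUp H.center₁.link
  have h2 := h1.blowUp H.center₂.link
  have h3 := h2.blowUp H.center₃.link
  have h4 := h3.blowUp H.center₄.link
  have h5 := h4.blowUp H.center₅.link
  have h6 := h5.blowUp H.center₆.link
  have h7 := h6.blowUp H.center₇.link
  exact ⟨h1, h2, h3, h4, h5, h6, h7, h7.blowUp H.center₈.link⟩

/-- Generators of the ideals of all centres. -/
structure Output (H : Half) (ζ₀ : K) (T : Set K) (D : Subring K → K → Prop)
    (V : Set (LocalSubring K)) : Prop where
  two : ∀ R ∈ H.V₁ V, H.D₂ T D R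
  three : ∀ R ∈ H.V₂ V, H.D₃ T D R
  four : ∀ R ∈ H.V₃ V, H.D₄ R
  five : ∀ R ∈ H.V₄ V, H.D₅ ζ₀ R
  six : ∀ R ∈ H.V₅ V, H.D₆ ζ₀ R
  seven : ∀ R ∈ H.V₆ V, H.D₇ ζ₀ R
  eight : ∀ R ∈ H.V₇ V, H.D₈ ζ₀ R

/-- Each centre is followed from the stage where its generators are first known: the fifth and
seventh pass unharmed through the second, third and fourth blow-ups, and the seventh also through
the fifth and sixth. -/
lemma Input.output (h : H.Input ζ₀ T D V) : H.Output ζ₀ T D V := by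
  have h2 := d₂ h.mono h.one
  have h3 := d₃ h.mono h2
  have h4 := d₄ (reg_V (H := H) (h.const H.a₀)).2.1 h3
  have h5 := d₅ h.param h.reg h.one h.five
  have h7 := d₇ h.param h.reg h.one h.seven
  have s2 : H.Second H.Γ₂ := .inl fun _ _ h => h
  have s3 : H.Second H.Γ₃ := second_of_three fun _ _ h => h
  have s4 : H.Second H.Γ₄ := second_of_three le₃₄
  have h5' := D₅.persist h.param H.center₄.link s4 (D₅.persist h.param H.center₃.link s3
    (D₅.persist h.param H.center₂.link s2 h5))
  have h7' := D₇.persist h.param H.center₄.link s4 (D₇.persist h.param H.center₃.link s3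
    (D₇.persist h.param H.center₂.link s2 h7))
  have h6 := D₅.six h.param (reg_V (H := H) (h.const H.α)).2.2.2.1 h5'
  have h7'' := D₇.six h.param h6 (D₇.five h.param h5' h7')
  exact ⟨h2, h3, h4, h5', h6, h7'',
    D₇.eight h.param (reg_V (H := H) (h.const H.β)).2.2.2.2.2.1 h7''⟩

variable {δ : Derivation ℂ K K} {𝒟 : List (Place K)}

/-- The divisors along which the vector field can have poles. -/
theorem Input.good (h : H.Input ζ₀ T D V) (hD : ∀ E ∈ 𝒟, E.Arch)
    (hV : ∀ R ∈ V, Good δ 𝒟 R.toSubring) :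
    ∀ S ∈ H.V₈ V, Good δ (H.divisors ++ 𝒟) S.toSubring := by
  have ho := h.output
  have hu := H.u_ne
  have hid : ∀ Γ : Place K, Γ ≤ Γ := fun _ _ _ h => h
  have ar : ∀ {E : Place K} {𝒟 : List (Place K)}, E.Arch → (∀ E ∈ 𝒟, E.Arch) →
      ∀ E' ∈ E :: 𝒟, E'.Arch := fun h1 h2 => List.forall_mem_cons.2 ⟨h1, h2⟩
  have g1 := H.center₁.good_of (V := V) (fun R hR hs => by
    obtain ⟨σ, -, γ, ζ, hsig, h1, -⟩ := h.one R hR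
    have hF : H.First H.Γ₁ := .inl (hid _)
    refine ⟨_, _, (1 - H.u * ζ) / γ, 1 / γ, hsig.ne_zero, hu, h1 _ hF hs,
      (hsig.unit_sub hF).div (hsig.unit _ hF), (unit_one.div (hsig.unit _ hF)).mem, ?_⟩
    rw [hsig.div_eq]
    rfl) hD hV
  have a1 := ar H.center₁.arch hD
  have g2 := H.center₂.good_of (V := H.V₁ V) (fun R hR hs => by
    obtain ⟨σ, -, γ, ζ, hsig, h1, -⟩ := ho.two R hR
    have hS : H.Second H.Γ₂ := .inl (hid _)
    refine ⟨_, _, (1 - H.u * ζ) / γ, ζ / γ, hsig.div_ne, hu, h1 _ hS hs,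
      (hsig.unit_sub hS.first).div (hsig.unit _ hS.first), ?_, ?_⟩
    · rw [div_eq_mul_inv]
      exact mul_mem (hsig.int _ hS.first) (hsig.unit _ hS.first).inv.mem
    · rw [hsig.div_div_eq]
      rfl) a1 g1
  have a2 := ar H.center₂.arch a1
  have g3 := H.center₃.good_of (V := H.V₂ V) (fun R hR hs => by
    obtain ⟨g, κ, d, e1, -, -, e2, e3, -, -, hk⟩ := ho.three R hR _ (hid _) hs
    exact ⟨_, _, d * κ, 0, mul_ne_zero e3.ne_zero s_ne, (ne_of_mul_eq e1).2, hk,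
      (e3.up le_W_₃).mul (e2 _ (hid _)), zero_mem _, by rw [mul_s_div e1, add_zero]; rfl⟩) a2 g2
  have a3 := ar H.center₃.arch a2
  have g4 := H.center₄.good_of (V := H.V₃ V) (fun R hR hs => by
    obtain ⟨g, κ, d, e1, e2, e3, hk⟩ := ho.four R hR _ (hid _) hs
    obtain ⟨k0, g0⟩ := ne_of_mul_eq e1
    have hv : H.v₃ + PainleveFlow.const H.a₀ ≠ 0 := by
      simpa using H.center₄.fst
    exact ⟨_, _, d * κ ^ 2, 0, mul_ne_zero (mul_ne_zero e3.ne_zero k0) hv, g0, hk,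
      (e3.up (le_trans' le_W_₃ le₃₄)).mul ((e2 _ le₃₄).pow 2), zero_mem _,
      by rw [mul_v₃_div e1, add_zero]; rfl⟩) a3 g3
  have a4 := ar H.center₄.arch a3
  have g5 := H.center₅.good_of (V := H.V₄ V) (fun R hR hs => by
    obtain ⟨e, -, he, hk⟩ := ho.five R hR _ (hid _) hs
    have h1 := unit_e₅ h.param (hid H.Γ₅) he
    exact ⟨_, _, e, 0, H.p_ne, div_ne_zero hu h1.ne_zero, hk, h1, zero_mem _,
      by rw [div_eq₅, add_zero]; rfl⟩) a4 g4
  have a5 := ar H.center₅.arch a4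
  have g6 := H.center₆.good_of (V := H.V₅ V) (fun R hR hs => by
    obtain ⟨e, -, he, hk⟩ := ho.six R hR _ (hid _) hs
    have h1 := unit_e₅ h.param le₅₆ he
    exact ⟨_, _, e ^ 2, 0, mul_ne_zero h1.ne_zero w₁_ne, div_ne_zero hu h1.ne_zero, hk, h1.pow 2,
      zero_mem _, by rw [div_eq₆, add_zero]; rfl⟩) a5 g5
  have a6 := ar H.center₆.arch a5
  have g7 := H.center₇.good_of (V := H.V₆ V) (fun R hR hs => by
    obtain ⟨e, he, hk⟩ : ∃ e, (e = 1 ∨ e = H.e₀ ζ₀ ∧ True) ∧ Kr H.Γ₇ R {H.q, H.t / e} := by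
      rcases ho.seven R hR _ (hid _) hs with ⟨-, hk⟩ | ⟨-, -, -, hk⟩
      exacts [⟨1, .inl rfl, by simpa using hk.kr⟩, ⟨_, .inr ⟨rfl, trivial⟩, hk⟩]
    have h1 := unit_e₇ h.param (hid H.Γ₇) he
    exact ⟨_, _, e, 0, H.q_ne, div_ne_zero H.t_ne h1.ne_zero, hk, h1, zero_mem _,
      by rw [div_eq₇, add_zero]; rfl⟩) a6 g6
  have a7 := ar H.center₇.arch a6
  exact H.center₈.good_of (V := H.V₇ V) (fun R hR hs => by
    obtain ⟨e, -, he, hk⟩ := ho.eight R hR _ (hid _) hs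
    have h1 := unit_e₇ h.param le₇₈ he
    exact ⟨_, _, e ^ 2, 0, mul_ne_zero h1.ne_zero z₁_ne, div_ne_zero H.t_ne h1.ne_zero, hk,
      h1.pow 2, zero_mem _, by rw [div_eq₈, add_zero]; rfl⟩) a7 g7

end Half

end PainleveFlow

/-!
# The two halves of the second family
-/

namespace PainleveFlow

open Place MvPolynomial

namespace Half

/-- The local rings of `(ℙ¹)⁴` in the coordinates of the half. -/
structure Flat (H : Half) : Prop where
  crd_Q : Crd projLines H.Q
  crd_P : Crd projLines H.P
  crd_q : Crd projLines H.q
  crd_p : Crd projLines H.p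
  ret : ∀ {R}, R ∈ projLines → ∀ {Γ : Place K} {G : Set K}, (∀ g ∈ G, g ∈ Mx R) →
    (∀ g ∈ G, Γ.rel g 0) → (Cg Γ R G H.Q ∧ Cg Γ R G H.Q⁻¹) → (Cg Γ R G H.P ∧ Cg Γ R G H.P⁻¹) →
    (Cg Γ R G H.q ∧ Cg Γ R G H.q⁻¹) → (Cg Γ R G H.p ∧ Cg Γ R G H.p⁻¹) → Γ.rel b₁ b₁ →
    Γ.rel b₂ b₂ → Ret Γ R G

/-- The factor that makes the equation `q + p = b` regular. -/
def Clears (H : Half) (A : Subring K) (d : K) : Prop :=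
  d = 1 ∧ H.q ∈ A ∧ H.p ∈ A ∨ d = H.q⁻¹ * H.p⁻¹ ∧ H.q⁻¹ ∈ A ∧ H.p⁻¹ ∈ A

variable {H : Half} {Γ : Place K} {R : LocalSubring K}

lemma b_sub_ne : H.b - H.q ≠ 0 := by
  intro h
  have hi := H.gen.algebraicIndependent.injective
  have h1 : H.b = H.q := sub_eq_zero.1 h
  rcases H.hb with h2 | h2
  · exact absurd (hi (a₁ := 4) (a₂ := 2) (h2.symm.trans h1)) (by decide)
  · exact absurd (hi (a₁ := 5) (a₂ := 2) (h2.symm.trans h1)) (by decide)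

lemma unit_W (hΓ : H.W ≤ Γ) : Γ.unit H.q ∧ Γ.unit H.p :=
  ⟨unit_of_fix (rel_W hΓ).2.2.1 H.q_ne, ⟨_, (rel_W hΓ).2.2.2.1, b_sub_ne⟩⟩

lemma rel_s (hΓ : H.W ≤ Γ) : Γ.rel H.s 0 := by
  obtain ⟨-, -, h1, h2, h3, h4⟩ := rel_W hΓ
  have := Place.sub h2 (Place.sub (rel_b (H := H) h3 h4) h1)
  rwa [sub_self] at this

lemma Cg.both_zero {G : Set K} {x : K} (h0 : x ≠ 0) (hx : x ∈ G) (hG : ∀ g ∈ G, g ∈ Mx R)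
    (hz : Γ.rel x 0) : Cg Γ R G x ∧ Cg Γ R G x⁻¹ :=
  ⟨Cg.gen hx hz, Cg.absurd (inv_ne_zero h0) (by rw [inv_inv]; exact hG _ hx)⟩

lemma Cg.both_fix {G : Set K} {x : K} (h : Γ.rel x x) : Cg Γ R G x ∧ Cg Γ R G x⁻¹ :=
  ⟨Cg.fix h, Cg.fix (Γ.fixed.inv_mem h)⟩

lemma Cg.both_inf {G : Set K} {x : K} (h0 : x ≠ 0) (hx : x⁻¹ ∈ G) (hG : ∀ g ∈ G, g ∈ Mx R)
    (hz : Γ.rel x⁻¹ 0) : Cg Γ R G x ∧ Cg Γ R G x⁻¹ := by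
  have := both_zero (inv_ne_zero h0) hx hG hz
  rw [inv_inv] at this
  exact this.symm

namespace Flat

variable (h : H.Flat)
include h

lemma mx_ut (hR : R ∈ projLines) (hΓ : H.First Γ) (hs : Sub R.toSubring Γ) :
    H.u ∈ Mx R ∧ H.t ∈ Mx R := by
  obtain ⟨h1, h2, -⟩ := hΓ.rel
  exact ⟨h.crd_Q.inv.mx hR hs h1 H.u_ne, h.crd_P.inv.mx hR hs h2 H.t_ne⟩

lemma ret₁ (hR : R ∈ projLines) (hΓ : H.First Γ) (hs : Sub R.toSubring Γ) :
    Ret H.Γ₁ R {H.t, H.u} := by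
  obtain ⟨hu, ht⟩ := h.mx_ut hR hΓ hs
  obtain ⟨h1, h2, h3, h4, h5, h6⟩ := rel₁ (fun _ _ h => h : H.Γ₁ ≤ H.Γ₁)
  have hG : ∀ g ∈ ({H.t, H.u} : Set K), g ∈ Mx R := by
    rintro g (rfl | rfl) <;> assumption
  refine h.ret hR hG ?_ (Cg.both_inf H.Q_ne (.inr rfl) hG h1)
    (Cg.both_inf H.P_ne (.inl rfl) hG h2) (Cg.both_fix h3) (Cg.both_fix h4) h5 h6
  rintro g (rfl | rfl) <;> assumption

/-- On the closure of `q + p = b` either `q` and `p` are both finite, and `s` itself is the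
equation, or both are infinite, and `q⁻¹ p⁻¹ s` is. The two cases are the two alternatives of
`Clears`. -/
lemma ret_W (hR : R ∈ projLines) (hΓ : H.W ≤ Γ) (hs : Sub R.toSubring Γ) :
    ∃ d ∈ R.toSubring, H.W.unit d ∧ H.Clears R.toSubring d ∧ Ret H.W R {H.t, H.u, d * H.s} := by
  obtain ⟨hu, ht⟩ := h.mx_ut hR (.inr hΓ) hs
  have hid : H.W ≤ H.W := fun _ _ h => h
  obtain ⟨h1, h2, h3, h4, h5, h6⟩ := rel_W hid
  obtain ⟨k1, k2⟩ := unit_W hid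
  have hq := H.q_ne
  have hp := H.p_ne
  have hb : H.b ∈ R.toSubring := H.b_mem (reg_b₁ R hR) (reg_b₂ R hR)
  have hsΓ := rel_s hΓ
  have key : ∀ d, H.W.unit d → d * H.s ∈ Mx R →
      (Cg H.W R {H.t, H.u, d * H.s} H.p ∧ Cg H.W R {H.t, H.u, d * H.s} H.p⁻¹) →
      Ret H.W R {H.t, H.u, d * H.s} := by
    intro d hd hds hcg
    have hG : ∀ g ∈ ({H.t, H.u, d * H.s} : Set K), g ∈ Mx R := by
      rintro g (rfl | rfl | rfl) <;> assumption
    refine h.ret hR hG ?_ (Cg.both_inf H.Q_ne (.inr (.inl rfl)) hG h1)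
      (Cg.both_inf H.P_ne (.inl rfl) hG h2) (Cg.both_fix h3) hcg h5 h6
    rintro g (rfl | rfl | rfl)
    exacts [h2, h1, rel_mem_mul (rel_s hid) hd.mem]
  by_cases hqp : H.q ∈ R.toSubring ∧ H.p ∈ R.toSubring
  · obtain ⟨hqR, hpR⟩ := hqp
    have hbq := sub_mem hb hqR
    have hsR : H.s ∈ Mx R := hs.mx (sub_mem hpR hbq) hsΓ
    refine ⟨1, one_mem _, unit_one, .inl ⟨rfl, hqR, hpR⟩, key 1 unit_one (by simpa using hsR) ?_⟩
    rw [one_mul]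
    refine ⟨fun _ => ⟨H.b - H.q, hbq, h4, Spn.gen (by simp [s_eq])⟩, fun hx => ?_⟩
    have hbu : H.b - H.q ∉ Mx R := by
      refine Mx.notMem_of_sub (y := H.p) ?_ (Mx.notMem_of_inv hp hx)
      simpa [s_eq] using Mx.neg hsR
    have hbi := Mx.inv_mem hbq hbu
    refine ⟨(H.b - H.q)⁻¹, hbi, H.W.inv h4 b_sub_ne, ?_⟩
    have : H.p⁻¹ - (H.b - H.q)⁻¹ = -(H.p⁻¹ * (H.b - H.q)⁻¹) * H.s := by
      have := b_sub_ne (H := H)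
      rw [s_eq]
      field_simp
      ring
    rw [this]
    exact Spn.mul (neg_mem (mul_mem hx hbi)) (Spn.gen (by simp))
  -- Exactly one of `q`, `p` infinite is impossible: if it is `q`, then `q⁻¹ s = 1 - q⁻¹ (b - p)` is
  -- a unit, although its residue is zero. The case of `p` is symmetric.
  · have hx : H.q⁻¹ ∈ Mx R ∧ H.p⁻¹ ∈ Mx R := by
      have a1 : H.p ∈ R.toSubring → H.q⁻¹ ∈ Mx R → False := fun hpR hx => by
        have e : H.q⁻¹ * H.s = 1 - H.q⁻¹ * (H.b - H.p) := by
          rw [s_eq]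
          field_simp
          ring
        have hm := sub_mem (one_mem R.toSubring) (mul_mem (Mx.mem hx) (sub_mem hb hpR))
        rw [← e] at hm
        have h1 := hs.mx hm (rel_mem_mul hsΓ (unit_W hΓ).1.inv.mem)
        rw [e] at h1
        exact Mx.one_sub_notMem (Mx.mul' hx (sub_mem hb hpR)) h1
      have a2 : H.q ∈ R.toSubring → H.p⁻¹ ∈ Mx R → False := fun hqR hx => by
        have e : H.p⁻¹ * H.s = 1 - H.p⁻¹ * (H.b - H.q) := by
          rw [s_eq]
          field_simp
        have hm := sub_mem (one_mem R.toSubring) (mul_mem (Mx.mem hx) (sub_mem hb hqR))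
        rw [← e] at hm
        have h1 := hs.mx hm (rel_mem_mul hsΓ (unit_W hΓ).2.inv.mem)
        rw [e] at h1
        exact Mx.one_sub_notMem (Mx.mul' hx (sub_mem hb hqR)) h1
      have b1 : H.q ∈ R.toSubring ∨ H.q⁻¹ ∈ Mx R := by
        by_contra! hc
        rcases h.crd_q R hR with h | h
        · exact hc.1 h
        · exact hc.1 (by simpa using Mx.inv_mem h hc.2)
      have b2 : H.p ∈ R.toSubring ∨ H.p⁻¹ ∈ Mx R := by
        by_contra! hc
        rcases h.crd_p R hR with h | h
        · exact hc.1 h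
        · exact hc.1 (by simpa using Mx.inv_mem h hc.2)
      rcases b1 with b1 | b1 <;> rcases b2 with b2 | b2
      exacts [(hqp ⟨b1, b2⟩).elim, (a2 b1 b2).elim, (a1 b2 b1).elim, ⟨b1, b2⟩]
    obtain ⟨hx, hy⟩ := hx
    have hd := mul_mem (Mx.mem hx) (Mx.mem hy)
    have hdu := k1.inv.mul k2.inv
    have e : H.q⁻¹ * H.p⁻¹ * H.s = H.q⁻¹ + H.p⁻¹ - H.b * H.q⁻¹ * H.p⁻¹ := by
      rw [s_eq]
      field_simp
      ring
    have hds : H.q⁻¹ * H.p⁻¹ * H.s ∈ Mx R := by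
      rw [e]
      exact Mx.sub (Mx.add hx hy) (Mx.mul (mul_mem hb (Mx.mem hx)) hy)
    refine ⟨_, hd, hdu, .inr ⟨rfl, Mx.mem hx, Mx.mem hy⟩, key _ hdu hds
      ⟨Cg.absurd hp hy, fun _ => ⟨(H.b - H.q)⁻¹, ?_⟩⟩⟩
    have hbq := b_sub_ne (H := H)
    -- Where both coordinates are infinite the residue of `p⁻¹` is `1 / (b - q)`, rewritten with
    -- `q⁻¹` to show that it belongs to the ring.
    have e2 : (H.b - H.q)⁻¹ = -(H.q⁻¹ * (1 - H.q⁻¹ * H.b)⁻¹) := by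
      have h1 : 1 - H.q⁻¹ * H.b = -(H.b - H.q) * H.q⁻¹ := by field_simp; ring
      rw [h1]
      field_simp
    have hi := Mx.inv_mem (sub_mem (one_mem _) (mul_mem (Mx.mem hx) hb))
      (Mx.one_sub_notMem (Mx.mul' hx hb))
    refine ⟨by rw [e2]; exact neg_mem (mul_mem (Mx.mem hx) hi), H.W.inv h4 hbq, ?_⟩
    have e3 : H.p⁻¹ - (H.b - H.q)⁻¹ = (1 - H.q⁻¹ * H.b)⁻¹ * (H.q⁻¹ * H.p⁻¹ * H.s) := by
      have h1 : 1 - H.q⁻¹ * H.b = -(H.b - H.q) * H.q⁻¹ := by field_simp; ring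
      rw [h1, s_eq]
      field_simp
      ring
    rw [e3]
    exact Spn.mul hi (Spn.gen (by simp))

lemma retOn {G : Set K} (hG : ∀ g ∈ G, Γ.rel g 0 ∧ g ≠ 0 ∧ Crd projLines g) (h1 : Std Γ G H.Q)
    (h2 : Std Γ G H.P) (h3 : Std Γ G H.q) (h4 : Std Γ G H.p) (h5 : Γ.rel b₁ b₁)
    (h6 : Γ.rel b₂ b₂) : RetOn projLines Γ G := by
  intro R hR Γ' hΓ hs
  have hM : ∀ g ∈ G, g ∈ Mx R := fun g hg =>
    (hG g hg).2.2.mx hR hs (hΓ _ _ (hG g hg).1) (hG g hg).2.1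
  have key : ∀ {x : K}, x ≠ 0 → Std Γ G x → Cg Γ R G x ∧ Cg Γ R G x⁻¹ := by
    rintro x hx (h | h | h)
    · exact Cg.both_fix h
    · exact Cg.both_zero hx h hM (hG x h).1
    · exact Cg.both_inf hx h hM (hG _ h).1
  exact h.ret hR hM (fun g hg => (hG g hg).1) (key H.Q_ne h1) (key H.P_ne h2) (key H.q_ne h3)
    (key H.p_ne h4) h5 h6

lemma ret₅ : RetOn projLines H.Γ₅ {H.p, H.u} := by
  obtain ⟨h1, h2, h3, h4, h5, h6⟩ := rel₅ (fun _ _ h => h : H.Γ₅ ≤ H.Γ₅)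
  refine h.retOn ?_ (.inr (.inr (.inr rfl))) (.inl h2) (.inl h3) (.inr (.inl (.inl rfl))) h5 h6
  rintro g (rfl | rfl)
  exacts [⟨h4, H.p_ne, h.crd_p⟩, ⟨h1, H.u_ne, h.crd_Q.inv⟩]

lemma ret₇ : RetOn projLines H.Γ₇ {H.q, H.t} := by
  obtain ⟨h1, h2, h3, h4, h5, h6⟩ := rel₇ (fun _ _ h => h : H.Γ₇ ≤ H.Γ₇)
  refine h.retOn ?_ (.inl h1) (.inr (.inr (.inr rfl))) (.inr (.inl (.inl rfl))) (.inl h4) h5 h6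
  rintro g (rfl | rfl)
  exacts [⟨h3, H.q_ne, h.crd_q⟩, ⟨h2, H.t_ne, h.crd_P.inv⟩]

/-- On `(ℙ¹)⁴` one may take `σ = t + u`, with `γ = 1` and `ζ = 0`. The set `{t + u}` and the
predicate `Clears` preserve the explicit shape of the generators, which the analysis of the second
half needs. -/
theorem input : H.Input 0 {H.t + H.u} H.Clears projLines := by
  refine ⟨.inl rfl, ?_, fun R _ => Subring.zero_mem _, reg_const, fun R hR => ?_,
    fun R hR Γ hΓ hs => (h.ret₅ R hR Γ hΓ hs).kr, h.ret₇⟩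
  · rintro A B d hAB (⟨h1, h2, h3⟩ | ⟨h1, h2, h3⟩)
    exacts [.inl ⟨h1, hAB h2, hAB h3⟩, .inr ⟨h1, hAB h2, hAB h3⟩]
  refine ⟨_, rfl, 1, 0, ⟨by ring, fun _ _ => unit_one, fun Γ _ => zero_mem _⟩, fun Γ hΓ hs => ?_,
    fun Γ hΓ hs => ?_, .inl ⟨rfl, rfl⟩⟩
  · have hk := (h.ret₁ hR hΓ hs).kr
    refine hk.congr ?_ ?_ ?_
    · rintro x (rfl | rfl)
      exacts [add_mem (hk.ring _ (by simp)) (hk.ring _ (by simp)), hk.ring _ (by simp)]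
    · rintro x (rfl | rfl)
      exacts [rel_zero_add (hk.zero _ (by simp)) (hk.zero _ (by simp)), hk.zero _ (by simp)]
    · rintro x (rfl | rfl)
      · have : H.t + H.u - H.u ∈ Spn R.toSubring {H.t + H.u, H.u} :=
          sub_mem (Spn.gen (by simp)) (Spn.gen (by simp))
        rwa [add_sub_cancel_right] at this
      · exact Spn.gen (by simp)
  · obtain ⟨d, hd, h1, h2, h3⟩ := h.ret_W hR hΓ hs
    have hk := h3.kr
    refine ⟨d, hd, h1, h2, hk.congr ?_ ?_ ?_⟩
    · rintro x (rfl | rfl | rfl)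
      exacts [add_mem (hk.ring _ (by simp)) (hk.ring _ (by simp)), hk.ring _ (by simp),
        hk.ring _ (by simp)]
    · rintro x (rfl | rfl | rfl)
      exacts [rel_zero_add (hk.zero _ (by simp)) (hk.zero _ (by simp)), hk.zero _ (by simp),
        hk.zero _ (by simp)]
    · rintro x (rfl | rfl | rfl)
      · have : H.t + H.u - H.u ∈ Spn R.toSubring {H.t + H.u, H.u, d * H.s} :=
          sub_mem (Spn.gen (by simp)) (Spn.gen (by simp))
        rwa [add_sub_cancel_right] at this
      · exact Spn.gen (by simp)
      · exact Spn.gen (by simp)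

end Flat

end Half

/-! ### The centres of the second family -/

lemma gen_left : Gen (tup q₂ p₁ q₁ p₂) := gen_of_gen gen_crds fun _ h1 h2 h3 h4 _ _ =>
  ⟨h3, h2, h1, h4⟩

lemma gen_right : Gen (tup q₁ p₂ q₂ p₁) := gen_of_gen gen_crds fun _ h1 h2 h3 h4 _ _ =>
  ⟨h1, h4, h3, h2⟩

/-- The coordinates and parameters of the first eight blow-ups. -/
noncomputable def left (a : Fin 6 → ℂ) : Half :=
  ⟨q₂, p₁, q₁, p₂, b₁, a 0, -a 2, a 4, gen_left, .inl rfl⟩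

/-- The coordinates and parameters of the last eight blow-ups. -/
noncomputable def right (a : Fin 6 → ℂ) : Half :=
  ⟨q₁, p₂, q₂, p₁, b₂, a 3, -a 5, a 1, gen_right, .inr rfl⟩

lemma flat_left (a : Fin 6 → ℂ) : (left a).Flat :=
  ⟨crd_q₂, crd_p₁, crd_q₁, crd_p₂, fun hR _ _ hG h0 h1 h2 h3 h4 h5 h6 =>
    projLines_ret hR hG h0 h3 h2 h1 h4 h5 h6⟩

lemma flat_right (a : Fin 6 → ℂ) : (right a).Flat :=
  ⟨crd_q₁, crd_p₂, crd_q₂, crd_p₁, fun hR _ _ hG h0 h1 h2 h3 h4 h5 h6 =>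
    projLines_ret hR hG h0 h1 h4 h3 h2 h5 h6⟩

lemma sv_left (x₁ x₂ x₃ x₄ : K) (e : Set K) : sv (tup x₁ x₂ x₃ x₄) e = ⟨chart x₃ x₂ x₁ x₄, e⟩ := by
  rw [sv, ← chart_eq, chart, chart]
  congr 3
  ext x
  simp only [Set.mem_insert_iff, Set.mem_singleton_iff]
  tauto

lemma sv_right (x₁ x₂ x₃ x₄ : K) (e : Set K) : sv (tup x₁ x₂ x₃ x₄) e = ⟨chart x₁ x₄ x₃ x₂, e⟩ := by
  rw [sv, ← chart_eq, chart, chart]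
  congr 3
  ext x
  simp only [Set.mem_insert_iff, Set.mem_singleton_iff]
  tauto

lemma const_neg (c : ℂ) : const (-c) = -const c := map_neg _ c

lemma centers_left (a : Fin 6 → ℂ) : (left a).centers = (centersA5 a).take 8 := by
  simp only [Half.centers, Half.C₁, Half.C₂, Half.C₃, Half.C₄, Half.C₅, Half.C₆, Half.C₇, Half.C₈,
    sv_left, Half.v₃, Half.v₂, Half.v₁, Half.w₁, Half.z₁, Half.u, Half.t, left, centersA5,
    const_neg, List.take_succ_cons, List.take_zero, List.cons.injEq, Subvariety.mk.injEq,
    and_true, true_and, sub_zero, sub_neg_eq_add, div_inv_eq_mul, inv_inv, sub_sub_eq_add_sub]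
  constructorm* _ ∧ _
  all_goals first
    | exact Set.pair_comm _ _
    | (congr 1 <;> ring1)
    | (congr 2; ring1)

lemma centers_right (a : Fin 6 → ℂ) : (right a).centers = (centersA5 a).drop 8 := by
  simp only [Half.centers, Half.C₁, Half.C₂, Half.C₃, Half.C₄, Half.C₅, Half.C₆, Half.C₇, Half.C₈,
    sv_right, Half.v₃, Half.v₂, Half.v₁, Half.w₁, Half.z₁, Half.u, Half.t, right, centersA5,
    const_neg, List.drop_succ_cons, List.drop_zero, List.cons.injEq, Subvariety.mk.injEq,
    and_true, true_and, sub_zero, sub_neg_eq_add, div_inv_eq_mul, inv_inv, sub_sub_eq_add_sub]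
  constructorm* _ ∧ _
  all_goals first
    | exact Set.pair_comm _ _
    | (congr 1 <;> ring1)
    | (congr 2; ring1)

lemma centersA5_eq (a : Fin 6 → ℂ) : centersA5 a = (left a).centers ++ (right a).centers := by
  rw [centers_left, centers_right, List.take_append_drop]

end PainleveFlow

/-!
# The first centre of the second half after the blow-ups of the first half
-/

namespace PainleveFlow

open Place MvPolynomial

lemma RetOn.disjoint {V : Set (LocalSubring K)} {C : Subvariety} {Γ Γ' : Place K} {G : Set K}
    {x : K} (hl : Link C Γ) (h : RetOn V Γ' G) (hx : Crd V x) (h1 : Γ.rel x⁻¹ 0)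
    (h2 : Γ'.rel x 0) (h0 : x ≠ 0) : RetOn (blowUp V C) Γ' G := by
  intro S hS Γ'' hΓ' hs
  rcases blowUp_cases hl hS with ⟨h3, -⟩ | ⟨R, hR, h3⟩
  · exact h S h3 Γ'' hΓ' hs
  · rcases hx R hR with hx | hx
    · exact (not_mem_inv h1 (inv_ne_zero h0) (by rw [inv_inv]; exact h3.sub _ hx)).elim
    · exact (not_mem_inv (hΓ' _ _ h2) h0 (hs _ (h3.le hx))).elim

/-- Replacement of a generator by the coordinate on the exceptional divisor. -/
lemma Over.kr_insert {Γ Γ' Γ₀ : Place K} {R S : LocalSubring K} {f g y : K} {Z : Set K}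
    (h : Over Γ' R S) (hk : Kr Γ' R {f, g}) (hf : f ≠ 0) (hg : g ≠ 0)
    (ha : Kr Γ₀ R (insert y Z)) (hs : Sub S.toSubring Γ) (hZ : ∀ z ∈ Z, Γ.rel z 0)
    (h0 : Γ₀.rel (f / g) 0) (h0' : Γ.rel (f / g) 0)
    (hy : y ∈ Spn S.toSubring (insert (f / g) Z)) : Kr Γ₀ S (insert (f / g) Z) := by
  have hz : Γ.rel (f / g - 0) 0 := by simpa using h0'
  have hm := h.mem_of hk hf hg hs (Subring.zero_mem _) hz
  refine h.kr hk hf hg ha (fun _ _ h => h) hs (Subring.zero_mem _) (by simpa using h0) hz ?_ ?_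
    (by simpa using Spn.gen (by simp))
  · rintro x (rfl | hx)
    · exact ⟨hm, h0, h0'⟩
    · exact ⟨h.le (ha.ring x (.inr hx)), ha.zero x (.inr hx), hZ x hx⟩
  · rintro x (hx | hx)
    · rwa [hx]
    · exact Spn.gen (.inr hx)

namespace Half

/-- The two halves of a system. -/
structure Dual (H H' : Half) : Prop where
  Q : H'.Q = H.q
  P : H'.P = H.p
  q : H'.q = H.Q
  p : H'.p = H.P

variable {H H' : Half} {Γ : Place K} {R S : LocalSubring K} {V : Set (LocalSubring K)}

section

variable (hd : Dual H H')
include hd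

lemma Dual.u_eq : H'.u = H.q⁻¹ := by rw [u, hd.Q]
lemma Dual.t_eq : H'.t = H.p⁻¹ := by rw [t, hd.P]
lemma Dual.s_eq : H'.s = H.P - (H'.b - H.Q) := by rw [Half.s_eq, hd.q, hd.p]

lemma Dual.sub_ne : H'.b - H.Q ≠ 0 := by
  rw [← hd.q]
  exact b_sub_ne

/-- Residues at the places over the first centre. -/
lemma Dual.rel (hΓ : H'.First Γ) : Γ.rel H'.u 0 ∧ Γ.rel H'.t 0 ∧ Γ.rel H.u H.u ∧ Γ.unit H.t ∧
    Γ.rel H.b H.b ∧ Γ.rel H'.b H'.b := by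
  obtain ⟨h1, h2, h3, h4, h5⟩ := hΓ.rel
  rw [hd.q] at h3
  refine ⟨h1, h2, Γ.inv h3 H.Q_ne, ?_, rel_b h4 h5, rel_b h4 h5⟩
  rcases hΓ with hΓ | hΓ
  · have h := (rel₁ hΓ).2.2.2.1
    rw [hd.p] at h
    exact ⟨_, Γ.inv h H.P_ne, inv_ne_zero H.P_ne⟩
  · have h := (rel_W hΓ).2.2.2.1
    rw [hd.p, hd.q] at h
    exact ⟨_, Γ.inv h hd.sub_ne, inv_ne_zero hd.sub_ne⟩

/-- One has `1 - u b' = -u (b' - Q)`, and `b' - Q` is nonzero by independence of the coordinates. -/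
lemma Dual.unit_W (hΓ : H'.W ≤ Γ) : Γ.unit H.u ∧ Γ.unit (1 - H.u * H'.b) := by
  obtain ⟨-, -, h3, -, -, h5⟩ := hd.rel (.inr hΓ)
  refine ⟨unit_of_fix h3 H.u_ne, ?_⟩
  have e : 1 - H.u * H'.b = -H.u * (H'.b - H.Q) := by
    have := H.Q_ne
    rw [u]
    field_simp
    ring
  refine unit_of_fix (Place.sub Place.one (Γ.mul h3 h5)) ?_
  rw [e]
  exact mul_ne_zero (neg_ne_zero.2 H.u_ne) hd.sub_ne

/-- The link between the halves: near `q = p = ∞` the cleared equation `q + p = b` of the third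
centre is `t' (1 - u' b) + u'`, an equation of the first centre of the other half. It is the reason
for the parameter `ζ₀` and for its value `b` in the second half. -/
lemma Dual.σ₀_eq : H.q⁻¹ * H.p⁻¹ * H.s = H'.σ₀ H.b := by
  have h1 := H.q_ne
  have h2 := H.p_ne
  rw [σ₀, Half.s_eq, hd.u_eq, hd.t_eq]
  field_simp
  ring

lemma Dual.rel_σ₀ (hΓ : H'.First Γ) : Γ.rel (H'.σ₀ H.b) 0 := by
  obtain ⟨h1, h2, -, -, h3, -⟩ := hd.rel hΓ
  have := Γ.add (Γ.mul h2 (Place.sub Place.one (Γ.mul h1 h3))) h1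
  simpa [σ₀] using this

/-- The point does not lie on the fifth and seventh centre of the second half. -/
lemma Dual.not_sub (hu : H.u ∈ R.toSubring) (ht : H.t ∈ R.toSubring) :
    ∀ Γ, H'.Γ₅ ≤ Γ ∨ H'.Γ₇ ≤ Γ → ¬ Sub R.toSubring Γ := by
  rintro Γ (hΓ | hΓ) hs
  · have h := (rel₅ hΓ).2.2.2.1
    rw [hd.p] at h
    exact not_mem_inv h H.P_ne (hs _ ht)
  · have h := (rel₇ hΓ).2.2.1
    rw [hd.q] at h
    exact not_mem_inv h H.Q_ne (hs _ hu)

/-- The third generator after a blow-up. -/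
lemma Dual.step_W {Γ' : Place K} {f d w : K} (ho : Over Γ' R S) (hk : Kr Γ' R {f, H.u})
    (hf : f ≠ 0) (hb : H'.b ∈ R.toSubring) (hw : Kr H'.W R {H'.t, H'.u, H.u * d * H'.s})
    (he : f / H.u + w = d * H'.s * (1 - H.u * H'.b)⁻¹) (hwR : w ∈ R.toSubring)
    (hd' : H'.W.unit d) (hΓ : H'.W ≤ Γ) (hs : Sub S.toSubring Γ) :
    Kr H'.W S {H'.t, H'.u, d * H'.s} := by
  have hid : H'.W ≤ H'.W := fun _ _ h => h
  have huR := hk.ring H.u (by simp)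
  have hz : ∀ {Γ}, H'.W ≤ Γ → Γ.rel (d * H'.s) 0 := fun hΓ =>
    rel_mem_mul (rel_s hΓ) (hd'.up hΓ).mem
  have hz' : ∀ {Γ}, H'.W ≤ Γ → Γ.rel (f / H.u - -w) 0 := fun hΓ => by
    rw [sub_neg_eq_add, he]
    exact rel_mul_mem (hz hΓ) (hd.unit_W hΓ).2.inv.mem
  have hm := ho.mem_of hk hf H.u_ne hs (neg_mem hwR) (hz' hΓ)
  have h1R := sub_mem (one_mem R.toSubring) (mul_mem huR hb)
  have hinv := Mx.inv_mem h1R (Mx.one_sub_notMem (Mx.mul' (hk.mx H.u (by simp)) hb))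
  have h0 := (hd.unit_W hid).2.ne_zero
  have hds : d * H'.s ∈ S.toSubring := by
    have : d * H'.s = (f / H.u + w) * (1 - H.u * H'.b) := by
      rw [he, mul_assoc, inv_mul_cancel₀ h0, mul_one]
    rw [this]
    exact mul_mem (add_mem hm (ho.le hwR)) (ho.le h1R)
  refine ho.kr hk hf H.u_ne hw hid hs (neg_mem hwR) (hz' hid) (hz' hΓ) ?_ ?_ ?_
  · rintro x (rfl | rfl | rfl)
    · exact ⟨ho.le (hw.ring _ (by simp)), hw.zero _ (by simp), hΓ _ _ (hw.zero _ (by simp))⟩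
    · exact ⟨ho.le (hw.ring _ (by simp)), hw.zero _ (by simp), hΓ _ _ (hw.zero _ (by simp))⟩
    · exact ⟨hds, hz hid, hz hΓ⟩
  · rintro x (rfl | rfl | rfl)
    · exact Spn.gen (by simp)
    · exact Spn.gen (by simp)
    · rw [mul_assoc]
      exact Spn.mul (ho.le huR) (Spn.gen (by simp))
  · rw [sub_neg_eq_add, he, mul_comm (d * H'.s)]
    exact Spn.mul (ho.le hinv) (Spn.gen (by simp))

end

/-- Generators of the ideal of the first centre of the second half, with a condition on the factor
of the third generator. -/
def Pre (H' : Half) (X : LocalSubring K → K → Prop) (R : LocalSubring K) : Prop :=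
  (∀ Γ, H'.First Γ → Sub R.toSubring Γ → Ret H'.Γ₁ R {H'.t, H'.u}) ∧
  ∀ Γ, H'.W ≤ Γ → Sub R.toSubring Γ →
    ∃ d ∈ R.toSubring, H'.W.unit d ∧ Kr H'.W R {H'.t, H'.u, d * H'.s} ∧ X R d

lemma Pre.ret_over {Γ' : Place K} {f g : K} {X : LocalSubring K → K → Prop} (h : H'.Pre X R)
    (ho : Over Γ' R S) (hk : Kr Γ' R {f, g}) (hf : f ≠ 0) (hg : g ≠ 0)
    (hfix : H'.Γ₁.rel (f / g) (f / g)) (hΓ : H'.First Γ) (hs : Sub S.toSubring Γ) : Ret H'.Γ₁ S {H'.t, H'.u} := by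
  refine ho.ret hk hf hg (h.1 Γ hΓ (hs.mono ho.le)) hs ?_ hfix
  rintro x (rfl | rfl)
  exacts [hΓ.rel.2.1, hΓ.rel.1]

/-! ### Effect of the first two blow-ups on the hypersurface of the other half -/

section

variable (hd : Dual H H')
include hd

lemma Dual.pre₀ (h' : H'.Flat) : ∀ R ∈ projLines,
    H'.Pre (fun R d => H.Q ∈ R.toSubring ∨ d = H.u * H.t) R := by
  refine fun R hR => ⟨fun Γ hΓ hs => h'.ret₁ hR hΓ hs, fun Γ hΓ hs => ?_⟩
  obtain ⟨d, h1, h2, h3, h4⟩ := h'.ret_W hR hΓ hs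
  refine ⟨d, h1, h2, h4.kr, ?_⟩
  rcases h3 with ⟨-, h3, -⟩ | ⟨h3, -⟩
  · rw [hd.q] at h3
    exact .inl h3
  · rw [hd.q, hd.p] at h3
    exact .inr h3

lemma Dual.fix₁ : H'.Γ₁.rel H.u H.u ∧ H'.Γ₁.rel H.t H.t := by
  obtain ⟨-, -, h1, h2, -⟩ := rel₁ (fun _ _ h => h : H'.Γ₁ ≤ H'.Γ₁)
  rw [hd.q] at h1
  rw [hd.p] at h2
  exact ⟨H'.Γ₁.inv h1 H.Q_ne, H'.Γ₁.inv h2 H.P_ne⟩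

/-- Where `Q` and `P` are infinite the equation of the other half's hypersurface is `u t s' = t + u
- b' u t`, which is close to the equation `t + u` being blown up. Dividing by `u` lowers the
clearing factor from `u t` to `t = u v₁`. If `Q` is finite the point is not on the centre. -/
lemma Dual.pre₁ {ζ₀ : K} {D : Subring K → K → Prop} (hb : Reg V H'.b)
    (h : ∀ R ∈ V, H.D₁ ζ₀ {H.t + H.u} D R)
    (h' : ∀ R ∈ V, H'.Pre (fun R d => H.Q ∈ R.toSubring ∨ d = H.u * H.t) R) :
    ∀ S ∈ blowUp V H.C₁,
      H'.Pre (fun R d => H.Q ∈ R.toSubring ∨ H.Off R ∨ d = H.u * H.v₁) S := by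
  intro S hS
  have hu := H.u_ne
  rcases blowUp_cases H.center₁.link hS with ⟨hV, hn⟩ | ⟨R, hR, ho⟩
  · obtain ⟨σ, rfl, γ, ζ, hsig, h1, -⟩ := h S hV
    refine ⟨(h' S hV).1, fun Γ hΓ hs => ?_⟩
    obtain ⟨d, d1, d2, d3, -⟩ := (h' S hV).2 Γ hΓ hs
    exact ⟨d, d1, d2, d3, .inr (.inl fun Γ hΓ hs => hn (h1 Γ hΓ hs).sub)⟩
  · obtain ⟨σ, rfl, γ, ζ, hsig, h1, -⟩ := h R hR
    have hk := h1 _ (.inl fun _ _ h => h) ho.sub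
    obtain ⟨f1, f2⟩ := hd.fix₁
    refine ⟨fun Γ hΓ hs => (h' R hR).ret_over ho hk hsig.ne_zero hu
      (Place.div (H'.Γ₁.add f2 f1) f1 hu) hΓ hs, fun Γ hΓ hs => ?_⟩
    obtain ⟨d, d1, d2, d3, d4⟩ := (h' R hR).2 Γ hΓ (hs.mono ho.le)
    have hut : H.u * H.v₁ = H.t := by rw [v₁_eq, mul_div_cancel₀ _ hu]
    have htR : H.t ∈ R.toSubring := by
      simpa using sub_mem (hk.ring (H.t + H.u) (by simp)) (hk.ring H.u (by simp))
    have htW : H'.W.unit H.t := (hd.rel first_W).2.2.2.1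
    refine ⟨H.t, ho.le htR, htW, ?_, .inr (.inr hut.symm)⟩
    rcases d4 with d4 | rfl
    · exact (not_mem_inv (hk.zero H.u (by simp)) hu
        (by rw [u, inv_inv]; exact ho.sub _ d4)).elim
    have hbR := hb R hR
    have huR := hk.ring H.u (by simp)
    have hinv := Mx.inv_mem (sub_mem (one_mem R.toSubring) (mul_mem huR hbR))
      (Mx.one_sub_notMem (Mx.mul' (hk.mx H.u (by simp)) hbR))
    refine hd.step_W (w := H.u * H'.b * (1 - H.u * H'.b)⁻¹) ho hk hsig.ne_zero hbR d3 ?_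
      (mul_mem (mul_mem huR hbR) hinv) htW hΓ hs
    have h0 := (hd.unit_W (fun _ _ h => h : H'.W ≤ H'.W)).2.ne_zero
    have hQ := H.Q_ne
    have hP := H.P_ne
    rw [hd.s_eq]
    field_simp
    rw [u, t]
    field_simp
    ring

/-- The second blow-up divides by `u` once more, which lowers the clearing factor from `u v₁` to
`v₁`. -/
lemma Dual.pre₂ {D : Subring K → K → Prop} (hb : Reg V H'.b)
    (h : ∀ R ∈ V, H.D₂ {H.t + H.u} D R)
    (h' : ∀ R ∈ V, H'.Pre (fun R d => H.Q ∈ R.toSubring ∨ H.Off R ∨ d = H.u * H.v₁) R) :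
    ∀ S ∈ blowUp V H.C₂, H'.Pre (fun _ _ => True) S := by
  intro S hS
  have hu := H.u_ne
  rcases blowUp_cases H.center₂.link hS with ⟨hV, hn⟩ | ⟨R, hR, ho⟩
  · refine ⟨(h' S hV).1, fun Γ hΓ hs => ?_⟩
    obtain ⟨d, d1, d2, d3, -⟩ := (h' S hV).2 Γ hΓ hs
    exact ⟨d, d1, d2, d3, trivial⟩
  · obtain ⟨σ, rfl, γ, ζ, hsig, h1, -⟩ := h R hR
    have hS₂ : H.Second H.Γ₂ := .inl fun _ _ h => h
    have hk := h1 _ hS₂ ho.sub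
    obtain ⟨f1, f2⟩ := hd.fix₁
    refine ⟨fun Γ hΓ hs => (h' R hR).ret_over ho hk hsig.div_ne hu
      (Place.div (Place.div (H'.Γ₁.add f2 f1) f1 hu) f1 hu) hΓ hs, fun Γ hΓ hs => ?_⟩
    obtain ⟨d, d1, d2, d3, d4⟩ := (h' R hR).2 Γ hΓ (hs.mono ho.le)
    have hv : H.v₁ ∈ R.toSubring := by
      have h2 := sub_mem (hk.ring ((H.t + H.u) / H.u) (by simp)) (one_mem R.toSubring)
      rwa [add_div, div_self hu, add_sub_cancel_right, ← v₁_eq] at h2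
    have hvW : H'.W.unit H.v₁ := by
      rw [v₁_eq]
      exact (hd.rel first_W).2.2.2.1.div (hd.unit_W fun _ _ h => h).1
    refine ⟨H.v₁, ho.le hv, hvW, ?_, trivial⟩
    rcases d4 with d4 | d4 | rfl
    · exact (not_mem_inv (hk.zero H.u (by simp)) hu
        (by rw [u, inv_inv]; exact ho.sub _ d4)).elim
    · exact (d4 _ hS₂.first ho.sub).elim
    have hbR := hb R hR
    have huR := hk.ring H.u (by simp)
    have hinv := Mx.inv_mem (sub_mem (one_mem R.toSubring) (mul_mem huR hbR))
      (Mx.one_sub_notMem (Mx.mul' (hk.mx H.u (by simp)) hbR))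
    refine hd.step_W (w := H'.b * (1 - H.u * H'.b)⁻¹) ho hk hsig.div_ne hbR d3 ?_
      (mul_mem hbR hinv) hvW hΓ hs
    have h0 := (hd.unit_W (fun _ _ h => h : H'.W ≤ H'.W)).2.ne_zero
    have hQ := H.Q_ne
    have hP := H.P_ne
    rw [hd.s_eq, v₁_eq]
    field_simp
    rw [u, t]
    field_simp
    ring

end

end Half

end PainleveFlow

/-!
# The second half after the blow-ups of the first half
-/

namespace PainleveFlow

open Place MvPolynomial

namespace Half

variable {H H' : Half} {Γ : Place K} {R S : LocalSubring K} {V : Set (LocalSubring K)}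

/-- The input for the second half. -/
abbrev Post (H H' : Half) (R : LocalSubring K) : Prop :=
  H'.D₁ H.b Set.univ (fun _ _ => True) R

/-- The data at a point over the third centre. -/
structure Over₃ (H H' : Half) (S : LocalSubring K) (g κ d : K) : Prop where
  eq : κ * g = H.u
  mem : κ ∈ S.toSubring
  unit : ∀ Γ, H'.First Γ → Γ.unit g
  u_mem : H.u ∈ S.toSubring
  t_mem : H.t ∈ S.toSubring
  clears : d = 1 ∧ H.q ∈ S.toSubring ∨ d = H.q⁻¹ * H.p⁻¹
  four : ∀ Γ, H.Γ₄ ≤ Γ → Sub S.toSubring Γ → Kr H.Γ₄ S {d * κ * (H.v₃ + const H.a₀), g}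
  first : ∀ Γ, H'.First Γ → Sub S.toSubring Γ → Kr H'.Γ₁ S {H'.σ₀ H.b / g, H'.u}
  third : ∀ Γ, H'.W ≤ Γ → Sub S.toSubring Γ →
    ∃ d ∈ S.toSubring, H'.W.unit d ∧ Kr H'.W S {H'.σ₀ H.b / g, H'.u, d * H'.s}

/-- Since `u'` is a nonunit, `1 - u' b` is invertible and `t'` can be solved for from `σ₀'` and
`u'`. -/
lemma t_mem_spn {g : K} {G : Set K} (hg : g ∈ S.toSubring) (hg0 : g ≠ 0)
    (hb : H.b ∈ S.toSubring) (hu : H'.u ∈ Mx S) (h1 : H'.σ₀ H.b / g ∈ G) (h2 : H'.u ∈ G)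
    (h0 : 1 - H'.u * H.b ≠ 0) : H'.t ∈ Spn S.toSubring G := by
  have e : H'.t = (1 - H'.u * H.b)⁻¹ * (g * (H'.σ₀ H.b / g) - H'.u) := by
    rw [mul_div_cancel₀ _ hg0, σ₀]
    field_simp
    ring
  have hinv := Mx.inv_mem (sub_mem (one_mem S.toSubring) (mul_mem (Mx.mem hu) hb))
    (Mx.one_sub_notMem (Mx.mul' hu hb))
  rw [e]
  exact Spn.mul hinv (sub_mem (Spn.mul hg (Spn.gen h1)) (Spn.gen h2))

section

variable (hd : Dual H H')
include hd

/-- On the first centre of the other half `q` is infinite, so finite `q` keeps the point away from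
it. -/
lemma Dual.not_first (hq : H.q ∈ S.toSubring) (hΓ : H'.First Γ) : ¬ Sub S.toSubring Γ := by
  intro hs
  have h := (hd.rel hΓ).1
  rw [hd.u_eq] at h
  exact not_mem_inv h (inv_ne_zero H.q_ne) (hs _ (by simpa using hq))

/-- Near the other half's first centre the third centre has the ideal `(σ₀', g)`. Blowing it up
replaces the equation `σ₀'` by `σ₀' / g`; here `g` is a unit at the places over that first centre,
whose strict transform is therefore still cut out by two elements. -/
lemma Dual.over₃ (hVb : Reg V H.b) (hVc : Reg V (const H.a₀)) (hP : Crd V H.P) (hζ : Param H.b)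
    (h : ∀ R ∈ V, H.D₃ {H.t + H.u} H.Clears R) (h' : ∀ R ∈ V, H'.Pre (fun _ _ => True) R)
    (hR : R ∈ V) (ho : Over H.Γ₃ R S) : ∃ g κ d, Over₃ H H' S g κ d := by
  obtain ⟨g, κ, d, g1, g2, g3, g4, g5, g6, g7, hk⟩ := h R hR _ (fun _ _ h => h) ho.sub
  obtain ⟨k0, g0⟩ := ne_of_mul_eq g1
  have hgu : ∀ Γ, H'.First Γ → Γ.unit g := fun Γ hΓ => by
    have hu := unit_of_fix (hd.rel hΓ).2.2.1 H.u_ne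
    rcases g7 with rfl | ⟨σ, rfl, rfl⟩
    · exact hu
    · have hne : (H.t + H.u) / H.u ≠ 0 := g0
      rcases hΓ with hΓ | hΓ
      · obtain ⟨f1, f2⟩ := hd.fix₁
        exact (unit_of_fix (Place.div (H'.Γ₁.add f2 f1) f1 H.u_ne) hne).up hΓ
      · have hid : H'.W ≤ H'.W := fun _ _ h => h
        obtain ⟨-, -, f1, -, -, f2⟩ := hd.rel (Γ := H'.W) (.inr hid)
        obtain ⟨-, u2⟩ := hd.unit_W hid
        -- As `s'` vanishes at `W'`, the residue there is `-u b' (1 - u b')⁻¹`, which is nonzero.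
        -- This is why `g` is a unit in its second form.
        have e : (H.t + H.u) / H.u = H.t * H'.s * (1 - H.u * H'.b)⁻¹
            - H.u * H'.b * (1 - H.u * H'.b)⁻¹ := by
          have h0 := u2.ne_zero
          have hQ := H.Q_ne
          have hP := H.P_ne
          rw [hd.s_eq]
          field_simp
          rw [u, t]
          field_simp
          ring
        have hbu : H'.W.unit H'.b := unit_of_fix f2 (by
          have := H'.gen.algebraicIndependent.ne_zero
          rcases H'.hb with h | h
          · rw [h]; exact this 4
          · rw [h]; exact this 5)
        rw [e, ← neg_sub]
        refine Place.unit.up (Place.unit.neg (Place.unit_sub ?_ ?_)) hΓ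
        · exact ((unit_of_fix f1 H.u_ne).mul hbu).mul u2.inv
        · exact rel_mul_mem (rel_mem_mul (rel_s hid) (hd.rel first_W).2.2.2.1.mem) u2.inv.mem
  have hgR := hk.ring g (by simp)
  have htR : H.t ∈ R.toSubring := by
    have r := (second_of_three (fun _ _ h => h : H.Γ₃ ≤ H.Γ₃)).first.rel.2.1
    exact Mx.mem (hP.inv.mx hR ho.sub r H.t_ne)
  have hcl : d = 1 ∧ H.q ∈ R.toSubring ∨ d = H.q⁻¹ * H.p⁻¹ :=
    g6.imp (fun h => ⟨h.1, h.2.1⟩) fun h => h.1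
  have hz : ∀ {Γ}, H'.First Γ → Γ.rel (H'.σ₀ H.b / g) 0 := fun hΓ => by
    rw [div_eq_mul_inv]
    exact rel_mul_mem (hd.rel_σ₀ hΓ) (hgu _ hΓ).inv.mem
  have hsig := sig₀ (H := H') hζ
  have main : ∀ {Γ₀ Γ : Place K} {Z : Set K}, H'.u ∈ Z → H'.First Γ₀ → H'.First Γ →
      (∀ z ∈ Z, Γ.rel z 0) → Sub S.toSubring Γ → Kr Γ₀ R (insert H'.t Z) →
      Kr Γ₀ S (insert (H'.σ₀ H.b / g) Z) := by
    intro Γ₀ Γ Z hZ hΓ₀ hΓ hz' hs hkr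
    rcases hcl with ⟨-, hc⟩ | hc
    · exact (hd.not_first (ho.le hc) hΓ hs).elim
    rw [hc, hd.σ₀_eq] at hk
    have huS : H'.u ∈ Mx S := hs.mx (ho.le (hkr.ring _ (.inr hZ))) hΓ.rel.1
    exact ho.kr_insert hk hsig.ne_zero g0 hkr hs hz' (hz hΓ₀) (hz hΓ)
      (t_mem_spn (ho.le hgR) g0 (ho.le (hVb R hR)) huS (.inl rfl) (.inr hZ) (one_sub_ne hζ))
  refine ⟨g, κ, d, g1, ho.le g2, hgu, ho.le (g1 ▸ mul_mem g2 hgR), ho.le htR,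
    hcl.imp_left fun h => ⟨h.1, ho.le h.2⟩,
    fun Γ hΓ hs => kr₄ ho hk g1 g2 g3 (hVc R hR) g4 (g5.up le_W_₃) hΓ hs, fun Γ hΓ hs => ?_,
    fun Γ hΓ hs => ?_⟩
  · refine main rfl (.inl fun _ _ h => h) hΓ ?_ hs ((h' R hR).1 Γ hΓ (hs.mono ho.le)).kr
    rintro z rfl
    exact hΓ.rel.1
  · obtain ⟨d', d1, d2, d3, -⟩ := (h' R hR).2 Γ hΓ (hs.mono ho.le)
    exact ⟨d', ho.le d1, d2, main (by simp) first_W (.inr hΓ)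
      (fun z hz => hΓ _ _ (d3.zero z (.inr hz))) hs d3⟩

/-- The input of the second half at a point that is not over the third centre. -/
lemma Dual.post_of_pre (hVb : Reg V H.b) (hζ : Param H.b) (hR : R ∈ V)
    (h : H'.Pre (fun _ _ => True) R) : Post H H' R := by
  have hsig := sig₀ (H := H') hζ
  have main : ∀ {Γ₀ : Place K} {Z : Set K}, H'.u ∈ Z → H'.First Γ₀ → Kr Γ₀ R (insert H'.t Z) →
      Kr Γ₀ R (insert (H'.σ₀ H.b) Z) := by
    intro Γ₀ Z hZ hΓ hk
    have hu := hk.mx _ (.inr hZ)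
    have hb := hVb R hR
    refine hk.congr ?_ ?_ ?_
    · rintro z (rfl | hz)
      · exact add_mem (mul_mem (hk.ring _ (.inl rfl))
          (sub_mem (one_mem _) (mul_mem (Mx.mem hu) hb))) (Mx.mem hu)
      · exact hk.ring z (.inr hz)
    · rintro z (rfl | hz)
      · exact hd.rel_σ₀ hΓ
      · exact hk.zero z (.inr hz)
    · rintro z (rfl | hz)
      · exact t_mem_spn (one_mem _) one_ne_zero hb hu (by simp) (.inr hZ) (one_sub_ne hζ)
      · exact Spn.gen (.inr hz)
  refine ⟨_, Set.mem_univ _, 1, H.b, hsig, fun Γ hΓ hs => main rfl (.inl fun _ _ h => h)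
    (h.1 Γ hΓ hs).kr, fun Γ hΓ hs => ?_, .inl ⟨rfl, rfl⟩⟩
  obtain ⟨d, d1, d2, d3, -⟩ := h.2 Γ hΓ hs
  exact ⟨d, d1, d2, trivial, main (by simp) first_W d3⟩

/-- The new equation is `σ = σ₀' / g`, with `γ = g` and unchanged `ζ = b`. Here `u` and `t` are
regular, so the fifth and seventh centres of the other half, with `P = 0` and `Q = 0`, are not met.
-/
lemma Dual.post_of_over₃ {g κ d : K} (h : Over₃ H H' S g κ d) : Post H H' S := by
  have g0 := (ne_of_mul_eq h.eq).2
  refine ⟨_, Set.mem_univ _, g, H.b, ⟨mul_div_cancel₀ _ g0, h.unit,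
    fun Γ hΓ => ⟨_, (hd.rel hΓ).2.2.2.2.1⟩⟩, h.first, fun Γ hΓ hs => ?_,
    .inr (hd.not_sub h.u_mem h.t_mem)⟩
  obtain ⟨d, d1, d2, d3⟩ := h.third Γ hΓ hs
  exact ⟨d, d1, d2, trivial, d3⟩

/-- Up to the correction `a₀ κ t' u'`, the equation of the fourth centre is `σ₀' / g`. The fourth
blow-up divides it by `g` again, and the correction is absorbed in a change of `ζ`; this explains
why `Sig` admits a variable `ζ`. -/
lemma Dual.post_over₄ {g κ d : K} (h : Over₃ H H' R g κ d) (hζ : Param H.b)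
    (hp : H'.t ∈ R.toSubring ∨ H'.t⁻¹ ∈ R.toSubring) (hc : const H.a₀ ∈ R.toSubring)
    (ho : Over H.Γ₄ R S) : Post H H' S := by
  obtain ⟨k0, g0⟩ := ne_of_mul_eq h.eq
  have h57 := hd.not_sub (ho.le h.u_mem) (ho.le h.t_mem)
  rcases h.clears with ⟨-, hq⟩ | hd'
  · exact ⟨_, Set.mem_univ _, 1, H.b, sig₀ hζ,
      fun Γ hΓ hs => (hd.not_first (ho.le hq) hΓ hs).elim,
      fun Γ hΓ hs => (hd.not_first (ho.le hq) (.inr hΓ) hs).elim, .inr h57⟩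
  have hk := h.four _ (fun _ _ h => h) ho.sub
  set c := const H.a₀ * κ * H'.t with hc'
  set f := d * κ * (H.v₃ + const H.a₀) with hf'
  have hf : f = H'.σ₀ H.b / g + c * H'.u := by
    have h1 : d * κ * H.v₃ = H'.σ₀ H.b / g := by rw [← mul_s_div h.eq, hd', hd.σ₀_eq]
    rw [hf', mul_add, h1, hd', hc', hd.u_eq, hd.t_eq]
    ring
  have hf0 : f ≠ 0 := by
    have hv : H.v₃ + const H.a₀ ≠ 0 := by
      simpa using H.center₄.fst
    refine mul_ne_zero (mul_ne_zero ?_ k0) hv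
    rw [hd']
    exact mul_ne_zero (inv_ne_zero H.q_ne) (inv_ne_zero H.p_ne)
  have hκ : ∀ {Γ}, H'.First Γ → κ ∈ Γ.integers := fun hΓ => by
    have e : κ = H.u * g⁻¹ := by rw [← h.eq, mul_inv_cancel_right₀ g0]
    rw [e]
    exact mul_mem ⟨_, (hd.rel hΓ).2.2.1⟩ (h.unit _ hΓ).inv.mem
  have hz : ∀ {Γ}, H'.First Γ → Γ.rel (f / g) 0 := fun {Γ} hΓ => by
    obtain ⟨r1, r2, -⟩ := hΓ.rel
    rw [div_eq_mul_inv, hf, div_eq_mul_inv]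
    refine rel_mul_mem (rel_zero_add (rel_mul_mem (hd.rel_σ₀ hΓ) (h.unit _ hΓ).inv.mem) ?_)
      (h.unit _ hΓ).inv.mem
    exact rel_mem_mul r1 (mul_mem (mul_mem ⟨_, Γ.const _⟩ (hκ hΓ)) ⟨_, r2⟩)
  have main : ∀ {Γ₀ Γ : Place K} {Z : Set K}, H'.u ∈ Z → H'.First Γ₀ → H'.First Γ →
      (∀ z ∈ Z, Γ.rel z 0) → Sub S.toSubring Γ → Kr Γ₀ R (insert (H'.σ₀ H.b / g) Z) →
      Kr Γ₀ S (insert (f / g) Z) := by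
    intro Γ₀ Γ Z hZ hΓ₀ hΓ hz' hs hkr
    refine ho.kr_insert hk hf0 g0 hkr hs hz' (hz hΓ₀) (hz hΓ) ?_
    have htR : H'.t ∈ R.toSubring := by
      refine hp.resolve_right fun hn => ?_
      exact not_mem_inv hΓ.rel.2.1 H'.t_ne (hs _ (ho.le hn))
    have e : H'.σ₀ H.b / g = g * (f / g) - c * H'.u := by
      rw [mul_div_cancel₀ _ g0, hf, add_sub_cancel_right]
    rw [e]
    exact sub_mem (Spn.mul (ho.le (hk.ring g (by simp))) (Spn.gen (.inl rfl)))
      (Spn.mul (ho.le (mul_mem (mul_mem hc h.mem) htR)) (Spn.gen (.inr hZ)))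
  -- Because `κ g = u`, one has `g f = σ₀' + a₀ u t' u' = t' (1 - u' (b - a₀ u)) + u'`.
  refine ⟨f / g, Set.mem_univ _, g ^ 2, H.b - const H.a₀ * H.u, ⟨?_, fun Γ hΓ => (h.unit Γ hΓ).pow 2,
    fun Γ hΓ => ?_⟩, fun Γ hΓ hs => ?_, fun Γ hΓ hs => ?_, .inr h57⟩
  · rw [hf, hc', σ₀, ← h.eq]
    field_simp
    ring
  · obtain ⟨-, -, r1, -, r2, -⟩ := hd.rel hΓ
    exact ⟨_, Place.sub r2 (Γ.mul (Γ.const _) r1)⟩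
  · refine main rfl (.inl fun _ _ h => h) hΓ ?_ hs (h.first Γ hΓ (hs.mono ho.le))
    rintro z rfl
    exact hΓ.rel.1
  · obtain ⟨d', d1, d2, d3⟩ := h.third Γ hΓ (hs.mono ho.le)
    exact ⟨d', ho.le d1, d2, trivial, main (by simp) first_W (.inr hΓ)
      (fun z hz => hΓ _ _ (d3.zero z (.inr hz))) hs d3⟩

end

/-- The new points lie over a centre with `x = ∞`, while the other half's first centre has `x = 0`.
At these points the requirements on generators are void. -/
lemma Post.blowUp {C : Subvariety} {Γ' : Place K} {x : K} (hl : Link C Γ')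
    (h : ∀ R ∈ V, Post H H' R) (hx : Crd V x) (h1 : Γ'.rel x⁻¹ 0)
    (h2 : ∀ Γ, H'.First Γ → Γ.rel x 0) (h0 : x ≠ 0) : ∀ S ∈ blowUp V C, Post H H' S := by
  intro S hS
  rcases blowUp_cases hl hS with ⟨hV, -⟩ | ⟨R, hR, ho⟩
  · exact h S hV
  have hn : ∀ Γ, H'.First Γ → ¬ Sub S.toSubring Γ := fun Γ hΓ hs => by
    rcases hx R hR with hx | hx
    · exact not_mem_inv h1 (inv_ne_zero h0) (by rw [inv_inv]; exact ho.sub _ hx)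
    · exact not_mem_inv (h2 Γ hΓ) h0 (hs _ (ho.le hx))
  obtain ⟨σ, -, γ, ζ, hsig, -, -, h57⟩ := h R hR
  exact ⟨σ, Set.mem_univ _, γ, ζ, hsig, fun Γ hΓ hs => (hn Γ hΓ hs).elim,
    fun Γ hΓ hs => (hn Γ (.inr hΓ) hs).elim,
    h57.imp_right fun h Γ hΓ hs => h Γ hΓ (hs.mono ho.le)⟩

end Half

end PainleveFlow

/-!
# The sixteen blow-ups of the second family
-/

namespace PainleveFlow

open Place MvPolynomial

namespace Half

variable {H H' : Half} {Γ' : Place K} {V : Set (LocalSubring K)} {G : Set K} {ζ₀ : K}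

lemma RetOn.five (hζ : Param ζ₀) (h : ∀ R ∈ V, H.D₅ ζ₀ R) (hr : RetOn V Γ' G)
    (hfix : Γ'.rel H.w₁ H.w₁) (hP : Γ'.rel H.P 0) : RetOn (blowUp V H.C₅) Γ' G := by
  intro S hS Γ hΓ hs
  rcases blowUp_cases H.center₅.link hS with ⟨hV, -⟩ | ⟨R, hR, ho⟩
  · exact hr S hV Γ hΓ hs
  have ha := hr R hR Γ hΓ (hs.mono ho.le)
  obtain ⟨e, -, he, hk⟩ := h R hR _ (fun _ _ h => h) ho.sub
  have h0 := (unit_e₅ hζ (fun _ _ h => h : H.Γ₅ ≤ H.Γ₅) he).ne_zero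
  refine ho.ret hk H.p_ne (div_ne_zero H.u_ne h0) ha hs (fun g hg => hΓ _ _ (ha.zero g hg)) ?_
  rcases he with ⟨rfl, -⟩ | ⟨-, -, ht⟩
  · rwa [div_eq₅, one_mul]
  · exact (not_mem_inv (hΓ _ _ hP) H.P_ne (hs _ (ho.le ht))).elim

lemma RetOn.six (hζ : Param ζ₀) (h : ∀ R ∈ V, H.D₆ ζ₀ R) (hr : RetOn V Γ' G)
    (hfix : Γ'.rel H.w₂ H.w₂) (hP : Γ'.rel H.P 0) : RetOn (blowUp V H.C₆) Γ' G := by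
  intro S hS Γ hΓ hs
  rcases blowUp_cases H.center₆.link hS with ⟨hV, -⟩ | ⟨R, hR, ho⟩
  · exact hr S hV Γ hΓ hs
  have ha := hr R hR Γ hΓ (hs.mono ho.le)
  obtain ⟨e, -, he, hk⟩ := h R hR _ (fun _ _ h => h) ho.sub
  have h0 := (unit_e₅ hζ le₅₆ he).ne_zero
  refine ho.ret hk (mul_ne_zero h0 w₁_ne) (div_ne_zero H.u_ne h0) ha hs
    (fun g hg => hΓ _ _ (ha.zero g hg)) ?_
  rcases he with ⟨rfl, -⟩ | ⟨-, -, ht⟩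
  · rwa [div_eq₆, one_pow, one_mul]
  · exact (not_mem_inv (hΓ _ _ hP) H.P_ne (hs _ (ho.le ht))).elim

lemma RetOn.seven (h : ∀ R ∈ V, H.D₇ ζ₀ R) (hr : RetOn V Γ' G)
    (hfix : Γ'.rel H.z₁ H.z₁) (hQ : Γ'.rel H.Q 0) : RetOn (blowUp V H.C₇) Γ' G := by
  intro S hS Γ hΓ hs
  rcases blowUp_cases H.center₇.link hS with ⟨hV, -⟩ | ⟨R, hR, ho⟩
  · exact hr S hV Γ hΓ hs
  have ha := hr R hR Γ hΓ (hs.mono ho.le)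
  rcases h R hR _ (fun _ _ h => h) ho.sub with ⟨-, hk⟩ | ⟨hu, -⟩
  · refine ho.ret hk.kr H.q_ne H.t_ne ha hs (fun g hg => hΓ _ _ (ha.zero g hg)) ?_
    rwa [← z₁_eq]
  · exact (not_mem_inv (hΓ _ _ hQ) H.Q_ne (hs _ (ho.le hu))).elim

lemma RetOn.eight (hζ : Param ζ₀) (h : ∀ R ∈ V, H.D₈ ζ₀ R) (hr : RetOn V Γ' G)
    (hfix : Γ'.rel H.z₂ H.z₂) (hQ : Γ'.rel H.Q 0) : RetOn (blowUp V H.C₈) Γ' G := by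
  intro S hS Γ hΓ hs
  rcases blowUp_cases H.center₈.link hS with ⟨hV, -⟩ | ⟨R, hR, ho⟩
  · exact hr S hV Γ hΓ hs
  have ha := hr R hR Γ hΓ (hs.mono ho.le)
  obtain ⟨e, -, he, hk⟩ := h R hR _ (fun _ _ h => h) ho.sub
  have h0 := (unit_e₇ hζ le₇₈ he).ne_zero
  refine ho.ret hk (mul_ne_zero h0 z₁_ne) (div_ne_zero H.t_ne h0) ha hs
    (fun g hg => hΓ _ _ (ha.zero g hg)) ?_
  rcases he with rfl | ⟨-, hu⟩
  · rwa [div_eq₈, one_pow, one_mul]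
  · exact (not_mem_inv (hΓ _ _ hQ) H.Q_ne (hs _ (ho.le hu))).elim

section

variable (hd : Dual H H') (hf : H.Flat) (hf' : H'.Flat) (hζ : Param H.b)
include hd hf hf'

/-- Here `P = 0`, which separates this centre from the first four and the last two of the first
half, all lying over `P = ∞`. To the fifth and sixth it is transverse. -/
lemma Dual.retOn₅ : RetOn (H.V₈ projLines) H'.Γ₅ {H'.p, H'.u} := by
  have ho := hf.input.output
  have c := crd_V (H := H) hf.crd_P
  obtain ⟨-, h2, h3, h4, -, -⟩ := rel₅ (fun _ _ h => h : H'.Γ₅ ≤ H'.Γ₅)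
  have hp : H'.Γ₅.rel H.P 0 := by rwa [hd.p] at h4
  have hu : H'.Γ₅.rel H.u H.u := by
    rw [hd.q] at h3
    exact H'.Γ₅.inv h3 H.Q_ne
  rw [hd.P] at h2
  obtain ⟨w1, w2⟩ := fix_w hu h2
  have hid : ∀ Γ : Place K, Γ ≤ Γ := fun _ _ _ h => h
  have hz : Param (0 : K) := .inl rfl
  have r1 := hf'.ret₅.disjoint H.center₁.link hf.crd_P (rel₁ (hid _)).2.1 hp H.P_ne
  have s2 : H.Second H.Γ₂ := .inl fun _ _ h => h
  have r2 := r1.disjoint H.center₂.link c.1 s2.first.rel.2.1 hp H.P_ne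
  have r3 := r2.disjoint H.center₃.link c.2.1 (second_of_three (hid _)).first.rel.2.1 hp H.P_ne
  have r4 := r3.disjoint H.center₄.link c.2.2.1 (second_of_three le₃₄).first.rel.2.1 hp H.P_ne
  have r5 := RetOn.five hz ho.five r4 w1 hp
  have r6 := RetOn.six hz ho.six r5 w2 hp
  have r7 := r6.disjoint H.center₇.link c.2.2.2.2.2.1 (rel₇ (hid _)).2.1 hp H.P_ne
  exact r7.disjoint H.center₈.link c.2.2.2.2.2.2.1 (rel₈ (hid _)).2.1 hp H.P_ne

/-- Here `Q = 0`, whereas the first six centres lie over `Q = ∞`. To the seventh and eighth this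
centre is transverse. -/
lemma Dual.retOn₇ : RetOn (H.V₈ projLines) H'.Γ₇ {H'.q, H'.t} := by
  have ho := hf.input.output
  have c := crd_V (H := H) hf.crd_Q
  obtain ⟨h1, -, h3, h4, -, -⟩ := rel₇ (fun _ _ h => h : H'.Γ₇ ≤ H'.Γ₇)
  have hq : H'.Γ₇.rel H.Q 0 := by rwa [hd.q] at h3
  have ht : H'.Γ₇.rel H.t H.t := by
    rw [hd.p] at h4
    exact H'.Γ₇.inv h4 H.P_ne
  rw [hd.Q] at h1
  obtain ⟨z1, z2⟩ := fix_z ht h1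
  have hid : ∀ Γ : Place K, Γ ≤ Γ := fun _ _ _ h => h
  have hz : Param (0 : K) := .inl rfl
  have r1 := hf'.ret₇.disjoint H.center₁.link hf.crd_Q (rel₁ (hid _)).1 hq H.Q_ne
  have s2 : H.Second H.Γ₂ := .inl fun _ _ h => h
  have r2 := r1.disjoint H.center₂.link c.1 s2.first.rel.1 hq H.Q_ne
  have r3 := r2.disjoint H.center₃.link c.2.1 (second_of_three (hid _)).first.rel.1 hq H.Q_ne
  have r4 := r3.disjoint H.center₄.link c.2.2.1 (second_of_three le₃₄).first.rel.1 hq H.Q_ne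
  have r5 := r4.disjoint H.center₅.link c.2.2.2.1 (rel₅ (hid _)).1 hq H.Q_ne
  have r6 := r5.disjoint H.center₆.link c.2.2.2.2.1 (rel₆ (hid _)).1 hq H.Q_ne
  have r7 := RetOn.seven ho.seven r6 z1 hq
  exact RetOn.eight hz ho.eight r7 z2 hq

include hζ

/-- Points fall into three kinds: off the third centre, over the third but not the fourth, and over
the fourth. A point over the fourth centre always comes from one over the third. -/
lemma Dual.post₄ : ∀ S ∈ H.V₄ projLines, Post H H' S := by
  have hi := hf.input
  have ho := hi.output
  have rb : ∀ H : Half, Reg projLines H.b := fun H R hR => H.b_mem (reg_b₁ R hR) (reg_b₂ R hR)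
  have p1 := hd.pre₁ (rb H') hi.one (hd.pre₀ hf')
  have p2 := hd.pre₂ (reg_V (H := H) (rb H')).1 ho.two p1
  have b2 := (reg_V (H := H) (rb H)).2.1
  have c2 := (reg_V (H := H) (reg_const H.a₀)).2.1
  have P2 := (crd_V (H := H) hf.crd_P).2.1
  have t3 := (crd_V (H := H) hf'.crd_P.inv).2.2.1
  have k3 : ∀ S ∈ H.V₃ projLines, (S ∈ H.V₂ projLines ∧ ¬ Sub S.toSubring H.Γ₃) ∨
      ∃ g κ d, Over₃ H H' S g κ d := by
    intro S hS
    rcases blowUp_cases H.center₃.link hS with h | ⟨R, hR, h⟩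
    · exact .inl h
    · exact .inr (hd.over₃ b2 c2 P2 hζ ho.three p2 hR h)
  have hpost : ∀ S ∈ H.V₃ projLines, Post H H' S := fun S hS => by
    rcases k3 S hS with ⟨h, -⟩ | ⟨g, κ, d, h⟩
    · exact hd.post_of_pre b2 hζ h (p2 S h)
    · exact hd.post_of_over₃ h
  intro S hS
  rcases blowUp_cases H.center₄.link hS with ⟨h, -⟩ | ⟨R, hR, h⟩
  · exact hpost S h
  rcases k3 R hR with ⟨h1, h2⟩ | ⟨g, κ, d, h1⟩
  · obtain ⟨g, κ, d, -, -, -, -, -, -, -, hk⟩ := ho.three R h1 _ le₃₄ h.sub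
    exact (h2 hk.sub).elim
  · exact hd.post_over₄ h1 hζ (t3 R hR) ((reg_V (H := H) (reg_const H.a₀)).2.2.1 R hR) h

/-- The fifth and sixth centres lie over `p = 0`, the seventh and eighth over `q = 0`; the other
half starts at `q = p = ∞`. -/
lemma Dual.post₈ : ∀ S ∈ H.V₈ projLines, Post H H' S := by
  have ct := crd_V (H := H) hf'.crd_P.inv
  have cu := crd_V (H := H) hf'.crd_Q.inv
  have hid : ∀ Γ : Place K, Γ ≤ Γ := fun _ _ _ h => h
  have ht : H'.t⁻¹ = H.p := by rw [hd.t_eq, inv_inv]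
  have hu : H'.u⁻¹ = H.q := by rw [hd.u_eq, inv_inv]
  have h6 : H.Γ₆.rel H.p 0 := (rel₅ le₅₆).2.2.2.1
  have h8 : H.Γ₈.rel H.q 0 := (rel₇ le₇₈).2.2.1
  have p5 := Post.blowUp H.center₅.link (hd.post₄ hf hf' hζ) ct.2.2.2.1
    (ht ▸ (rel₅ (hid _)).2.2.2.1) (fun Γ hΓ => hΓ.rel.2.1) H'.t_ne
  have p6 := Post.blowUp H.center₆.link p5 ct.2.2.2.2.1 (ht ▸ h6) (fun Γ hΓ => hΓ.rel.2.1) H'.t_ne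
  have p7 := Post.blowUp H.center₇.link p6 cu.2.2.2.2.2.1
    (hu ▸ (rel₇ (hid _)).2.2.1) (fun Γ hΓ => hΓ.rel.1) H'.u_ne
  exact Post.blowUp H.center₈.link p7 cu.2.2.2.2.2.2.1 (hu ▸ h8) (fun Γ hΓ => hΓ.rel.1) H'.u_ne

theorem Dual.input : H'.Input H.b Set.univ (fun _ _ => True) (H.V₈ projLines) := by
  have rb : Reg projLines H.b := fun R hR => H.b_mem (reg_b₁ R hR) (reg_b₂ R hR)
  exact ⟨hζ, fun _ _ _ _ _ => trivial, (reg_V rb).2.2.2.2.2.2.2,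
    fun c => (reg_V (reg_const c)).2.2.2.2.2.2.2, hd.post₈ hf hf' hζ,
    fun R hR Γ hΓ hs => (hd.retOn₅ hf hf' R hR Γ hΓ hs).kr, hd.retOn₇ hf hf'⟩

end

end Half

lemma dual (a : Fin 6 → ℂ) : Half.Dual (left a) (right a) := ⟨rfl, rfl, rfl, rfl⟩

lemma spaceA5_eq (a : Fin 6 → ℂ) : spaceA5 a = (right a).V₈ ((left a).V₈ projLines) := by
  rw [spaceA5, centersA5_eq, iteratedBlowUp, List.foldl_append]
  rfl

end PainleveFlow

/-!
# The vector field of the second family along the exceptional divisors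
-/

namespace PainleveFlow

open Place MvPolynomial

namespace Half

/-- The Hamiltonian system in the coordinates of a half; `c` is the other moving parameter. -/
structure IsFlowV (δ : Derivation ℂ K K) (H : Half) (c : K) (l g a₁ a₅ : ℂ) : Prop where
  dQ : δ H.Q = H.Q * (2 * H.p - H.b) * (H.Q - c) + const a₁ * c + const g * H.Q
    - 2 * H.q * H.P * H.Q
  dP : δ H.P = -H.P * (H.P - c) * (2 * H.q - H.b) + const a₅ * c + const g * H.P
    + 2 * H.P * H.Q * H.p
  dq : δ H.q = H.q * (2 * H.P - c) * (H.q - H.b) + const H.β * H.b - const g * H.q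
    - 2 * H.q * H.Q * H.p
  dp : δ H.p = -H.p * (H.p - H.b) * (2 * H.Q - c) - const H.α * H.b - const g * H.p
    + 2 * H.q * H.P * H.p
  db : δ H.b = const l * H.b
  dc : δ c = const l * c
  hl : l + g = H.a₀ - H.α + H.β
  hc : H.b = b₁ ∧ c = b₂ ∨ H.b = b₂ ∧ c = b₁

namespace IsFlowV

variable {δ : Derivation ℂ K K} {H : Half} {c : K} {l g a₁ a₅ : ℂ}
  (h : IsFlowV δ H c l g a₁ a₅)
include h

lemma hl' : const l + const g = const H.a₀ - const H.α + const H.β := by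
  simpa [const] using congrArg const h.hl

lemma params {Γ : Place K} (h1 : Γ.rel b₁ b₁) (h2 : Γ.rel b₂ b₂) :
    Γ.mem (δ b₁) ∧ Γ.mem (δ b₂) ∧ H.b ∈ Γ.integers ∧ c ∈ Γ.integers := by
  have m : ∀ x, Γ.rel x x → Γ.mem (const l * x) := fun x hx => ⟨_, Γ.mul (Γ.const _) hx⟩
  have hb := h.db
  have hc := h.dc
  rcases h.hc with ⟨h3, h4⟩ | ⟨h3, h4⟩ <;> rw [h3] at hb <;> rw [h4] at hc <;> rw [hb, hc, h3, h4]
  exacts [⟨m _ h1, m _ h2, ⟨_, h1⟩, ⟨_, h2⟩⟩, ⟨m _ h1, m _ h2, ⟨_, h2⟩, ⟨_, h1⟩⟩]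

lemma stable {i : Fin 6} {x₁ x₂ x₃ x₄ : K} {hg : Gen (tup x₁ x₂ x₃ x₄)} (h1 : i ≠ 4) (h2 : i ≠ 5)
    (hm : H.b ∈ (dvs (tup x₁ x₂ x₃ x₄) i hg).integers → c ∈ (dvs (tup x₁ x₂ x₃ x₄) i hg).integers →
      δ x₁ ∈ (dvs (tup x₁ x₂ x₃ x₄) i hg).integers ∧ δ x₂ ∈ (dvs (tup x₁ x₂ x₃ x₄) i hg).integers ∧
      δ x₃ ∈ (dvs (tup x₁ x₂ x₃ x₄) i hg).integers ∧ δ x₄ ∈ (dvs (tup x₁ x₂ x₃ x₄) i hg).integers) :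
    Stable δ (dvs (tup x₁ x₂ x₃ x₄) i hg) := by
  obtain ⟨k1, k2, k3, k4⟩ := h.params (dvs_fix (hy := hg) h1.symm) (dvs_fix (hy := hg) h2.symm)
  obtain ⟨m1, m2, m3, m4⟩ := hm k3 k4
  exact fun x hx => dvs_stable (forall_fin_six.2 ⟨m1, m2, m3, m4, k1, k2⟩) hx

lemma du : δ H.u = -((2 * H.p - H.b) * (1 - H.u * c) + const a₁ * c * H.u ^ 2 + const g * H.u
    - 2 * H.q * H.P * H.u) := by
  have hQ := H.Q_ne
  rw [u, deriv_inv, h.dQ]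
  field_simp

lemma dt : δ H.t = (1 - c * H.t) * (2 * H.q - H.b) - const a₅ * c * H.t ^ 2 - const g * H.t
    - 2 * H.Q * H.p * H.t := by
  have hP := H.P_ne
  rw [t, deriv_inv, h.dP]
  field_simp
  ring

/-- The pole in the derivative of `w₁` is `b (w₁ - α) / u`, which equals `b w₂` by the choice of the
sixth centre. -/
lemma six : δ H.P = -H.P * (H.P - c) * (2 * H.q - H.b) + const a₅ * c + const g * H.P
      + 2 * H.P * H.w₁ ∧
    δ H.q = H.q * (2 * H.P - c) * (H.q - H.b) + const H.β * H.b - const g * H.q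
      - 2 * H.q * H.w₁ ∧
    δ H.w₂ = c * H.w₁ * (const a₁ - H.w₁) + H.w₂ * (2 * H.w₁ - c * (2 * H.p - H.b)
      + const a₁ * c * H.u + const g - 2 * H.q * H.P) := by
  have hu := H.u_ne
  have hQ : H.Q = H.u⁻¹ := by rw [u, inv_inv]
  have e0 : H.p = H.u * H.w₁ := by rw [w₁_eq]; field_simp
  have e1 : H.w₁ = H.u * H.w₂ + const H.α := by rw [w₂]; field_simp; ring
  have d1 : δ H.w₁ = H.b * H.w₂ + c * H.u * H.w₁ * (const a₁ - H.w₁) := by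
    rw [deriv_exc δ hu (w₁.eq_1 H), map_zero, h.dp, h.du, hQ, e0]
    field_simp
    linear_combination H.b * e1
  refine ⟨?_, ?_, ?_⟩
  · rw [h.dP, hQ, e0]
    field_simp
  · rw [h.dq, hQ, e0]
    field_simp
  · rw [deriv_exc δ hu (w₂.eq_1 H), deriv_const, d1, h.du, e0]
    field_simp
    ring

lemma eight : δ H.t = (1 - c * H.t) * (2 * H.q - H.b) - const a₅ * c * H.t ^ 2 - const g * H.t
      - 2 * H.Q * H.p * H.t ∧
    δ H.Q = H.Q * (2 * H.p - H.b) * (H.Q - c) + const a₁ * c + const g * H.Q - 2 * H.z₁ * H.Q ∧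
    δ H.p = -H.p * (H.p - H.b) * (2 * H.Q - c) - const H.α * H.b - const g * H.p
      + 2 * H.z₁ * H.p ∧
    δ H.z₂ = c * H.z₁ * (H.z₁ + const a₅) - H.z₂ * (2 * H.z₁ - c * (2 * H.q - H.b)
      - const a₅ * c * H.t - const g - 2 * H.Q * H.p) := by
  have ht := H.t_ne
  have hP : H.P = H.t⁻¹ := by rw [t, inv_inv]
  have e0 : H.q = H.t * H.z₁ := by rw [z₁_eq]; field_simp
  have e1 : H.z₁ = H.t * H.z₂ + const H.β := by rw [z₂]; field_simp; ring
  have d1 : δ H.z₁ = -H.b * H.z₂ + c * H.t * H.z₁ * (H.z₁ + const a₅) := by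
    rw [deriv_exc δ ht (z₁.eq_1 H), map_zero, h.dq, h.dt, hP, e0]
    field_simp
    linear_combination -H.b * e1
  refine ⟨h.dt, ?_, ?_, ?_⟩
  · rw [h.dQ, hP, e0]
    field_simp
  · rw [h.dp, hP, e0]
    field_simp
  · rw [deriv_exc δ ht (z₂.eq_1 H), deriv_const, d1, h.dt, e0]
    field_simp
    ring

/-- All derivatives are regular because `v₁` is a unit on `u = 0`, where it equals `-1`. The poles
disappear on substituting `v₁ = u v₂ - 1`, `p = u v₃ + b - q` and `v₃ = u v₄ - a₀`. -/
lemma four : δ H.u = -((2 * H.p - H.b) * (1 - H.u * c) + const a₁ * c * H.u ^ 2 + const g * H.u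
      - 2 * H.q * H.v₁⁻¹) ∧
    δ H.q = H.q * (2 * (H.q - H.b) * H.v₂ * H.v₁⁻¹ - 2 * H.v₃ - c * (H.q - H.b))
      + const H.β * H.b - const g * H.q ∧
    δ H.v₂ = -2 * c * H.v₁ * H.v₃ + c * H.v₁ * (const a₁ - const a₅ * H.v₁)
      + H.v₂ * (2 * H.v₃ - 2 * H.q * H.v₂ * H.v₁⁻¹ - c * (2 * H.p - H.b) + const a₁ * c * H.u
        + const g) ∧
    δ H.v₄ = c * H.v₃ * (const a₁ - H.v₃) + H.v₄ * (2 * H.v₃ - 2 * H.q * H.v₂ * H.v₁⁻¹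
      - c * (2 * H.p - H.b) + const a₁ * c * H.u + const g) := by
  have hu := H.u_ne
  have hv : H.v₁ ≠ 0 := by rw [v₁_eq]; exact div_ne_zero H.t_ne hu
  have hQ : H.Q = H.u⁻¹ := by rw [u, inv_inv]
  have e0 : H.t = H.u * H.v₁ := by rw [v₁_eq]; field_simp
  have hP : H.P = H.u⁻¹ * H.v₁⁻¹ := by rw [← mul_inv, ← e0, t, inv_inv]
  have e1 : H.v₁ = H.u * H.v₂ - 1 := by rw [v₂_eq]; field_simp; ring
  have e2 : H.p = H.u * H.v₃ + H.b - H.q := by rw [v₃_eq, s_eq]; field_simp; ring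
  have e3 : H.v₃ = H.u * H.v₄ - const H.a₀ := by rw [v₄_eq]; field_simp; ring
  have du : δ H.u = -((2 * H.p - H.b) * (1 - H.u * c) + const a₁ * c * H.u ^ 2 + const g * H.u
      - 2 * H.q * H.v₁⁻¹) := by
    rw [h.du, hP]
    field_simp
  have d1 : δ H.v₁ = -H.b * H.v₂ - 2 * c * H.v₁ * H.u * H.v₃
      + c * H.u * H.v₁ * (const a₁ - const a₅ * H.v₁) := by
    rw [deriv_exc δ hu (v₁.eq_1 H), map_zero, h.dt, du, hQ, e0]
    field_simp
    rw [e2]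
    linear_combination -H.b * e1
  -- Here the motion of `b` enters: the pole is `-b (v₃ + l + g + α - β) / u`, and it becomes `-b
  -- v₄` precisely by the relation `l + g = a₀ - α + β`.
  have d3 : δ H.v₃ = -H.b * H.v₄ + H.u * c * H.v₃ * (const a₁ - H.v₃) := by
    rw [deriv_exc δ hu (v₃.eq_1 H), map_sub, h.dp, h.db, h.dq, du, hQ, hP]
    field_simp
    rw [e2]
    linear_combination -H.u * H.b * H.v₁ * (e3 + h.hl')
  refine ⟨du, ?_, ?_, ?_⟩
  · rw [h.dq, hQ, hP, e2]
    field_simp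
    linear_combination 2 * H.q * (H.q - H.b) * e1
  · rw [deriv_exc δ hu (v₂.eq_1 H), map_neg, Derivation.map_one_eq_zero, d1, du]
    field_simp
    rw [e2]
    linear_combination -2 * H.q * H.v₂ * e1
  · rw [deriv_exc δ hu (v₄.eq_1 H), map_neg, deriv_const, d3, du]
    field_simp
    rw [e2]
    linear_combination -2 * H.q * H.v₄ * e1

lemma stable₆ : Stable δ H.E₆ := by
  refine h.stable (by decide) (by decide) fun hb hc => ?_
  have ru : H.E₆.rel H.u 0 := dvs_zero (hy := H.gen_w₂) (i := 0)
  have hu := integers_of_rel ru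
  have hP : H.P ∈ H.E₆.integers :=
    integers_of_rel (dvs_fix (hy := H.gen_w₂) (i := 0) (k := 1) (by decide))
  have hq : H.q ∈ H.E₆.integers :=
    integers_of_rel (dvs_fix (hy := H.gen_w₂) (i := 0) (k := 2) (by decide))
  have hw : H.w₂ ∈ H.E₆.integers :=
    integers_of_rel (dvs_fix (hy := H.gen_w₂) (i := 0) (k := 3) (by decide))
  change _ ∈ H.E₆.integers at hb hc
  change _ ∈ H.E₆.integers ∧ _ ∈ H.E₆.integers ∧ _ ∈ H.E₆.integers ∧ _ ∈ H.E₆.integers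
  have h2 : (2 : K) ∈ H.E₆.integers := ofNat_mem _ 2
  have h1 : H.w₁ ∈ H.E₆.integers := by
    rw [eq_of_exc H.u_ne (w₂.eq_1 H)]
    exact add_mem (mul_mem hw hu) (Subalgebra.algebraMap_mem _ _)
  have hp : H.p ∈ H.E₆.integers := by
    rw [eq_of_exc H.u_ne (w₁.eq_1 H)]
    exact add_mem (mul_mem h1 hu) (zero_mem _)
  have hk : ∀ c, const c ∈ H.E₆.integers := fun c => Subalgebra.algebraMap_mem _ c
  obtain ⟨e1, e2, e3⟩ := h.six
  rw [h.du, e1, e2, e3]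
  refine ⟨?_, ?_, ?_, ?_⟩
  all_goals
    repeat' first
      | assumption | apply hk | apply sub_mem | apply add_mem | apply neg_mem | apply mul_mem
      | apply pow_mem | apply one_mem

lemma stable₈ : Stable δ H.E₈ := by
  refine h.stable (by decide) (by decide) fun hb hc => ?_
  have rt : H.E₈.rel H.t 0 := dvs_zero (hy := H.gen_z₂) (i := 1)
  have ht := integers_of_rel rt
  have hQ : H.Q ∈ H.E₈.integers :=
    integers_of_rel (dvs_fix (hy := H.gen_z₂) (i := 1) (k := 0) (by decide))
  have hz : H.z₂ ∈ H.E₈.integers :=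
    integers_of_rel (dvs_fix (hy := H.gen_z₂) (i := 1) (k := 2) (by decide))
  have hp : H.p ∈ H.E₈.integers :=
    integers_of_rel (dvs_fix (hy := H.gen_z₂) (i := 1) (k := 3) (by decide))
  change _ ∈ H.E₈.integers at hb hc
  change _ ∈ H.E₈.integers ∧ _ ∈ H.E₈.integers ∧ _ ∈ H.E₈.integers ∧ _ ∈ H.E₈.integers
  have h2 : (2 : K) ∈ H.E₈.integers := ofNat_mem _ 2
  have h1 : H.z₁ ∈ H.E₈.integers := by
    rw [eq_of_exc H.t_ne (z₂.eq_1 H)]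
    exact add_mem (mul_mem hz ht) (Subalgebra.algebraMap_mem _ _)
  have hq : H.q ∈ H.E₈.integers := by
    rw [eq_of_exc H.t_ne (z₁.eq_1 H)]
    exact add_mem (mul_mem h1 ht) (zero_mem _)
  have hk : ∀ c, const c ∈ H.E₈.integers := fun c => Subalgebra.algebraMap_mem _ c
  obtain ⟨e1, e2, e3, e4⟩ := h.eight
  rw [e1, e2, e3, e4]
  refine ⟨?_, ?_, ?_, ?_⟩
  all_goals
    repeat' first
      | assumption | apply hk | apply sub_mem | apply add_mem | apply neg_mem | apply mul_mem
      | apply pow_mem | apply one_mem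

lemma stable₄ : Stable δ H.E₄ := by
  refine h.stable (by decide) (by decide) fun hb hc => ?_
  have ru : H.E₄.rel H.u 0 := dvs_zero (hy := H.gen₄) (i := 0)
  have hu := integers_of_rel ru
  have r2 : H.E₄.rel H.v₂ H.v₂ := dvs_fix (hy := H.gen₄) (i := 0) (k := 1) (by decide)
  have hv2 := integers_of_rel r2
  have hq : H.q ∈ H.E₄.integers :=
    integers_of_rel (dvs_fix (hy := H.gen₄) (i := 0) (k := 2) (by decide))
  have hv4 : H.v₄ ∈ H.E₄.integers :=
    integers_of_rel (dvs_fix (hy := H.gen₄) (i := 0) (k := 3) (by decide))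
  change _ ∈ H.E₄.integers at hb hc
  change _ ∈ H.E₄.integers ∧ _ ∈ H.E₄.integers ∧ _ ∈ H.E₄.integers ∧ _ ∈ H.E₄.integers
  have h2 : (2 : K) ∈ H.E₄.integers := ofNat_mem _ 2
  have h1 := v₁_of_v₂ ru r2
  have hv1 := integers_of_rel h1
  have hi := integers_of_rel (H.E₄.inv h1 (neg_ne_zero.2 one_ne_zero))
  have hk : ∀ c, const c ∈ H.E₄.integers := fun c => Subalgebra.algebraMap_mem _ c
  have hv3 : H.v₃ ∈ H.E₄.integers := by
    rw [eq_of_exc H.u_ne (v₄.eq_1 H)]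
    exact add_mem (mul_mem hv4 hu) (neg_mem (hk _))
  have hp : H.p ∈ H.E₄.integers := by
    rw [eq_of_exc H.u_ne (v₃.eq_1 H)]
    exact add_mem (mul_mem hv3 hu) (sub_mem hb hq)
  obtain ⟨e1, e2, e3, e4⟩ := h.four
  rw [e1, e2, e3, e4]
  refine ⟨?_, ?_, ?_, ?_⟩
  all_goals
    repeat' first
      | assumption | apply hk | apply sub_mem | apply add_mem | apply neg_mem | apply mul_mem
      | apply pow_mem | apply one_mem

end IsFlowV

/-- The exceptional divisors that belong to the boundary. -/
noncomputable def boundary (H : Half) : List Subvariety :=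
  [sv (tup H.u H.v₁ H.q H.p) {H.u}, sv (tup H.u H.v₂ H.q H.p) {H.u},
    sv (tup H.u H.v₂ H.q H.v₃) {H.u}, sv (tup H.u H.P H.q H.w₁) {H.u},
    sv (tup H.Q H.t H.z₁ H.p) {H.t}]

lemma IsFlowV.fine {δ : Derivation ℂ K K} {H : Half} {c : K} {l g a₁ a₅ : ℂ}
    (h : IsFlowV δ H c l g a₁ a₅) : ∀ D ∈ H.divisors, Fine δ H.boundary D := by
  intro D hD
  simp only [divisors, List.mem_cons, List.not_mem_nil, or_false] at hD
  rcases hD with rfl | rfl | rfl | rfl | rfl | rfl | rfl | rfl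
  · exact .inr h.stable₈
  · exact .inl ⟨sv (tup H.Q H.t H.z₁ H.p) {H.t}, by simp [boundary], dvs_link rfl rfl⟩
  · exact .inr h.stable₆
  · exact .inl ⟨sv (tup H.u H.P H.q H.w₁) {H.u}, by simp [boundary], dvs_link rfl rfl⟩
  · exact .inr h.stable₄
  · exact .inl ⟨sv (tup H.u H.v₂ H.q H.v₃) {H.u}, by simp [boundary], dvs_link rfl rfl⟩
  · exact .inl ⟨sv (tup H.u H.v₂ H.q H.p) {H.u}, by simp [boundary], dvs_link rfl rfl⟩
  · exact .inl ⟨sv (tup H.u H.v₁ H.q H.p) {H.u}, by simp [boundary], dvs_link rfl rfl⟩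

end Half

end PainleveFlow

/-!
# Regularity for the second family
-/

namespace PainleveFlow

open Place MvPolynomial

lemma boundary_left_A5 (a : Fin 6 → ℂ) : (left a).boundary = (boundaryA5.drop 4).take 5 := by
  simp only [Half.boundary, sv_left, Half.v₃, Half.v₂, Half.v₁, Half.w₁, Half.z₁, Half.u, Half.t,
    left, boundaryA5, List.drop_succ_cons, List.drop_zero, List.take_succ_cons, List.take_zero,
    List.cons.injEq, Subvariety.mk.injEq, and_true, sub_zero, sub_neg_eq_add,
    div_inv_eq_mul, inv_inv, sub_sub_eq_add_sub]
  constructorm* _ ∧ _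
  all_goals (congr 1 <;> ring1)

lemma boundary_right_A5 (a : Fin 6 → ℂ) : (right a).boundary = boundaryA5.drop 9 := by
  simp only [Half.boundary, sv_right, Half.v₃, Half.v₂, Half.v₁, Half.w₁, Half.z₁, Half.u, Half.t,
    right, boundaryA5, List.drop_succ_cons, List.drop_zero, List.cons.injEq, Subvariety.mk.injEq,
    and_true, sub_zero, sub_neg_eq_add, div_inv_eq_mul, inv_inv, sub_sub_eq_add_sub]
  constructorm* _ ∧ _
  all_goals (congr 1 <;> ring1)

lemma fine_infs_A5 (δ : Derivation ℂ K K) : ∀ D ∈ infs, Fine δ boundaryA5 D := by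
  intro D hD
  simp only [infs, List.mem_cons, List.not_mem_nil, or_false] at hD
  rcases hD with rfl | rfl | rfl | rfl
  exacts [.inl ⟨_, by simp [boundaryA5], link_inf₄⟩, .inl ⟨_, by simp [boundaryA5], link_inf₃⟩,
    .inl ⟨_, by simp [boundaryA5], link_inf₂⟩, .inl ⟨_, by simp [boundaryA5], link_inf₁⟩]

/-- The polynomial functions are preserved by the vector field. -/
lemma stable_chart {a : Fin 6 → ℂ} {δ : Derivation ℂ K K} {l g a₁ a₅ : ℂ}
    (h : (left a).IsFlowV δ b₂ l g a₁ a₅) : ∀ x ∈ chart q₁ p₁ q₂ p₂, δ x ∈ chart q₁ p₁ q₂ p₂ := by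
  refine stable_adjoin ?_
  set S := Algebra.adjoin ℂ ({q₁, p₁, q₂, p₂, b₁, b₂} : Set K) with hS
  have hm : ∀ x ∈ ({q₁, p₁, q₂, p₂, b₁, b₂} : Set K), x ∈ S := fun x hx =>
    Algebra.subset_adjoin hx
  have m1 : (left a).q ∈ S := hm q₁ (by simp)
  have m2 : (left a).P ∈ S := hm p₁ (by simp)
  have m3 : (left a).Q ∈ S := hm q₂ (by simp)
  have m4 : (left a).p ∈ S := hm p₂ (by simp)
  have m5 : (left a).b ∈ S := hm b₁ (by simp)
  have m6 : b₂ ∈ S := hm b₂ (by simp)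
  have h2 : (2 : K) ∈ S := ofNat_mem _ 2
  have hk : ∀ c, const c ∈ S := fun c => S.algebraMap_mem c
  have key : δ (left a).q ∈ S ∧ δ (left a).P ∈ S ∧ δ (left a).Q ∈ S ∧ δ (left a).p ∈ S ∧
      δ (left a).b ∈ S ∧ δ b₂ ∈ S := by
    rw [h.dQ, h.dP, h.dq, h.dp, h.db, h.dc]
    refine ⟨?_, ?_, ?_, ?_, ?_, ?_⟩
    all_goals
      repeat' first
        | assumption | apply hk | apply sub_mem | apply add_mem | apply neg_mem | apply mul_mem
  obtain ⟨k1, k2, k3, k4, k5, k6⟩ := key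
  rintro x (rfl | rfl | rfl | rfl | rfl | rfl)
  exacts [k1, k2, k3, k4, k5, k6]

/-- The theorem on eight blow-ups is applied twice, the second time to the space produced by the
first. The polynomial functions are stable, so the initial list contains only the divisors at
infinity. -/
theorem regular_A5 {a : Fin 6 → ℂ} {δ : Derivation ℂ K K} {l g a₁ a₅ l' g' a₁' a₅' : ℂ}
    (h : (left a).IsFlowV δ b₂ l g a₁ a₅) (h' : (right a).IsFlowV δ b₁ l' g' a₁' a₅') :
    IsRegularOn δ (openSpaceA5 a) := by
  have hl := (left a).divisors_arch
  have g1 := (flat_left a).input.good infs_arch (good_projLines (stable_chart h))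
  have a1 : ∀ E ∈ (left a).divisors ++ infs, E.Arch := fun E hE =>
    (List.mem_append.1 hE).elim (hl E) (infs_arch E)
  have g2 := ((dual a).input (flat_left a) (flat_right a) (.inr (.inl rfl))).good a1 g1
  unfold openSpaceA5
  rw [spaceA5_eq]
  refine regular_of_fine g2 fun D hD => ?_
  rcases List.mem_append.1 hD with hD | hD
  · refine (h'.fine D hD).imp_left fun ⟨Z, hZ, h⟩ => ⟨Z, ?_, h⟩
    rw [boundary_right_A5] at hZ
    exact List.mem_of_mem_drop hZ
  rcases List.mem_append.1 hD with hD | hD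
  · refine (h.fine D hD).imp_left fun ⟨Z, hZ, h⟩ => ⟨Z, ?_, h⟩
    rw [boundary_left_A5] at hZ
    exact List.mem_of_mem_drop (List.mem_of_mem_take hZ)
  · exact fine_infs_A5 δ D hD

theorem isRegularSystem_A5 (a : Fin 6 → ℂ) :
    IsRegularSystem (coupledHamV a) (C ((1 / 2) * (a 0 + a 1 + a 2 + a 3 + a 4 + a 5)) * X .b₁)
      (C ((1 / 2) * (a 0 + a 1 + a 2 + a 3 + a 4 + a 5)) * X .b₂) (openSpaceA5 a) := by
  refine isRegularSystem_of fun δ h => ?_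
  have hq₁ : algebraMap Poly K (X .q₁) = q₁ := rfl
  have hp₁ : algebraMap Poly K (X .p₁) = p₁ := rfl
  have hq₂ : algebraMap Poly K (X .q₂) = q₂ := rfl
  have hp₂ : algebraMap Poly K (X .p₂) = p₂ := rfl
  have hb₁ : algebraMap Poly K (X .b₁) = b₁ := rfl
  have hb₂ : algebraMap Poly K (X .b₂) = b₂ := rfl
  set g : ℂ := (1 / 2) * (a 0 + a 2 + a 4 - a 1 - a 3 - a 5) with hg
  set l : ℂ := (1 / 2) * (a 0 + a 1 + a 2 + a 3 + a 4 + a 5) with hl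
  have h2 : (2 : Poly) = C 2 := (map_ofNat C 2).symm
  have h2' : const 2 = 2 := map_ofNat _ 2
  have e1 : δ q₁ = q₁ * (2 * p₁ - b₂) * (q₁ - b₁) + const (a 4) * b₁ - const g * q₁
      - 2 * q₁ * q₂ * p₂ := by
    rw [h.dq₁, coupledHamV, hamV, hamV, ← hg, h2]
    simp [algebraMap_C, h2', hq₁, hp₁, hq₂, hp₂, hb₁, hb₂]
    ring
  have e2 : δ p₁ = -p₁ * (p₁ - b₂) * (2 * q₁ - b₁) + const (a 5) * b₂ + const g * p₁
      + 2 * p₁ * q₂ * p₂ := by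
    rw [h.dp₁, coupledHamV, hamV, hamV, ← hg, h2]
    simp [algebraMap_C, h2', hq₁, hp₁, hq₂, hp₂, hb₁, hb₂]
    ring
  have e3 : δ q₂ = q₂ * (2 * p₂ - b₁) * (q₂ - b₂) + const (a 1) * b₂ + const g * q₂
      - 2 * q₁ * p₁ * q₂ := by
    rw [h.dq₂, coupledHamV, hamV, hamV, ← hg, h2]
    simp [algebraMap_C, h2', hq₁, hp₁, hq₂, hp₂, hb₁, hb₂]
    ring
  have e4 : δ p₂ = -p₂ * (p₂ - b₁) * (2 * q₂ - b₂) + const (a 2) * b₁ - const g * p₂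
      + 2 * q₁ * p₁ * p₂ := by
    rw [h.dp₂, coupledHamV, hamV, hamV, ← hg, h2]
    simp [algebraMap_C, h2', hq₁, hp₁, hq₂, hp₂, hb₁, hb₂]
    ring
  have e5 : δ b₁ = const l * b₁ := by rw [h.db₁, map_mul, algebraMap_C, hb₁]
  have e6 : δ b₂ = const l * b₂ := by rw [h.db₂, map_mul, algebraMap_C, hb₂]
  -- Exchanging the halves changes the sign of `γ₀`. The two conditions on constants are `l + γ₀ =
  -- a₀ + a₂ + a₄` and `l - γ₀ = a₁ + a₃ + a₅`.
  refine regular_A5 (l := l) (g := g) (a₁ := a 1) (a₅ := a 5) (l' := l) (g' := -g) (a₁' := a 4)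
    (a₅' := a 2) ⟨?_, ?_, ?_, ?_, e5, e6, ?_, .inl ⟨rfl, rfl⟩⟩
    ⟨?_, ?_, ?_, ?_, e6, e5, ?_, .inr ⟨rfl, rfl⟩⟩
  all_goals simp only [left, right, const_neg]
  · rw [e3]
  · rw [e2]
  · rw [e1]
  · rw [e4]; ring
  · rw [hl, hg]; ring
  · rw [e1]; ring
  · rw [e4]; ring
  · rw [e3]; ring
  · rw [e2]; ring
  · rw [hl, hg]; ring

end PainleveFlow

theorem mainTheorem7 :
    (∀ a a' : Fin 3 → ℂ,
      PainleveFlow.IsRegularSystem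
        (PainleveFlow.hamIV (MvPolynomial.X .q₁) (MvPolynomial.X .p₁) (MvPolynomial.X .b₁)
          (a 1) (a 2))
        (MvPolynomial.C (a 0 + a 1 + a 2)) 0 (PainleveFlow.openSpaceA2A2 a a') ∧
      PainleveFlow.IsRegularSystem
        (PainleveFlow.hamIV (MvPolynomial.X .q₂) (MvPolynomial.X .p₂) (MvPolynomial.X .b₂)
          (a' 1) (a' 2))
        0 (MvPolynomial.C (a' 0 + a' 1 + a' 2)) (PainleveFlow.openSpaceA2A2 a a')) ∧
    (∀ a : Fin 6 → ℂ,
      PainleveFlow.IsRegularSystem (PainleveFlow.coupledHamV a)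
        (MvPolynomial.C ((1 / 2) * (a 0 + a 1 + a 2 + a 3 + a 4 + a 5)) * MvPolynomial.X .b₁)
        (MvPolynomial.C ((1 / 2) * (a 0 + a 1 + a 2 + a 3 + a 4 + a 5)) * MvPolynomial.X .b₂)
        (PainleveFlow.openSpaceA5 a)) := by
  exact ⟨fun a a' => ⟨PainleveFlow.isRegularSystem_A2A2_left a a',
    PainleveFlow.isRegularSystem_A2A2_right a a'⟩,
    PainleveFlow.isRegularSystem_A5⟩
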